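/- **Setting.** A *structure* $\mathcal S$ on nodes $X_1,\dots,X_n$ is a directed acyclic graph; its *degree* is the maximum in-degree, and its *skeleton* is the underlying undirected graph. A distribution $P$ over $\{0,1\}^n$ is a *Bayes net with structure $\mathcal S$* if, for a numbering of the nodes in which all edges point from smaller to larger numbers, the conditional probability that $X_i=1$ given the values of all nodes with smaller numbers depends only on the values of the parents of $X_i$. Its conditional probability table has the entries $p_{i,a}=\Pr_P[X_i=1\mid X_{\mathrm{Pa}(i)}=a]$ for $a\in\{0,1\}^{\mathrm{Pa}(i)}$. $P$ is *$(c,C)$-balanced* (with respect to $\mathcal S$) if $p_{i,a}\in[c,1-c]$ and $\Pr_P[X_{\mathrm{Pa}(i)}=a]\ge C$ for all $i,a$. Nodes $X_i,X_j$ are *$\gamma$-far from independent conditioned on $X_A$* under $P$ if no distribution $R$ over $\{0,1\}^n$ with $d_{\mathrm{TV}}(P,R)<\gamma$ makes $X_i$ and $X_j$ independent conditioned on $X_A$. $P$ is *$\gamma$-non-degenerate with respect to $\mathcal S$ and degree $d$* if $X_i,X_j$ are $\gamma$-far from independent conditioned on $X_A$ whenever $i\ne j$, $|A|\le d$, $i,j\notin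 A$, and in $\mathcal S$ one of the following holds: (i) $X_i$ is a parent of $X_j$; (ii) $A$ contains a common child of $X_i$ and $X_j$; (iii) some $X_k$ with $k\notin A$ is a child of $X_i$ and a parent of $X_j$; (iv) some $X_k$ with $k\notin A$ is a common parent of $X_i$ and $X_j$. An *algorithm* is a single program for a randomized real RAM: unit-cost comparison of numbers and access to memory cells, $+,-$ on natural numbers, $+,-,\times,\div$ on reals, conversion from natural numbers to reals but not back, natural-number constants only, unit-cost requests for samples and for fair coins, and unit-cost reading of a bit of a sample or of an entry of the input. **Theorem.** There are an algorithm and absolute constants $\beta,K>0$ such that the following holds for all $n\ge1$, $d\ge0$, $\epsilon\in(0,1]$ and $\gamma>0$. Let $Q$ be a Bayes net over $\{0,1\}^n$ with a structure $\mathcal S$ of degree at most $d$ that is $(c,C)$-balanced with $$c\ \ge\ \beta\,\frac{1+\log n}{\sqrt n},\qquad C\ \ge\ \beta\,(1+\log n)\,\frac{d\,\epsilon^2}{\sqrt n},$$ and $\gamma$-non-degenerate with respect to $\mathcal S$ and degree $d$. Let $P$ be a Bayes net over $\{0,1\}^n$ with some (unknown) structure $\mathcal S'$ of degree at most $d$ whose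 skeleton has no more edges than that of $\mathcal S$. Given $n,d,\epsilon,\gamma$, the structure $\mathcal S$, the conditional probability table of $Q$, and independent samples from $P$, the algorithm always takes at most $$K\left(\frac{2^{d/2}\sqrt n}{\epsilon^2}+\frac{2^d+d\log n}{\gamma^2}\right)$$ samples, always halts in time at most $$(Kn)^{d+3}\left(\frac1{\gamma^2}+\frac1{\epsilon^2}\right),$$ accepts with probability at least $2/3$ if $P=Q$, and rejects with probability at least $2/3$ if $\|P-Q\|_1>\epsilon$. -/

import Mathlib

open MeasureTheory ProbabilityTheory

/-! ### Bayes nets over `{0,1}^n` -/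

/-- A structure on the nodes `X_0, …, X_{n-1}`: a directed acyclic graph. `Adj i j` means that
`X_i` is a parent of `X_j`. -/
structure BNStructure (n : ℕ) extends Digraph (Fin n) where
  acyclic : ∀ i, ¬ Relation.TransGen Adj i i

/-- The set of parents of `X_i`. -/
def BNStructure.parents {n : ℕ} (S : BNStructure n) (i : Fin n) : Set (Fin n) :=
  {j | S.Adj j i}

/-- Every node has at most `d` parents. -/
def BNStructure.DegreeLE {n : ℕ} (S : BNStructure n) (d : ℕ) : Prop :=
  ∀ i, (S.parents i).ncard ≤ d

/-- The skeleton: the underlying undirected graph. -/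
def BNStructure.skeleton {n : ℕ} (S : BNStructure n) : SimpleGraph (Fin n) :=
  SimpleGraph.fromRel S.Adj

/-- The number of edges of the skeleton. -/
noncomputable def BNStructure.edgeCount {n : ℕ} (S : BNStructure n) : ℕ :=
  S.skeleton.edgeSet.ncard

/-- The event `X_A = a_A`; only the values of `a` on `A` matter. -/
def configEvent {n : ℕ} (A : Set (Fin n)) (a : Fin n → Bool) : Set (Fin n → Bool) :=
  {x | ∀ j ∈ A, x j = a j}

/-- `P` is a Bayes net with structure `S`: for some numbering `σ` of the nodes in which all edges
point from smaller to larger numbers, the conditional probability that `X_i = 1` given the values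
of all nodes with smaller number (whenever that conditioning event has positive probability)
depends only on the values of the parents of `X_i`. -/
def IsBayesNet {n : ℕ} (S : BNStructure n) (P : Measure (Fin n → Bool)) : Prop :=
  ∃ σ : Equiv.Perm (Fin n), (∀ i j, S.Adj i j → σ i < σ j) ∧
    ∀ (i : Fin n) (a b : Fin n → Bool), (∀ j ∈ S.parents i, a j = b j) →
      P (configEvent {j | σ j < σ i} a) ≠ 0 → P (configEvent {j | σ j < σ i} b) ≠ 0 →
      (cond P (configEvent {j | σ j < σ i} a)).real {x | x i = true} =
        (cond P (configEvent {j | σ j < σ i} b)).real {x | x i = true}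

/-- The entry `p_{i,a} = Pr[X_i = 1 | X_{parents of i} = a]` of the conditional probability
table. -/
noncomputable def condProbTable {n : ℕ} (S : BNStructure n) (P : Measure (Fin n → Bool))
    (i : Fin n) (a : Fin n → Bool) : ℝ :=
  (cond P (configEvent (S.parents i) a)).real {x | x i = true}

/-- `(c, C)`-balancedness. -/
def IsBalanced {n : ℕ} (S : BNStructure n) (P : Measure (Fin n → Bool)) (c C : ℝ) : Prop :=
  ∀ (i : Fin n) (a : Fin n → Bool),
    condProbTable S P i a ∈ Set.Icc c (1 - c) ∧ C ≤ P.real (configEvent (S.parents i) a)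

/-- The `L¹` distance `‖P - Q‖₁` of two distributions over `{0,1}^n`. -/
noncomputable def l1Dist {n : ℕ} (P Q : Measure (Fin n → Bool)) : ℝ :=
  ∑ x : Fin n → Bool, |P.real {x} - Q.real {x}|

/-- The total variation distance of two distributions over `{0,1}^n`. -/
noncomputable def tvDist {n : ℕ} (P Q : Measure (Fin n → Bool)) : ℝ :=
  l1Dist P Q / 2

/-- `X_i` and `X_j` are independent conditioned on `X_A`, that is, independent under `P`
conditioned on `X_A = a`, for every configuration `a` of positive probability. -/
def CondIndepGiven {n : ℕ} (P : Measure (Fin n → Bool)) (i j : Fin n) (A : Set (Fin n)) : Prop :=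
  ∀ a : Fin n → Bool, P (configEvent A a) ≠ 0 →
    IndepFun (fun x : Fin n → Bool => x i) (fun x : Fin n → Bool => x j)
      (cond P (configEvent A a))

/-- `X_i` and `X_j` are `γ`-far from independent conditioned on `X_A`. -/
def FarFromCondIndep {n : ℕ} (P : Measure (Fin n → Bool)) (γ : ℝ) (i j : Fin n)
    (A : Set (Fin n)) : Prop :=
  ∀ R : Measure (Fin n → Bool), IsProbabilityMeasure R → tvDist P R < γ → ¬ CondIndepGiven R i j A

/-- `P` is `γ`-non-degenerate with respect to the structure `S` and the degree `d`. -/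
def IsNonDegenerate {n : ℕ} (S : BNStructure n) (d : ℕ) (P : Measure (Fin n → Bool))
    (γ : ℝ) : Prop :=
  ∀ (i j : Fin n) (A : Set (Fin n)), i ≠ j → A.ncard ≤ d → i ∉ A → j ∉ A →
    (S.Adj i j ∨
      (∃ k ∈ A, S.Adj i k ∧ S.Adj j k) ∨
      (∃ k, k ∉ A ∧ S.Adj i k ∧ S.Adj k j) ∨
      (∃ k, k ∉ A ∧ S.Adj k i ∧ S.Adj k j)) →
    FarFromCondIndep P γ i j A

/-! ### The machine model: a randomized real RAM

Programs of a structured imperative language over two banks of arrays, one of natural numbers and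
one of real numbers, with read-only access to the input, to samples and to fair coins. Every
elementary operation costs one unit of time. There is no multiplication of integers and no
conversion (such as rounding) from reals to integers. A program contains only finitely many integer
constants and no other constant. -/

/-- What a program can read. `edge i j` is `1` if `X_i` is a parent of `X_j` and `0` otherwise.
`cpt i k` is the `k`-th entry of the conditional probability table of node `i`. `sample s i` is
the `i`-th bit of the `s`-th sample, and `coin s` the `s`-th coin. -/
structure RamInput where
  dim : ℕ
  deg : ℕ
  eps : ℝ
  gam : ℝ
  edge : ℕ → ℕ → ℕ
  cpt : ℕ → ℕ → ℝ
  sample : ℕ → ℕ → ℕ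
  coin : ℕ → ℕ

/-- The memory: array number `r` has the cells `nat r 0, nat r 1, …` (or `real r 0, …`). Further,
the numbers of samples drawn and of coins flipped so far. -/
structure RamState where
  nat : ℕ → ℕ → ℕ
  real : ℕ → ℕ → ℝ
  drawn : ℕ
  flipped : ℕ

/-- All cells are zero, nothing has been drawn. -/
def RamState.init : RamState := ⟨fun _ _ => 0, fun _ _ => 0, 0, 0⟩

/-- Expressions with natural numbers as values. -/
inductive NatExpr where
  | lit (k : ℕ)
  | cell (arr : ℕ) (idx : NatExpr)
  | add (e f : NatExpr)
  | sub (e f : NatExpr)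
  | dim
  | deg
  | edge (e f : NatExpr)
  | sample (e f : NatExpr)
  | coin (e : NatExpr)

/-- Only samples that were drawn and coins that were flipped can be read (otherwise the value
is `0`). -/
def NatExpr.eval (I : RamInput) (s : RamState) : NatExpr → ℕ
  | .lit k => k
  | .cell r e => s.nat r (e.eval I s)
  | .add e f => e.eval I s + f.eval I s
  | .sub e f => e.eval I s - f.eval I s
  | .dim => I.dim
  | .deg => I.deg
  | .edge e f => I.edge (e.eval I s) (f.eval I s)
  | .sample e f => if e.eval I s < s.drawn then I.sample (e.eval I s) (f.eval I s) else 0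
  | .coin e => if e.eval I s < s.flipped then I.coin (e.eval I s) else 0

/-- The time to evaluate an expression: its number of operations. -/
def NatExpr.cost : NatExpr → ℕ
  | .lit _ => 1
  | .cell _ e => e.cost + 1
  | .add e f => e.cost + f.cost + 1
  | .sub e f => e.cost + f.cost + 1
  | .dim => 1
  | .deg => 1
  | .edge e f => e.cost + f.cost + 1
  | .sample e f => e.cost + f.cost + 1
  | .coin e => e.cost + 1

/-- Expressions with real numbers as values. -/
inductive RealExpr where
  | ofNat (e : NatExpr)
  | cell (arr : ℕ) (idx : NatExpr)
  | add (e f : RealExpr)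
  | sub (e f : RealExpr)
  | mul (e f : RealExpr)
  | div (e f : RealExpr)
  | eps
  | gam
  | cpt (e f : NatExpr)

noncomputable def RealExpr.eval (I : RamInput) (s : RamState) : RealExpr → ℝ
  | .ofNat e => (e.eval I s : ℝ)
  | .cell r e => s.real r (e.eval I s)
  | .add e f => e.eval I s + f.eval I s
  | .sub e f => e.eval I s - f.eval I s
  | .mul e f => e.eval I s * f.eval I s
  | .div e f => e.eval I s / f.eval I s
  | .eps => I.eps
  | .gam => I.gam
  | .cpt e f => I.cpt (e.eval I s) (f.eval I s)

def RealExpr.cost : RealExpr → ℕ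
  | .ofNat e => e.cost + 1
  | .cell _ e => e.cost + 1
  | .add e f => e.cost + f.cost + 1
  | .sub e f => e.cost + f.cost + 1
  | .mul e f => e.cost + f.cost + 1
  | .div e f => e.cost + f.cost + 1
  | .eps => 1
  | .gam => 1
  | .cpt e f => e.cost + f.cost + 1

/-- Tests. -/
inductive TestExpr where
  | natLT (e f : NatExpr)
  | realLT (e f : RealExpr)
  | neg (b : TestExpr)
  | and (b b' : TestExpr)

def TestExpr.holds (I : RamInput) (s : RamState) : TestExpr → Prop
  | .natLT e f => e.eval I s < f.eval I s
  | .realLT e f => e.eval I s < f.eval I s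
  | .neg b => ¬ b.holds I s
  | .and b b' => b.holds I s ∧ b'.holds I s

def TestExpr.cost : TestExpr → ℕ
  | .natLT e f => e.cost + f.cost + 1
  | .realLT e f => e.cost + f.cost + 1
  | .neg b => b.cost + 1
  | .and b b' => b.cost + b'.cost + 1

/-- Programs. `draw` requests a fresh sample, `flip` a fresh fair coin. -/
inductive RamProg where
  | nop
  | setNat (arr : ℕ) (idx val : NatExpr)
  | setReal (arr : ℕ) (idx : NatExpr) (val : RealExpr)
  | draw
  | flip
  | seq (p q : RamProg)
  | branch (b : TestExpr) (p q : RamProg)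
  | loop (b : TestExpr) (p : RamProg)

def RamState.setNat (s : RamState) (r k v : ℕ) : RamState :=
  { s with nat := Function.update s.nat r (Function.update (s.nat r) k v) }

def RamState.setReal (s : RamState) (r k : ℕ) (v : ℝ) : RamState :=
  { s with real := Function.update s.real r (Function.update (s.real r) k v) }

/-- `Exec I p s s' t`: on input `I`, the program `p` started in state `s` terminates in state `s'`
after exactly `t` units of time. -/
inductive Exec (I : RamInput) : RamProg → RamState → RamState → ℕ → Prop
  | nop (s) : Exec I .nop s s 1
  | setNat (s r e f) :
      Exec I (.setNat r e f) s (s.setNat r (e.eval I s) (f.eval I s)) (e.cost + f.cost + 1)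
  | setReal (s r e f) :
      Exec I (.setReal r e f) s (s.setReal r (e.eval I s) (f.eval I s)) (e.cost + f.cost + 1)
  | draw (s) : Exec I .draw s { s with drawn := s.drawn + 1 } 1
  | flip (s) : Exec I .flip s { s with flipped := s.flipped + 1 } 1
  | seq {p q s₁ s₂ s₃ t₁ t₂} : Exec I p s₁ s₂ t₁ → Exec I q s₂ s₃ t₂ →
      Exec I (.seq p q) s₁ s₃ (t₁ + t₂)
  | branch_true {b p q s₁ s₂ t} : b.holds I s₁ → Exec I p s₁ s₂ t →
      Exec I (.branch b p q) s₁ s₂ (b.cost + 1 + t)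
  | branch_false {b p q s₁ s₂ t} : ¬ b.holds I s₁ → Exec I q s₁ s₂ t →
      Exec I (.branch b p q) s₁ s₂ (b.cost + 1 + t)
  | loop_true {b p s₁ s₂ s₃ t₁ t₂} : b.holds I s₁ → Exec I p s₁ s₂ t₁ →
      Exec I (.loop b p) s₂ s₃ t₂ → Exec I (.loop b p) s₁ s₃ (b.cost + 1 + t₁ + t₂)
  | loop_false {b p s} : ¬ b.holds I s → Exec I (.loop b p) s s (b.cost + 1)

/-- The program terminates and its output (cell `0` of the integer array `0`) is `v`. -/
def Outputs (I : RamInput) (p : RamProg) (v : ℕ) : Prop :=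
  ∃ s t, Exec I p RamState.init s t ∧ s.nat 0 0 = v

/-! ### The tester's input and its randomness -/

/-- The `k`-th parental configuration of node `i`: its `r`-th smallest parent has the `r`-th bit
of `k` as its value. -/
noncomputable def tableConfig {n : ℕ} (S : BNStructure n) (i : Fin n) (k : ℕ) : Fin n → Bool :=
  fun j => Nat.testBit k {l | l ∈ S.parents i ∧ l < j}.ncard

/-- The samples and coins that an execution can request: pairs of a sample and a coin. -/
abbrev Tape (n : ℕ) : Type := ℕ → (Fin n → Bool) × Bool

/-- All samples are drawn from `P`, all coins are fair, and everything is independent. -/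
noncomputable def tapeLaw {n : ℕ} (P : Measure (Fin n → Bool)) : Measure (Tape n) :=
  Measure.infinitePi fun _ : ℕ => P.prod (PMF.uniformOfFintype Bool).toMeasure

open Classical in
/-- The input of the tester: the numbers `n`, `d`, `ε`, `γ`, the structure `S` and the conditional
probability table of the Bayes net `Q`, and oracle access to the samples and coins of `ω`. -/
noncomputable def testerInput {n : ℕ} (d : ℕ) (ε γ : ℝ) (S : BNStructure n)
    (Q : Measure (Fin n → Bool)) (ω : Tape n) : RamInput where
  dim := n
  deg := d
  eps := ε
  gam := γ
  edge i j := if ∃ (hi : i < n) (hj : j < n), S.Adj ⟨i, hi⟩ ⟨j, hj⟩ then 1 else 0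
  cpt i k := if h : i < n then condProbTable S Q ⟨i, h⟩ (tableConfig S ⟨i, h⟩ k) else 0
  sample s i := if h : i < n then ((ω s).1 ⟨i, h⟩).toNat else 0
  coin s := (ω s).2.toNat

/-! ### Total correctness of programs with time bounds -/

/-! The tester reduces the problem to identity testing over the known structure `S`. On samples of
`P` it checks every conditional dependence that non-degeneracy forces on `Q`. Suppose that `P`
satisfies none of the corresponding independences exactly. Two nodes that are not adjacent in `S'`
are independent given the parents of the later one, a set of at most `d` nodes. So nodes adjacent in
`S` are adjacent in `S'`, and the bound on the number of edges makes the skeletons equal. The same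
separating sets, with conditions (ii)–(iv), show that both structures have the same colliders with
non-adjacent parents. Hence they have the same families, i.e. sets with a member to which all other
members point (`isFamily_iff_of_dependent`). The logarithm of the mass of a Bayes net is a
combination of log-marginals, which Möbius inversion turns into a sum over families, each counted
once; so `P` also factorizes over `S` (`IsMarkov.of_families`). This needs every parental
configuration of `S` to have positive probability under `P`; if one is rare, the identity test
rejects for that reason.

A conditional independence test sums, over the configurations of `X_A`, the absolute determinant of
the `2 × 2` table of `(X_i, X_j)` divided by its total. This vanishes under independence. If `P` is
`γ`-far from independent it is at least `γ / 2`, because gluing the two conditional laws together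
independently yields a conditionally independent distribution at `L¹` distance at most four times
the statistic (`two_mul_le_covStat`). The statistic is 2-Lipschitz in the cell weights, so it
suffices to learn a distribution on `4 · 2 ^ d` cells in `L¹`; the union bound over all tests costs
the term `d log n`.

The identity test concerns the entries `α = (i, a)` of the table, with values `p`, `q` for `P`, `Q`
and parental probability `π` under `P`. Since `log r ≤ r - 1`, the divergence of `P` from `Q` is at
most the sum of `π (p - q)² / (q (1 - q))`, and through the Hellinger distance this sum is at least
`‖P - Q‖₁² / 4` (`IsTable.sq_l1Dist_le`). It is estimated from three batches of `M` samples: the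
first gives counts `N` of the parental configurations, the other two give sums `A`, `B` of the
deviations `X_i - q` on each configuration, and the statistic is the sum of `A B / (N q (1 - q))`.
Given the first batch its mean is `M` times the divergence up to a factor 2. Under `P` each
deviation is a residual plus a multiple of an indicator; the residuals of different entries are
orthogonal, like martingale differences (`IsTable.avg_bitResidual_mul`). So the variance is of the
order of the number of entries, at most `2 ^ d n`, plus terms that are small against the squared
mean (`quad_variance_le`), and `M ε²` of order `√(2 ^ d n)` suffices. The lower bound on `C` makes
all counts concentrate under `P = Q`; the one on `c` controls the terms with `1 / (q (1 - q))`.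

The program flips no coins. It is verified by Hoare triples carrying time bounds; all probability
takes place on the tape of samples. -/

/-- Started in `s`, the program `p` halts within time `τ` in a state satisfying `Q`. -/
def Reaches (I : RamInput) (p : RamProg) (s : RamState) (τ : ℕ) (Q : RamState → Prop) : Prop :=
  ∃ s' t, Exec I p s s' t ∧ t ≤ τ ∧ Q s'

/-- The program contains an assignment to the integer array `r`. -/
def RamProg.writesNat (r : ℕ) : RamProg → Bool
  | .nop => false
  | .setNat r' _ _ => r' == r
  | .setReal _ _ _ => false
  | .draw => false
  | .flip => false
  | .seq p q => p.writesNat r || q.writesNat r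
  | .branch _ p q => p.writesNat r || q.writesNat r
  | .loop _ p => p.writesNat r

/-- The program contains an assignment to the real array `r`. -/
def RamProg.writesReal (r : ℕ) : RamProg → Bool
  | .nop => false
  | .setNat _ _ _ => false
  | .setReal r' _ _ => r' == r
  | .draw => false
  | .flip => false
  | .seq p q => p.writesReal r || q.writesReal r
  | .branch _ p q => p.writesReal r || q.writesReal r
  | .loop _ p => p.writesReal r

/-- The program contains a request for a sample. -/
def RamProg.draws : RamProg → Bool
  | .nop => false
  | .setNat _ _ _ => false
  | .setReal _ _ _ => false
  | .draw => true
  | .flip => false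
  | .seq p q => p.draws || q.draws
  | .branch _ p q => p.draws || q.draws
  | .loop _ p => p.draws

/-- The states `s` and `s'` differ only in what `p` may change. -/
structure Agree (p : RamProg) (s s' : RamState) : Prop where
  nat : ∀ r, p.writesNat r = false → s'.nat r = s.nat r
  real : ∀ r, p.writesReal r = false → s'.real r = s.real r
  drawn : p.draws = false → s'.drawn = s.drawn

theorem Agree.refl (p : RamProg) (s : RamState) : Agree p s s :=
  ⟨fun _ _ => rfl, fun _ _ => rfl, fun _ => rfl⟩

theorem Agree.trans {p : RamProg} {s₁ s₂ s₃ : RamState} (h : Agree p s₁ s₂) (h' : Agree p s₂ s₃) :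
    Agree p s₁ s₃ :=
  ⟨fun r hr => (h'.nat r hr).trans (h.nat r hr), fun r hr => (h'.real r hr).trans (h.real r hr),
    fun hr => (h'.drawn hr).trans (h.drawn hr)⟩

theorem RamState.setNat_nat (s : RamState) (r k v r' k' : ℕ) :
    (s.setNat r k v).nat r' k' = if r' = r ∧ k' = k then v else s.nat r' k' := by
  unfold RamState.setNat
  by_cases h : r' = r
  · subst h
    by_cases h' : k' = k
    · subst h'; simp
    · simp [h']
  · simp [h]

theorem RamState.setNat_nat_of_ne (s : RamState) {r r' : ℕ} (h : r' ≠ r) (k v : ℕ) :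
    (s.setNat r k v).nat r' = s.nat r' := by
  simp [RamState.setNat, h]

theorem RamState.setReal_real (s : RamState) (r k : ℕ) (v : ℝ) (r' k' : ℕ) :
    (s.setReal r k v).real r' k' = if r' = r ∧ k' = k then v else s.real r' k' := by
  unfold RamState.setReal
  by_cases h : r' = r
  · subst h
    by_cases h' : k' = k
    · subst h'; simp
    · simp [h']
  · simp [h]

@[simp] theorem RamState.setNat_real (s : RamState) (r k v : ℕ) :
    (s.setNat r k v).real = s.real := rfl
@[simp] theorem RamState.setReal_nat (s : RamState) (r k : ℕ) (v : ℝ) :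
    (s.setReal r k v).nat = s.nat := rfl
@[simp] theorem RamState.setNat_drawn (s : RamState) (r k v : ℕ) :
    (s.setNat r k v).drawn = s.drawn := rfl
@[simp] theorem RamState.setReal_drawn (s : RamState) (r k : ℕ) (v : ℝ) :
    (s.setReal r k v).drawn = s.drawn := rfl

/-- The frame property. Write sets are computed from the syntax, so that for a concrete program and
array the side condition is closed by `rfl`. Specifications below therefore mention only the cells
that matter, and everything else is carried through `Agree`. -/
theorem Exec.agree {I : RamInput} {p : RamProg} {s s' : RamState} {t : ℕ}
    (h : Exec I p s s' t) : Agree p s s' := by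
  induction h with
  | nop s => exact Agree.refl _ _
  | setNat s r e f =>
    refine ⟨fun r' hr => ?_, fun _ _ => rfl, fun _ => rfl⟩
    have : r' ≠ r := by
      rintro rfl
      simp [RamProg.writesNat] at hr
    exact RamState.setNat_nat_of_ne _ this _ _
  | setReal s r e f =>
    refine ⟨fun _ _ => rfl, fun r' hr => ?_, fun _ => rfl⟩
    have : r' ≠ r := by
      rintro rfl
      simp [RamProg.writesReal] at hr
    simp [RamState.setReal, this]
  | draw s => exact ⟨fun _ _ => rfl, fun _ _ => rfl, fun h => by simp [RamProg.draws] at h⟩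
  | flip s => exact ⟨fun _ _ => rfl, fun _ _ => rfl, fun _ => rfl⟩
  | seq _ _ h₁ h₂ =>
    refine ⟨fun r hr => ?_, fun r hr => ?_, fun hr => ?_⟩
    · simp only [RamProg.writesNat, Bool.or_eq_false_iff] at hr
      rw [h₂.nat r hr.2, h₁.nat r hr.1]
    · simp only [RamProg.writesReal, Bool.or_eq_false_iff] at hr
      rw [h₂.real r hr.2, h₁.real r hr.1]
    · simp only [RamProg.draws, Bool.or_eq_false_iff] at hr
      rw [h₂.drawn hr.2, h₁.drawn hr.1]
  | branch_true _ _ h =>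
    refine ⟨fun r hr => ?_, fun r hr => ?_, fun hr => ?_⟩
    · simp only [RamProg.writesNat, Bool.or_eq_false_iff] at hr
      exact h.nat r hr.1
    · simp only [RamProg.writesReal, Bool.or_eq_false_iff] at hr
      exact h.real r hr.1
    · simp only [RamProg.draws, Bool.or_eq_false_iff] at hr
      exact h.drawn hr.1
  | branch_false _ _ h =>
    refine ⟨fun r hr => ?_, fun r hr => ?_, fun hr => ?_⟩
    · simp only [RamProg.writesNat, Bool.or_eq_false_iff] at hr
      exact h.nat r hr.2
    · simp only [RamProg.writesReal, Bool.or_eq_false_iff] at hr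
      exact h.real r hr.2
    · simp only [RamProg.draws, Bool.or_eq_false_iff] at hr
      exact h.drawn hr.2
  | loop_true _ _ _ h₁ h₂ =>
    refine ⟨fun r hr => ?_, fun r hr => ?_, fun hr => ?_⟩
    · rw [h₂.nat r hr, h₁.nat r hr]
    · rw [h₂.real r hr, h₁.real r hr]
    · rw [h₂.drawn hr, h₁.drawn hr]
  | loop_false _ => exact Agree.refl _ _

/-! ### Hoare rules with time bounds. -/

section Rules

variable {I : RamInput} {p q : RamProg} {s : RamState} {τ τ₁ τ₂ : ℕ} {P Q : RamState → Prop}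

theorem Reaches.frame (h : Reaches I p s τ Q) :
    Reaches I p s τ (fun s' => Q s' ∧ Agree p s s') := by
  obtain ⟨s', t, he, ht, hQ⟩ := h
  exact ⟨s', t, he, ht, hQ, he.agree⟩

theorem Reaches.mono (h : Reaches I p s τ₁ P) (hτ : τ₁ ≤ τ₂) (hPQ : ∀ s', P s' → Q s') :
    Reaches I p s τ₂ Q := by
  obtain ⟨s', t, he, ht, hP⟩ := h
  exact ⟨s', t, he, ht.trans hτ, hPQ _ hP⟩

theorem Reaches.nop (h : Q s) : Reaches I .nop s 1 Q := ⟨_, _, .nop s, le_rfl, h⟩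

theorem Reaches.setNat {r : ℕ} {e f : NatExpr} (h : Q (s.setNat r (e.eval I s) (f.eval I s))) :
    Reaches I (.setNat r e f) s (e.cost + f.cost + 1) Q := ⟨_, _, .setNat s r e f, le_rfl, h⟩

theorem Reaches.setReal {r : ℕ} {e : NatExpr} {f : RealExpr}
    (h : Q (s.setReal r (e.eval I s) (f.eval I s))) :
    Reaches I (.setReal r e f) s (e.cost + f.cost + 1) Q := ⟨_, _, .setReal s r e f, le_rfl, h⟩

theorem Reaches.draw (h : Q { s with drawn := s.drawn + 1 }) : Reaches I .draw s 1 Q :=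
  ⟨_, _, .draw s, le_rfl, h⟩

theorem Reaches.seq (hp : Reaches I p s τ₁ P) (hq : ∀ s', P s' → Reaches I q s' τ₂ Q) :
    Reaches I (.seq p q) s (τ₁ + τ₂) Q := by
  obtain ⟨s', t, he, ht, hP⟩ := hp
  obtain ⟨s'', t', he', ht', hQ⟩ := hq s' hP
  exact ⟨s'', _, .seq he he', add_le_add ht ht', hQ⟩

theorem Reaches.branch {b : TestExpr} (ht : b.holds I s → Reaches I p s τ Q)
    (hf : ¬ b.holds I s → Reaches I q s τ Q) : Reaches I (.branch b p q) s (b.cost + 1 + τ) Q := by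
  by_cases hb : b.holds I s
  · obtain ⟨s', t, he, ht, hQ⟩ := ht hb
    exact ⟨s', _, .branch_true hb he, by omega, hQ⟩
  · obtain ⟨s', t, he, ht, hQ⟩ := hf hb
    exact ⟨s', _, .branch_false hb he, by omega, hQ⟩

/-- Set cell `0` of array `r` to `0`, and increment it after each execution of `p` as long as `b`
holds. -/
def RamProg.count (r : ℕ) (b : TestExpr) (p : RamProg) : RamProg :=
  .seq (.setNat r (.lit 0) (.lit 0))
    (.loop b (.seq p (.setNat r (.lit 0) (.add (.cell r (.lit 0)) (.lit 1)))))

/-- The invariant is asserted after the counter has been updated, hence the `setNat` in `h0` and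
`hstep`. Every obligation also receives agreement with the initial state on what the whole loop
leaves alone. An iteration costs `τ` for the body, 6 for the increment and `b.cost + 1` for the
test; the final constant is the initialization and the last test, which fails. -/
theorem Reaches.count {r : ℕ} {b : TestExpr} {N : ℕ} {s₀ : RamState} (Inv : ℕ → RamState → Prop)
    (hr : p.writesNat r = false) (h0 : Inv 0 (s₀.setNat r 0 0))
    (htest : ∀ k s, k ≤ N → Agree (.count r b p) s₀ s → s.nat r 0 = k → Inv k s →
      (b.holds I s ↔ k < N))
    (hstep : ∀ k s, k < N → Agree (.count r b p) s₀ s → s.nat r 0 = k → Inv k s →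
      Reaches I p s τ (fun s' => Inv (k + 1) (s'.setNat r 0 (k + 1))))
    (hQ : ∀ s, Agree (.count r b p) s₀ s → s.nat r 0 = N → Inv N s → Q s) :
    Reaches I (.count r b p) s₀ (N * (τ + b.cost + 7) + b.cost + 4) Q := by
  have main : ∀ m k s, k + m = N → Agree (.count r b p) s₀ s → s.nat r 0 = k → Inv k s →
      Reaches I (.loop b (.seq p (.setNat r (.lit 0) (.add (.cell r (.lit 0)) (.lit 1))))) s
        (m * (τ + b.cost + 7) + b.cost + 1) Q := by
    intro m
    induction m with
    | zero =>
      intro k s hk hA hs hI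
      have hb : ¬ b.holds I s := by
        rw [htest k s (by omega) hA hs hI]; omega
      exact ⟨s, _, .loop_false hb, by omega, hQ s hA (by omega) (by
        have : k = N := by omega
        exact this ▸ hI)⟩
    | succ m ih =>
      intro k s hk hA hs hI
      have hb : b.holds I s := by
        rw [htest k s (by omega) hA hs hI]; omega
      obtain ⟨s₁, t₁, he₁, ht₁, hI₁⟩ := hstep k s (by omega) hA hs hI
      have hs₁ : s₁.nat r 0 = k := by rw [he₁.agree.nat r hr, hs]
      have he₂ := Exec.seq he₁ (Exec.setNat (I := I) s₁ r (.lit 0) (.add (.cell r (.lit 0)) (.lit 1)))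
      simp only [NatExpr.eval, hs₁] at he₂
      have hA₂ : Agree (.count r b p) s₀ (s₁.setNat r 0 (k + 1)) := by
        refine hA.trans ⟨fun r' h' => ?_, fun r' h' => ?_, fun h' => ?_⟩
        · exact he₂.agree.nat r' (by
            simp only [RamProg.count, RamProg.writesNat, Bool.or_eq_false_iff] at h' ⊢
            exact h'.2)
        · exact he₂.agree.real r' (by
            simp only [RamProg.count, RamProg.writesReal, Bool.or_eq_false_iff] at h' ⊢
            exact h'.2)
        · exact he₂.agree.drawn (by
            simp only [RamProg.count, RamProg.draws, Bool.or_eq_false_iff] at h' ⊢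
            exact h'.2)
      obtain ⟨s₃, t₃, he₃, ht₃, hQ₃⟩ := ih (k + 1) _ (by omega) hA₂
        (by simp [RamState.setNat_nat]) hI₁
      refine ⟨s₃, _, .loop_true hb he₂ he₃, ?_, hQ₃⟩
      simp only [NatExpr.cost]
      rw [add_mul, one_mul]
      omega
  have h1 := main N 0 (s₀.setNat r 0 0) (by omega)
    ⟨fun r' h' => by
      have : r' ≠ r := by
        rintro rfl
        simp [RamProg.count, RamProg.writesNat] at h'
      exact RamState.setNat_nat_of_ne _ this _ _, fun _ _ => rfl, fun _ => rfl⟩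
    (by simp [RamState.setNat_nat]) h0
  have h2 : Reaches I (.setNat r (.lit 0) (.lit 0)) s₀ 3 (fun s => s = s₀.setNat r 0 0) :=
    Reaches.setNat (e := .lit 0) (f := .lit 0) rfl
  refine (h2.seq (τ₂ := N * (τ + b.cost + 7) + b.cost + 1) ?_).mono (by omega) (fun _ h => h)
  rintro _ rfl
  exact h1

/-- `for r < e do p`. -/
def RamProg.forLT (r : ℕ) (e : NatExpr) (p : RamProg) : RamProg :=
  .count r (.natLT (.cell r (.lit 0)) e) p

theorem Reaches.forLT {r : ℕ} {e : NatExpr} {N : ℕ} {s₀ : RamState} (Inv : ℕ → RamState → Prop)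
    (hr : p.writesNat r = false) (h0 : Inv 0 (s₀.setNat r 0 0))
    (he : ∀ s, Agree (.forLT r e p) s₀ s → e.eval I s = N)
    (hstep : ∀ k s, k < N → Agree (.forLT r e p) s₀ s → s.nat r 0 = k → Inv k s →
      Reaches I p s τ (fun s' => Inv (k + 1) (s'.setNat r 0 (k + 1))))
    (hQ : ∀ s, Agree (.forLT r e p) s₀ s → Inv N s → Q s) :
    Reaches I (.forLT r e p) s₀ (N * (τ + e.cost + 10) + e.cost + 7) Q := by
  refine (Reaches.count (Q := Q) Inv hr h0 (fun k s _ hA hs _ => ?_) hstep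
    (fun s hA _ hI => hQ s hA hI)).mono (le_of_eq ?_) (fun _ h => h)
  · simp [TestExpr.holds, NatExpr.eval, hs, he s hA]
  · simp only [TestExpr.cost, NatExpr.cost]
    ring

end Rules

/-! ### The conditional independence tests as a program -/

/-- Closes the time bounds of nested loops: the iteration count `N` multiplies a nonlinear
expression, and only the inner comparison is left to linear arithmetic. -/
theorem mul_add_add_le {N a b c₁ c₂ d : ℕ} (h : a ≤ b) (h' : c₁ + c₂ ≤ d) :
    N * a + c₁ + c₂ ≤ N * b + d := by
  have := Nat.mul_le_mul_left N h
  omega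

/-- The integer variable `r`: cell `0` of array `r`. -/
abbrev NatExpr.reg (r : ℕ) : NatExpr := .cell r (.lit 0)

/-- The real variable `r`: cell `0` of array `r`. -/
abbrev RealExpr.reg (r : ℕ) : RealExpr := .cell r (.lit 0)

abbrev TestExpr.natEq (e f : NatExpr) : TestExpr := .and (.neg (.natLT e f)) (.neg (.natLT f e))

abbrev TestExpr.or (b b' : TestExpr) : TestExpr := .neg (.and (.neg b) (.neg b'))

abbrev TestExpr.pos (e : NatExpr) : TestExpr := .natLT (.lit 0) e

theorem TestExpr.natEq_holds {I : RamInput} {s : RamState} {e f : NatExpr} :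
    (TestExpr.natEq e f).holds I s ↔ e.eval I s = f.eval I s := by
  simp only [TestExpr.holds]; omega

/-- The number with binary digits `f 0, …, f (r - 1)`, the most significant first. -/
def hornerKey (f : ℕ → ℕ) : ℕ → ℕ
  | 0 => 0
  | r + 1 => hornerKey f r + hornerKey f r + f r

/-- Compute the configuration of sample `20` on the tuple in array `7`. -/
def keyProg : RamProg :=
  .seq (.setNat 21 (.lit 0) (.lit 0))
    (.forLT 22 .deg (.setNat 21 (.lit 0) (.add (.add (.reg 21) (.reg 21))
      (.sample (.reg 20) (.cell 7 (.reg 22))))))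

/-- The sample must already be drawn, since others read as `0`. Integer registers of the tester: `1`
holds `⌈log₂ n⌉`, `3` holds `2 ^ d`, `5` and `6` hold the batch sizes `M` and `m`, `7` the current
tuple, `8` the number of tuples, `13` and `14` the current pair, `15` the marks of the tuple, `19`
the configuration, `20` the sample, `23` the four counts, `24` the rejection flag. In the identity
test, `26`, `27`, `38` are node, entry and sample, and `32` to `37` the counts of the three batches.
The real registers `0` and `1` hold the statistics of the two kinds of tests. -/
theorem keyProg_spec {I : RamInput} {s : RamState} (hs : s.nat 20 0 < s.drawn) :
    Reaches I keyProg s (30 * I.deg + 20) fun s' =>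
      s'.nat 21 0 = hornerKey (fun r => I.sample (s.nat 20 0) (s.nat 7 r)) I.deg := by
  refine (Reaches.seq (Reaches.setNat (Q := fun s' => s' = s.setNat 21 0 0) rfl)
    (τ₂ := I.deg * 30 + 8) ?_).mono (by simp only [NatExpr.cost]; omega) (fun _ h => h)
  rintro _ rfl
  refine (Reaches.forLT (N := I.deg) (fun k s' => s'.nat 21 0 =
    hornerKey (fun r => I.sample (s.nat 20 0) (s.nat 7 r)) k) rfl ?_ (fun _ _ => rfl)
    (fun k s' hk hA hk' hI => Reaches.setNat ?_) (fun s' _ h => h)).mono ?_ (fun _ h => h)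
  · simp [RamState.setNat_nat, hornerKey]
  · have h20 := hA.nat 20 rfl
    have h7 := hA.nat 7 rfl
    have hd := hA.drawn rfl
    rw [RamState.setNat_nat_of_ne _ (by decide)] at h20 h7
    simp only [RamState.setNat_drawn] at hd
    simp [RamState.setNat_nat, NatExpr.eval, h20, h7, hd, hs, hk', hornerKey, hI]
  · simp only [NatExpr.cost]; omega

/-- The number of samples `t < m` with configuration `k` on the tuple `T` and with
`2 x_i + x_j = c`. -/
def ciCount (I : RamInput) (T : ℕ → ℕ) (m i j k c : ℕ) : ℕ :=
  ((Finset.range m).filter fun t => hornerKey (fun r => I.sample t (T r)) I.deg = k ∧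
    I.sample t i + I.sample t i + I.sample t j = c).card

theorem ciCount_succ (I : RamInput) (T : ℕ → ℕ) (m i j k c : ℕ) :
    ciCount I T (m + 1) i j k c = ciCount I T m i j k c +
      if hornerKey (fun r => I.sample m (T r)) I.deg = k ∧
        I.sample m i + I.sample m i + I.sample m j = c then 1 else 0 := by
  unfold ciCount
  rw [Finset.range_add_one, Finset.filter_insert]
  split_ifs with h
  · rw [Finset.card_insert_of_notMem (by simp)]
  · rfl

/-- The index `2 x_i + x_j` for sample `20`. -/
abbrev pairIdx : NatExpr :=
  .add (.add (.sample (.reg 20) (.reg 13)) (.sample (.reg 20) (.reg 13)))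
    (.sample (.reg 20) (.reg 14))

/-- Count, in array `23`, the samples with configuration `19`. -/
def countProg : RamProg :=
  .seq (.forLT 20 (.lit 4) (.setNat 23 (.reg 20) (.lit 0)))
    (.forLT 20 (.reg 6) (.seq keyProg
      (.branch (.natEq (.reg 21) (.reg 19))
        (.setNat 23 pairIdx (.add (.cell 23 pairIdx) (.lit 1))) .nop)))

theorem countProg_spec {I : RamInput} {s : RamState} (hs : s.nat 6 0 ≤ s.drawn) :
    Reaches I countProg s (s.nat 6 0 * (30 * I.deg + 90) + 100) fun s' => ∀ c < 4,
      s'.nat 23 c = ciCount I (s.nat 7) (s.nat 6 0) (s.nat 13 0) (s.nat 14 0) (s.nat 19 0) c := by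
  refine (Reaches.seq (P := fun s' => (∀ c < 4, s'.nat 23 c = 0) ∧
    Agree (.forLT 20 (.lit 4) (.setNat 23 (.reg 20) (.lit 0))) s s') (τ₁ := 80)
    (τ₂ := s.nat 6 0 * (30 * I.deg + 90) + 10) ?_ ?_).mono (by omega) (fun _ h => h)
  · refine Reaches.frame ((Reaches.forLT (N := 4) (fun k s' => ∀ c < k, s'.nat 23 c = 0) rfl
      (by simp) (fun _ _ => rfl) (fun k s' hk hA hk' hI => Reaches.setNat ?_)
      (fun s' _ h => h)).mono ?_ (fun _ h => h))
    · intro c hc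
      simp only [RamState.setNat_nat, NatExpr.eval, hk']
      by_cases h : c = k
      · simp [h]
      · simp [h, hI c (by omega)]
    · simp only [NatExpr.cost]; omega
  rintro s₁ ⟨h23, hA₁⟩
  have e6 : s₁.nat 6 = s.nat 6 := hA₁.nat 6 rfl
  have e7 : s₁.nat 7 = s.nat 7 := hA₁.nat 7 rfl
  have e13 : s₁.nat 13 = s.nat 13 := hA₁.nat 13 rfl
  have e14 : s₁.nat 14 = s.nat 14 := hA₁.nat 14 rfl
  have e19 : s₁.nat 19 = s.nat 19 := hA₁.nat 19 rfl
  have ed : s₁.drawn = s.drawn := hA₁.drawn rfl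
  rw [← e6, ← e7, ← e13, ← e14, ← e19]
  rw [← e6, ← ed] at hs
  clear e6 e7 e13 e14 e19 ed hA₁
  refine (Reaches.forLT (N := s₁.nat 6 0) (fun k s' => ∀ c < 4, s'.nat 23 c =
    ciCount I (s₁.nat 7) k (s₁.nat 13 0) (s₁.nat 14 0) (s₁.nat 19 0) c) rfl
    ?_ (fun s' hA => ?_) (τ := 30 * I.deg + 72)
    (fun k s' hk hA hk' hI => ?_) (fun s' _ h => h)).mono ?_ (fun _ h => h)
  · intro c hc
    simp [RamState.setNat_nat, h23 c hc, ciCount]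
  · simp only [NatExpr.eval, hA.nat 6 rfl]
  · have hd := hA.drawn rfl
    refine (Reaches.seq (keyProg_spec (by omega)).frame (τ₂ := 52) ?_).mono (by omega)
      (fun _ h => h)
    rintro s₂ ⟨hkey, hA₂⟩
    have e7 : s₂.nat 7 = s₁.nat 7 := (hA₂.nat 7 rfl).trans (hA.nat 7 rfl)
    have e7' : s'.nat 7 = s₁.nat 7 := hA.nat 7 rfl
    have e13 : s₂.nat 13 = s₁.nat 13 := (hA₂.nat 13 rfl).trans (hA.nat 13 rfl)
    have e14 : s₂.nat 14 = s₁.nat 14 := (hA₂.nat 14 rfl).trans (hA.nat 14 rfl)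
    have e19 : s₂.nat 19 = s₁.nat 19 := (hA₂.nat 19 rfl).trans (hA.nat 19 rfl)
    have e20 : s₂.nat 20 0 = k := by rw [hA₂.nat 20 rfl, hk']
    have e23 : s₂.nat 23 = s'.nat 23 := hA₂.nat 23 rfl
    have ed : s₂.drawn = s₁.drawn := (hA₂.drawn rfl).trans hd
    have hlt : k < s₁.drawn := by omega
    rw [hk', e7'] at hkey
    have hsum : pairIdx.eval I s₂ =
        I.sample k (s₁.nat 13 0) + I.sample k (s₁.nat 13 0) + I.sample k (s₁.nat 14 0) := by
      simp [NatExpr.eval, e20, ed, hlt, e13, e14]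
    refine (Reaches.branch (τ := 38) (fun hb => (Reaches.setNat ?_).mono ?_ (fun _ h => h))
      (fun hb => (Reaches.nop ?_).mono (by omega) (fun _ h => h))).mono ?_ (fun _ h => h)
    · rw [TestExpr.natEq_holds] at hb
      simp only [NatExpr.eval, e19, hkey] at hb
      intro c hc
      rw [RamState.setNat_nat_of_ne _ (by decide), RamState.setNat_nat, hsum, ciCount_succ]
      have hv : ((NatExpr.cell 23 pairIdx).add (.lit 1)).eval I s₂ = s'.nat 23
          (I.sample k (s₁.nat 13 0) + I.sample k (s₁.nat 13 0) + I.sample k (s₁.nat 14 0)) + 1 := by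
        show s₂.nat 23 (pairIdx.eval I s₂) + 1 = _
        rw [hsum, e23]
      rw [hv, e23, hb]
      simp only [true_and]
      by_cases h : c = I.sample k (s₁.nat 13 0) + I.sample k (s₁.nat 13 0) + I.sample k (s₁.nat 14 0)
      · rw [← h, if_pos rfl, if_pos (by simp), hI c hc]
      · rw [if_neg h, if_neg (by tauto), hI c hc, add_zero]
    · simp only [NatExpr.cost]; omega
    · rw [TestExpr.natEq_holds] at hb
      simp only [NatExpr.eval, e19, hkey] at hb
      intro c hc
      rw [RamState.setNat_nat_of_ne _ (by decide), ciCount_succ, e23, hI c hc,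
        if_neg (by tauto), add_zero]
    · simp only [NatExpr.cost, TestExpr.cost]; omega
  · simp only [NatExpr.cost]
    exact mul_add_add_le (by omega) (by omega)

/-- The empirical covariance of `X_i` and `X_j` given the tuple `T`, up to normalization. -/
noncomputable def ciStat (I : RamInput) (T : ℕ → ℕ) (m i j K : ℕ) : ℝ :=
  ∑ k ∈ Finset.range K,
    |(ciCount I T m i j k 3 : ℝ) * ciCount I T m i j k 0 -
        ciCount I T m i j k 1 * ciCount I T m i j k 2| /
      (ciCount I T m i j k 0 + ciCount I T m i j k 1 + ciCount I T m i j k 2 +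
        ciCount I T m i j k 3)

abbrev cellSum : NatExpr :=
  .add (.add (.add (.cell 23 (.lit 0)) (.cell 23 (.lit 1))) (.cell 23 (.lit 2)))
    (.cell 23 (.lit 3))

abbrev mulCells (a b : ℕ) : RealExpr :=
  .mul (.ofNat (.cell 23 (.lit a))) (.ofNat (.cell 23 (.lit b)))

/-- Add the contribution of the counts in array `23` to the real variable `0`. -/
def addStatProg : RamProg :=
  .branch (.pos cellSum)
    (.branch (.realLT (mulCells 3 0) (mulCells 1 2))
      (.setReal 0 (.lit 0) (.add (.reg 0)
        (.div (.sub (mulCells 1 2) (mulCells 3 0)) (.ofNat cellSum))))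
      (.setReal 0 (.lit 0) (.add (.reg 0)
        (.div (.sub (mulCells 3 0) (mulCells 1 2)) (.ofNat cellSum)))))
    .nop

/-- The machine has no absolute value, hence the case distinction on the sign. An empty table is
skipped, which agrees with the convention `0 / 0 = 0` in the formula. -/
theorem addStatProg_spec {I : RamInput} {s : RamState} :
    Reaches I addStatProg s 100 fun s' => s'.real 0 0 = s.real 0 0 +
      |(s.nat 23 3 : ℝ) * s.nat 23 0 - s.nat 23 1 * s.nat 23 2| /
        (s.nat 23 0 + s.nat 23 1 + s.nat 23 2 + s.nat 23 3) := by
  refine (Reaches.branch (τ := 70) (fun hb => (Reaches.branch (τ := 36)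
    (fun hb' => (Reaches.setReal ?_).mono ?_ (fun _ h => h))
    (fun hb' => (Reaches.setReal ?_).mono ?_ (fun _ h => h))).mono ?_ (fun _ h => h))
    (fun hb => (Reaches.nop ?_).mono (by omega) (fun _ h => h))).mono ?_ (fun _ h => h)
  · simp only [TestExpr.holds, RealExpr.eval, NatExpr.eval] at hb'
    simp only [RamState.setReal_real, NatExpr.eval, RealExpr.eval, and_self, if_true]
    rw [abs_of_neg (by linarith)]
    push_cast
    ring
  · simp only [NatExpr.cost, RealExpr.cost]; omega
  · simp only [TestExpr.holds, RealExpr.eval, NatExpr.eval, not_lt] at hb'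
    simp only [RamState.setReal_real, NatExpr.eval, RealExpr.eval, and_self, if_true]
    rw [abs_of_nonneg (by linarith)]
    push_cast
    ring
  · simp only [NatExpr.cost, RealExpr.cost]; omega
  · simp only [NatExpr.cost, RealExpr.cost, TestExpr.cost]; omega
  · simp only [TestExpr.holds, NatExpr.eval, not_lt, nonpos_iff_eq_zero, Nat.add_eq_zero_iff]
      at hb
    simp [hb.1.1.1, hb.1.1.2, hb.1.2, hb.2]
  · simp only [NatExpr.cost, TestExpr.cost]; omega

/-- Compute `ciStat` in the real variable `0`. -/
def statProg : RamProg :=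
  .seq (.setReal 0 (.lit 0) (.ofNat (.lit 0))) (.forLT 19 (.reg 3) (.seq countProg addStatProg))

theorem statProg_spec {I : RamInput} {s : RamState} (hs : s.nat 6 0 ≤ s.drawn) :
    Reaches I statProg s (s.nat 3 0 * (s.nat 6 0 * (30 * I.deg + 90) + 220) + 20) fun s' =>
      s'.real 0 0 = ciStat I (s.nat 7) (s.nat 6 0) (s.nat 13 0) (s.nat 14 0) (s.nat 3 0) := by
  refine (Reaches.seq (Reaches.setReal (Q := fun s' => s' = s.setReal 0 0 0) ?_)
    (τ₂ := s.nat 3 0 * (s.nat 6 0 * (30 * I.deg + 90) + 220) + 9) ?_).mono ?_ (fun _ h => h)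
  · simp [NatExpr.eval, RealExpr.eval]
  · rintro _ rfl
    refine (Reaches.forLT (N := s.nat 3 0) (τ := s.nat 6 0 * (30 * I.deg + 90) + 200)
      (fun k s' => s'.real 0 0 =
      ciStat I (s.nat 7) (s.nat 6 0) (s.nat 13 0) (s.nat 14 0) k) rfl
      ?_ (fun s' hA => ?_) (fun k s' hk hA hk' hI => ?_) (fun s' _ h => h)).mono ?_ (fun _ h => h)
    · simp [ciStat, RamState.setReal_real]
    · simp only [NatExpr.eval, hA.nat 3 rfl, RamState.setReal_nat]
    · have e6 := hA.nat 6 rfl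
      have e7 := hA.nat 7 rfl
      have e13 := hA.nat 13 rfl
      have e14 := hA.nat 14 rfl
      have ed := hA.drawn rfl
      simp only [RamState.setReal_nat, RamState.setReal_drawn] at e6 e7 e13 e14 ed
      refine (Reaches.seq (countProg_spec (by rw [e6, ed]; exact hs)).frame (τ₂ := 100)
        ?_).mono (by rw [e6]) (fun _ h => h)
      rintro s₂ ⟨hc, hA₂⟩
      rw [e6, e7, e13, e14, hk'] at hc
      refine addStatProg_spec.mono le_rfl (fun s₃ h => ?_)
      have h0 : s₂.real 0 = s'.real 0 := hA₂.real 0 rfl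
      rw [RamState.setNat_real, h, h0, hI, hc 0 (by omega), hc 1 (by omega), hc 2 (by omega),
        hc 3 (by omega), ciStat, ciStat, Finset.sum_range_succ]
    · simp only [NatExpr.cost]
      exact mul_add_add_le (by omega) (by omega)
  · simp only [NatExpr.cost, RealExpr.cost]; omega

/-- Mark, in array `15`, the entries of the tuple in array `7`. -/
def markProg : RamProg :=
  .seq (.forLT 16 (.add .dim (.lit 1)) (.setNat 15 (.reg 16) (.lit 0)))
    (.forLT 16 .deg (.setNat 15 (.cell 7 (.reg 16)) (.lit 1)))

/-- Marks are kept for `0, …, n` and not only for the nodes, because the entry `n` of a tuple stands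
for an unused place and is marked as well. -/
theorem markProg_spec {I : RamInput} {s : RamState} :
    Reaches I markProg s (I.dim * 20 + I.deg * 20 + 60) fun s' =>
      ∀ k ≤ I.dim, (0 < s'.nat 15 k ↔ ∃ r < I.deg, s.nat 7 r = k) := by
  refine (Reaches.seq (P := fun s' => (∀ k < I.dim + 1, s'.nat 15 k = 0) ∧
    Agree (.forLT 16 (.add .dim (.lit 1)) (.setNat 15 (.reg 16) (.lit 0))) s s')
    (τ₁ := (I.dim + 1) * 20 + 20) (τ₂ := I.deg * 20 + 10) ?_ ?_).mono (by omega) (fun _ h => h)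
  · refine Reaches.frame ((Reaches.forLT (N := I.dim + 1) (fun k s' => ∀ c < k, s'.nat 15 c = 0)
      rfl (by simp) (fun _ _ => rfl) (fun k s' hk hA hk' hI => Reaches.setNat ?_)
      (fun s' _ h => h)).mono ?_ (fun _ h => h))
    · intro c hc
      simp only [RamState.setNat_nat, NatExpr.eval, hk']
      by_cases h : c = k
      · simp [h]
      · simp [h, hI c (by omega)]
    · simp only [NatExpr.cost]; omega
  rintro s₁ ⟨h15, hA₁⟩
  have e7 : s₁.nat 7 = s.nat 7 := hA₁.nat 7 rfl
  refine (Reaches.forLT (N := I.deg) (fun m s' => ∀ k ≤ I.dim, (0 < s'.nat 15 k ↔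
    ∃ r < m, s.nat 7 r = k)) rfl ?_ (fun _ _ => rfl) (fun m s' hm hA hm' hI => Reaches.setNat ?_)
    (fun s' _ h => h)).mono ?_ (fun _ h => h)
  · intro k hk
    simp [RamState.setNat_nat, h15 k (by omega)]
  · intro k hk
    have e7' : s'.nat 7 = s.nat 7 := (hA.nat 7 rfl).trans e7
    simp only [RamState.setNat_nat, NatExpr.eval, hm', e7']
    by_cases h : k = s.nat 7 m
    · simp only [h, and_self, if_true, show ¬ (15 = 16) by decide, false_and, if_false]
      simp only [Nat.zero_lt_one, true_iff]
      exact ⟨m, by omega, rfl⟩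
    · simp only [h, and_false, if_false, show ¬ (15 = 16) by decide, false_and, hI k hk]
      constructor
      · rintro ⟨r, hr, rfl⟩
        exact ⟨r, by omega, rfl⟩
      · rintro ⟨r, hr, rfl⟩
        refine ⟨r, ?_, rfl⟩
        rcases Nat.lt_succ_iff_lt_or_eq.1 hr with h' | h'
        · exact h'
        · exact absurd (by rw [h']) h
  · simp only [NatExpr.cost]; omega

/-- The edges of the input force `X_i` and `X_j` to be dependent conditioned on the set marked
by `A`, apart from the conditions that `i ≠ j` and that neither is in the set. -/
def edgeFlag (I : RamInput) (A : ℕ → Prop) (i j N : ℕ) : Prop :=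
  0 < I.edge i j ∨ ∃ k < N, (A k ∧ 0 < I.edge i k ∧ 0 < I.edge j k) ∨
    (¬ A k ∧ 0 < I.edge k j ∧ (0 < I.edge i k ∨ 0 < I.edge k i))

/-- Compute `edgeFlag` in the integer variable `17`. -/
def flagProg : RamProg :=
  .seq (.setNat 17 (.lit 0) (.edge (.reg 13) (.reg 14)))
    (.forLT 18 .dim (.branch (.or
      (.and (.pos (.cell 15 (.reg 18))) (.and (.pos (.edge (.reg 13) (.reg 18)))
        (.pos (.edge (.reg 14) (.reg 18)))))
      (.and (.neg (.pos (.cell 15 (.reg 18)))) (.and (.pos (.edge (.reg 18) (.reg 14)))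
        (.or (.pos (.edge (.reg 13) (.reg 18))) (.pos (.edge (.reg 18) (.reg 13)))))))
      (.setNat 17 (.lit 0) (.lit 1)) .nop))

theorem flagProg_spec {I : RamInput} {s : RamState} :
    Reaches I flagProg s (I.dim * 100 + 30) fun s' =>
      (0 < s'.nat 17 0 ↔
        edgeFlag I (fun k => 0 < s.nat 15 k) (s.nat 13 0) (s.nat 14 0) I.dim) := by
  refine (Reaches.seq (Reaches.setNat (Q := fun s' =>
    s' = s.setNat 17 0 (I.edge (s.nat 13 0) (s.nat 14 0))) rfl)
    (τ₂ := I.dim * 100 + 10) ?_).mono (by simp only [NatExpr.cost]; omega) (fun _ h => h)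
  rintro _ rfl
  refine (Reaches.forLT (N := I.dim) (fun m s' => (0 < s'.nat 17 0 ↔
    edgeFlag I (fun k => 0 < s.nat 15 k) (s.nat 13 0) (s.nat 14 0) m)) rfl ?_ (fun _ _ => rfl)
    (fun m s' hm hA hm' hI => (Reaches.branch (τ := 3) (fun hb => (Reaches.setNat ?_))
      (fun hb => (Reaches.nop ?_).mono (by omega) (fun _ h => h))))
    (fun s' _ h => h)).mono ?_ (fun _ h => h)
  · simp [RamState.setNat_nat, edgeFlag]
  · have e13 := hA.nat 13 rfl
    have e14 := hA.nat 14 rfl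
    have e15 := hA.nat 15 rfl
    rw [RamState.setNat_nat_of_ne _ (by decide)] at e13 e14 e15
    simp only [TestExpr.holds, NatExpr.eval, e13, e14, e15, hm'] at hb
    simp only [RamState.setNat_nat, NatExpr.eval]
    simp only [show ¬ (17 = 18) by decide, false_and, if_false, and_self, if_true, edgeFlag,
      Nat.zero_lt_one, true_iff]
    exact Or.inr ⟨m, by omega, by tauto⟩
  · have e13 := hA.nat 13 rfl
    have e14 := hA.nat 14 rfl
    have e15 := hA.nat 15 rfl
    rw [RamState.setNat_nat_of_ne _ (by decide)] at e13 e14 e15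
    simp only [TestExpr.holds, NatExpr.eval, e13, e14, e15, hm'] at hb
    simp only [RamState.setNat_nat, show ¬ (17 = 18) by decide, false_and, if_false, hI, edgeFlag]
    refine or_congr_right ⟨?_, ?_⟩
    · rintro ⟨k, hk, h⟩
      exact ⟨k, by omega, h⟩
    · rintro ⟨k, hk, h⟩
      rcases Nat.lt_succ_iff_lt_or_eq.1 hk with h' | rfl
      · exact ⟨k, h', h⟩
      · tauto
  · simp only [NatExpr.cost, TestExpr.cost]; omega

/-- The triple of `i`, `j` and the entries of `T` is to be tested, and is found to be close to
conditionally independent. -/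
def ciFails (I : RamInput) (m K : ℕ) (T : ℕ → ℕ) (i j : ℕ) : Prop :=
  (edgeFlag I (fun k => ∃ r < I.deg, T r = k) i j I.dim ∧ i ≠ j ∧ (¬ ∃ r < I.deg, T r = i) ∧
    ¬ ∃ r < I.deg, T r = j) ∧ 4 * ciStat I T m i j K ≤ I.gam * m

/-- Test one triple. -/
def pairProg : RamProg :=
  .seq flagProg
    (.branch (.and (.pos (.reg 17)) (.and (.neg (.natEq (.reg 13) (.reg 14)))
        (.and (.neg (.pos (.cell 15 (.reg 13)))) (.neg (.pos (.cell 15 (.reg 14)))))))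
      (.seq statProg
        (.branch (.realLT (.mul .gam (.ofNat (.reg 6))) (.mul (.ofNat (.lit 4)) (.reg 0)))
          .nop (.setNat 24 (.lit 0) (.lit 1))))
      .nop)

/-- The flag `24` is only ever raised, so a pass over all tests computes the disjunction of the
failures. Both nodes must be less than `n` for their marks in array `15` to be meaningful. -/
theorem pairProg_spec {I : RamInput} {s : RamState} (hs : s.nat 6 0 ≤ s.drawn)
    (hmark : ∀ k ≤ I.dim, (0 < s.nat 15 k ↔ ∃ r < I.deg, s.nat 7 r = k))
    (hi : s.nat 13 0 < I.dim) (hj : s.nat 14 0 < I.dim) :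
    Reaches I pairProg s
      (I.dim * 100 + s.nat 3 0 * (s.nat 6 0 * (30 * I.deg + 90) + 220) + 200) fun s' =>
      (0 < s'.nat 24 0 ↔ 0 < s.nat 24 0 ∨
        ciFails I (s.nat 6 0) (s.nat 3 0) (s.nat 7) (s.nat 13 0) (s.nat 14 0)) := by
  refine (Reaches.seq flagProg_spec.frame
    (τ₂ := s.nat 3 0 * (s.nat 6 0 * (30 * I.deg + 90) + 220) + 150) ?_).mono
    (by omega) (fun _ h => h)
  rintro s₁ ⟨h17, hA⟩
  have hflag : edgeFlag I (fun k => 0 < s.nat 15 k) (s.nat 13 0) (s.nat 14 0) I.dim ↔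
      edgeFlag I (fun k => ∃ r < I.deg, s.nat 7 r = k) (s.nat 13 0) (s.nat 14 0) I.dim := by
    unfold edgeFlag
    refine or_congr_right (exists_congr fun k => and_congr_right fun hk => ?_)
    simp only [hmark k hk.le]
  have e3 := hA.nat 3 rfl
  have e6 := hA.nat 6 rfl
  have e7 := hA.nat 7 rfl
  have e13 := hA.nat 13 rfl
  have e14 := hA.nat 14 rfl
  have e15 := hA.nat 15 rfl
  have e24 := hA.nat 24 rfl
  have ed := hA.drawn rfl
  rw [hflag] at h17
  have hmi := hmark _ hi.le
  have hmj := hmark _ hj.le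
  rw [← e15] at hmi hmj
  rw [← ed, ← e6] at hs
  rw [← e7, ← e13] at hmi
  rw [← e7, ← e14] at hmj
  rw [← e7, ← e13, ← e14] at h17
  rw [← e3, ← e6, ← e7, ← e13, ← e14, ← e24]
  have hne : (¬ (¬ s₁.nat 13 0 < s₁.nat 14 0 ∧ ¬ s₁.nat 14 0 < s₁.nat 13 0)) ↔
      s₁.nat 13 0 ≠ s₁.nat 14 0 := by omega
  refine (Reaches.branch (τ := s₁.nat 3 0 * (s₁.nat 6 0 * (30 * I.deg + 90) + 220) + 60)
    (fun hb => (Reaches.seq (statProg_spec (by omega)).frame (τ₂ := 30) ?_).mono (by omega)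
      (fun _ h => h))
      (fun hb => (Reaches.nop ?_).mono (by omega) (fun _ h => h))).mono ?_ (fun _ h => h)
  · simp only [TestExpr.holds, NatExpr.eval, hmi, hmj, h17, hne] at hb
    rintro s₂ ⟨h0, hA₂⟩
    have e6' := hA₂.nat 6 rfl
    refine (Reaches.branch (τ := 3) (fun hb' => (Reaches.nop ?_).mono (by omega) (fun _ h => h))
      (fun hb' => (Reaches.setNat ?_))).mono ?_ (fun _ h => h)
    · simp only [TestExpr.holds, RealExpr.eval, NatExpr.eval, h0, e6'] at hb'
      rw [hA₂.nat 24 rfl, iff_self_or]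
      intro h
      exact absurd h.2 (not_le.2 (by exact_mod_cast hb'))
    · simp only [TestExpr.holds, RealExpr.eval, NatExpr.eval, h0, e6', not_lt] at hb'
      simp only [RamState.setNat_nat, NatExpr.eval, and_self, if_true, Nat.zero_lt_one, true_iff]
      exact Or.inr ⟨hb, by exact_mod_cast hb'⟩
    · simp only [NatExpr.cost, TestExpr.cost, RealExpr.cost]; omega
  · simp only [TestExpr.holds, NatExpr.eval, hmi, hmj, h17, hne] at hb
    rw [iff_self_or]
    exact fun h => absurd h.1 hb
  · simp only [NatExpr.cost, TestExpr.cost]; omega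

/-! ### Enumeration of tuples by counting to base `n + 1`. -/

theorem succ_div_pow_aux (b u r : ℕ) :
    (u + 1) / b ^ r = u / b ^ r + (if b ^ r ∣ u + 1 then 1 else 0) := by
  have := Nat.succ_div (a := u) (b := b ^ r)
  simpa using this

/-- Add `1` to the number with base `n + 1` digits in array `7`. -/
def incProg : RamProg :=
  .seq (.setNat 25 (.lit 0) (.lit 1))
    (.forLT 16 .deg (.seq (.setNat 7 (.reg 16) (.add (.cell 7 (.reg 16)) (.reg 25)))
      (.branch (.natLT .dim (.cell 7 (.reg 16)))
        (.seq (.setNat 7 (.reg 16) (.lit 0)) (.setNat 25 (.lit 0) (.lit 1)))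
        (.setNat 25 (.lit 0) (.lit 0)))))

/-- The `r`-th digit of `u` to base `n + 1`. -/
def tupleDigit (n u r : ℕ) : ℕ := u / (n + 1) ^ r % (n + 1)

/-- Schoolbook addition of `1`: the carry into place `r` is the difference of the two quotients by
`(n + 1) ^ r`, which is `0` or `1`, and it passes on exactly when the digit plus the carry exceeds
`n`. -/
theorem tupleDigit_carry (n u r : ℕ) :
    ((u + 1) / (n + 1) ^ (r + 1) - u / (n + 1) ^ (r + 1) =
      if n < tupleDigit n u r + ((u + 1) / (n + 1) ^ r - u / (n + 1) ^ r) then 1 else 0) ∧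
    tupleDigit n (u + 1) r =
      if n < tupleDigit n u r + ((u + 1) / (n + 1) ^ r - u / (n + 1) ^ r) then 0
      else tupleDigit n u r + ((u + 1) / (n + 1) ^ r - u / (n + 1) ^ r) := by
  unfold tupleDigit
  rw [pow_succ, ← Nat.div_div_eq_div_mul, ← Nat.div_div_eq_div_mul,
    succ_div_pow_aux _ u r]
  set v := u / (n + 1) ^ r
  have hv := Nat.div_add_mod v (n + 1)
  have hlt : v % (n + 1) < n + 1 := Nat.mod_lt v (Nat.succ_pos n)
  split_ifs with h1 h2 h2
  · have h3 : v % (n + 1) = n := by simp at h2; omega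
    have h4 : v + 1 = (n + 1) * (v / (n + 1) + 1) := by rw [mul_add, mul_one]; omega
    rw [h4, Nat.mul_div_cancel_left _ (Nat.succ_pos n)]
    simp
  · have h3 : v % (n + 1) + 1 < n + 1 := by simp at h2; omega
    have h4 : v + 1 = (v % (n + 1) + 1) + (n + 1) * (v / (n + 1)) := by omega
    have h5 : (v + 1) / (n + 1) = v / (n + 1) := by
      rw [h4, Nat.add_mul_div_left _ _ (Nat.succ_pos n), Nat.div_eq_of_lt h3, zero_add]
    have h6 : (v + 1) % (n + 1) = v % (n + 1) + 1 := by
      rw [h4, Nat.add_mul_mod_self_left, Nat.mod_eq_of_lt h3]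
    rw [h5, h6]
    simp
  · simp at h2; omega
  · simp

theorem incProg_spec {I : RamInput} {s : RamState} {u : ℕ}
    (hT : ∀ r < I.deg, s.nat 7 r = tupleDigit I.dim u r) :
    Reaches I incProg s (I.deg * 60 + 20) fun s' =>
      ∀ r < I.deg, s'.nat 7 r = tupleDigit I.dim (u + 1) r := by
  refine (Reaches.seq (Reaches.setNat (Q := fun s' => s' = s.setNat 25 0 1) rfl)
    (τ₂ := I.deg * 60 + 10) ?_).mono (by simp only [NatExpr.cost]; omega) (fun _ h => h)
  rintro _ rfl
  -- Register `25` is the carry into place `m`; lower places already hold the digits of `u + 1`, the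
  -- others still those of `u`. A carry out of the last place is dropped.
  refine (Reaches.forLT (N := I.deg) (fun m s' =>
    s'.nat 25 0 = (u + 1) / (I.dim + 1) ^ m - u / (I.dim + 1) ^ m ∧
    (∀ r < m, s'.nat 7 r = tupleDigit I.dim (u + 1) r) ∧
    (∀ r < I.deg, m ≤ r → s'.nat 7 r = tupleDigit I.dim u r)) rfl ?_ (fun _ _ => rfl)
    (fun m s' hm hA hm' hI => (Reaches.seq (Reaches.setNat (Q := fun s'' => s'' =
      s'.setNat 7 m (tupleDigit I.dim u m + s'.nat 25 0)) ?_) (τ₂ := 20) ?_))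
    (fun s' _ h => h.2.1)).mono ?_ (fun _ h => h)
  · refine ⟨by simp [RamState.setNat_nat], by simp, fun r hr _ => ?_⟩
    simp [RamState.setNat_nat, hT r hr]
  · simp only [NatExpr.eval, hm', hI.2.2 m hm le_rfl]
  · rintro _ rfl
    obtain ⟨h1, h2⟩ := tupleDigit_carry I.dim u m
    rw [← hI.1] at h1 h2
    refine (Reaches.branch (τ := 9) (fun hb => ((Reaches.setNat (Q := fun s'' => s'' =
      (s'.setNat 7 m (tupleDigit I.dim u m + s'.nat 25 0)).setNat 7 m 0) ?_).seq
      (τ₂ := 3) ?_).mono ?_ (fun _ h => h))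
      (fun hb => (Reaches.setNat ?_).mono ?_ (fun _ h => h))).mono ?_ (fun _ h => h)
    · simp [NatExpr.eval, RamState.setNat_nat, hm']
    · rintro _ rfl
      simp only [TestExpr.holds, NatExpr.eval, RamState.setNat_nat, hm'] at hb
      simp only [show ¬ (16 = 7) by decide, false_and, if_false, and_self, if_true] at hb
      rw [if_pos hb] at h1 h2
      refine Reaches.setNat ⟨?_, fun r hr => ?_, fun r hr hr' => ?_⟩
      · simp [RamState.setNat_nat, NatExpr.eval, h1]
      · simp only [RamState.setNat_nat, NatExpr.eval]
        by_cases h : r = m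
        · simp [h, h2]
        · simp [h, hI.2.1 r (by omega)]
      · have h : r ≠ m := by omega
        simp [RamState.setNat_nat, NatExpr.eval, h, hI.2.2 r hr (by omega)]
    · simp only [NatExpr.cost]; omega
    · simp only [TestExpr.holds, NatExpr.eval, RamState.setNat_nat, hm'] at hb
      simp only [show ¬ (16 = 7) by decide, false_and, if_false, and_self, if_true] at hb
      rw [if_neg hb] at h1 h2
      refine ⟨?_, fun r hr => ?_, fun r hr hr' => ?_⟩
      · simp [RamState.setNat_nat, NatExpr.eval, h1]
      · simp only [RamState.setNat_nat, NatExpr.eval]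
        by_cases h : r = m
        · simp [h, h2]
        · simp [h, hI.2.1 r (by omega)]
      · have h : r ≠ m := by omega
        simp [RamState.setNat_nat, NatExpr.eval, h, hI.2.2 r hr (by omega)]
    · simp only [NatExpr.cost]; omega
    · simp only [NatExpr.cost, TestExpr.cost]; omega
  · simp only [NatExpr.cost]; omega

theorem hornerKey_congr {f g : ℕ → ℕ} {d : ℕ} (h : ∀ r < d, f r = g r) :
    hornerKey f d = hornerKey g d := by
  induction d with
  | zero => rfl
  | succ d ih => rw [hornerKey, hornerKey, ih fun r hr => h r (by omega), h d (by omega)]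

/-- Array `7` is known to hold the digits of `u` only in its first `d` places, and nothing else
enters the test. -/
theorem ciFails_congr {I : RamInput} {m K i j : ℕ} {T T' : ℕ → ℕ}
    (h : ∀ r < I.deg, T r = T' r) : ciFails I m K T i j ↔ ciFails I m K T' i j := by
  have h1 : ∀ k, (∃ r < I.deg, T r = k) ↔ ∃ r < I.deg, T' r = k := fun k =>
    exists_congr fun r => and_congr_right fun hr => by rw [h r hr]
  have h2 : ∀ k c, ciCount I T m i j k c = ciCount I T' m i j k c := fun k c => by
    unfold ciCount
    congr 1
    refine Finset.filter_congr fun t _ => ?_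
    rw [hornerKey_congr (f := fun r => I.sample t (T r)) fun r hr => by rw [h r hr]]
  simp only [ciFails, edgeFlag, ciStat, h1, h2]

/-- Test all pairs of nodes with the tuple in array `7`. -/
def allPairsProg : RamProg := .forLT 13 .dim (.forLT 14 .dim pairProg)

theorem allPairsProg_spec {I : RamInput} {s : RamState} (hs : s.nat 6 0 ≤ s.drawn)
    (hmark : ∀ k ≤ I.dim, (0 < s.nat 15 k ↔ ∃ r < I.deg, s.nat 7 r = k)) :
    Reaches I allPairsProg s
      (I.dim * (I.dim * (I.dim * 100 + s.nat 3 0 * (s.nat 6 0 * (30 * I.deg + 90) + 220) + 220)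
        + 20) + 10) fun s' =>
      (0 < s'.nat 24 0 ↔ 0 < s.nat 24 0 ∨ ∃ i < I.dim, ∃ j < I.dim,
        ciFails I (s.nat 6 0) (s.nat 3 0) (s.nat 7) i j) := by
  refine (Reaches.forLT (N := I.dim) (τ := I.dim * (I.dim * 100 +
    s.nat 3 0 * (s.nat 6 0 * (30 * I.deg + 90) + 220) + 220) + 8) (fun m s' => (0 < s'.nat 24 0 ↔
    0 < s.nat 24 0 ∨ ∃ i < m, ∃ j < I.dim, ciFails I (s.nat 6 0) (s.nat 3 0) (s.nat 7) i j)) rfl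
    (by simp [RamState.setNat_nat])
    (fun _ _ => rfl) (fun i s₁ hi hA hi' hI => ?_) (fun s' _ h => h)).mono ?_ (fun _ h => h)
  · have e3 := hA.nat 3 rfl
    have e6 := hA.nat 6 rfl
    have e7 := hA.nat 7 rfl
    have e15 := hA.nat 15 rfl
    have ed := hA.drawn rfl
    rw [← e15, ← e7] at hmark
    rw [← e6, ← ed] at hs
    rw [← e3, ← e6, ← e7] at hI ⊢
    refine (Reaches.forLT (N := I.dim) (τ := I.dim * 100 +
      s₁.nat 3 0 * (s₁.nat 6 0 * (30 * I.deg + 90) + 220) + 200) (fun m s' => (0 < s'.nat 24 0 ↔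
      0 < s₁.nat 24 0 ∨ ∃ j < m, ciFails I (s₁.nat 6 0) (s₁.nat 3 0) (s₁.nat 7) i j)) rfl
      (by simp [RamState.setNat_nat])
      (fun _ _ => rfl) (fun j s₂ hj hA₂ hj' hI₂ => (pairProg_spec ?_ ?_ ?_ ?_).mono
        (by rw [hA₂.nat 3 rfl, hA₂.nat 6 rfl])
        (fun s₃ h => ?_)) (fun s' _ h => ?_)).mono ?_ (fun _ h => h)
    · rw [hA₂.nat 6 rfl, hA₂.drawn rfl]; exact hs
    · rw [hA₂.nat 15 rfl, hA₂.nat 7 rfl]; exact hmark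
    · rw [hA₂.nat 13 rfl, hi']; exact hi
    · rw [hj']; exact hj
    · rw [hA₂.nat 6 rfl, hA₂.nat 7 rfl, hA₂.nat 3 rfl, hA₂.nat 13 rfl, hi', hj', hI₂] at h
      rw [RamState.setNat_nat_of_ne _ (by decide), h, or_assoc, Nat.exists_lt_succ_right]
    · rw [RamState.setNat_nat_of_ne _ (by decide), h, hI, or_assoc, Nat.exists_lt_succ_right]
    · simp only [NatExpr.cost]
      exact mul_add_add_le (by omega) (by omega)
  · simp only [NatExpr.cost]
    exact mul_add_add_le (by omega) (by omega)

/-- Perform all conditional independence tests. -/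
def ciProg : RamProg :=
  .forLT 12 (.reg 8) (.seq markProg (.seq allPairsProg incProg))

/-- The zeros in array `7` are the digits of the first tuple `u = 0`. The tests read the first `m`
of the samples drawn, which also occur in the batches of the identity test; this is harmless because
the two kinds of tests are combined by union bounds only. -/
theorem ciProg_spec {I : RamInput} {s : RamState} (hs : s.nat 6 0 ≤ s.drawn)
    (h7 : ∀ r, s.nat 7 r = 0) :
    Reaches I ciProg s
      (s.nat 8 0 * (I.dim * (I.dim * (I.dim * 100 +
        s.nat 3 0 * (s.nat 6 0 * (30 * I.deg + 90) + 220) + 220) + 20) + I.dim * 20 +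
        I.deg * 80 + 110) + 10) fun s' =>
      (0 < s'.nat 24 0 ↔ 0 < s.nat 24 0 ∨ ∃ u < s.nat 8 0, ∃ i < I.dim, ∃ j < I.dim,
        ciFails I (s.nat 6 0) (s.nat 3 0) (tupleDigit I.dim u) i j) := by
  refine (Reaches.forLT (N := s.nat 8 0) (τ := I.dim * (I.dim * (I.dim * 100 +
        s.nat 3 0 * (s.nat 6 0 * (30 * I.deg + 90) + 220) + 220) + 20) + I.dim * 20 +
        I.deg * 80 + 90) (fun m s' => (∀ r < I.deg, s'.nat 7 r = tupleDigit I.dim m r) ∧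
      (0 < s'.nat 24 0 ↔ 0 < s.nat 24 0 ∨ ∃ u < m, ∃ i < I.dim, ∃ j < I.dim,
        ciFails I (s.nat 6 0) (s.nat 3 0) (tupleDigit I.dim u) i j)) rfl
    (by simp [RamState.setNat_nat, h7, tupleDigit])
    (fun s' hA => by simp only [NatExpr.eval, hA.nat 8 rfl]) (fun u s₁ hu hA hu' hI => ?_)
    (fun s' _ h => h.2)).mono ?_ (fun _ h => h)
  · have e3 := hA.nat 3 rfl
    have e6 := hA.nat 6 rfl
    have ed := hA.drawn rfl
    rw [← e6, ← ed] at hs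
    rw [← e3, ← e6] at hI ⊢
    refine (Reaches.seq markProg_spec.frame (τ₂ := I.dim * (I.dim * (I.dim * 100 +
        s₁.nat 3 0 * (s₁.nat 6 0 * (30 * I.deg + 90) + 220) + 220) + 20) + 10 +
        (I.deg * 60 + 20)) ?_).mono
        (by omega) (fun _ h => h)
    rintro s₂ ⟨hmark, hA₂⟩
    have e7₂ := hA₂.nat 7 rfl
    have e6₂ := hA₂.nat 6 rfl
    have e3₂ := hA₂.nat 3 rfl
    have ed₂ := hA₂.drawn rfl
    have e24₂ := hA₂.nat 24 rfl
    rw [← e7₂] at hmark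
    refine (Reaches.seq (allPairsProg_spec (by rw [e6₂, ed₂]; exact hs) hmark).frame
      (τ₂ := I.deg * 60 + 20) ?_).mono (by rw [e6₂, e3₂]) (fun _ h => h)
    rintro s₃ ⟨h24, hA₃⟩
    have e7₃ := (hA₃.nat 7 rfl).trans e7₂
    refine (incProg_spec (u := u) (by rw [e7₃]; exact hI.1)).frame.mono le_rfl ?_
    rintro s₄ ⟨hT, hA₄⟩
    refine ⟨fun r hr => ?_, ?_⟩
    · rw [RamState.setNat_nat_of_ne _ (by decide)]; exact hT r hr
    · rw [RamState.setNat_nat_of_ne _ (by decide), hA₄.nat 24 rfl, h24, e24₂, hI.2, or_assoc,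
        Nat.exists_lt_succ_right, e6₂, e3₂, e7₂]
      refine or_congr_right (or_congr_right (exists_congr fun i => and_congr_right fun _ =>
        exists_congr fun j => and_congr_right fun _ => ciFails_congr hI.1))
  · simp only [NatExpr.cost]
    exact mul_add_add_le (by omega) (by omega)

/-! ### The identity test as a program -/

/-- The number of configurations of those parents of node `i` that are smaller than `j`. -/
def parPow (I : RamInput) (i : ℕ) : ℕ → ℕ
  | 0 => 1
  | j + 1 => if 0 < I.edge j i then parPow I i j + parPow I i j else parPow I i j

/-- The index of the configuration, in sample `t`, of those parents of node `i` that are smaller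
than `j`. -/
def parIdx (I : RamInput) (t i : ℕ) : ℕ → ℕ
  | 0 => 0
  | j + 1 => if 0 < I.edge j i ∧ 0 < I.sample t j then parIdx I t i j + parPow I i j
      else parIdx I t i j

/-- Compute `parIdx` and `parPow` of node `26` in sample `38`. -/
def parProg : RamProg :=
  .seq (.setNat 29 (.lit 0) (.lit 0)) (.seq (.setNat 30 (.lit 0) (.lit 1))
    (.forLT 31 .dim (.branch (.pos (.edge (.reg 31) (.reg 26)))
      (.seq (.branch (.pos (.sample (.reg 38) (.reg 31)))
        (.setNat 29 (.lit 0) (.add (.reg 29) (.reg 30))) .nop)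
        (.setNat 30 (.lit 0) (.add (.reg 30) (.reg 30)))) .nop)))

/-- The smallest parent supplies the lowest binary digit, in accordance with `tableConfig`. Register
`30` is the weight of the next digit and ends as the number of configurations. -/
theorem parProg_spec {I : RamInput} {s : RamState} (hs : s.nat 38 0 < s.drawn) :
    Reaches I parProg s (I.dim * 60 + 20) fun s' =>
      s'.nat 29 0 = parIdx I (s.nat 38 0) (s.nat 26 0) I.dim ∧
        s'.nat 30 0 = parPow I (s.nat 26 0) I.dim := by
  refine (Reaches.seq (Reaches.setNat (Q := fun s' => s' = s.setNat 29 0 0) rfl)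
    (τ₂ := 3 + (I.dim * 60 + 10)) ?_).mono (by simp only [NatExpr.cost]; omega) (fun _ h => h)
  rintro _ rfl
  refine Reaches.seq (Reaches.setNat (e := .lit 0) (f := .lit 1) (Q := fun s' =>
    s' = (s.setNat 29 0 0).setNat 30 0 1) rfl) ?_
  rintro _ rfl
  refine (Reaches.forLT (N := I.dim) (τ := 40) (fun m s' =>
      s'.nat 29 0 = parIdx I (s.nat 38 0) (s.nat 26 0) m ∧
        s'.nat 30 0 = parPow I (s.nat 26 0) m) rfl
      (by simp [RamState.setNat_nat, parIdx, parPow])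
      (fun _ _ => rfl) (fun j s₂ hj hA hj' hI => ?_) (fun s' _ h => h)).mono ?_ (fun _ h => h)
  · have e26 := hA.nat 26 rfl
    have e38 := hA.nat 38 rfl
    have ed := hA.drawn rfl
    rw [RamState.setNat_nat_of_ne _ (by decide), RamState.setNat_nat_of_ne _ (by decide)]
      at e26 e38
    simp only [RamState.setNat_drawn] at ed
    rw [← e26, ← e38] at hI ⊢
    rw [← e38, ← ed] at hs
    refine (Reaches.branch (τ := 30) (fun hb => ?_)
      (fun hb => (Reaches.nop ?_).mono (by omega) (fun _ h => h))).mono ?_ (fun _ h => h)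
    · simp only [TestExpr.holds, NatExpr.eval, hj'] at hb
      refine (Reaches.seq (P := fun s' => s'.nat 29 0 = parIdx I (s₂.nat 38 0) (s₂.nat 26 0) (j + 1)
        ∧ s'.nat 30 0 = parPow I (s₂.nat 26 0) j) (τ₁ := 20) (τ₂ := 7)
        ((Reaches.branch (τ := 7) (fun hb' => Reaches.setNat ?_)
          (fun hb' => (Reaches.nop ?_).mono (by omega) (fun _ h => h))).mono ?_ (fun _ h => h))
        (fun s₃ h => Reaches.setNat ?_)).mono (by omega) (fun _ h => h)
      · simp only [TestExpr.holds, NatExpr.eval, hj', hs, if_true] at hb'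
        simp [RamState.setNat_nat, NatExpr.eval, parIdx, hb, hb', hI]
      · simp only [TestExpr.holds, NatExpr.eval, hj', hs, if_true] at hb'
        simp only [parIdx, hb, hb', and_false, if_false, hI, and_self]
      · simp only [NatExpr.cost, TestExpr.cost]; omega
      · simp [RamState.setNat_nat, NatExpr.eval, parPow, hb, h]
    · simp only [TestExpr.holds, NatExpr.eval, hj'] at hb
      simp only [RamState.setNat_nat, parPow, parIdx, hb, false_and, if_false,
        show ¬ (29 = 31) by decide, show ¬ (30 = 31) by decide, hI, and_self]
    · simp only [NatExpr.cost, TestExpr.cost]; omega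
  · simp only [NatExpr.cost]; omega

/-- Compare the parental configuration of node `26` in sample `38` with `27`; update the number
`a` of matches and the number `b` of matches with value `1`. -/
def tallyProg (a b : ℕ) : RamProg :=
  .seq parProg (.branch (.natEq (.reg 29) (.reg 27))
    (.seq (.setNat a (.lit 0) (.add (.reg a) (.lit 1)))
      (.setNat b (.lit 0) (.add (.reg b) (.sample (.reg 38) (.reg 26))))) .nop)

theorem tallyProg_spec {I : RamInput} {s : RamState} {a b : ℕ} (hs : s.nat 38 0 < s.drawn)
    (ha : parProg.writesNat a = false) (hb : parProg.writesNat b = false) (hab : a ≠ b)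
    (ha38 : a ≠ 38) (ha26 : a ≠ 26) :
    Reaches I (tallyProg a b) s (I.dim * 60 + 70) fun s' =>
      s'.nat a 0 = s.nat a 0 +
        (if parIdx I (s.nat 38 0) (s.nat 26 0) I.dim = s.nat 27 0 then 1 else 0) ∧
      s'.nat b 0 = s.nat b 0 + (if parIdx I (s.nat 38 0) (s.nat 26 0) I.dim = s.nat 27 0 then
        I.sample (s.nat 38 0) (s.nat 26 0) else 0) := by
  refine (Reaches.seq (parProg_spec hs).frame (τ₂ := 50) ?_).mono (by omega) (fun _ h => h)
  rintro s₁ ⟨⟨h29, -⟩, hA⟩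
  have e27 := hA.nat 27 rfl
  refine (Reaches.branch (τ := 20) (fun hc => (Reaches.seq (Reaches.setNat (Q := fun s' =>
    s' = s₁.setNat a 0 (s.nat a 0 + 1)) ?_) (τ₂ := 10) ?_).mono ?_ (fun _ h => h))
    (fun hc => (Reaches.nop ?_).mono (by omega) (fun _ h => h))).mono ?_ (fun _ h => h)
  · simp [NatExpr.eval, hA.nat a ha]
  · rintro _ rfl
    simp only [TestExpr.natEq_holds, NatExpr.eval, h29, e27] at hc
    refine (Reaches.setNat ?_).mono ?_ (fun _ h => h)
    · simp only [RamState.setNat_nat, NatExpr.eval, RamState.setNat_drawn, hA.drawn rfl,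
        hA.nat 38 rfl, hA.nat 26 rfl, hA.nat b hb, ha38.symm, ha26.symm, hab, hab.symm, hs, hc,
        and_self, if_true, false_and, if_false]
    · simp only [NatExpr.cost]; omega
  · simp only [NatExpr.cost]; omega
  · have hc' : ¬ (parIdx I (s.nat 38 0) (s.nat 26 0) I.dim = s.nat 27 0) := by
      intro h
      exact hc (TestExpr.natEq_holds.2 (by simp only [NatExpr.eval, h29, e27, h]))
    simp only [if_neg hc', hA.nat a ha, hA.nat b hb, add_zero, and_self]
  · simp only [NatExpr.cost, TestExpr.cost]; omega

/-- The number of samples `t` among the first `m` after `o` in which the parents of `i` have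
configuration `k`. -/
def parCount (I : RamInput) (o m i k : ℕ) : ℕ :=
  ∑ t ∈ Finset.range m, if parIdx I (t + o) i I.dim = k then 1 else 0

/-- The number of those of these samples in which `X_i = 1`. -/
def parOnes (I : RamInput) (o m i k : ℕ) : ℕ :=
  ∑ t ∈ Finset.range m, if parIdx I (t + o) i I.dim = k then I.sample (t + o) i else 0

/-- Count for three batches of samples, each of size `5`. -/
def batchProg : RamProg :=
  .forLT 28 (.reg 5)
    (.seq (.setNat 38 (.lit 0) (.reg 28)) (.seq (tallyProg 32 33)
      (.seq (.setNat 38 (.lit 0) (.add (.reg 38) (.reg 5))) (.seq (tallyProg 34 35)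
        (.seq (.setNat 38 (.lit 0) (.add (.reg 38) (.reg 5))) (tallyProg 36 37))))))

/-- One loop serves three batches: for `k < M` it inspects the samples `k`, `k + M` and `k + 2 M`.
The batches are disjoint blocks of samples, hence independent. -/
theorem batchProg_spec {I : RamInput} {s : RamState}
    (hs : s.nat 5 0 + s.nat 5 0 + s.nat 5 0 ≤ s.drawn) :
    Reaches I batchProg s (s.nat 5 0 * (I.dim * 180 + 250) + 10) fun s' =>
      ((s'.nat 32 0 = s.nat 32 0 + parCount I 0 (s.nat 5 0) (s.nat 26 0) (s.nat 27 0) ∧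
        s'.nat 33 0 = s.nat 33 0 + parOnes I 0 (s.nat 5 0) (s.nat 26 0) (s.nat 27 0)) ∧
      (s'.nat 34 0 = s.nat 34 0 + parCount I (s.nat 5 0) (s.nat 5 0) (s.nat 26 0) (s.nat 27 0) ∧
        s'.nat 35 0 = s.nat 35 0 + parOnes I (s.nat 5 0) (s.nat 5 0) (s.nat 26 0) (s.nat 27 0)) ∧
      (s'.nat 36 0 = s.nat 36 0 +
          parCount I (s.nat 5 0 + s.nat 5 0) (s.nat 5 0) (s.nat 26 0) (s.nat 27 0) ∧
        s'.nat 37 0 = s.nat 37 0 +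
          parOnes I (s.nat 5 0 + s.nat 5 0) (s.nat 5 0) (s.nat 26 0) (s.nat 27 0))) := by
  refine (Reaches.forLT (N := s.nat 5 0) (τ := I.dim * 180 + 230) (fun m s' =>
      ((s'.nat 32 0 = s.nat 32 0 + parCount I 0 m (s.nat 26 0) (s.nat 27 0) ∧
        s'.nat 33 0 = s.nat 33 0 + parOnes I 0 m (s.nat 26 0) (s.nat 27 0)) ∧
      (s'.nat 34 0 = s.nat 34 0 + parCount I (s.nat 5 0) m (s.nat 26 0) (s.nat 27 0) ∧
        s'.nat 35 0 = s.nat 35 0 + parOnes I (s.nat 5 0) m (s.nat 26 0) (s.nat 27 0)) ∧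
      (s'.nat 36 0 = s.nat 36 0 +
          parCount I (s.nat 5 0 + s.nat 5 0) m (s.nat 26 0) (s.nat 27 0) ∧
        s'.nat 37 0 = s.nat 37 0 +
          parOnes I (s.nat 5 0 + s.nat 5 0) m (s.nat 26 0) (s.nat 27 0)))) rfl
      (by simp [RamState.setNat_nat, parCount, parOnes])
      (fun s' hA => by simp only [NatExpr.eval, hA.nat 5 rfl])
      (fun k s₁ hk hA hk' hI => ?_) (fun s' _ h => h)).mono ?_ (fun _ h => h)
  · have e5 : s₁.nat 5 0 = s.nat 5 0 := by rw [hA.nat 5 rfl]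
    have e26 := hA.nat 26 rfl
    have e27 := hA.nat 27 rfl
    have ed := hA.drawn rfl
    generalize s.nat 5 0 = M at *
    refine (Reaches.seq (Reaches.setNat (Q := fun s' => s' = s₁.setNat 38 0 k) ?_)
      (τ₂ := (I.dim * 60 + 70) + (7 + ((I.dim * 60 + 70) + (7 + (I.dim * 60 + 70))))) ?_).mono
      (by simp only [NatExpr.cost]; omega) (fun _ h => h)
    · simp [NatExpr.eval, hk']
    rintro _ rfl
    refine (Reaches.seq (tallyProg_spec ?_ rfl rfl (by decide) (by decide) (by decide)).frame ?_)
    · simp [RamState.setNat_nat, ed]; omega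
    rintro s₂ ⟨⟨h32, h33⟩, hA₂⟩
    simp only [RamState.setNat_nat, show ¬ (32 = 38) by decide, show ¬ (33 = 38) by decide,
      show ¬ (26 = 38) by decide, show ¬ (27 = 38) by decide, false_and, if_false, and_self,
      if_true, e26, e27] at h32 h33
    have e2 : ∀ r, (tallyProg 32 33).writesNat r = false → r ≠ 38 → s₂.nat r = s₁.nat r :=
      fun r h h' => (hA₂.nat r h).trans (RamState.setNat_nat_of_ne _ h' _ _)
    have e2d : s₂.drawn = s.drawn := (hA₂.drawn rfl).trans ed
    have e2k : s₂.nat 38 0 = k := by rw [hA₂.nat 38 rfl]; simp [RamState.setNat_nat]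
    refine Reaches.seq (Reaches.setNat (e := .lit 0) (f := .add (.reg 38) (.reg 5))
      (Q := fun s' => s' = s₂.setNat 38 0 (k + M)) ?_) ?_
    · simp only [NatExpr.eval, e2k, e2 5 rfl (by decide), e5]
    rintro _ rfl
    refine (Reaches.seq (tallyProg_spec ?_ rfl rfl (by decide) (by decide) (by decide)).frame ?_)
    · simp [RamState.setNat_nat, e2d]; omega
    rintro s₃ ⟨⟨h34, h35⟩, hA₃⟩
    have e3 : ∀ r, (tallyProg 34 35).writesNat r = false → r ≠ 38 → s₃.nat r = s₂.nat r :=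
      fun r h h' => (hA₃.nat r h).trans (RamState.setNat_nat_of_ne _ h' _ _)
    have e3d : s₃.drawn = s.drawn := (hA₃.drawn rfl).trans e2d
    have e3k : s₃.nat 38 0 = k + M := by rw [hA₃.nat 38 rfl]; simp [RamState.setNat_nat]
    simp only [RamState.setNat_nat, show ¬ (34 = 38) by decide, show ¬ (35 = 38) by decide,
      show ¬ (26 = 38) by decide, show ¬ (27 = 38) by decide, false_and, if_false, and_self,
      if_true, e2 26 rfl (by decide), e2 27 rfl (by decide), e2 34 rfl (by decide),
      e2 35 rfl (by decide), e26, e27] at h34 h35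
    refine Reaches.seq (Reaches.setNat (e := .lit 0) (f := .add (.reg 38) (.reg 5))
      (Q := fun s' => s' = s₃.setNat 38 0 (k + (M + M))) ?_) ?_
    · simp only [NatExpr.eval, e3k, e3 5 rfl (by decide), e2 5 rfl (by decide), e5, add_assoc]
    rintro _ rfl
    refine (tallyProg_spec ?_ rfl rfl (by decide) (by decide) (by decide)).frame.mono le_rfl ?_
    · simp [RamState.setNat_nat, e3d]; omega
    rintro s₄ ⟨⟨h36, h37⟩, hA₄⟩
    have e4 : ∀ r, (tallyProg 36 37).writesNat r = false → r ≠ 38 → s₄.nat r = s₃.nat r :=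
      fun r h h' => (hA₄.nat r h).trans (RamState.setNat_nat_of_ne _ h' _ _)
    simp only [RamState.setNat_nat, show ¬ (36 = 38) by decide, show ¬ (37 = 38) by decide,
      show ¬ (26 = 38) by decide, show ¬ (27 = 38) by decide, false_and, if_false, and_self,
      if_true, e3 26 rfl (by decide), e3 27 rfl (by decide), e3 36 rfl (by decide),
      e3 37 rfl (by decide), e2 26 rfl (by decide), e2 27 rfl (by decide), e2 36 rfl (by decide),
      e2 37 rfl (by decide), e26, e27] at h36 h37
    obtain ⟨⟨i1, i2⟩, ⟨i3, i4⟩, i5, i6⟩ := hI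
    simp only [RamState.setNat_nat, show ¬ (32 = 28) by decide, show ¬ (33 = 28) by decide,
      show ¬ (34 = 28) by decide, show ¬ (35 = 28) by decide, show ¬ (36 = 28) by decide,
      show ¬ (37 = 28) by decide, false_and, if_false, h36, h37, e4 32 rfl (by decide),
      e4 33 rfl (by decide), e4 34 rfl (by decide), e4 35 rfl (by decide),
      e3 32 rfl (by decide), e3 33 rfl (by decide), h32, h33, h34, h35, i1, i2, i3, i4, i5, i6,
      parCount, parOnes, Finset.sum_range_succ, add_assoc, and_self, Nat.add_zero]
  · simp only [NatExpr.cost]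
    exact mul_add_add_le (by omega) (by omega)

/-- Some configuration is too rare among the samples of the first batch. -/
def idFails (I : RamInput) (M : ℕ) (L : ℝ) (i k : ℕ) : Prop := (parCount I 0 M i k : ℝ) < L

open Classical in
/-- The contribution of one entry of the table to the statistic of the identity test. -/
noncomputable def idTerm (I : RamInput) (M : ℕ) (L : ℝ) (i k : ℕ) : ℝ :=
  if idFails I M L i k then 0 else
    (parOnes I M M i k - parCount I M M i k * I.cpt i k) *
      (parOnes I (M + M) M i k - parCount I (M + M) M i k * I.cpt i k) /
    (I.cpt i k * (1 - I.cpt i k) * parCount I 0 M i k)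

abbrev cptExpr : RealExpr := .cpt (.reg 26) (.reg 27)

/-- The threshold `k (d + l + 1)` for the counts of the first batch. -/
abbrev countLB (k : ℕ) : RealExpr :=
  .mul (.ofNat (.lit k)) (.ofNat (.add (.add .deg (.reg 1)) (.lit 1)))

def clearProg : RamProg :=
  .seq (.setNat 32 (.lit 0) (.lit 0)) (.seq (.setNat 33 (.lit 0) (.lit 0))
    (.seq (.setNat 34 (.lit 0) (.lit 0)) (.seq (.setNat 35 (.lit 0) (.lit 0))
      (.seq (.setNat 36 (.lit 0) (.lit 0)) (.setNat 37 (.lit 0) (.lit 0))))))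

theorem clearProg_spec {I : RamInput} {s : RamState} : Reaches I clearProg s 18 fun s' =>
    s'.nat 32 0 = 0 ∧ s'.nat 33 0 = 0 ∧ s'.nat 34 0 = 0 ∧ s'.nat 35 0 = 0 ∧ s'.nat 36 0 = 0 ∧
      s'.nat 37 0 = 0 := by
  have h : ∀ s r, Reaches I (.setNat r (.lit 0) (.lit 0)) s 3 (fun s' => s' = s.setNat r 0 0) :=
    fun s r => Reaches.setNat rfl
  refine ((h _ _).seq fun _ h₁ => (h _ _).seq fun _ h₂ => (h _ _).seq fun _ h₃ =>
    (h _ _).seq fun _ h₄ => (h _ _).seq fun _ h₅ => (h _ _).mono le_rfl fun _ h₆ => ?_).mono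
    (by norm_num) (fun _ h => h)
  subst h₁ h₂ h₃ h₄ h₅ h₆
  simp [RamState.setNat_nat]

/-- Treat the entry `27` of the table of node `26`. -/
def entryProg (K₃ : ℕ) : RamProg :=
  .seq clearProg (.seq batchProg
    (.branch (.realLT (.ofNat (.reg 32)) (countLB K₃))
      (.setNat 24 (.lit 0) (.lit 1))
      (.setReal 1 (.lit 0) (.add (.reg 1)
        (.div (.mul (.sub (.ofNat (.reg 35)) (.mul (.ofNat (.reg 34)) cptExpr))
            (.sub (.ofNat (.reg 37)) (.mul (.ofNat (.reg 36)) cptExpr)))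
          (.mul (.mul cptExpr (.sub (.ofNat (.lit 1)) cptExpr)) (.ofNat (.reg 32))))))))

theorem entryProg_spec {I : RamInput} {s : RamState} {K₃ M : ℕ} (hM : s.nat 5 0 = M)
    (hs : M + M + M ≤ s.drawn) :
    Reaches I (entryProg K₃) s (M * (I.dim * 180 + 250) + 150) fun s' =>
      (0 < s'.nat 24 0 ↔ 0 < s.nat 24 0 ∨
        idFails I M (K₃ * (I.deg + s.nat 1 0 + 1 : ℕ)) (s.nat 26 0) (s.nat 27 0)) ∧
      s'.real 1 0 = s.real 1 0 +
        idTerm I M (K₃ * (I.deg + s.nat 1 0 + 1 : ℕ)) (s.nat 26 0) (s.nat 27 0) := by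
  refine (Reaches.seq clearProg_spec.frame (τ₂ := M * (I.dim * 180 + 250) + 10 + 100) ?_).mono
    (by omega) (fun _ h => h)
  rintro s₁ ⟨⟨z1, z2, z3, z4, z5, z6⟩, hA⟩
  have e1 := hA.nat 1 rfl
  have e5 := hA.nat 5 rfl
  have e26 := hA.nat 26 rfl
  have e27 := hA.nat 27 rfl
  have e24 := hA.nat 24 rfl
  have ed := hA.drawn rfl
  have er := hA.real 1 rfl
  rw [← e5] at hM
  refine (Reaches.seq (batchProg_spec (by rw [hM, ed]; exact hs)).frame (τ₂ := 100) ?_).mono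
    (by rw [hM]) (fun _ h => h)
  rintro s₂ ⟨h, hA₂⟩
  rw [z1, z2, z3, z4, z5, z6, hM, e26, e27] at h
  simp only [zero_add] at h
  obtain ⟨⟨h32, -⟩, ⟨h34, h35⟩, h36, h37⟩ := h
  have e1' := (hA₂.nat 1 rfl).trans e1
  have e26' := (hA₂.nat 26 rfl).trans e26
  have e27' := (hA₂.nat 27 rfl).trans e27
  have e24' := (hA₂.nat 24 rfl).trans e24
  have er' := (hA₂.real 1 rfl).trans er
  refine (Reaches.branch (τ := 60) (fun hb => (Reaches.setNat ?_).mono ?_ (fun _ h => h))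
    (fun hb => (Reaches.setReal ?_).mono ?_ (fun _ h => h))).mono ?_ (fun _ h => h)
  · simp only [TestExpr.holds, RealExpr.eval, NatExpr.eval, h32, e1'] at hb
    have hf : idFails I M (K₃ * (I.deg + s.nat 1 0 + 1 : ℕ)) (s.nat 26 0) (s.nat 27 0) := hb
    clear hb
    generalize (K₃ : ℝ) * (I.deg + s.nat 1 0 + 1 : ℕ) = L at hf ⊢
    refine ⟨?_, ?_⟩
    · simp [RamState.setNat_nat, NatExpr.eval, hf]
    · rw [idTerm, if_pos hf, RamState.setNat_real, er', add_zero]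
  · simp only [NatExpr.cost]; omega
  · simp only [TestExpr.holds, RealExpr.eval, NatExpr.eval, h32, e1'] at hb
    have hf : ¬ idFails I M (K₃ * (I.deg + s.nat 1 0 + 1 : ℕ)) (s.nat 26 0) (s.nat 27 0) := hb
    clear hb
    generalize (K₃ : ℝ) * (I.deg + s.nat 1 0 + 1 : ℕ) = L at hf ⊢
    refine ⟨?_, ?_⟩
    · simp [hf, e24']
    · rw [idTerm, if_neg hf]
      simp [RamState.setReal_real, RealExpr.eval, NatExpr.eval, er', h32, h34, h35, h36, h37,
        e26', e27']
  · simp only [NatExpr.cost, RealExpr.cost]; omega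
  · simp only [NatExpr.cost, RealExpr.cost, TestExpr.cost]; omega

/-- The identity test. -/
def idProg (K₃ : ℕ) : RamProg :=
  .forLT 26 .dim (.seq (.setNat 38 (.lit 0) (.lit 0)) (.seq parProg
    (.seq (.setNat 39 (.lit 0) (.reg 30)) (.forLT 27 (.reg 39) (entryProg K₃)))))

/-- The number of entries varies with the node; `D` is a common upper bound, used for the running
time alone. -/
theorem idProg_spec {I : RamInput} {s : RamState} {K₃ M D : ℕ} (hM : s.nat 5 0 = M)
    (hs : M + M + M ≤ s.drawn) (hd : 0 < s.drawn) (hD : ∀ i, parPow I i I.dim ≤ D) :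
    Reaches I (idProg K₃) s
      (I.dim * (D * (M * (I.dim * 180 + 250) + 170) + I.dim * 60 + 80) + 10) fun s' =>
      (0 < s'.nat 24 0 ↔ 0 < s.nat 24 0 ∨ ∃ i < I.dim, ∃ k < parPow I i I.dim,
        idFails I M (K₃ * (I.deg + s.nat 1 0 + 1 : ℕ)) i k) ∧
      s'.real 1 0 = s.real 1 0 + ∑ i ∈ Finset.range I.dim, ∑ k ∈ Finset.range (parPow I i I.dim),
        idTerm I M (K₃ * (I.deg + s.nat 1 0 + 1 : ℕ)) i k := by
  refine (Reaches.forLT (N := I.dim) (τ := D * (M * (I.dim * 180 + 250) + 170) + I.dim * 60 + 60)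
    (fun m s' => (0 < s'.nat 24 0 ↔ 0 < s.nat 24 0 ∨ ∃ i < m, ∃ k < parPow I i I.dim,
        idFails I M (K₃ * (I.deg + s.nat 1 0 + 1 : ℕ)) i k) ∧
      s'.real 1 0 = s.real 1 0 + ∑ i ∈ Finset.range m, ∑ k ∈ Finset.range (parPow I i I.dim),
        idTerm I M (K₃ * (I.deg + s.nat 1 0 + 1 : ℕ)) i k) rfl
    (by simp [RamState.setNat_nat])
    (fun _ _ => rfl) (fun i s₁ hi hA hi' hI => ?_) (fun s' _ h => h)).mono ?_ (fun _ h => h)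
  · have e1 := hA.nat 1 rfl
    have e5 := hA.nat 5 rfl
    have ed := hA.drawn rfl
    refine (Reaches.seq (Reaches.setNat (Q := fun s' => s' = s₁.setNat 38 0 0) rfl)
      (τ₂ := (I.dim * 60 + 20) + (4 + (D * (M * (I.dim * 180 + 250) + 170) + 10))) ?_).mono
      (by simp only [NatExpr.cost]; omega) (fun _ h => h)
    rintro _ rfl
    -- This run of `parProg` serves only to obtain the number of parental configurations; its index
    -- for sample `0` is ignored, but that sample has to exist.
    refine Reaches.seq (parProg_spec (by simpa [RamState.setNat_nat, ed] using hd)).frame ?_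
    rintro s₂ ⟨⟨-, h30⟩, hA₂⟩
    refine Reaches.seq (Reaches.setNat (e := .lit 0) (f := .reg 30)
      (Q := fun s' => s' = s₂.setNat 39 0 (parPow I i I.dim)) ?_) ?_
    · simp [NatExpr.eval, h30, RamState.setNat_nat, hi']
    rintro _ rfl
    have e : ∀ r, parProg.writesNat r = false → r ≠ 38 → r ≠ 39 →
        (s₂.setNat 39 0 (parPow I i I.dim)).nat r = s₁.nat r := fun r h h' h'' => by
      rw [RamState.setNat_nat_of_ne _ h'', hA₂.nat r h, RamState.setNat_nat_of_ne _ h']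
    have er : s₂.real = s₁.real := by
      ext r : 1
      exact (hA₂.real r rfl)
    have ed₂ : s₂.drawn = s.drawn := (hA₂.drawn rfl).trans ed
    have e39 : (s₂.setNat 39 0 (parPow I i I.dim)).nat 39 0 = parPow I i I.dim := by
      simp [RamState.setNat_nat]
    have ed₃ : (s₂.setNat 39 0 (parPow I i I.dim)).drawn = s.drawn := ed₂
    have er₃ : (s₂.setNat 39 0 (parPow I i I.dim)).real = s₁.real := er
    generalize s₂.setNat 39 0 (parPow I i I.dim) = s₃ at e ed₃ er₃ e39
    refine (Reaches.forLT (N := parPow I i I.dim) (τ := M * (I.dim * 180 + 250) + 150)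
      (fun m s' => (0 < s'.nat 24 0 ↔ 0 < s₁.nat 24 0 ∨ ∃ k < m,
        idFails I M (K₃ * (I.deg + s.nat 1 0 + 1 : ℕ)) i k) ∧
        s'.real 1 0 = s₁.real 1 0 + ∑ k ∈ Finset.range m,
        idTerm I M (K₃ * (I.deg + s.nat 1 0 + 1 : ℕ)) i k) rfl
      (by simp [RamState.setNat_nat, e 24 rfl (by decide) (by decide), er₃])
      (fun s' hA => by simp only [NatExpr.eval, hA.nat 39 rfl, e39])
      (fun k s₄ hk hA₄ hk' hI₄ => (entryProg_spec (M := M) ?_ ?_).mono le_rfl (fun s₅ h => ?_))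
      (fun s' _ h => ?_)).mono ?_ (fun _ h => h)
    · rw [hA₄.nat 5 rfl, e 5 rfl (by decide) (by decide), e5, hM]
    · rw [hA₄.drawn rfl, ed₃]; exact hs
    · rw [hA₄.nat 1 rfl, e 1 rfl (by decide) (by decide), e1, hA₄.nat 26 rfl,
        e 26 rfl (by decide) (by decide), hi', hk', hI₄.1, hI₄.2] at h
      rw [RamState.setNat_nat_of_ne _ (by decide), RamState.setNat_real, h.1, h.2, or_assoc,
        Nat.exists_lt_succ_right, Finset.sum_range_succ]
      exact ⟨Iff.rfl, add_assoc _ _ _⟩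
    · rw [RamState.setNat_nat_of_ne _ (by decide), RamState.setNat_real, h.1, h.2, hI.1, hI.2,
        or_assoc, Nat.exists_lt_succ_right, Finset.sum_range_succ]
      exact ⟨Iff.rfl, add_assoc _ _ _⟩
    · simp only [NatExpr.cost]
      have := Nat.mul_le_mul_right (M * (I.dim * 180 + 250) + 170) (hD i)
      refine le_trans ?_ (Nat.add_le_add_right this 10)
      exact mul_add_add_le (by omega) (by omega)
  · simp only [NatExpr.cost]
    exact mul_add_add_le (by omega) (by omega)

/-! ### The tester -/

/-- Compute, in `1`, the logarithm of the dimension to base `2`. -/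
def logProg : RamProg :=
  .seq (.setNat 2 (.lit 0) (.lit 1))
    (.count 1 (.natLT (.reg 2) .dim) (.setNat 2 (.lit 0) (.add (.reg 2) (.reg 2))))

theorem logProg_spec {I : RamInput} {s : RamState} :
    Reaches I logProg s (Nat.clog 2 I.dim * 30 + 20) fun s' => s'.nat 1 0 = Nat.clog 2 I.dim := by
  refine (Reaches.seq (Reaches.setNat (Q := fun s' => s' = s.setNat 2 0 1) rfl)
    (τ₂ := Nat.clog 2 I.dim * 30 + 15) ?_).mono (by simp only [NatExpr.cost]; omega) (fun _ h => h)
  rintro _ rfl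
  refine (Reaches.count (N := Nat.clog 2 I.dim) (fun k s' => s'.nat 2 0 = 2 ^ k) rfl
    (by simp [RamState.setNat_nat]) (fun k s' _ _ _ hI => ?_)
    (fun k s' _ _ _ hI => Reaches.setNat ?_) (fun s' _ h _ => h)).mono ?_ (fun _ h => h)
  · simp only [TestExpr.holds, NatExpr.eval, hI]
    exact (Nat.lt_clog_iff_pow_lt (by norm_num)).symm
  · simp [RamState.setNat_nat, NatExpr.eval, hI, pow_succ]; ring
  · simp only [NatExpr.cost, TestExpr.cost]; omega

/-- Compute, in `3`, the number `2 ^ d`. -/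
def twoPowProg : RamProg :=
  .seq (.setNat 3 (.lit 0) (.lit 1))
    (.forLT 4 .deg (.setNat 3 (.lit 0) (.add (.reg 3) (.reg 3))))

theorem twoPowProg_spec {I : RamInput} {s : RamState} :
    Reaches I twoPowProg s (I.deg * 30 + 20) fun s' => s'.nat 3 0 = 2 ^ I.deg := by
  refine (Reaches.seq (Reaches.setNat (Q := fun s' => s' = s.setNat 3 0 1) rfl)
    (τ₂ := I.deg * 30 + 15) ?_).mono (by simp only [NatExpr.cost]; omega) (fun _ h => h)
  rintro _ rfl
  refine (Reaches.forLT (N := I.deg) (fun k s' => s'.nat 3 0 = 2 ^ k) rfl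
    (by simp [RamState.setNat_nat]) (fun _ _ => rfl)
    (fun k s' _ _ _ hI => Reaches.setNat ?_) (fun s' _ h => h)).mono ?_ (fun _ h => h)
  · simp [RamState.setNat_nat, NatExpr.eval, hI, pow_succ]; ring
  · simp only [NatExpr.cost]; omega

/-- Compute, in `8`, the number `(n + 1) ^ d`. -/
def powProg : RamProg :=
  .seq (.setNat 8 (.lit 0) (.lit 1))
    (.forLT 10 .deg (.seq (.setNat 9 (.lit 0) (.lit 0))
      (.seq (.forLT 11 (.add .dim (.lit 1)) (.setNat 9 (.lit 0) (.add (.reg 9) (.reg 8))))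
        (.setNat 8 (.lit 0) (.reg 9)))))

theorem powProg_spec {I : RamInput} {s : RamState} :
    Reaches I powProg s (I.deg * (I.dim * 30 + 80) + 20) fun s' =>
      s'.nat 8 0 = (I.dim + 1) ^ I.deg := by
  refine (Reaches.seq (Reaches.setNat (Q := fun s' => s' = s.setNat 8 0 1) rfl)
    (τ₂ := I.deg * (I.dim * 30 + 80) + 15) ?_).mono (by simp only [NatExpr.cost]; omega)
    (fun _ h => h)
  rintro _ rfl
  refine (Reaches.forLT (N := I.deg) (τ := I.dim * 30 + 60)
    (fun k s' => s'.nat 8 0 = (I.dim + 1) ^ k) rfl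
    (by simp [RamState.setNat_nat]) (fun _ _ => rfl)
    (fun k s₁ _ _ _ hI => ?_) (fun s' _ h => h)).mono ?_ (fun _ h => h)
  · refine (Reaches.seq (Reaches.setNat (Q := fun s' => s' = s₁.setNat 9 0 0) rfl)
      (τ₂ := I.dim * 30 + 45 + 4) ?_).mono (by simp only [NatExpr.cost]; omega) (fun _ h => h)
    rintro _ rfl
    refine Reaches.seq (P := fun s' => s'.nat 9 0 = (I.dim + 1) * (I.dim + 1) ^ k)
      ((Reaches.forLT (N := I.dim + 1) (fun m s' => s'.nat 9 0 = m * (I.dim + 1) ^ k) rfl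
      (by simp [RamState.setNat_nat]) (fun _ _ => rfl)
      (fun m s' _ hA _ hI' => Reaches.setNat ?_) (fun s' _ h => h)).mono ?_ (fun _ h => h))
      (fun s₂ h => Reaches.setNat ?_)
    · have e8 : s'.nat 8 = s₁.nat 8 := (hA.nat 8 rfl).trans
        (RamState.setNat_nat_of_ne _ (by decide) _ _)
      simp [RamState.setNat_nat, NatExpr.eval, hI', e8, hI]; ring
    · simp only [NatExpr.cost]; omega
    · simp [RamState.setNat_nat, NatExpr.eval, h, pow_succ]; ring
  · simp only [NatExpr.cost]
    exact mul_add_add_le (by omega) (by omega)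

/-- Draw three batches of samples for the identity test. -/
def drawProg (K₁ : ℕ) : RamProg :=
  .count 5 (.realLT (.mul (.mul (.ofNat (.reg 5)) (.ofNat (.reg 5)))
      (.mul (.mul .eps .eps) (.mul .eps .eps)))
    (.mul (.mul (.ofNat (.lit K₁)) (.ofNat (.lit K₁))) (.mul (.ofNat (.reg 3)) (.ofNat .dim))))
    (.seq .draw (.seq .draw .draw))

/-- There is no square root on the machine, so the condition `k ε² < K₁ √(2 ^ d n)` is tested in
squared form. The hypothesis says that `M` is the first number violating it. -/
theorem drawProg_spec {I : RamInput} {s : RamState} {K₁ M : ℕ}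
    (hM : ∀ k : ℕ, (k : ℝ) * k * (I.eps * I.eps * (I.eps * I.eps)) <
      (K₁ : ℝ) * K₁ * (s.nat 3 0 * I.dim) ↔ k < M) :
    Reaches I (drawProg K₁) s (M * 60 + 40) fun s' =>
      s'.nat 5 0 = M ∧ s'.drawn = s.drawn + (M + M + M) := by
  refine (Reaches.count (N := M) (τ := 3) (fun k s' => s'.drawn = s.drawn + (k + k + k)) rfl
    (by simp) (fun k s' _ hA hk hI => ?_)
    (fun k s₁ _ _ _ hI => ?_) (fun s' _ h h' => ⟨h, h'⟩)).mono ?_ (fun _ h => h)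
  · rw [← hM k]
    simp only [TestExpr.holds, NatExpr.eval, RealExpr.eval, hk, hA.nat 3 rfl]
  · refine Reaches.seq (τ₁ := 1) (τ₂ := 2) (P := fun s' => s'.drawn = s₁.drawn + 1)
      (Reaches.draw rfl) (fun s₂ h₂ => Reaches.seq (τ₁ := 1) (τ₂ := 1)
      (P := fun s' => s'.drawn = s₁.drawn + 2) (Reaches.draw ?_) (fun s₃ h₃ => Reaches.draw ?_))
    · simp [h₂]
    · simp [h₃, hI]; omega
  · simp only [NatExpr.cost, RealExpr.cost, TestExpr.cost]; omega

/-- Draw further samples, in a number sufficient for the conditional independence tests. -/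
def drawProg' (K₂ : ℕ) : RamProg :=
  .count 6 (.realLT (.mul (.ofNat (.reg 6)) (.mul .gam .gam))
    (.mul (.ofNat (.lit K₂)) (.add (.ofNat (.reg 3)) (.mul (.ofNat .deg) (.ofNat (.reg 1))))))
    .draw

theorem drawProg'_spec {I : RamInput} {s : RamState} {K₂ m : ℕ}
    (hm : ∀ k : ℕ, (k : ℝ) * (I.gam * I.gam) <
      (K₂ : ℝ) * (s.nat 3 0 + I.deg * s.nat 1 0) ↔ k < m) :
    Reaches I (drawProg' K₂) s (m * 60 + 40) fun s' =>
      s'.nat 6 0 = m ∧ s'.drawn = s.drawn + m := by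
  refine (Reaches.count (N := m) (τ := 1) (fun k s' => s'.drawn = s.drawn + k) rfl
    (by simp) (fun k s' _ hA hk hI => ?_)
    (fun k s₁ _ _ _ hI => Reaches.draw ?_) (fun s' _ h h' => ⟨h, h'⟩)).mono ?_ (fun _ h => h)
  · rw [← hm k]
    simp only [TestExpr.holds, NatExpr.eval, RealExpr.eval, hk, hA.nat 3 rfl, hA.nat 1 rfl]
  · simp [hI]; omega
  · simp only [NatExpr.cost, RealExpr.cost, TestExpr.cost]; omega

/-- The tester. -/
def testerProg (K₁ K₂ K₃ : ℕ) : RamProg :=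
  .seq logProg (.seq twoPowProg (.seq (drawProg K₁) (.seq (drawProg' K₂) (.seq powProg
    (.seq ciProg (.seq (idProg K₃)
      (.branch (.and (.neg (.pos (.reg 24)))
          (.neg (.realLT (.div (.mul (.ofNat (.reg 5)) (.mul .eps .eps)) (.ofNat (.lit 16)))
            (.reg 1))))
        (.setNat 0 (.lit 0) (.lit 1)) .nop)))))))

/-- The conditions under which the tester accepts. -/
def Accepts (I : RamInput) (K₃ M m : ℕ) : Prop :=
  (¬ ∃ u < (I.dim + 1) ^ I.deg, ∃ i < I.dim, ∃ j < I.dim,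
      ciFails I m (2 ^ I.deg) (tupleDigit I.dim u) i j) ∧
    (¬ ∃ i < I.dim, ∃ k < parPow I i I.dim,
      idFails I M (K₃ * (I.deg + Nat.clog 2 I.dim + 1 : ℕ)) i k) ∧
    ∑ i ∈ Finset.range I.dim, ∑ k ∈ Finset.range (parPow I i I.dim),
        idTerm I M (K₃ * (I.deg + Nat.clog 2 I.dim + 1 : ℕ)) i k ≤
      M * (I.eps * I.eps) / 16

/-- A bound for the running time of the tester. -/
def testerTime (n d M m D : ℕ) : ℕ :=
  (Nat.clog 2 n * 30 + 20) + ((d * 30 + 20) + ((M * 60 + 40) + ((m * 60 + 40) +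
    ((d * (n * 30 + 80) + 20) + (((n + 1) ^ d * (n * (n * (n * 100 +
        2 ^ d * (m * (30 * d + 90) + 220) + 220) + 20) + n * 20 +
        d * 80 + 110) + 10) +
      ((n * (D * (M * (n * 180 + 250) + 170) + n * 60 + 80) + 10) + 40))))))

/-- Running time, number of samples and output are reduced to the two thresholds `M`, `m` and the
predicate `Accepts`; from here on the program is no longer looked at. -/
theorem testerProg_spec {I : RamInput} {K₁ K₂ K₃ M m D : ℕ}
    (hM : ∀ k : ℕ, (k : ℝ) * k * (I.eps * I.eps * (I.eps * I.eps)) <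
      (K₁ : ℝ) * K₁ * ((2 ^ I.deg : ℕ) * I.dim) ↔ k < M)
    (hm : ∀ k : ℕ, (k : ℝ) * (I.gam * I.gam) <
      (K₂ : ℝ) * ((2 ^ I.deg : ℕ) + I.deg * Nat.clog 2 I.dim) ↔ k < m)
    (hM0 : 0 < M) (hD : ∀ i, parPow I i I.dim ≤ D) :
    ∃ s t, Exec I (testerProg K₁ K₂ K₃) RamState.init s t ∧ s.drawn = M + M + M + m ∧
      t ≤ testerTime I.dim I.deg M m D ∧ (Accepts I K₃ M m → s.nat 0 0 = 1) ∧
      (¬ Accepts I K₃ M m → s.nat 0 0 = 0) := by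
  have key : Reaches I (testerProg K₁ K₂ K₃) RamState.init (testerTime I.dim I.deg M m D)
      (fun s => s.drawn = M + M + M + m ∧ (Accepts I K₃ M m → s.nat 0 0 = 1) ∧
      (¬ Accepts I K₃ M m → s.nat 0 0 = 0)) := by
    refine logProg_spec.frame.seq ?_
    rintro s₁ ⟨h1, hA₁⟩
    refine twoPowProg_spec.frame.seq ?_
    rintro s₂ ⟨h3, hA₂⟩
    refine Reaches.seq (drawProg_spec (M := M) (by rw [h3]; exact hM)).frame ?_
    rintro s₃ ⟨⟨h5, hd3⟩, hA₃⟩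
    have h1₃ : s₃.nat 1 0 = Nat.clog 2 I.dim := by rw [hA₃.nat 1 rfl, hA₂.nat 1 rfl, h1]
    have h3₃ : s₃.nat 3 0 = 2 ^ I.deg := by rw [hA₃.nat 3 rfl, h3]
    refine Reaches.seq (drawProg'_spec (m := m) (by rw [h3₃, h1₃]; exact hm)).frame ?_
    rintro s₄ ⟨⟨h6, hd4⟩, hA₄⟩
    have hd : s₄.drawn = M + M + M + m := by
      rw [hd4, hd3, hA₂.drawn rfl, hA₁.drawn rfl]
      simp [RamState.init]
    refine powProg_spec.frame.seq ?_
    rintro s₅ ⟨h8, hA₅⟩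
    have h7 : ∀ r, s₅.nat 7 r = 0 := fun r => by
      rw [hA₅.nat 7 rfl, hA₄.nat 7 rfl, hA₃.nat 7 rfl, hA₂.nat 7 rfl, hA₁.nat 7 rfl]
      rfl
    have h3₅ : s₅.nat 3 0 = 2 ^ I.deg := by rw [hA₅.nat 3 rfl, hA₄.nat 3 rfl, h3₃]
    have h6₅ : s₅.nat 6 0 = m := by rw [hA₅.nat 6 rfl, h6]
    have hd₅ : s₅.drawn = M + M + M + m := (hA₅.drawn rfl).trans hd
    have h24 : s₅.nat 24 0 = 0 := by
      rw [hA₅.nat 24 rfl, hA₄.nat 24 rfl, hA₃.nat 24 rfl, hA₂.nat 24 rfl, hA₁.nat 24 rfl]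
      rfl
    refine Reaches.seq ((ciProg_spec (by rw [h6₅, hd₅]; omega) h7).frame.mono
      (by rw [h8, h3₅, h6₅]) (fun _ h => h)) ?_
    rintro s₆ ⟨hci, hA₆⟩
    rw [h24, h8, h6₅, h3₅] at hci
    have hd₆ : s₆.drawn = M + M + M + m := (hA₆.drawn rfl).trans hd₅
    have h5₆ : s₆.nat 5 0 = M := by
      rw [hA₆.nat 5 rfl, hA₅.nat 5 rfl, hA₄.nat 5 rfl, h5]
    have h1₆ : s₆.nat 1 0 = Nat.clog 2 I.dim := by
      rw [hA₆.nat 1 rfl, hA₅.nat 1 rfl, hA₄.nat 1 rfl, h1₃]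
    have hW : s₆.real 1 0 = 0 := by
      rw [hA₆.real 1 rfl, hA₅.real 1 rfl, hA₄.real 1 rfl, hA₃.real 1 rfl, hA₂.real 1 rfl,
        hA₁.real 1 rfl]
      rfl
    refine Reaches.seq (idProg_spec (M := M) (D := D) h5₆ (by rw [hd₆]; omega)
      (by rw [hd₆]; omega) hD).frame ?_
    rintro s₇ ⟨⟨hid, hW₇⟩, hA₇⟩
    rw [hci, h1₆] at hid
    rw [hW, h1₆, zero_add] at hW₇
    have hd₇ : s₇.drawn = M + M + M + m := (hA₇.drawn rfl).trans hd₆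
    have h5₇ : s₇.nat 5 0 = M := by rw [hA₇.nat 5 rfl, h5₆]
    have h0₇ : s₇.nat 0 0 = 0 := by
      rw [hA₇.nat 0 rfl, hA₆.nat 0 rfl, hA₅.nat 0 rfl, hA₄.nat 0 rfl, hA₃.nat 0 rfl,
        hA₂.nat 0 rfl, hA₁.nat 0 rfl]
      rfl
    have hacc : (TestExpr.and (.neg (.pos (.reg 24)))
        (.neg (.realLT (.div (.mul (.ofNat (.reg 5)) (.mul .eps .eps)) (.ofNat (.lit 16)))
          (.reg 1)))).holds I s₇ ↔ Accepts I K₃ M m := by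
      simp only [TestExpr.holds, NatExpr.eval, RealExpr.eval, h5₇, hW₇, hid, Accepts, not_lt,
        not_or, lt_irrefl, not_false_eq_true, true_and, and_assoc, Nat.cast_ofNat]
    refine (Reaches.branch (τ := 5) (fun hb => (Reaches.setNat ?_).mono ?_ (fun _ h => h))
      (fun hb => (Reaches.nop ?_).mono (by omega) (fun _ h => h))).mono ?_ (fun _ h => h)
    · rw [hacc] at hb
      refine ⟨hd₇, fun _ => ?_, fun h => absurd hb h⟩
      simp [RamState.setNat_nat, NatExpr.eval]
    · simp only [NatExpr.cost]; omega
    · rw [hacc] at hb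
      exact ⟨hd₇, fun h => absurd h hb, fun _ => h0₇⟩
    · simp only [NatExpr.cost, RealExpr.cost, TestExpr.cost]; omega
  obtain ⟨s, t, he, ht, h1, h2, h3⟩ := key
  exact ⟨s, t, he, h1, ht, h2, h3⟩

/-! ### Marginals of distributions over `{0,1}^n` -/

section Marginals

variable {n : ℕ}

/-- The probability mass function of a distribution over `{0,1}^n`. -/
noncomputable def mass (P : Measure (Fin n → Bool)) (x : Fin n → Bool) : ℝ := P.real {x}

/-- The total weight of the points that agree with `x` on `B`. -/
noncomputable def marg (F : (Fin n → Bool) → ℝ) (B : Finset (Fin n)) (x : Fin n → Bool) : ℝ :=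
  ∑ y, if ∀ j ∈ B, y j = x j then F y else 0

theorem mass_nonneg (P : Measure (Fin n → Bool)) (x : Fin n → Bool) : 0 ≤ mass P x :=
  measureReal_nonneg

theorem cond_real_eq (P : Measure (Fin n → Bool)) (E T : Set (Fin n → Bool)) :
    (cond P E).real T = P.real (E ∩ T) / P.real E := by
  rw [measureReal_def, cond_apply (DiscreteMeasurableSpace.forall_measurableSet _),
    ENNReal.toReal_mul, ENNReal.toReal_inv, ← div_eq_inv_mul]
  rfl

theorem sum_mass_filter (P : Measure (Fin n → Bool)) [IsProbabilityMeasure P]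
    (E : Set (Fin n → Bool)) [DecidablePred (· ∈ E)] :
    ∑ y, (if y ∈ E then mass P y else 0) = P.real E := by
  rw [← Finset.sum_filter]
  simp [mass]

theorem marg_mass (P : Measure (Fin n → Bool)) [IsProbabilityMeasure P] (B : Finset (Fin n))
    (x : Fin n → Bool) : marg (mass P) B x = P.real (configEvent (B : Set (Fin n)) x) := by
  classical
  rw [← sum_mass_filter]
  refine Finset.sum_congr rfl fun y _ => ?_
  simp only [configEvent, Set.mem_ofPred_eq, Finset.mem_coe]

theorem sum_mass (P : Measure (Fin n → Bool)) [IsProbabilityMeasure P] : ∑ y, mass P y = 1 := by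
  have := sum_mass_filter P Set.univ
  simpa using this

variable {F : (Fin n → Bool) → ℝ} {B : Finset (Fin n)} {x y : Fin n → Bool} {i : Fin n}

theorem marg_nonneg (hF : ∀ y, 0 ≤ F y) (B : Finset (Fin n)) (x : Fin n → Bool) :
    0 ≤ marg F B x :=
  Finset.sum_nonneg fun y _ => by split_ifs <;> [exact hF y; exact le_rfl]

theorem le_marg (hF : ∀ y, 0 ≤ F y) (B : Finset (Fin n)) (x : Fin n → Bool) :
    F x ≤ marg F B x := by
  refine le_trans (by simp) (Finset.single_le_sum (f := fun y =>
    if ∀ j ∈ B, y j = x j then F y else 0) (fun y _ => ?_) (Finset.mem_univ x))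
  show 0 ≤ if ∀ j ∈ B, y j = x j then F y else 0
  split_ifs <;> [exact hF y; exact le_rfl]

theorem marg_congr (h : ∀ j ∈ B, x j = y j) : marg F B x = marg F B y := by
  unfold marg
  refine Finset.sum_congr rfl fun z _ => ?_
  have : (∀ j ∈ B, z j = x j) ↔ ∀ j ∈ B, z j = y j :=
    forall₂_congr fun j hj => by rw [h j hj]
  simp only [this]

theorem marg_empty : marg F ∅ x = ∑ y, F y := by simp [marg]

theorem marg_univ : marg F Finset.univ x = F x := by
  unfold marg
  rw [Finset.sum_eq_single x]
  · simp
  · intro y _ hy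
    rw [if_neg]
    exact fun h => hy (funext fun j => h j (Finset.mem_univ j))
  · simp

/-- Summing out one coordinate. All manipulations of conditional probabilities below go through this
identity for unnormalized marginals, which needs no positivity. -/
theorem marg_insert_update (hi : i ∉ B) : marg F B x =
    marg F (insert i B) (Function.update x i true) +
      marg F (insert i B) (Function.update x i false) := by
  unfold marg
  rw [← Finset.sum_add_distrib]
  refine Finset.sum_congr rfl fun y _ => ?_
  have h : ∀ v, (∀ j ∈ insert i B, y j = Function.update x i v j) ↔
      y i = v ∧ ∀ j ∈ B, y j = x j := fun v => by
    rw [Finset.forall_mem_insert, Function.update_self]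
    refine and_congr_right fun _ => forall₂_congr fun j hj => ?_
    rw [Function.update_of_ne (ne_of_mem_of_not_mem hj hi)]
  simp only [h]
  cases y i <;> simp

theorem marg_eq_add (hi : i ∉ B) : marg F B x =
    marg F (insert i B) x + marg F (insert i B) (Function.update x i (!x i)) := by
  rw [marg_insert_update hi]
  have : Function.update x i (x i) = x := Function.update_eq_self i x
  cases h : x i
  · rw [h] at this
    rw [this, add_comm]; rfl
  · rw [h] at this
    rw [this]; rfl

theorem marg_le_of_subset (hF : ∀ y, 0 ≤ F y) {A : Finset (Fin n)} (h : A ⊆ B) :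
    marg F B x ≤ marg F A x := by
  unfold marg
  refine Finset.sum_le_sum fun y _ => ?_
  split_ifs with h1 h2 h2
  · exact le_rfl
  · exact absurd (fun j hj => h1 j (h hj)) h2
  · exact hF y
  · exact le_rfl

end Marginals

/-! ### The Markov property -/

section Markov

variable {n : ℕ}

open Classical in
/-- The parents of `X_i`, as a finite set. -/
noncomputable def BNStructure.pa (S : BNStructure n) (i : Fin n) : Finset (Fin n) :=
  Finset.univ.filter fun j => S.Adj j i

theorem BNStructure.mem_pa {S : BNStructure n} {i j : Fin n} : j ∈ S.pa i ↔ S.Adj j i := by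
  simp [BNStructure.pa]

theorem BNStructure.coe_pa (S : BNStructure n) (i : Fin n) :
    (S.pa i : Set (Fin n)) = S.parents i := by
  ext j
  simp [BNStructure.mem_pa, BNStructure.parents]

/-- The nodes with smaller number than `i`. -/
def predecessors (σ : Equiv.Perm (Fin n)) (i : Fin n) : Finset (Fin n) :=
  Finset.univ.filter fun j => σ j < σ i

theorem mem_predecessors {σ : Equiv.Perm (Fin n)} {i j : Fin n} :
    j ∈ predecessors σ i ↔ σ j < σ i := by simp [predecessors]

theorem coe_predecessors (σ : Equiv.Perm (Fin n)) (i : Fin n) :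
    (predecessors σ i : Set (Fin n)) = {j | σ j < σ i} := by
  ext j
  simp [mem_predecessors]

/-- All edges of `S` point from smaller to larger numbers. -/
def IsNumbering (S : BNStructure n) (σ : Equiv.Perm (Fin n)) : Prop :=
  ∀ i j, S.Adj i j → σ i < σ j

/-- Given the parents of `X_i`, the node `X_i` is independent of its predecessors. -/
def IsMarkov (S : BNStructure n) (σ : Equiv.Perm (Fin n)) (F : (Fin n → Bool) → ℝ) : Prop :=
  ∀ (i : Fin n) (B : Finset (Fin n)) (x : Fin n → Bool), S.pa i ⊆ B → B ⊆ predecessors σ i →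
    marg F (insert i B) x * marg F (S.pa i) x = marg F B x * marg F (insert i (S.pa i)) x

/-- If a kernel depending only on `X_i` and its parents gives the law of `X_i` from all
predecessors, then it does so from every set between the parents and the predecessors: sum out the
remaining predecessors one at a time, the kernel being unaffected. Comparing a set `B` with the
parents themselves removes the kernel. -/
theorem isMarkov_of_kernel {S : BNStructure n} {σ : Equiv.Perm (Fin n)}
    {F : (Fin n → Bool) → ℝ} (κ : Fin n → (Fin n → Bool) → ℝ) (hσ : IsNumbering S σ)
    (hκ : ∀ i x y, (∀ j ∈ insert i (S.pa i), x j = y j) → κ i x = κ i y)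
    (h : ∀ i x, marg F (insert i (predecessors σ i)) x =
      κ i x * marg F (predecessors σ i) x) : IsMarkov S σ F := by
  have main : ∀ (i : Fin n) (m : ℕ) (B : Finset (Fin n)) (x : Fin n → Bool),
      (predecessors σ i \ B).card = m → S.pa i ⊆ B →
      B ⊆ predecessors σ i → marg F (insert i B) x = κ i x * marg F B x := by
    intro i m
    induction m with
    | zero =>
      intro B x hm _ hB'
      rw [Finset.card_eq_zero, Finset.sdiff_eq_empty_iff_subset] at hm
      rw [hB'.antisymm hm]
      exact h i x
    | succ m ih =>
      intro B x hm hB hB'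
      obtain ⟨j, hj⟩ : (predecessors σ i \ B).Nonempty := by
        rw [← Finset.card_pos]; omega
      rw [Finset.mem_sdiff] at hj
      have hji : j ≠ i := by
        rintro rfl
        exact lt_irrefl _ (mem_predecessors.1 hj.1)
      have hj' : j ∉ insert i B := by simp [hji, hj.2]
      have hcard : (predecessors σ i \ insert j B).card = m := by
        rw [Finset.sdiff_insert, Finset.card_erase_of_mem (Finset.mem_sdiff.2 hj)]
        omega
      have hsub : insert j B ⊆ predecessors σ i := Finset.insert_subset hj.1 hB'
      have hk : ∀ v, κ i (Function.update x j v) = κ i x := fun v => hκ i _ _ fun l hl => by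
        have : l ≠ j := by
          rintro rfl
          rcases Finset.mem_insert.1 hl with h | h
          · exact hji h
          · exact hj.2 (hB h)
        exact Function.update_of_ne this _ _
      rw [marg_insert_update hj', marg_insert_update hj.2, Finset.insert_comm,
        ih _ _ hcard (hB.trans (Finset.subset_insert _ _)) hsub,
        ih _ _ hcard (hB.trans (Finset.subset_insert _ _)) hsub, hk, hk]
      ring
  intro i B x hB hB'
  rw [main i _ B x rfl hB hB', main i _ (S.pa i) x rfl (Finset.Subset.refl _) (fun j hj =>
    mem_predecessors.2 (hσ _ _ (BNStructure.mem_pa.1 hj)))]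
  ring

theorem configEvent_inter_eq {A : Finset (Fin n)} {a : Fin n → Bool} {i : Fin n} :
    configEvent (A : Set (Fin n)) a ∩ {x | x i = a i} =
      configEvent ((insert i A : Finset (Fin n)) : Set (Fin n)) a := by
  ext y
  simp only [configEvent, Set.mem_inter_iff, Set.mem_ofPred_eq, Finset.mem_coe,
    Finset.forall_mem_insert]
  tauto

/-- The definition compares conditional probabilities on histories of positive probability. A kernel
on all configurations of the parents is obtained by choosing such a history wherever one exists. -/
theorem IsBayesNet.exists_isMarkov {S : BNStructure n} {P : Measure (Fin n → Bool)}
    [IsProbabilityMeasure P] (h : IsBayesNet S P) :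
    ∃ σ, IsNumbering S σ ∧ IsMarkov S σ (mass P) := by
  classical
  obtain ⟨σ, hσ, h⟩ := h
  refine ⟨σ, hσ, ?_⟩
  let c : Fin n → (Fin n → Bool) → ℝ := fun i z =>
    (cond P (configEvent {j | σ j < σ i} z)).real {x | x i = true}
  let G : Fin n → (Fin n → Bool) → (Fin n → Bool) → Prop := fun i a z =>
    (∀ j ∈ S.pa i, z j = a j) ∧ P (configEvent {j | σ j < σ i} z) ≠ 0
  -- The default `0` is arbitrary: where it is used, the history has probability zero and both sides
  -- of the kernel equation vanish.
  let κ₁ : Fin n → (Fin n → Bool) → ℝ := fun i a =>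
    if h : ∃ z, G i a z then c i h.choose else 0
  have hc : ∀ i z, P (configEvent {j | σ j < σ i} z) ≠ 0 → c i z = κ₁ i z := by
    intro i z hz
    have hex : ∃ z', G i z z' := ⟨z, fun _ _ => rfl, hz⟩
    simp only [κ₁, dif_pos hex]
    refine h i _ _ (fun j hj => ?_) hz hex.choose_spec.2
    rw [← S.coe_pa] at hj
    exact (hex.choose_spec.1 j hj).symm
  have hκ₁ : ∀ i a b, (∀ j ∈ S.pa i, a j = b j) → κ₁ i a = κ₁ i b := by
    intro i a b hab
    have : G i a = G i b := by
      ext z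
      simp only [G]
      refine and_congr_left fun _ => forall₂_congr fun j hj => by rw [hab j hj]
    simp only [κ₁, this]
  have htrue : ∀ i z, z i = true → marg (mass P) (insert i (predecessors σ i)) z =
      κ₁ i z * marg (mass P) (predecessors σ i) z := by
    intro i z hz
    rw [marg_mass, marg_mass, ← configEvent_inter_eq, coe_predecessors, hz]
    by_cases h0 : P (configEvent {j | σ j < σ i} z) = 0
    · rw [measureReal_def, measureReal_def, h0, measure_mono_null Set.inter_subset_left h0]
      simp
    · rw [← hc i z h0]
      simp only [c]
      rw [cond_real_eq]
      have h0' : P.real (configEvent {j | σ j < σ i} z) ≠ 0 := by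
        rw [measureReal_def, ENNReal.toReal_ne_zero]
        exact ⟨h0, measure_ne_top _ _⟩
      field_simp
  refine isMarkov_of_kernel (fun i x => if x i then κ₁ i x else 1 - κ₁ i x) hσ ?_ ?_
  · intro i x y hxy
    rw [Finset.forall_mem_insert] at hxy
    simp only [hxy.1, hκ₁ i x y hxy.2]
  · intro i x
    have hi : i ∉ predecessors σ i := by simp [mem_predecessors]
    have hpa : i ∉ S.pa i := fun h => lt_irrefl _ (hσ _ _ (BNStructure.mem_pa.1 h))
    cases hx : x i
    · have h1 := marg_eq_add (F := mass P) (x := x) hi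
      have h2 := htrue i (Function.update x i (!x i)) (by simp [hx])
      have h3 : κ₁ i (Function.update x i (!x i)) = κ₁ i x := hκ₁ _ _ _ fun j hj =>
        Function.update_of_ne (ne_of_mem_of_not_mem hj hpa) _ _
      have h4 : marg (mass P) (predecessors σ i) (Function.update x i (!x i)) =
          marg (mass P) (predecessors σ i) x := marg_congr fun j hj =>
        Function.update_of_ne (ne_of_mem_of_not_mem hj hi) _ _
      rw [h3, h4] at h2
      simp only [Bool.false_eq_true, if_false]
      linarith
    · simp only [if_true]
      exact htrue i x hx

/-! ### Structures with the same families have the same Markov distributions. -/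

/-- The sets that the factorization over `S` involves: `A ⊆ {X_i} ∪ Pa(X_i)` for some `X_i` in
`A`. -/
def IsFamily (S : BNStructure n) (A : Finset (Fin n)) : Prop :=
  ∃ i ∈ A, ∀ u ∈ A, u ≠ i → S.Adj u i

/-- Adjacency in the skeleton. -/
def BNStructure.Linked (S : BNStructure n) (i j : Fin n) : Prop := S.Adj i j ∨ S.Adj j i

/-- Let `i` be the sink of `A` in `S` and `w` the last node of `A` in the numbering of `S'`. Then
`w` is a sink in `S'` as soon as every other `u` in `A` is linked to it. The only doubtful case is
that `u` and `w` are both parents of `i` and not linked; then `hv` preserves the collider, so `w`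
precedes `i`, against its choice. -/
theorem IsFamily.of_equivalent {S S' : BNStructure n} {σ : Equiv.Perm (Fin n)}
    (hσ : IsNumbering S' σ) (hs : ∀ i j, S.Linked i j → S'.Linked i j)
    (hv : ∀ u w i, u ≠ w → S.Adj u i → S.Adj w i → ¬ S.Linked u w → S'.Adj u i ∧ S'.Adj w i)
    {A : Finset (Fin n)} (hA : IsFamily S A) : IsFamily S' A := by
  obtain ⟨i, hi, hiA⟩ := hA
  obtain ⟨w, hw, hmax⟩ := A.exists_max_image σ ⟨i, hi⟩
  have adj : ∀ u ∈ A, u ≠ w → S'.Linked u w → S'.Adj u w := by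
    intro u hu _ h
    rcases h with h | h
    · exact h
    · exact absurd (hσ _ _ h) (not_lt.2 (hmax u hu))
  refine ⟨w, hw, fun u hu huw => adj u hu huw ?_⟩
  by_cases hwi : w = i
  · subst hwi
    exact hs _ _ (Or.inl (hiA u hu huw))
  by_cases hui : u = i
  · subst hui
    exact hs _ _ (Or.inr (hiA w hw hwi))
  by_contra hl
  have h := hv u w i huw (hiA u hu hui) (hiA w hw hwi) fun h => hl (hs _ _ h)
  exact absurd (hσ _ _ h.2) (not_lt.2 (hmax i hi))

/-- Möbius inversion on the lattice of finite sets; existence is enough, so `g` is defined by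
recursion over proper subsets. -/
theorem exists_sum_powerset {α : Type*} [DecidableEq α] (h : Finset α → ℝ) :
    ∃ g : Finset α → ℝ, ∀ B, h B = ∑ A ∈ B.powerset, g A := by
  let g : Finset α → ℝ := Finset.strongInduction fun B ih =>
    h B - ∑ A ∈ B.ssubsets.attach, ih A.1 (Finset.mem_ssubsets.1 A.2)
  refine ⟨g, fun B => ?_⟩
  have hg : g B = h B - ∑ A ∈ B.ssubsets, g A := by
    show Finset.strongInduction _ B = _
    rw [Finset.strongInduction_eq, ← Finset.sum_attach B.ssubsets]
  have hB : B.powerset = insert B B.ssubsets := by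
    rw [Finset.ssubsets, Finset.insert_erase (Finset.mem_powerset_self B)]
  rw [hB, Finset.sum_insert (by simp), hg]
  ring

/-- After Möbius inversion the term of node `i` is the sum of `g` over the sets that contain `i` and
otherwise only parents of `i`, that is, over the families with sink `i`. By acyclicity a family has
only one sink, so each family is counted once and the total depends on the families alone. -/
theorem sum_family_eq {S S' : BNStructure n} {σ σ' : Equiv.Perm (Fin n)} (hσ : IsNumbering S σ)
    (hσ' : IsNumbering S' σ') (hf : ∀ A, IsFamily S A ↔ IsFamily S' A)
    (h : Finset (Fin n) → ℝ) :
    ∑ i, (h (insert i (S.pa i)) - h (S.pa i)) =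
      ∑ i, (h (insert i (S'.pa i)) - h (S'.pa i)) := by
  classical
  obtain ⟨g, hg⟩ := exists_sum_powerset h
  have main : ∀ (T : BNStructure n) (τ : Equiv.Perm (Fin n)), IsNumbering T τ →
      ∑ i, (h (insert i (T.pa i)) - h (T.pa i)) =
        ∑ A : Finset (Fin n), if IsFamily T A then g A else 0 := by
    intro T τ hτ
    have h1 : ∀ i, h (insert i (T.pa i)) - h (T.pa i) =
        ∑ A : Finset (Fin n), if i ∈ A ∧ ∀ u ∈ A, u ≠ i → T.Adj u i then g A else 0 := by
      intro i
      have hi : i ∉ T.pa i := fun hi => lt_irrefl _ (hτ _ _ (BNStructure.mem_pa.1 hi))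
      rw [hg, hg, ← Finset.sum_sdiff (Finset.powerset_mono.2 (Finset.subset_insert i (T.pa i))),
        add_sub_cancel_right, ← Finset.sum_filter]
      refine Finset.sum_congr ?_ fun _ _ => rfl
      ext A
      simp only [Finset.mem_sdiff, Finset.mem_powerset, Finset.mem_filter, Finset.mem_univ,
        true_and]
      constructor
      · rintro ⟨h1, h2⟩
        have hiA : i ∈ A := by
          by_contra hiA
          refine h2 fun u hu => ?_
          rcases Finset.mem_insert.1 (h1 hu) with rfl | h
          · exact absurd hu hiA
          · exact h
        refine ⟨hiA, fun u hu hui => ?_⟩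
        rcases Finset.mem_insert.1 (h1 hu) with rfl | h
        · exact absurd rfl hui
        · exact BNStructure.mem_pa.1 h
      · rintro ⟨h1, h2⟩
        refine ⟨fun u hu => ?_, fun h => hi (h h1)⟩
        by_cases hui : u = i
        · exact Finset.mem_insert.2 (Or.inl hui)
        · exact Finset.mem_insert.2 (Or.inr (BNStructure.mem_pa.2 (h2 u hu hui)))
    rw [Finset.sum_congr rfl fun i _ => h1 i, Finset.sum_comm]
    refine Finset.sum_congr rfl fun A _ => ?_
    split_ifs with hA
    · obtain ⟨i, hi, hiA⟩ := hA
      rw [Finset.sum_eq_single i, if_pos ⟨hi, hiA⟩]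
      · intro j _ hji
        refine if_neg ?_
        rintro ⟨hj, hjA⟩
        exact lt_asymm (hτ _ _ (hjA i hi hji.symm)) (hτ _ _ (hiA j hj hji))
      · simp
    · refine Finset.sum_eq_zero fun i _ => if_neg fun h => hA ⟨i, h.1, h.2⟩
  rw [main S σ hσ, main S' σ' hσ']
  simp only [hf]

/-- The set of the `k` nodes with the smallest numbers. -/
def initialNodes (σ : Equiv.Perm (Fin n)) (k : ℕ) : Finset (Fin n) :=
  Finset.univ.filter fun j => (σ j : ℕ) < k

theorem initialNodes_val (σ : Equiv.Perm (Fin n)) (i : Fin n) :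
    initialNodes σ (σ i) = predecessors σ i := by
  ext j
  simp [initialNodes, predecessors]

theorem initialNodes_succ (σ : Equiv.Perm (Fin n)) (i : Fin n) :
    initialNodes σ (σ i + 1) = insert i (predecessors σ i) := by
  ext j
  simp only [initialNodes, predecessors, Finset.mem_filter, Finset.mem_univ, true_and,
    Finset.mem_insert]
  rw [Nat.lt_succ_iff_lt_or_eq, ← Fin.ext_iff, σ.injective.eq_iff, Fin.lt_def]
  tauto

theorem sum_predecessors (σ : Equiv.Perm (Fin n)) (h : Finset (Fin n) → ℝ) :
    ∑ i, (h (insert i (predecessors σ i)) - h (predecessors σ i)) = h Finset.univ - h ∅ := by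
  have h1 : ∑ i, (h (insert i (predecessors σ i)) - h (predecessors σ i)) =
      ∑ k : Fin n, (h (initialNodes σ (k + 1)) - h (initialNodes σ k)) := by
    rw [← Equiv.sum_comp σ (fun k : Fin n => h (initialNodes σ (k + 1)) - h (initialNodes σ k))]
    refine Finset.sum_congr rfl fun i _ => ?_
    rw [initialNodes_succ, initialNodes_val]
  rw [h1, Fin.sum_univ_eq_sum_range (fun k => h (initialNodes σ (k + 1)) - h (initialNodes σ k)),
    Finset.sum_range_sub (fun k => h (initialNodes σ k))]
  congr 2
  · ext j
    simp [initialNodes]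
  · ext j
    simp [initialNodes]

/-- The chain rule telescopes along the numbering, and the Markov property replaces the predecessors
by the parents. Positivity of `F x` makes all marginals at `x` positive. -/
theorem IsMarkov.log_mass {S : BNStructure n} {σ : Equiv.Perm (Fin n)}
    {F : (Fin n → Bool) → ℝ} (hF : ∀ y, 0 ≤ F y) (hF1 : ∑ y, F y = 1) (hσ : IsNumbering S σ)
    (hS : IsMarkov S σ F) {x : Fin n → Bool} (hx : 0 < F x) :
    Real.log (F x) = ∑ i, (Real.log (marg F (insert i (S.pa i)) x) -
      Real.log (marg F (S.pa i) x)) := by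
  have hpos : ∀ B, marg F B x ≠ 0 := fun B => (hx.trans_le (le_marg hF B x)).ne'
  have h := sum_predecessors σ (fun B => Real.log (marg F B x))
  rw [marg_univ, marg_empty, hF1, Real.log_one, sub_zero] at h
  rw [← h]
  refine Finset.sum_congr rfl fun i _ => ?_
  have h1 := hS i (predecessors σ i) x (fun j hj =>
    mem_predecessors.2 (hσ _ _ (BNStructure.mem_pa.1 hj))) (Finset.Subset.refl _)
  have h2 := congrArg Real.log h1
  rw [Real.log_mul (hpos _) (hpos _), Real.log_mul (hpos _) (hpos _)] at h2
  linarith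

/-- Distributions that satisfy the Markov property for a structure satisfy it for every structure
with the same families, provided that all parental configurations have positive probability. -/
theorem IsMarkov.of_families {S S' : BNStructure n} {σ σ' : Equiv.Perm (Fin n)}
    {F : (Fin n → Bool) → ℝ} (hF : ∀ y, 0 ≤ F y) (hF1 : ∑ y, F y = 1) (hσ : IsNumbering S σ)
    (hσ' : IsNumbering S' σ') (hf : ∀ A, IsFamily S A ↔ IsFamily S' A)
    (hS' : IsMarkov S' σ' F) (hpos : ∀ i x, 0 < marg F (S.pa i) x) : IsMarkov S σ F := by
  let f : Fin n → (Fin n → Bool) → ℝ := fun i x =>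
    marg F (insert i (S.pa i)) x / marg F (S.pa i) x
  have hpa : ∀ i, i ∉ S.pa i := fun i h => lt_irrefl _ (hσ _ _ (BNStructure.mem_pa.1 h))
  have hf0 : ∀ i x, 0 ≤ f i x := fun i x => div_nonneg (marg_nonneg hF _ _) (marg_nonneg hF _ _)
  have hfc : ∀ i x y, (∀ j ∈ insert i (S.pa i), x j = y j) → f i x = f i y := fun i x y h => by
    simp only [f]
    rw [marg_congr h, marg_congr fun j hj => h j (Finset.mem_insert_of_mem hj)]
  have hf1 : ∀ i x, f i (Function.update x i true) + f i (Function.update x i false) = 1 := by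
    intro i x
    simp only [f]
    have h : ∀ v, marg F (S.pa i) (Function.update x i v) = marg F (S.pa i) x := fun v =>
      marg_congr fun j hj => Function.update_of_ne (ne_of_mem_of_not_mem hj (hpa i)) _ _
    rw [h, h, ← add_div, ← marg_insert_update (hpa i), div_self (hpos i x).ne']
  let G : (Fin n → Bool) → ℝ := fun x => ∏ i, f i x
  -- Sum out the nodes from the last to the first: the factor of the last node sums to one, and no
  -- earlier factor involves that node.
  have hG : ∀ k ≤ n, ∀ x, marg G (initialNodes σ k) x = ∏ i ∈ initialNodes σ k, f i x := by
    intro k hk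
    induction hk using Nat.decreasingInduction with
    | self =>
      intro x
      have : initialNodes σ n = Finset.univ := by ext j; simp [initialNodes]
      rw [this, marg_univ]
    | of_succ k hk ih =>
      intro x
      obtain ⟨i, hi⟩ := σ.surjective ⟨k, hk⟩
      have hk' : k = (σ i : ℕ) := by rw [hi]
      have hmem : i ∉ predecessors σ i := by simp [mem_predecessors]
      rw [hk', initialNodes_succ] at ih
      rw [hk', initialNodes_val, marg_insert_update hmem, ih, ih, Finset.prod_insert hmem,
        Finset.prod_insert hmem]
      have : ∀ v, ∏ j ∈ predecessors σ i, f j (Function.update x i v) =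
          ∏ j ∈ predecessors σ i, f j x := fun v => by
        refine Finset.prod_congr rfl fun j hj => hfc j _ _ fun l hl => ?_
        refine Function.update_of_ne ?_ _ _
        rintro rfl
        have h1 := mem_predecessors.1 hj
        rcases Finset.mem_insert.1 hl with h | h
        · rw [h] at h1
          exact lt_irrefl _ h1
        · exact lt_asymm h1 (hσ _ _ (BNStructure.mem_pa.1 h))
      rw [this, this, ← add_mul, hf1, one_mul]
  have hG1 : ∑ y, G y = 1 := by
    have h := hG 0 (Nat.zero_le _) (fun _ => false)
    have h0 : initialNodes σ 0 = ∅ := by ext j; simp [initialNodes]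
    rw [h0, marg_empty, Finset.prod_empty] at h
    exact h
  -- On the support of `F` equality holds, by comparing logarithms through `sum_family_eq`. Off the
  -- support there is only the trivial inequality, but both functions have total mass one, which
  -- forces equality everywhere.
  have hle : ∀ x, F x ≤ G x := by
    intro x
    rcases (hF x).eq_or_lt with h0 | h0
    · rw [← h0]
      exact Finset.prod_nonneg fun i _ => hf0 i x
    · have hm : ∀ B, 0 < marg F B x := fun B => h0.trans_le (le_marg hF B x)
      have h1 := hS'.log_mass hF hF1 hσ' h0
      rw [← sum_family_eq hσ hσ' hf (fun B => Real.log (marg F B x))] at h1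
      have h2 : Real.log (G x) = Real.log (F x) := by
        rw [h1, Real.log_prod fun i _ => (div_pos (hm _) (hm _)).ne']
        exact Finset.sum_congr rfl fun i _ => Real.log_div (hm _).ne' (hm _).ne'
      exact (Real.log_injOn_pos (Finset.prod_pos fun i _ => div_pos (hm _) (hm _)) h0 h2).ge
  have hFG : F = G := by
    funext x
    exact (Finset.sum_eq_sum_iff_of_le fun y _ => hle y).1 (hF1.trans hG1.symm) x
      (Finset.mem_univ x)
  refine isMarkov_of_kernel f hσ hfc fun i x => ?_
  have hmem : i ∉ predecessors σ i := by simp [mem_predecessors]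
  have h1 := hG _ (σ i).isLt x
  have h2 := hG _ (σ i).isLt.le x
  rw [Nat.succ_eq_add_one, initialNodes_succ, Finset.prod_insert hmem] at h1
  rw [initialNodes_val] at h2
  rw [← hFG] at h1 h2
  rw [h1, h2]

end Markov

/-! ### Conditional independence and the structure -/

section Structure

variable {n : ℕ}

/-- The cross-multiplied form holds trivially where the conditioning event has probability zero, so
it can be required of all points. -/
theorem condIndepGiven_iff {P : Measure (Fin n → Bool)} [IsProbabilityMeasure P] {i j : Fin n}
    {A : Finset (Fin n)} (hij' : i ≠ j) (hiA : i ∉ A) (hjA : j ∉ A) :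
    CondIndepGiven P i j (A : Set (Fin n)) ↔ ∀ x, marg (mass P) (insert i (insert j A)) x *
      marg (mass P) A x = marg (mass P) (insert i A) x * marg (mass P) (insert j A) x := by
  have hpre : ∀ (k : Fin n) (v : Bool), (fun x : Fin n → Bool => x k) ⁻¹' {v} = {x | x k = v} :=
    fun _ _ => rfl
  have hi : ∀ (k : Fin n) (x : Fin n → Bool),
      (cond P (configEvent (A : Set (Fin n)) x)).real {y | y k = x k} =
        marg (mass P) (insert k A) x / marg (mass P) A x := fun k x => by
    rw [cond_real_eq, configEvent_inter_eq, marg_mass, marg_mass]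
  have hij : ∀ x : Fin n → Bool, (cond P (configEvent (A : Set (Fin n)) x)).real
      ({y | y i = x i} ∩ {y | y j = x j}) =
        marg (mass P) (insert i (insert j A)) x / marg (mass P) A x := fun x => by
    rw [cond_real_eq, Set.inter_comm {y : Fin n → Bool | y i = x i}, ← Set.inter_assoc, configEvent_inter_eq,
      configEvent_inter_eq, marg_mass, marg_mass]
  constructor
  · intro h x
    have hle : ∀ B, A ⊆ B → marg (mass P) B x ≤ marg (mass P) A x := fun B hB =>
      marg_le_of_subset (mass_nonneg P) hB
    have hsub : ∀ k, A ⊆ insert k A := fun k => Finset.subset_insert _ _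
    rcases (marg_nonneg (mass_nonneg P) A x).eq_or_lt with h0 | h0
    · rw [← h0, mul_zero, le_antisymm (h0 ▸ hle _ (hsub i)) (marg_nonneg (mass_nonneg P) _ _),
        zero_mul]
    · have hne : P (configEvent (A : Set (Fin n)) x) ≠ 0 := by
        rw [marg_mass, measureReal_def] at h0
        intro h
        rw [h] at h0
        exact lt_irrefl _ h0
      have h1 := (h x hne).measure_inter_preimage_eq_mul {x i} {x j} (MeasurableSet.singleton _)
        (MeasurableSet.singleton _)
      have h2 := congrArg ENNReal.toReal h1
      rw [ENNReal.toReal_mul, hpre, hpre] at h2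
      change (cond P (configEvent (A : Set (Fin n)) x)).real _ =
        (cond P (configEvent (A : Set (Fin n)) x)).real _ *
        (cond P (configEvent (A : Set (Fin n)) x)).real _ at h2
      rw [hij, hi, hi] at h2
      field_simp at h2
      linarith
  · intro h a ha
    have : IsProbabilityMeasure (cond P (configEvent (A : Set (Fin n)) a)) :=
      cond_isProbabilityMeasure ha
    rw [indepFun_iff_map_prod_eq_prod_map_map (Measurable.of_discrete.aemeasurable)
      (Measurable.of_discrete.aemeasurable)]
    refine Measure.ext_of_singleton fun vw => ?_
    obtain ⟨v, w⟩ := vw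
    rw [Measure.map_apply Measurable.of_discrete (MeasurableSet.singleton _),
      ← Set.singleton_prod_singleton, Measure.prod_prod,
      Measure.map_apply Measurable.of_discrete (MeasurableSet.singleton _),
      Measure.map_apply Measurable.of_discrete (MeasurableSet.singleton _)]
    -- A point with the configuration `a` on `A` and the prescribed values at `i` and `j`, at which
    -- the identity of marginals is used.
    set y := Function.update (Function.update a i v) j w
    have hyi : y i = v := by simp [y, hij']
    have hyj : y j = w := by simp [y]
    have hyA : ∀ k ∈ A, y k = a k := fun k hk => by
      simp only [y]
      rw [Function.update_of_ne (ne_of_mem_of_not_mem hk hjA),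
        Function.update_of_ne (ne_of_mem_of_not_mem hk hiA)]
    have hE : configEvent (A : Set (Fin n)) a = configEvent (A : Set (Fin n)) y := by
      ext z
      simp only [configEvent, Set.mem_ofPred_eq, Finset.mem_coe]
      exact forall₂_congr fun k hk => by rw [hyA k hk]
    rw [hE] at ha this ⊢
    have hpair : (fun x : Fin n → Bool => (x i, x j)) ⁻¹' ({v} ×ˢ {w}) =
        {x | x i = v} ∩ {x | x j = w} := by
      ext x; simp
    rw [hpair, hpre, hpre, ← ENNReal.toReal_eq_toReal_iff' (measure_ne_top _ _)
      (ENNReal.mul_ne_top (measure_ne_top _ _) (measure_ne_top _ _)), ENNReal.toReal_mul]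
    change (cond P (configEvent (A : Set (Fin n)) y)).real _ =
      (cond P (configEvent (A : Set (Fin n)) y)).real _ *
      (cond P (configEvent (A : Set (Fin n)) y)).real _
    have h0 : marg (mass P) A y ≠ 0 := by
      rw [marg_mass, measureReal_def, ENNReal.toReal_ne_zero]
      exact ⟨ha, measure_ne_top _ _⟩
    rw [← hyi, ← hyj, hij, hi, hi]
    field_simp
    linarith [h y]

/-- The conditions of non-degeneracy on the edges of the structure. -/
def Forced (S : BNStructure n) (i j : Fin n) (A : Set (Fin n)) : Prop :=
  S.Adj i j ∨ (∃ k ∈ A, S.Adj i k ∧ S.Adj j k) ∨ (∃ k, k ∉ A ∧ S.Adj i k ∧ S.Adj k j) ∨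
    ∃ k, k ∉ A ∧ S.Adj k i ∧ S.Adj k j

theorem CondIndepGiven.symm {P : Measure (Fin n → Bool)} {i j : Fin n} {A : Set (Fin n)}
    (h : CondIndepGiven P i j A) : CondIndepGiven P j i A := fun a ha => (h a ha).symm

/-- The later of the two nodes is independent of the earlier one given its own parents. Besides the
separating set, its owner `z` is retained, since the position of `z` in the numbering decides the
orientation of edges later. -/
theorem exists_condIndepGiven {S : BNStructure n} {σ : Equiv.Perm (Fin n)}
    {P : Measure (Fin n → Bool)} [IsProbabilityMeasure P] {d : ℕ} (hσ : IsNumbering S σ)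
    (hS : IsMarkov S σ (mass P)) (hd : S.DegreeLE d) {u w : Fin n} (huw : u ≠ w)
    (hl : ¬ S.Linked u w) :
    ∃ z, (z = u ∨ z = w) ∧ σ u ≤ σ z ∧ σ w ≤ σ z ∧ (S.pa z).card ≤ d ∧ u ∉ S.pa z ∧
      w ∉ S.pa z ∧ CondIndepGiven P u w (S.pa z : Set (Fin n)) := by
  have hirr : ∀ z, z ∉ S.pa z := fun z hz => lt_irrefl _ (hσ _ _ (BNStructure.mem_pa.1 hz))
  have hcard : ∀ z, (S.pa z).card ≤ d := fun z => by
    rw [← Set.ncard_coe_finset, S.coe_pa]; exact hd z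
  have main : ∀ u w, σ u < σ w → ¬ S.Linked u w →
      CondIndepGiven P u w (S.pa w : Set (Fin n)) := by
    intro u w hlt hl
    rw [condIndepGiven_iff (fun h => by rw [h] at hlt; exact lt_irrefl _ hlt)
      (fun h => hl (Or.inl (BNStructure.mem_pa.1 h))) (hirr w)]
    intro x
    have h := hS w (insert u (S.pa w)) x (Finset.subset_insert _ _)
      (Finset.insert_subset (mem_predecessors.2 hlt) fun j hj =>
        mem_predecessors.2 (hσ _ _ (BNStructure.mem_pa.1 hj)))
    rw [Finset.insert_comm]
    exact h
  rcases lt_or_gt_of_ne (fun h => huw (σ.injective h) : σ u ≠ σ w) with h | h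
  · exact ⟨w, Or.inr rfl, h.le, le_rfl, hcard w, fun hm => hl (Or.inl (BNStructure.mem_pa.1 hm)),
      hirr w, main u w h hl⟩
  · exact ⟨u, Or.inl rfl, le_rfl, h.le, hcard u, hirr u,
      fun hm => hl (Or.inr (BNStructure.mem_pa.1 hm)), (main w u h fun h => hl h.symm).symm⟩

/-- Adjacent nodes of `S` cannot be separated, by condition (i), so they are adjacent in `S'`;
counting edges gives equal skeletons. For a collider `u → i ← w` of `S` with `u`, `w` non-adjacent,
condition (ii) keeps `i` out of the separating set `Pa(z)` in `S'`, so the edge between `z` and `i`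
points to `i`; thus `i` comes after `u` and `w`, and both edges point to it. For such a collider of
`S'`, `i` comes after `z` and again is not in the separating set; any other orientation in `S` would
be a chain or a fork through `i`, excluded by (iii) and (iv). -/
theorem isFamily_iff_of_dependent {S S' : BNStructure n} {σ σ' : Equiv.Perm (Fin n)}
    {P : Measure (Fin n → Bool)} [IsProbabilityMeasure P] {d : ℕ} (hσ : IsNumbering S σ)
    (hσ' : IsNumbering S' σ') (hS' : IsMarkov S' σ' (mass P)) (hd : S'.DegreeLE d)
    (he : S'.edgeCount ≤ S.edgeCount)
    (hdep : ∀ (i j : Fin n) (A : Finset (Fin n)), i ≠ j → A.card ≤ d → i ∉ A → j ∉ A →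
      Forced S i j (A : Set (Fin n)) → ¬ CondIndepGiven P i j (A : Set (Fin n)))
    (A : Finset (Fin n)) : IsFamily S A ↔ IsFamily S' A := by
  have hirr : ∀ i, ¬ S.Adj i i := fun i h => lt_irrefl _ (hσ _ _ h)
  have hlink : ∀ u w, S.Linked u w → S'.Linked u w := by
    intro u w h
    by_contra hl
    have huw : u ≠ w := by
      rintro rfl
      exact h.elim (hirr u) (hirr u)
    obtain ⟨z, -, -, -, hz, hu, hw, hci⟩ := exists_condIndepGiven hσ' hS' hd huw hl
    rcases h with h | h
    · exact hdep u w _ huw hz hu hw (Or.inl h) hci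
    · exact hdep w u _ huw.symm hz hw hu (Or.inl h) hci.symm
  have hskel : S.skeleton = S'.skeleton := by
    have hle : S.skeleton ≤ S'.skeleton := by
      intro u w h
      rw [BNStructure.skeleton, SimpleGraph.fromRel_adj] at h ⊢
      exact ⟨h.1, hlink u w h.2⟩
    exact SimpleGraph.edgeSet_injective
      (Set.eq_of_subset_of_ncard_le (SimpleGraph.edgeSet_mono hle) he)
  have hlink' : ∀ u w, S'.Linked u w → S.Linked u w := by
    intro u w h
    have hne : u ≠ w := by
      rintro rfl
      exact h.elim (fun h => lt_irrefl _ (hσ' _ _ h)) (fun h => lt_irrefl _ (hσ' _ _ h))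
    have h1 : S'.skeleton.Adj u w := by
      rw [BNStructure.skeleton, SimpleGraph.fromRel_adj]; exact ⟨hne, h⟩
    rw [← hskel, BNStructure.skeleton, SimpleGraph.fromRel_adj] at h1
    exact h1.2
  constructor
  · refine IsFamily.of_equivalent hσ' hlink fun u w i huw hu hw hl => ?_
    obtain ⟨z, hz, hzu, hzw, hcard, huA, hwA, hci⟩ :=
      exists_condIndepGiven hσ' hS' hd huw (fun h => hl (hlink' _ _ h))
    have hi : i ∉ S'.pa z := fun hi =>
      hdep u w _ huw hcard huA hwA (Or.inr (Or.inl ⟨i, hi, hu, hw⟩)) hci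
    have hzi : S'.Adj z i := by
      have h1 : S'.Linked z i := by
        rcases hz with rfl | rfl
        · exact hlink _ _ (Or.inl hu)
        · exact hlink _ _ (Or.inl hw)
      exact h1.resolve_right fun h => hi (BNStructure.mem_pa.2 h)
    have hlt := hσ' _ _ hzi
    exact ⟨(hlink _ _ (Or.inl hu)).resolve_right fun h =>
        absurd (hσ' _ _ h) (not_lt.2 (hzu.trans hlt.le)),
      (hlink _ _ (Or.inl hw)).resolve_right fun h =>
        absurd (hσ' _ _ h) (not_lt.2 (hzw.trans hlt.le))⟩
  · refine IsFamily.of_equivalent hσ hlink' fun u w i huw hu hw hl => ?_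
    obtain ⟨z, hz, hzu, hzw, hcard, huA, hwA, hci⟩ := exists_condIndepGiven hσ' hS' hd huw hl
    have hi : i ∉ S'.pa z := fun hi => by
      have h1 := hσ' _ _ (BNStructure.mem_pa.1 hi)
      rcases hz with rfl | rfl
      · exact lt_asymm h1 (hσ' _ _ hu)
      · exact lt_asymm h1 (hσ' _ _ hw)
    have hu' := hlink' _ _ (Or.inl hu)
    have hw' := hlink' _ _ (Or.inl hw)
    rcases hu' with hu' | hu'
    · refine ⟨hu', hw'.resolve_right fun hw' => ?_⟩
      exact hdep u w _ huw hcard huA hwA (Or.inr (Or.inr (Or.inl ⟨i, hi, hu', hw'⟩))) hci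
    · exfalso
      rcases hw' with hw' | hw'
      · exact hdep w u _ huw.symm hcard hwA huA (Or.inr (Or.inr (Or.inl ⟨i, hi, hw', hu'⟩)))
          hci.symm
      · exact hdep u w _ huw hcard huA hwA (Or.inr (Or.inr (Or.inr ⟨i, hi, hu', hw'⟩))) hci

end Structure

/-! ### The covariance statistic -/

section Covariance

/-- The absolute value of the unnormalized covariance of a `2 × 2` table. -/
noncomputable def covTerm (a : ℕ → ℝ) : ℝ :=
  |a 3 * a 0 - a 1 * a 2| / (a 0 + a 1 + a 2 + a 3)

theorem covTerm_nonneg {a : ℕ → ℝ} (ha : ∀ c, 0 ≤ a c) : 0 ≤ covTerm a :=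
  div_nonneg (abs_nonneg _) (by linarith [ha 0, ha 1, ha 2, ha 3])

theorem covTerm_smul {a : ℕ → ℝ} {m : ℝ} (hm : 0 < m) :
    covTerm (fun c => m * a c) = m * covTerm a := by
  unfold covTerm
  rw [show m * a 3 * (m * a 0) - m * a 1 * (m * a 2) = (m * m) * (a 3 * a 0 - a 1 * a 2) by ring,
    show m * a 0 + m * a 1 + m * a 2 + m * a 3 = m * (a 0 + a 1 + a 2 + a 3) by ring,
    abs_mul, abs_of_pos (mul_pos hm hm), mul_assoc, mul_div_mul_left _ _ hm.ne', mul_div_assoc]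

theorem covTerm_le_sum {a : ℕ → ℝ} (ha : ∀ c, 0 ≤ a c) :
    covTerm a ≤ a 0 + a 1 + a 2 + a 3 := by
  have h0 := ha 0
  have h1 := ha 1
  have h2 := ha 2
  have h3 := ha 3
  unfold covTerm
  refine div_le_of_le_mul₀ (by linarith) (by linarith) ?_
  rw [abs_le]
  constructor <;> nlinarith [mul_nonneg h0 h1, mul_nonneg h0 h2, mul_nonneg h0 h3,
    mul_nonneg h1 h2, mul_nonneg h1 h3, mul_nonneg h2 h3]

/-- The coefficient of `|s - s'|` is left exact: for the two products of a determinant these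
coefficients add up to at most one, where separate bounds would lose a factor of two. -/
theorem abs_div_sub_div_le {x y s x' y' s' : ℝ} (hx : 0 ≤ x) (hy' : 0 ≤ y') (hs : 0 < s)
    (hs' : 0 < s') (hxs : x ≤ s) (hys : y' ≤ s') :
    |x * y / s - x' * y' / s'| ≤ |y - y'| + |x - x'| + x * y' / (s * s') * |s - s'| := by
  have h : x * y / s - x' * y' / s' =
      (y - y') * (x / s) + (x - x') * (y' / s') + x * y' / (s * s') * (s' - s) := by
    field_simp
    ring
  rw [h]
  have h1 : |(y - y') * (x / s)| ≤ |y - y'| := by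
    rw [abs_mul, abs_of_nonneg (div_nonneg hx hs.le)]
    exact mul_le_of_le_one_right (abs_nonneg _) ((div_le_one hs).2 hxs)
  have h2 : |(x - x') * (y' / s')| ≤ |x - x'| := by
    rw [abs_mul, abs_of_nonneg (div_nonneg hy' hs'.le)]
    exact mul_le_of_le_one_right (abs_nonneg _) ((div_le_one hs').2 hys)
  have h3 : |x * y' / (s * s') * (s' - s)| = x * y' / (s * s') * |s - s'| := by
    rw [abs_mul, abs_of_nonneg (by positivity), abs_sub_comm]
  calc _ ≤ |(y - y') * (x / s)| + |(x - x') * (y' / s')| + |x * y' / (s * s') * (s' - s)| :=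
        abs_add_three _ _ _
    _ ≤ _ := by rw [h3]; linarith

/-- The normalized determinant is homogeneous of degree one, so Lipschitz continuity holds
uniformly, however small the table. An empty table is treated apart, by `covTerm_le_sum`. -/
theorem abs_covTerm_sub_le {a b : ℕ → ℝ} (ha : ∀ c, 0 ≤ a c) (hb : ∀ c, 0 ≤ b c) :
    |covTerm a - covTerm b| ≤ 2 * ∑ c ∈ Finset.range 4, |a c - b c| := by
  have ha0 := ha 0
  have ha1 := ha 1
  have ha2 := ha 2
  have ha3 := ha 3
  have hb0 := hb 0
  have hb1 := hb 1
  have hb2 := hb 2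
  have hb3 := hb 3
  set L := ∑ c ∈ Finset.range 4, |a c - b c| with hL
  have hL' : L = |a 0 - b 0| + |a 1 - b 1| + |a 2 - b 2| + |a 3 - b 3| := by
    simp [hL, Finset.sum_range_succ]
  have hL0 : 0 ≤ L := by rw [hL']; positivity
  have hdiff : |(a 0 + a 1 + a 2 + a 3) - (b 0 + b 1 + b 2 + b 3)| ≤ L := by
    rw [hL', abs_le]
    constructor <;> linarith [neg_abs_le (a 0 - b 0), neg_abs_le (a 1 - b 1),
      neg_abs_le (a 2 - b 2), neg_abs_le (a 3 - b 3), le_abs_self (a 0 - b 0),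
      le_abs_self (a 1 - b 1), le_abs_self (a 2 - b 2), le_abs_self (a 3 - b 3)]
  have hA := covTerm_le_sum ha
  have hB := covTerm_le_sum hb
  have hA0 := covTerm_nonneg ha
  have hB0 := covTerm_nonneg hb
  have hd := abs_le.1 hdiff
  rcases (show 0 ≤ a 0 + a 1 + a 2 + a 3 by linarith).eq_or_lt with hs | hs
  · rw [abs_le]; constructor <;> linarith
  rcases (show 0 ≤ b 0 + b 1 + b 2 + b 3 by linarith).eq_or_lt with hs' | hs'
  · rw [abs_le]; constructor <;> linarith
  set s := a 0 + a 1 + a 2 + a 3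
  set s' := b 0 + b 1 + b 2 + b 3
  have hc : ∀ c : ℕ → ℝ, 0 < c 0 + c 1 + c 2 + c 3 → covTerm c =
      |c 3 * c 0 / (c 0 + c 1 + c 2 + c 3) - c 1 * c 2 / (c 0 + c 1 + c 2 + c 3)| := by
    intro c hc
    rw [← sub_div, abs_div, abs_of_pos hc, covTerm]
  rw [hc a hs, hc b hs']
  refine (abs_abs_sub_abs_le_abs_sub _ _).trans ?_
  have h1 := abs_div_sub_div_le (x := a 3) (y := a 0) (x' := b 3) (y' := b 0) ha3 hb0 hs hs'
    (by simp only [s]; linarith) (by simp only [s']; linarith)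
  have h2 := abs_div_sub_div_le (x := a 1) (y := a 2) (x' := b 1) (y' := b 2) ha1 hb2 hs hs'
    (by simp only [s]; linarith) (by simp only [s']; linarith)
  have h3 : a 3 * b 0 / (s * s') + a 1 * b 2 / (s * s') ≤ 1 := by
    rw [← add_div, div_le_one (mul_pos hs hs')]
    simp only [s, s']
    nlinarith [mul_nonneg ha0 hb0, mul_nonneg ha0 hb1, mul_nonneg ha0 hb2, mul_nonneg ha0 hb3,
      mul_nonneg ha1 hb0, mul_nonneg ha1 hb1, mul_nonneg ha1 hb3, mul_nonneg ha2 hb0,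
      mul_nonneg ha2 hb1, mul_nonneg ha2 hb2, mul_nonneg ha2 hb3, mul_nonneg ha3 hb1,
      mul_nonneg ha3 hb2, mul_nonneg ha3 hb3]
  have h4 : (a 3 * b 0 / (s * s') + a 1 * b 2 / (s * s')) * |s - s'| ≤ L :=
    (mul_le_of_le_one_left (abs_nonneg _) h3).trans hdiff
  have h5 : a 3 * a 0 / s - a 1 * a 2 / s - (b 3 * b 0 / s' - b 1 * b 2 / s') =
    (a 3 * a 0 / s - b 3 * b 0 / s') - (a 1 * a 2 / s - b 1 * b 2 / s') := by ring
  rw [h5]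
  refine (abs_sub _ _).trans ?_
  rw [add_mul] at h4
  rw [hL'] at h4 ⊢
  linarith

end Covariance

/-! ### Covariance statistic and distance from conditional independence. -/

section Cells

variable {n : ℕ}

/-- The index `2 x_i + x_j`. -/
def pairIndex (i j : Fin n) (x : Fin n → Bool) : ℕ := (x i).toNat + (x i).toNat + (x j).toNat

/-- The weight of the points with `key x = k` and `2 x_i + x_j = c`. -/
noncomputable def cellWeight (F : (Fin n → Bool) → ℝ) (key : (Fin n → Bool) → ℕ) (i j : Fin n)
    (k c : ℕ) : ℝ := ∑ x, if key x = k ∧ pairIndex i j x = c then F x else 0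

theorem cellWeight_nonneg {F : (Fin n → Bool) → ℝ} (hF : ∀ y, 0 ≤ F y)
    (key : (Fin n → Bool) → ℕ) (i j : Fin n) (k c : ℕ) : 0 ≤ cellWeight F key i j k c :=
  Finset.sum_nonneg fun y _ => by split_ifs <;> [exact hF y; exact le_rfl]

/-- The point `y` with the values of `X_i`, `X_j` replaced. -/
def setPair (i j : Fin n) (y : Fin n → Bool) (v w : Bool) : Fin n → Bool :=
  Function.update (Function.update y i v) j w

variable {F : (Fin n → Bool) → ℝ} {key : (Fin n → Bool) → ℕ} {i j : Fin n}
  {A : Finset (Fin n)}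

/-- The key is any function that separates exactly the configurations on `A`; thus cells are the
same as marginals on `A` together with the two nodes. -/
theorem cellWeight_key (hij : i ≠ j) (hi : i ∉ A) (hj : j ∉ A)
    (hkey : ∀ x y, key x = key y ↔ ∀ l ∈ A, x l = y l) (y : Fin n → Bool) (v w : Bool) :
    cellWeight F key i j (key y) (v.toNat + v.toNat + w.toNat) =
      marg F (insert i (insert j A)) (setPair i j y v w) := by
  unfold cellWeight marg
  refine Finset.sum_congr rfl fun x _ => ?_
  have h : (key x = key y ∧ pairIndex i j x = v.toNat + v.toNat + w.toNat) ↔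
      ∀ l ∈ insert i (insert j A), x l = setPair i j y v w l := by
    rw [hkey, Finset.forall_mem_insert, Finset.forall_mem_insert]
    have h1 : setPair i j y v w i = v := by simp [setPair, hij]
    have h2 : setPair i j y v w j = w := by simp [setPair]
    have h3 : (∀ l ∈ A, x l = setPair i j y v w l) ↔ ∀ l ∈ A, x l = y l :=
      forall₂_congr fun l hl => by
        rw [setPair, Function.update_of_ne (ne_of_mem_of_not_mem hl hj),
          Function.update_of_ne (ne_of_mem_of_not_mem hl hi)]
    rw [h1, h2, h3, pairIndex]
    generalize x i = p
    generalize x j = q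
    cases p <;> cases q <;> cases v <;> cases w <;> simp
  simp only [h]

theorem marg_pair (hij : i ≠ j) (hi : i ∉ A) (hj : j ∉ A) (y : Fin n → Bool) (v w : Bool) :
    marg F (insert i A) (setPair i j y v w) =
        marg F (insert i (insert j A)) (setPair i j y v true) +
          marg F (insert i (insert j A)) (setPair i j y v false) ∧
      marg F (insert j A) (setPair i j y v w) =
        marg F (insert i (insert j A)) (setPair i j y true w) +
          marg F (insert i (insert j A)) (setPair i j y false w) ∧
      marg F A (setPair i j y v w) =
        marg F (insert i (insert j A)) (setPair i j y true true) +
          marg F (insert i (insert j A)) (setPair i j y true false) +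
          (marg F (insert i (insert j A)) (setPair i j y false true) +
          marg F (insert i (insert j A)) (setPair i j y false false)) := by
  have e1 : ∀ v w u, Function.update (setPair i j y v w) j u = setPair i j y v u :=
    fun v w u => by simp [setPair]
  have e2 : ∀ v w u, Function.update (setPair i j y v w) i u = setPair i j y u w :=
    fun v w u => by
      rw [setPair, Function.update_comm hij.symm, Function.update_idem, setPair]
  have h1 : ∀ v w, marg F (insert i A) (setPair i j y v w) =
        marg F (insert i (insert j A)) (setPair i j y v true) +
          marg F (insert i (insert j A)) (setPair i j y v false) := fun v w => by
    rw [marg_insert_update (i := j) (by simp [hij.symm, hj]), e1, e1, Finset.insert_comm]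
  refine ⟨h1 v w, ?_, ?_⟩
  · rw [marg_insert_update (i := i) (by simp [hij, hi]), e2, e2]
  · rw [marg_insert_update hi, e2, e2, h1, h1]

/-- The covariance statistic of a distribution. -/
noncomputable def covStat (F : (Fin n → Bool) → ℝ) (key : (Fin n → Bool) → ℕ) (i j : Fin n)
    (K : ℕ) : ℝ := ∑ k ∈ Finset.range K, covTerm (cellWeight F key i j k)

theorem covStat_eq_zero {P : Measure (Fin n → Bool)} [IsProbabilityMeasure P] (hij : i ≠ j)
    (hi : i ∉ A) (hj : j ∉ A) (hkey : ∀ x y, key x = key y ↔ ∀ l ∈ A, x l = y l)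
    (h : CondIndepGiven P i j (A : Set (Fin n))) (K : ℕ) :
    covStat (mass P) key i j K = 0 := by
  rw [condIndepGiven_iff hij hi hj] at h
  refine Finset.sum_eq_zero fun k _ => ?_
  by_cases hk : ∃ y, key y = k
  · obtain ⟨y, rfl⟩ := hk
    have hc := cellWeight_key (F := mass P) hij hi hj hkey y
    obtain ⟨h1, h2, h3⟩ := marg_pair (F := mass P) hij hi hj y true true
    have h4 := h (setPair i j y true true)
    rw [h1, h2, h3] at h4
    have c0 : cellWeight (mass P) key i j (key y) 0 = _ := hc false false
    have c1 : cellWeight (mass P) key i j (key y) 1 = _ := hc false true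
    have c2 : cellWeight (mass P) key i j (key y) 2 = _ := hc true false
    have c3 : cellWeight (mass P) key i j (key y) 3 = _ := hc true true
    rw [covTerm, c0, c1, c2, c3]
    have h5 : marg (mass P) (insert i (insert j A)) (setPair i j y true true) *
        marg (mass P) (insert i (insert j A)) (setPair i j y false false) -
        marg (mass P) (insert i (insert j A)) (setPair i j y false true) *
        marg (mass P) (insert i (insert j A)) (setPair i j y true false) = 0 := by
      linarith
    rw [h5, abs_zero, zero_div]
  · have h0 : ∀ c, cellWeight (mass P) key i j k c = 0 := fun c =>
      Finset.sum_eq_zero fun x _ => if_neg fun hx => hk ⟨x, hx.1⟩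
    simp [covTerm, h0]

theorem exists_measure_mass {F : (Fin n → Bool) → ℝ} (hF : ∀ y, 0 ≤ F y) (hF1 : ∑ y, F y = 1) :
    ∃ P : Measure (Fin n → Bool), IsProbabilityMeasure P ∧ mass P = F := by
  let P : Measure (Fin n → Bool) := ∑ x, ENNReal.ofReal (F x) • Measure.dirac x
  refine ⟨P, ⟨?_⟩, ?_⟩
  · simp only [P, Measure.coe_finsetSum, Finset.sum_apply, Measure.smul_apply,
      Measure.dirac_apply_of_mem (Set.mem_univ _), smul_eq_mul, mul_one]
    rw [← ENNReal.ofReal_sum_of_nonneg fun x _ => hF x, hF1, ENNReal.ofReal_one]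
  · funext x
    simp only [mass, measureReal_def, P, Measure.coe_finsetSum, Finset.sum_apply,
      Measure.smul_apply, smul_eq_mul]
    rw [Finset.sum_eq_single x]
    · simp [hF x]
    · intro y _ hy
      simp [hy]
    · simp

theorem marg_mul_of_const {g κ : (Fin n → Bool) → ℝ} {B : Finset (Fin n)}
    (hg : ∀ x y, (∀ l ∈ B, x l = y l) → g x = g y) (x : Fin n → Bool) :
    marg (fun y => g y * κ y) B x = g x * marg κ B x := by
  unfold marg
  rw [Finset.mul_sum]
  refine Finset.sum_congr rfl fun y _ => ?_
  split_ifs with h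
  · show g y * κ y = _
    rw [hg y x h]
  · rw [mul_zero]

/-- Every function has a conditional version given the values on `B`. -/
theorem exists_conditional {p : (Fin n → Bool) → ℝ} (hp : ∀ y, 0 ≤ p y) (B : Finset (Fin n)) :
    ∃ κ : (Fin n → Bool) → ℝ, (∀ x, 0 ≤ κ x) ∧ (∀ x, marg κ B x = 1) ∧
      ∀ x, p x = marg p B x * κ x := by
  -- Where the marginal vanishes, the conditional law is taken to be the point mass at the extension
  -- by `false`, so that `κ` is normalized everywhere.
  let κ : (Fin n → Bool) → ℝ := fun x => if marg p B x = 0 then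
    (if ∀ l, l ∉ B → x l = false then 1 else 0) else p x / marg p B x
  refine ⟨κ, fun x => ?_, fun x => ?_, fun x => ?_⟩
  · simp only [κ]
    split_ifs
    · exact zero_le_one
    · exact le_rfl
    · exact div_nonneg (hp x) (marg_nonneg hp _ _)
  · by_cases h0 : marg p B x = 0
    · unfold marg
      rw [Finset.sum_eq_single (fun l => if l ∈ B then x l else false)]
      · have h1 : ∀ l ∈ B, (fun l => if l ∈ B then x l else false) l = x l := fun l hl => by
          simp [hl]
        rw [if_pos h1]
        simp only [κ]
        rw [if_pos (by rw [marg_congr h1]; exact h0), if_pos fun l hl => by simp [hl]]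
      · intro y _ hy
        split_ifs with h
        · simp only [κ]
          rw [if_pos (by rw [marg_congr h]; exact h0), if_neg]
          refine fun h' => hy (funext fun l => ?_)
          split_ifs with hl
          · exact h l hl
          · exact h' l hl
        · rfl
      · simp
    · have h1 : marg κ B x = marg (fun y => (marg p B y)⁻¹ * p y) B x := by
        unfold marg
        refine Finset.sum_congr rfl fun y _ => ?_
        split_ifs with h
        · have h2 := marg_congr (F := p) h
          simp only [κ]
          rw [if_neg (by rw [h2]; exact h0), div_eq_inv_mul, marg]
        · rfl
      rw [h1, marg_mul_of_const (g := fun y => (marg p B y)⁻¹)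
        (fun y z h => by rw [marg_congr h]), inv_mul_cancel₀ h0]
  · simp only [κ]
    split_ifs with h0 h1
    · rw [h0, zero_mul]
      exact le_antisymm (h0 ▸ le_marg hp B x) (hp x)
    · rw [h0, zero_mul]
      exact le_antisymm (h0 ▸ le_marg hp B x) (hp x)
    · field_simp

/-- Replace the joint law of `(X_i, X_j)` given `X_A` by the product of its marginals, and keep the
law of `X_A` and the conditional law `κ` of all other nodes. The result `R` makes `X_i`, `X_j`
conditionally independent. In each table all four cells move by the same amount, the normalized
determinant, so the `L¹` distance is at most four times the statistic; it is at least `2 γ` by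
hypothesis. -/
theorem two_mul_le_covStat {P : Measure (Fin n → Bool)} [IsProbabilityMeasure P] {γ : ℝ}
    (hij : i ≠ j) (hi : i ∉ A) (hj : j ∉ A) (hkey : ∀ x y, key x = key y ↔ ∀ l ∈ A, x l = y l)
    {K : ℕ} (hK : ∀ x, key x < K) (h : FarFromCondIndep P γ i j (A : Set (Fin n))) :
    2 * γ ≤ 4 * covStat (mass P) key i j K := by
  set p := mass P with hp
  have hp0 : ∀ y, 0 ≤ p y := mass_nonneg P
  set B := insert i (insert j A) with hB
  obtain ⟨κ, hκ0, hκ1, hκ⟩ := exists_conditional hp0 B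
  have hiB : insert i A ⊆ B := Finset.insert_subset_insert _ (Finset.subset_insert _ _)
  have hjB : insert j A ⊆ B := Finset.subset_insert _ _
  have hAB : A ⊆ B := (Finset.subset_insert _ _).trans hiB
  let r : (Fin n → Bool) → ℝ := fun x => marg p (insert i A) x * marg p (insert j A) x / marg p A x
  have hr : ∀ x y, (∀ l ∈ B, x l = y l) → r x = r y := fun x y hxy => by
    simp only [r]
    rw [marg_congr fun l hl => hxy l (hiB hl), marg_congr fun l hl => hxy l (hjB hl),
      marg_congr fun l hl => hxy l (hAB hl)]
  let R : (Fin n → Bool) → ℝ := fun x => r x * κ x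
  have hR0 : ∀ x, 0 ≤ R x := fun x => mul_nonneg (div_nonneg (mul_nonneg (marg_nonneg hp0 _ _)
    (marg_nonneg hp0 _ _)) (marg_nonneg hp0 _ _)) (hκ0 x)
  have hRB : ∀ x, marg R B x = r x := fun x => by
    rw [marg_mul_of_const hr, hκ1, mul_one]
  -- the marginals on `X_A` together with one of the nodes are unchanged
  have hpair : ∀ y : Fin n → Bool, setPair i j y (y i) (y j) = y := fun y => by
    simp [setPair]
  have hsetA : ∀ (G : (Fin n → Bool) → ℝ) y v w, marg G A (setPair i j y v w) = marg G A y :=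
    fun G y v w => marg_congr fun l hl => by
      rw [setPair, Function.update_of_ne (ne_of_mem_of_not_mem hl hj),
        Function.update_of_ne (ne_of_mem_of_not_mem hl hi)]
  have hseti : ∀ (G : (Fin n → Bool) → ℝ) y v w w', marg G (insert i A) (setPair i j y v w) =
      marg G (insert i A) (setPair i j y v w') := fun G y v w w' => by
    rw [(marg_pair hij hi hj y v w).1, (marg_pair hij hi hj y v w').1]
  have hsetj : ∀ (G : (Fin n → Bool) → ℝ) y v v' w, marg G (insert j A) (setPair i j y v w) =
      marg G (insert j A) (setPair i j y v' w) := fun G y v v' w => by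
    rw [(marg_pair hij hi hj y v w).2.1, (marg_pair hij hi hj y v' w).2.1]
  have hsumi : ∀ y w, marg p (insert i A) (setPair i j y true w) +
      marg p (insert i A) (setPair i j y false w) = marg p A y := fun y w => by
    rw [(marg_pair hij hi hj y true w).1, (marg_pair hij hi hj y false w).1,
      ← (marg_pair hij hi hj y true w).2.2, hsetA]
  have hsumj : ∀ y v, marg p (insert j A) (setPair i j y v true) +
      marg p (insert j A) (setPair i j y v false) = marg p A y := fun y v => by
    rw [(marg_pair hij hi hj y v true).2.1, (marg_pair hij hi hj y v false).2.1,
      ← hsetA p y v true, (marg_pair hij hi hj y v true).2.2]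
    ring
  have hle : ∀ C y, A ⊆ C → marg p A y = 0 → marg p C y = 0 := fun C y hC h0 =>
    le_antisymm (h0 ▸ marg_le_of_subset hp0 hC) (marg_nonneg hp0 _ _)
  have hRi : ∀ y, marg R (insert i A) y = marg p (insert i A) y := by
    intro y
    obtain ⟨h1, -, -⟩ := marg_pair (F := R) hij hi hj y (y i) (y j)
    rw [hpair, ← hB, hRB, hRB] at h1
    rw [h1]
    simp only [r]
    rw [hsetA, hsetA, hseti p y (y i) true (y j), hseti p y (y i) false (y j), hpair, ← add_div,
      ← mul_add, hsumj]
    by_cases h0 : marg p A y = 0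
    · rw [h0, hle _ _ (Finset.subset_insert _ _) h0]; simp
    · field_simp
  have hRj : ∀ y, marg R (insert j A) y = marg p (insert j A) y := by
    intro y
    obtain ⟨-, h1, -⟩ := marg_pair (F := R) hij hi hj y (y i) (y j)
    rw [hpair, ← hB, hRB, hRB] at h1
    rw [h1]
    simp only [r]
    rw [hsetA, hsetA, hsetj p y true (y i) (y j), hsetj p y false (y i) (y j), hpair, ← add_div,
      ← add_mul, hsumi]
    by_cases h0 : marg p A y = 0
    · rw [h0, hle _ _ (Finset.subset_insert _ _) h0]; simp
    · field_simp
  have hRA : ∀ y, marg R A y = marg p A y := fun y => by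
    rw [marg_insert_update hi, marg_insert_update hi, hRi, hRi]
  -- Equality of the marginals on `A` passes to subsets; the empty set gives the total mass of `R`.
  have hsub : ∀ (C : Finset (Fin n)), ∀ y, marg R (A \ C) y = marg p (A \ C) y := by
    intro C
    induction C using Finset.induction_on with
    | empty => simpa using hRA
    | insert l C _ ih =>
      intro y
      rw [Finset.sdiff_insert]
      by_cases hl : l ∈ A \ C
      · have h1 : l ∉ (A \ C).erase l := Finset.notMem_erase _ _
        rw [marg_insert_update h1, marg_insert_update h1, Finset.insert_erase hl, ih, ih]
      · rw [Finset.erase_eq_of_notMem hl]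
        exact ih y
  have hR1 : ∑ y, R y = 1 := by
    have h1 := hsub A (fun _ => false)
    rw [Finset.sdiff_self, marg_empty, marg_empty, sum_mass] at h1
    exact h1
  obtain ⟨Q, hQ, hQR⟩ := exists_measure_mass hR0 hR1
  have hCI : CondIndepGiven Q i j (A : Set (Fin n)) := by
    rw [condIndepGiven_iff hij hi hj, hQR]
    intro x
    rw [← hB, hRB, hRA, hRi, hRj]
    simp only [r]
    by_cases h0 : marg p A x = 0
    · rw [h0, hle _ _ (Finset.subset_insert _ _) h0]; simp
    · field_simp
  have htv : γ ≤ tvDist P Q := by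
    by_contra hlt
    exact h Q hQ (lt_of_not_ge hlt) hCI
  have hl1 : l1Dist P Q ≤ 4 * covStat p key i j K := by
    have h1 : ∀ x, |P.real {x} - Q.real {x}| = |marg p B x - r x| * κ x := by
      intro x
      have h2 : Q.real {x} = R x := congrFun hQR x
      have h3 : P.real {x} = p x := rfl
      rw [h2, h3, hκ x, ← sub_mul, abs_mul, abs_of_nonneg (hκ0 x)]
    -- Expanding `marg p A` as the sum of the four cells, `p_B p_A - p_{iA} p_{jA}` equals the
    -- determinant up to sign, whichever cell contains `x`.
    have hcov : ∀ x, |marg p B x - r x| = covTerm (cellWeight p key i j (key x)) := by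
      intro x
      have hc := cellWeight_key (F := p) hij hi hj hkey x
      have c0 : cellWeight p key i j (key x) 0 = _ := hc false false
      have c1 : cellWeight p key i j (key x) 1 = _ := hc false true
      have c2 : cellWeight p key i j (key x) 2 = _ := hc true false
      have c3 : cellWeight p key i j (key x) 3 = _ := hc true true
      obtain ⟨m1, m2, m3⟩ := marg_pair (F := p) hij hi hj x (x i) (x j)
      have hsum : cellWeight p key i j (key x) 0 + cellWeight p key i j (key x) 1 +
          cellWeight p key i j (key x) 2 + cellWeight p key i j (key x) 3 = marg p A x := by
        rw [hpair] at m3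
        rw [m3, c0, c1, c2, c3]
        ring
      have hx := hpair x
      have hBx : marg p B x = marg p B (setPair i j x (x i) (x j)) := by rw [hx]
      rw [hx] at m1 m2 m3
      rw [covTerm, hsum]
      simp only [r]
      by_cases h0 : marg p A x = 0
      · rw [h0, hle _ _ hAB h0]; simp
      · rw [eq_div_iff h0, ← abs_of_nonneg (marg_nonneg hp0 A x), ← abs_mul,
          abs_of_nonneg (marg_nonneg hp0 A x), sub_mul, div_mul_cancel₀ _ h0, c0, c1, c2, c3,
          m3, m1, m2, hBx]
        cases x i <;> cases x j
        · congr 1; ring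
        · rw [← abs_neg]; congr 1; ring
        · rw [← abs_neg]; congr 1; ring
        · congr 1; ring
    -- `κ` has mass one on each of the four cells over a configuration of `A`; this is the factor 4
    -- of the bound.
    have hκA : ∀ y, marg κ A y = 4 := by
      intro y
      have h4 := (marg_pair (F := κ) hij hi hj y true true).2.2
      rw [hsetA, ← hB, hκ1, hκ1, hκ1, hκ1] at h4
      rw [h4]; norm_num
    have h2 : l1Dist P Q = ∑ k ∈ Finset.range K, ∑ x, if key x = k then
        covTerm (cellWeight p key i j k) * κ x else 0 := by
      rw [l1Dist, Finset.sum_comm]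
      refine Finset.sum_congr rfl fun x _ => ?_
      rw [h1, hcov, Finset.sum_ite_eq, if_pos (Finset.mem_range.2 (hK x))]
    rw [h2, covStat, Finset.mul_sum]
    refine Finset.sum_le_sum fun k _ => ?_
    by_cases hk : ∃ y, key y = k
    · obtain ⟨y, rfl⟩ := hk
      have h3 := hκA y
      unfold marg at h3
      rw [← h3, Finset.sum_mul]
      refine Finset.sum_le_sum fun x _ => ?_
      simp only [hkey x y]
      split_ifs
      · rw [mul_comm]
      · rw [zero_mul]
    · rw [Finset.sum_eq_zero fun x _ => if_neg fun hx => hk ⟨x, hx⟩]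
      exact mul_nonneg (by norm_num) (covTerm_nonneg (cellWeight_nonneg hp0 _ _ _ _))
  rw [tvDist] at htv
  linarith

end Cells

/-! ### Independent samples -/

/-- The expectation of `g` under `P`, as a finite sum. -/
noncomputable def avg {n : ℕ} (P : Measure (Fin n → Bool)) (g : (Fin n → Bool) → ℝ) : ℝ :=
  ∑ x, mass P x * g x

/-- The random variables `Y 0, Y 1, …` are independent and have law `P`. -/
structure IsSampling {n : ℕ} {Ω : Type*} [MeasurableSpace Ω] (P : Measure (Fin n → Bool))
    (μ : Measure Ω) (Y : ℕ → Ω → Fin n → Bool) : Prop where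
  measurable : ∀ s, Measurable (Y s)
  indep : iIndepFun Y μ
  law : ∀ s, μ.map (Y s) = P

theorem isSampling_tapeLaw {n : ℕ} (P : Measure (Fin n → Bool)) [IsProbabilityMeasure P] :
    IsSampling P (tapeLaw P) (fun s ω => (ω s).1) where
  measurable s := measurable_fst.comp (measurable_pi_apply s)
  indep := iIndepFun_infinitePi (X := fun _ (z : (Fin n → Bool) × Bool) => z.1)
    fun _ => measurable_fst
  law s := by
    have h : (fun ω : Tape n => (ω s).1) = Prod.fst ∘ fun ω : Tape n => ω s := rfl
    rw [h, ← Measure.map_map measurable_fst (measurable_pi_apply s), tapeLaw,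
      Measure.infinitePi_map_eval, Measure.map_fst_prod, measure_univ, one_smul]

instance isProbabilityMeasure_tapeLaw {n : ℕ} (P : Measure (Fin n → Bool))
    [IsProbabilityMeasure P] : IsProbabilityMeasure (tapeLaw P) := by
  unfold tapeLaw; infer_instance

theorem integrable_comp_of_finite {Ω α : Type*} [MeasurableSpace Ω] {μ : Measure Ω}
    [IsFiniteMeasure μ] [Finite α] [MeasurableSpace α] [MeasurableSingletonClass α] {V : Ω → α}
    (hV : Measurable V) (H : α → ℝ) : Integrable (fun ω => H (V ω)) μ :=
  (Integrable.of_finite (μ := μ.map V) (f := H)).comp_measurable hV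

/-- Conditioning on a variable with finitely many values, done by a union over these values. No
measurability of the event in `Ω` has to be verified. -/
theorem measureReal_le_of_indepFun {Ω α β : Type*} [MeasurableSpace Ω] {μ : Measure Ω}
    [IsProbabilityMeasure μ] [Fintype α] [MeasurableSpace α] [MeasurableSingletonClass α]
    [Finite β] [MeasurableSpace β] [MeasurableSingletonClass β] {V : Ω → α} {W : Ω → β}
    (hV : Measurable V) (h : IndepFun V W μ) {F : α → β → Prop} {δ : ℝ}
    (hF : ∀ a, μ.real {ω | F a (W ω)} ≤ δ) : μ.real {ω | F (V ω) (W ω)} ≤ δ := by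
  classical
  have h1 : {ω | F (V ω) (W ω)} ⊆ ⋃ a ∈ (Finset.univ : Finset α), (V ⁻¹' {a} ∩ W ⁻¹' {b | F a b}) := by
    intro ω hω
    simp only [Finset.mem_univ, Set.iUnion_true, Set.mem_iUnion]
    exact ⟨V ω, rfl, hω⟩
  have h2 : ∀ a, μ.real (V ⁻¹' {a} ∩ W ⁻¹' {b | F a b}) ≤ μ.real (V ⁻¹' {a}) * δ := by
    intro a
    have h3 := h.measure_inter_preimage_eq_mul {a} {b | F a b} (measurableSet_singleton a)
      (Set.toFinite _).measurableSet
    rw [Measure.real, h3, ENNReal.toReal_mul]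
    exact mul_le_mul_of_nonneg_left (hF a) ENNReal.toReal_nonneg
  have h4 : ∑ a, μ.real (V ⁻¹' {a}) = 1 := by
    have h5 := sum_measureReal_preimage_singleton (μ := μ) (f := V) Finset.univ
      (fun y _ => hV (measurableSet_singleton y))
    rw [h5]; simp
  calc μ.real {ω | F (V ω) (W ω)}
      ≤ μ.real (⋃ a ∈ (Finset.univ : Finset α), (V ⁻¹' {a} ∩ W ⁻¹' {b | F a b})) :=
        measureReal_mono h1 (measure_ne_top _ _)
    _ ≤ ∑ a, μ.real (V ⁻¹' {a} ∩ W ⁻¹' {b | F a b}) := measureReal_biUnion_finset_le _ _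
    _ ≤ ∑ a, μ.real (V ⁻¹' {a}) * δ := Finset.sum_le_sum fun a _ => h2 a
    _ = δ := by rw [← Finset.sum_mul, h4, one_mul]

theorem sum_eq_sum_coe {T U : Finset ℕ} (h : T ⊆ U) (F : ℕ → ℝ) :
    ∑ s ∈ T, F s = ∑ s : U, if (s : ℕ) ∈ T then F s else 0 := by
  rw [Finset.sum_coe_sort U (fun s => if s ∈ T then F s else 0), ← Finset.sum_filter]
  refine Finset.sum_congr ?_ fun _ _ => rfl
  ext s
  simp only [Finset.mem_filter]
  exact ⟨fun hs => ⟨h hs, hs⟩, fun hs => hs.2⟩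

/-! ### Moments and tail bounds for independent samples. -/

namespace IsSampling

variable {n : ℕ} {Ω : Type*} [MeasurableSpace Ω] {P : Measure (Fin n → Bool)}
  {μ : Measure Ω} [IsProbabilityMeasure μ] {Y : ℕ → Ω → Fin n → Bool}

theorem isProbabilityMeasure (h : IsSampling P μ Y) : IsProbabilityMeasure P := by
  rw [← h.law 0]; exact Measure.isProbabilityMeasure_map (h.measurable 0).aemeasurable

theorem integrable (h : IsSampling P μ Y) (g : (Fin n → Bool) → ℝ) (s : ℕ) :
    Integrable (fun ω => g (Y s ω)) μ := integrable_comp_of_finite (h.measurable s) g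

theorem integral_eq (h : IsSampling P μ Y) (g : (Fin n → Bool) → ℝ) (s : ℕ) :
    ∫ ω, g (Y s ω) ∂μ = avg P g := by
  have := h.isProbabilityMeasure
  rw [← integral_map (h.measurable s).aemeasurable
    (measurable_of_finite g).aestronglyMeasurable, h.law s, integral_fintype Integrable.of_finite]
  simp [avg, mass]

omit [IsProbabilityMeasure μ] in
theorem indep_comp (h : IsSampling P μ Y) (g : (Fin n → Bool) → ℝ) :
    iIndepFun (fun s ω => g (Y s ω)) μ :=
  h.indep.comp (fun _ => g) fun _ => measurable_of_finite g

omit [IsProbabilityMeasure μ] in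
theorem measurable_comp (h : IsSampling P μ Y) (g : (Fin n → Bool) → ℝ) (s : ℕ) :
    Measurable fun ω => g (Y s ω) := (measurable_of_finite g).comp (h.measurable s)

/-- Hoeffding's inequality. -/
theorem hoeffding (h : IsSampling P μ Y) {g : (Fin n → Bool) → ℝ}
    (hg : ∀ x, g x ∈ Set.Icc (0 : ℝ) 1) (T : Finset ℕ) {η : ℝ} (hη : 0 ≤ η) :
    μ.real {ω | η * T.card ≤ ∑ s ∈ T, (g (Y s ω) - avg P g)} ≤
      Real.exp (-2 * η ^ 2 * T.card) := by
  rcases T.eq_empty_or_nonempty with rfl | hT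
  · simp
  have h1 := HasSubgaussianMGF.measure_sum_ge_le_of_iIndepFun (μ := μ)
    (X := fun s ω => g (Y s ω) - avg P g) (h.indep_comp fun x => g x - avg P g)
    (c := fun _ => (‖(1 : ℝ) - 0‖₊ / 2) ^ 2) (s := T) (ε := η * T.card) ?_ (by positivity)
  · refine h1.trans (le_of_eq ?_)
    have hT' : (0 : ℝ) < T.card := by exact_mod_cast hT.card_pos
    congr 1
    simp
    field_simp
  · intro s _
    have h2 := hasSubgaussianMGF_of_mem_Icc (μ := μ) (X := fun ω => g (Y s ω)) (a := 0) (b := 1)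
      (h.measurable_comp g s).aemeasurable (Filter.Eventually.of_forall fun ω => hg _)
    rwa [h.integral_eq] at h2

/-- Concentration of an empirical distribution in `L¹`. -/
theorem l1_concentration (h : IsSampling P μ Y) {ζ : Type*} [DecidableEq ζ]
    (κ : (Fin n → Bool) → ζ) (Z : Finset ζ)
    (hZ : ∀ x, κ x ∈ Z) (m : ℕ) {η : ℝ} (hη : 0 < η) :
    μ.real {ω | 2 * η * m ≤ ∑ z ∈ Z, |(∑ s ∈ Finset.range m, if κ (Y s ω) = z then (1 : ℝ) else 0)
      - m * avg P (fun x => if κ x = z then 1 else 0)|} ≤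
      2 ^ Z.card * Real.exp (-2 * η ^ 2 * m) := by
  have hP := h.isProbabilityMeasure
  set a : ζ → Ω → ℝ := fun z ω => (∑ s ∈ Finset.range m, if κ (Y s ω) = z then (1 : ℝ) else 0)
      - m * avg P (fun x => if κ x = z then 1 else 0) with ha
  -- For one set `B` of cells the sum of the deviations is that of the count of `κ ∈ B`, to which
  -- Hoeffding's inequality applies.
  have key : ∀ B : Finset ζ, μ.real {ω | η * m ≤ ∑ z ∈ B, a z ω} ≤
      Real.exp (-2 * η ^ 2 * m) := by
    intro B
    have h1 := h.hoeffding (g := fun x => if κ x ∈ B then 1 else 0)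
      (fun x => by by_cases hx : κ x ∈ B <;> simp [hx]) (Finset.range m) hη.le
    rw [Finset.card_range] at h1
    refine le_trans (le_of_eq ?_) h1
    congr 1
    ext ω
    simp only [Set.mem_ofPred_eq]
    have h2 : ∀ x, (if κ x ∈ B then (1 : ℝ) else 0) = ∑ z ∈ B, if κ x = z then (1 : ℝ) else 0 := by
      intro x; simp [Finset.sum_ite_eq]
    have h3 : avg P (fun x => if κ x ∈ B then (1 : ℝ) else 0) =
        ∑ z ∈ B, avg P (fun x => if κ x = z then (1 : ℝ) else 0) := by
      unfold avg
      rw [Finset.sum_comm]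
      refine Finset.sum_congr rfl fun x _ => ?_
      simp only [h2, Finset.mul_sum]
    have h4 : ∑ z ∈ B, a z ω = ∑ s ∈ Finset.range m, ((if κ (Y s ω) ∈ B then (1 : ℝ) else 0) -
        avg P (fun x => if κ x ∈ B then (1 : ℝ) else 0)) := by
      simp only [ha]
      rw [Finset.sum_sub_distrib, Finset.sum_sub_distrib, Finset.sum_const, Finset.card_range, nsmul_eq_mul, h3,
        Finset.sum_congr rfl fun s _ => h2 (Y s ω), Finset.sum_comm, Finset.mul_sum]
    rw [h4]
  have hsum : ∀ ω, ∑ z ∈ Z, a z ω = 0 := by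
    intro ω
    simp only [ha, Finset.sum_sub_distrib, ← Finset.mul_sum]
    rw [Finset.sum_comm]
    have h5 : ∀ x, ∑ z ∈ Z, (if κ x = z then (1 : ℝ) else 0) = 1 := by
      intro x; simp [Finset.sum_ite_eq, hZ x]
    simp only [h5]
    have h6 : ∑ z ∈ Z, avg P (fun x => if κ x = z then (1 : ℝ) else 0) = 1 := by
      unfold avg
      rw [Finset.sum_comm]
      simp only [← Finset.mul_sum, h5, mul_one]
      exact sum_mass P
    rw [h6]; simp
  have hsub : {ω | 2 * η * m ≤ ∑ z ∈ Z, |a z ω|} ⊆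
      ⋃ B ∈ Z.powerset, {ω | η * m ≤ ∑ z ∈ B, a z ω} := by
    intro ω hω
    simp only [Set.mem_ofPred_eq] at hω
    simp only [Set.mem_iUnion, Set.mem_ofPred_eq, Finset.mem_powerset]
    refine ⟨Z.filter (fun z => 0 ≤ a z ω), Finset.filter_subset _ _, ?_⟩
    -- The deviations sum to zero, so their `L¹` norm is twice the sum of the non-negative ones.
    -- That sum is one of the `2 ^ |Z|` sums controlled above.
    have h7 : ∑ z ∈ Z, |a z ω| = 2 * ∑ z ∈ Z.filter (fun z => 0 ≤ a z ω), a z ω := by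
      have h8 := hsum ω
      suffices h9 : ∑ z ∈ Z, |a z ω| + ∑ z ∈ Z, a z ω =
          2 * ∑ z ∈ Z.filter (fun z => 0 ≤ a z ω), a z ω by linarith
      rw [Finset.sum_filter, Finset.mul_sum, ← Finset.sum_add_distrib]
      refine Finset.sum_congr rfl fun z _ => ?_
      by_cases hz : 0 ≤ a z ω
      · rw [if_pos hz, abs_of_nonneg hz]; ring
      · rw [if_neg hz, abs_of_neg (not_le.1 hz)]; ring
    linarith
  calc μ.real {ω | 2 * η * m ≤ ∑ z ∈ Z, |a z ω|}
      ≤ μ.real (⋃ B ∈ Z.powerset, {ω | η * m ≤ ∑ z ∈ B, a z ω}) :=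
        measureReal_mono hsub (measure_ne_top _ _)
    _ ≤ ∑ B ∈ Z.powerset, μ.real {ω | η * m ≤ ∑ z ∈ B, a z ω} :=
        measureReal_biUnion_finset_le _ _
    _ ≤ ∑ B ∈ Z.powerset, Real.exp (-2 * η ^ 2 * m) := Finset.sum_le_sum fun B _ => key B
    _ = 2 ^ Z.card * Real.exp (-2 * η ^ 2 * m) := by
        rw [Finset.sum_const, Finset.card_powerset, nsmul_eq_mul]; push_cast; rfl

/-- The moment generating function of the number of occurrences of an event. -/
theorem mgf_count_le (h : IsSampling P μ Y) (E : Set (Fin n → Bool)) [DecidablePred (· ∈ E)]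
    (T : Finset ℕ) (t : ℝ) :
    mgf (fun ω => ∑ s ∈ T, if Y s ω ∈ E then (1 : ℝ) else 0) μ t ≤
      Real.exp (T.card * avg P (fun x => if x ∈ E then 1 else 0) * (Real.exp t - 1)) := by
  have hP := h.isProbabilityMeasure
  set π := avg P (fun x => if x ∈ E then 1 else 0) with hπ
  have h0 : (fun ω => ∑ s ∈ T, if Y s ω ∈ E then (1 : ℝ) else 0) =
      ∑ s ∈ T, fun ω => if Y s ω ∈ E then (1 : ℝ) else 0 := by
    ext ω; simp
  have h1 := (h.indep_comp (fun x => if x ∈ E then (1 : ℝ) else 0)).mgf_sum (t := t)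
    (h.measurable_comp fun x => if x ∈ E then (1 : ℝ) else 0) T
  rw [h0, h1]
  have h2 : ∀ s, mgf (fun ω => if Y s ω ∈ E then (1 : ℝ) else 0) μ t = 1 + π * (Real.exp t - 1) := by
    intro s
    have h3 := h.integral_eq (fun x => Real.exp (t * if x ∈ E then (1 : ℝ) else 0)) s
    rw [mgf, h3, hπ]
    have h5 : avg P (fun x => Real.exp (t * if x ∈ E then (1 : ℝ) else 0)) = ∑ x, mass P x +
        avg P (fun x => if x ∈ E then 1 else 0) * (Real.exp t - 1) := by
      unfold avg
      rw [Finset.sum_mul, ← Finset.sum_add_distrib]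
      refine Finset.sum_congr rfl fun x _ => ?_
      by_cases hx : x ∈ E <;> simp [hx]; ring
    rw [h5, sum_mass]
  simp only [h2, Finset.prod_const]
  have h4 : 0 ≤ 1 + π * (Real.exp t - 1) := by
    rw [← h2 0]; exact mgf_nonneg
  calc (1 + π * (Real.exp t - 1)) ^ T.card ≤ (Real.exp (π * (Real.exp t - 1))) ^ T.card :=
        pow_le_pow_left₀ h4 (by linarith [Real.add_one_le_exp (π * (Real.exp t - 1))]) _
    _ = _ := by rw [← Real.exp_nat_mul]; congr 1; ring

theorem integrable_exp_count (h : IsSampling P μ Y) (E : Set (Fin n → Bool))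
    [DecidablePred (· ∈ E)] (T : Finset ℕ) (t : ℝ) :
    Integrable (fun ω => Real.exp (t * ∑ s ∈ T, if Y s ω ∈ E then (1 : ℝ) else 0)) μ := by
  have h1 := integrable_comp_of_finite (μ := μ) (V := fun ω (s : T) => Y s ω)
    (measurable_pi_lambda _ fun s => h.measurable s)
    (fun z => Real.exp (t * ∑ s, if z s ∈ E then (1 : ℝ) else 0))
  refine h1.congr (Filter.Eventually.of_forall fun ω => ?_)
  simp only
  rw [Finset.sum_coe_sort T (fun s => if Y s ω ∈ E then (1 : ℝ) else 0)]

/-- Chernoff's bound for the lower tail. -/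
theorem chernoff_lower (h : IsSampling P μ Y) (E : Set (Fin n → Bool)) [DecidablePred (· ∈ E)]
    (T : Finset ℕ) {u : ℝ} (hu : T.card * avg P (fun x => if x ∈ E then 1 else 0) = u)
    (hu0 : 0 ≤ u) :
    μ.real {ω | ∑ s ∈ T, (if Y s ω ∈ E then (1 : ℝ) else 0) ≤ u / 2} ≤ Real.exp (-u / 8) := by
  have h1 := measure_le_le_exp_mul_mgf (μ := μ) (u / 2) (by norm_num : (-1 : ℝ) ≤ 0)
    (h.integrable_exp_count E T (-1))
  have h2 := h.mgf_count_le E T (-1)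
  rw [hu] at h2
  refine h1.trans ((mul_le_mul_of_nonneg_left h2 (Real.exp_pos _).le).trans ?_)
  rw [← Real.exp_add, Real.exp_le_exp]
  -- At `t = -1` the exponent is `u (1 / 2 + 1 / e - 1)`, which is below `-u / 8`.
  have h3 : Real.exp (-1) < 0.3679 := by
    have := Real.exp_neg_one_lt_d9; linarith
  nlinarith

/-- Chernoff's bound for the upper tail. -/
theorem chernoff_upper (h : IsSampling P μ Y) (E : Set (Fin n → Bool)) [DecidablePred (· ∈ E)]
    (T : Finset ℕ) {u : ℝ} (hu : T.card * avg P (fun x => if x ∈ E then 1 else 0) = u)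
    (hu0 : 0 ≤ u) :
    μ.real {ω | 2 * u ≤ ∑ s ∈ T, (if Y s ω ∈ E then (1 : ℝ) else 0)} ≤ Real.exp (-u / 8) := by
  have h1 := measure_ge_le_exp_mul_mgf (μ := μ) (2 * u) (by norm_num : (0 : ℝ) ≤ 1)
    (h.integrable_exp_count E T 1)
  have h2 := h.mgf_count_le E T 1
  rw [hu] at h2
  refine h1.trans ((mul_le_mul_of_nonneg_left h2 (Real.exp_pos _).le).trans ?_)
  rw [← Real.exp_add, Real.exp_le_exp]
  -- At `t = 1` the exponent is `u (e - 1 - 2)`, which is below `-u / 8`.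
  have h3 : Real.exp 1 < 2.7183 := by
    have := Real.exp_one_lt_d9; linarith
  nlinarith

/-- Markov's inequality for the number of occurrences of an event. -/
theorem markov_count (h : IsSampling P μ Y) (E : Set (Fin n → Bool)) [DecidablePred (· ∈ E)]
    (T : Finset ℕ) (b : ℝ) :
    b * μ.real {ω | b ≤ ∑ s ∈ T, (if Y s ω ∈ E then (1 : ℝ) else 0)} ≤
      T.card * avg P (fun x => if x ∈ E then 1 else 0) := by
  have hi : ∀ s ∈ T, Integrable (fun ω => if Y s ω ∈ E then (1 : ℝ) else 0) μ :=
    fun s _ => h.integrable (fun x => if x ∈ E then (1 : ℝ) else 0) s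
  have h1 := mul_meas_ge_le_integral_of_nonneg (μ := μ)
    (f := fun ω => ∑ s ∈ T, if Y s ω ∈ E then (1 : ℝ) else 0)
    (Filter.Eventually.of_forall fun ω => Finset.sum_nonneg fun s _ => by split_ifs <;> simp)
    (integrable_finsetSum _ hi) b
  rw [integral_finsetSum _ hi] at h1
  refine h1.trans (le_of_eq ?_)
  have h2 : ∀ s, ∫ ω, (if Y s ω ∈ E then (1 : ℝ) else 0) ∂μ =
      avg P (fun x => if x ∈ E then 1 else 0) :=
    fun s => h.integral_eq (fun x => if x ∈ E then (1 : ℝ) else 0) s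
  simp [h2]

theorem integral_sum (h : IsSampling P μ Y) (f : (Fin n → Bool) → ℝ) (T : Finset ℕ) :
    ∫ ω, ∑ s ∈ T, f (Y s ω) ∂μ = T.card * avg P f := by
  rw [integral_finsetSum _ fun s _ => h.integrable f s]
  simp [h.integral_eq f]

theorem integral_mul (h : IsSampling P μ Y) (f g : (Fin n → Bool) → ℝ) {s t : ℕ} (hst : s ≠ t) :
    ∫ ω, f (Y s ω) * g (Y t ω) ∂μ = avg P f * avg P g := by
  have h1 := (h.indep.indepFun hst).comp (measurable_of_finite f) (measurable_of_finite g)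
  have h2 := h1.integral_fun_mul_eq_mul_integral (h.measurable_comp f s).aestronglyMeasurable
    (h.measurable_comp g t).aestronglyMeasurable
  simp only [Function.comp] at h2
  rw [h2, h.integral_eq, h.integral_eq]

theorem integrable_sum (h : IsSampling P μ Y) (T : Finset ℕ) (H : (T → Fin n → Bool) → ℝ) :
    Integrable (fun ω => H (fun s => Y s ω)) μ :=
  integrable_comp_of_finite (V := fun ω (s : T) => Y s ω)
    (measurable_pi_lambda _ fun s => h.measurable s) H

theorem integral_sum_mul_sum (h : IsSampling P μ Y) (f g : (Fin n → Bool) → ℝ) (T : Finset ℕ) :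
    ∫ ω, (∑ s ∈ T, f (Y s ω)) * ∑ s ∈ T, g (Y s ω) ∂μ =
      T.card * avg P (fun x => f x * g x) + T.card * (T.card - 1) * (avg P f * avg P g) := by
  have h1 : ∀ s t, Integrable (fun ω => f (Y s ω) * g (Y t ω)) μ := by
    intro s t
    exact integrable_comp_of_finite (V := fun ω => (Y s ω, Y t ω))
      ((h.measurable s).prodMk (h.measurable t)) (fun z => f z.1 * g z.2)
  have h2 : ∀ s t, ∫ ω, f (Y s ω) * g (Y t ω) ∂μ = avg P f * avg P g +
      if s = t then avg P (fun x => f x * g x) - avg P f * avg P g else 0 := by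
    intro s t
    by_cases hst : s = t
    · subst hst
      rw [if_pos rfl, h.integral_eq (fun x => f x * g x)]; ring
    · rw [if_neg hst, h.integral_mul f g hst, add_zero]
  simp only [Finset.sum_mul_sum]
  rw [integral_finsetSum _ fun s _ => integrable_finsetSum _ fun t _ => h1 s t]
  simp only [integral_finsetSum _ fun t _ => h1 _ t, h2, Finset.sum_add_distrib,
    Finset.sum_ite_eq, Finset.sum_const, nsmul_eq_mul]
  rw [Finset.sum_congr rfl (fun s hs => if_pos hs)]
  simp only [Finset.sum_const, nsmul_eq_mul]
  ring

omit [IsProbabilityMeasure μ] in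
theorem indepFun_restrict (h : IsSampling P μ Y) {T T' : Finset ℕ} (hT : Disjoint T T') :
    IndepFun (fun ω (s : T) => Y s ω) (fun ω (s : T') => Y s ω) μ :=
  h.indep.indepFun_finset T T' hT h.measurable

theorem integral_mul_of_disjoint (h : IsSampling P μ Y) {T T' : Finset ℕ} (hT : Disjoint T T')
    (H : (T → Fin n → Bool) → ℝ) (H' : (T' → Fin n → Bool) → ℝ) :
    ∫ ω, H (fun s => Y s ω) * H' (fun s => Y s ω) ∂μ =
      (∫ ω, H (fun s => Y s ω) ∂μ) * ∫ ω, H' (fun s => Y s ω) ∂μ := by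
  have h1 := (h.indepFun_restrict hT).comp (measurable_of_finite H) (measurable_of_finite H')
  exact h1.integral_fun_mul_eq_mul_integral (h.integrable_sum T H).aestronglyMeasurable
    (h.integrable_sum T' H').aestronglyMeasurable

/-- Chebyshev's inequality for a diagonal quadratic form in the sums over two batches. -/
theorem quad_chebyshev (h : IsSampling P μ Y) {ι : Type*} [Fintype ι] (v : ι → ℝ)
    (f : ι → (Fin n → Bool) → ℝ) {T T' : Finset ℕ} (hT : Disjoint T T') {M : ℕ}
    (hM : T.card = M) (hM' : T'.card = M) {b : ℝ} (hb : 0 ≤ b) :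
    b ^ 2 * μ.real {ω | b ≤ |∑ α, v α * ((∑ s ∈ T, f α (Y s ω)) * ∑ s ∈ T', f α (Y s ω)) -
        M ^ 2 * ∑ α, v α * avg P (f α) ^ 2|} ≤
      M ^ 2 * ∑ α, ∑ β, v α * v β * avg P (fun x => f α x * f β x) ^ 2 +
      2 * M ^ 3 * ∑ α, ∑ β, v α * v β * (avg P (fun x => f α x * f β x) *
        (avg P (f α) * avg P (f β))) := by
  set A : ι → Ω → ℝ := fun α ω => ∑ s ∈ T, f α (Y s ω) with hA
  set B : ι → Ω → ℝ := fun α ω => ∑ s ∈ T', f α (Y s ω) with hB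
  set G : ι → ι → ℝ := fun α β => avg P (fun x => f α x * f β x) with hG
  set W : Ω → ℝ := fun ω => ∑ α, v α * (A α ω * B α ω) with hW
  set e : ℝ := M ^ 2 * ∑ α, v α * avg P (f α) ^ 2 with he
  have hA' : ∀ α ω, A α ω = ∑ s : T, f α (Y s ω) := fun α ω =>
    (Finset.sum_coe_sort T fun s => f α (Y s ω)).symm
  have hB' : ∀ α ω, B α ω = ∑ s : T', f α (Y s ω) := fun α ω =>
    (Finset.sum_coe_sort T' fun s => f α (Y s ω)).symm
  have hint : ∀ H : (↥(T ∪ T') → Fin n → Bool) → ℝ, Integrable (fun ω => H fun s => Y s ω) μ :=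
    h.integrable_sum (T ∪ T')
  have hAu : ∀ α ω, A α ω = ∑ s : ↥(T ∪ T'), if (s : ℕ) ∈ T then f α (Y s ω) else 0 := by
    exact fun α ω => sum_eq_sum_coe Finset.subset_union_left fun s => f α (Y s ω)
  have hBu : ∀ α ω, B α ω = ∑ s : ↥(T ∪ T'), if (s : ℕ) ∈ T' then f α (Y s ω) else 0 := by
    exact fun α ω => sum_eq_sum_coe Finset.subset_union_right fun s => f α (Y s ω)
  have hE1 : ∀ α, ∫ ω, A α ω * B α ω ∂μ = M ^ 2 * avg P (f α) ^ 2 := by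
    intro α
    simp only [hA', hB']
    rw [h.integral_mul_of_disjoint hT (fun z => ∑ s, f α (z s)) (fun z => ∑ s, f α (z s))]
    simp only [← hA', ← hB']
    rw [h.integral_sum (f α) T, h.integral_sum (f α) T', hM, hM']; ring
  -- The expectation factorizes over the two batches, and both factors are the same second moment.
  have hE2 : ∀ α β, ∫ ω, (A α ω * A β ω) * (B α ω * B β ω) ∂μ =
      (M * G α β + M * (M - 1) * (avg P (f α) * avg P (f β))) ^ 2 := by
    intro α β
    simp only [hA', hB']
    rw [h.integral_mul_of_disjoint hT (fun z => (∑ s, f α (z s)) * ∑ s, f β (z s))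
      (fun z => (∑ s, f α (z s)) * ∑ s, f β (z s))]
    simp only [← hA', ← hB']
    rw [h.integral_sum_mul_sum (f α) (f β) T, h.integral_sum_mul_sum (f α) (f β) T', hM, hM']
    ring
  have hi1 : ∀ α, Integrable (fun ω => v α * (A α ω * B α ω)) μ := by
    intro α
    simp only [hAu, hBu]
    exact hint fun z => v α * ((∑ s : ↥(T ∪ T'), if (s : ℕ) ∈ T then f α (z s) else 0) *
      ∑ s : ↥(T ∪ T'), if (s : ℕ) ∈ T' then f α (z s) else 0)
  have hi2 : ∀ α β, Integrable (fun ω => v α * v β * ((A α ω * A β ω) * (B α ω * B β ω))) μ := by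
    intro α β
    simp only [hAu, hBu]
    exact hint fun z => v α * v β * (((∑ s : ↥(T ∪ T'), if (s : ℕ) ∈ T then f α (z s) else 0) *
      ∑ s : ↥(T ∪ T'), if (s : ℕ) ∈ T then f β (z s) else 0) *
      ((∑ s : ↥(T ∪ T'), if (s : ℕ) ∈ T' then f α (z s) else 0) *
      ∑ s : ↥(T ∪ T'), if (s : ℕ) ∈ T' then f β (z s) else 0))
  have hWi : Integrable W μ := integrable_finsetSum _ fun α _ => hi1 α
  have hWe : ∫ ω, W ω ∂μ = e := by
    rw [hW, integral_finsetSum _ fun α _ => hi1 α, he, Finset.mul_sum]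
    refine Finset.sum_congr rfl fun α _ => ?_
    rw [integral_const_mul, hE1]; ring
  have hW2 : ∀ ω, W ω ^ 2 = ∑ α, ∑ β, v α * v β * ((A α ω * A β ω) * (B α ω * B β ω)) := by
    intro ω
    rw [sq, hW, Finset.sum_mul_sum]
    refine Finset.sum_congr rfl fun α _ => Finset.sum_congr rfl fun β _ => by ring
  have hW2i : Integrable (fun ω => W ω ^ 2) μ := by
    simp only [hW2]
    exact integrable_finsetSum _ fun α _ => integrable_finsetSum _ fun β _ => hi2 α β
  have hW2e : ∫ ω, W ω ^ 2 ∂μ = ∑ α, ∑ β, v α * v β *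
      (M * G α β + M * (M - 1) * (avg P (f α) * avg P (f β))) ^ 2 := by
    simp only [hW2]
    rw [integral_finsetSum _ fun α _ => integrable_finsetSum _ fun β _ => hi2 α β]
    refine Finset.sum_congr rfl fun α _ => ?_
    rw [integral_finsetSum _ fun β _ => hi2 α β]
    refine Finset.sum_congr rfl fun β _ => ?_
    rw [integral_const_mul, hE2]
  have hexp : ∀ ω, (W ω - e) ^ 2 = (W ω ^ 2 - 2 * e * W ω) + e ^ 2 := fun ω => by ring
  have hvi' : Integrable (fun ω => W ω ^ 2 - 2 * e * W ω) μ := hW2i.sub (hWi.const_mul _)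
  have hvi : Integrable (fun ω => (W ω - e) ^ 2) μ := by
    simp only [hexp]
    exact hvi'.add (integrable_const _)
  have hve : ∫ ω, (W ω - e) ^ 2 ∂μ = ∫ ω, W ω ^ 2 ∂μ - e ^ 2 := by
    simp only [hexp]
    rw [integral_add hvi' (integrable_const _), integral_sub hW2i (hWi.const_mul _),
      integral_const_mul, hWe]
    simp; ring
  have hmk := mul_meas_ge_le_integral_of_nonneg (μ := μ) (f := fun ω => (W ω - e) ^ 2)
    (Filter.Eventually.of_forall fun ω => sq_nonneg _) hvi (b ^ 2)
  have hset : {ω | b ≤ |W ω - e|} = {ω | b ^ 2 ≤ (W ω - e) ^ 2} := by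
    ext ω
    simp only [Set.mem_ofPred_eq]
    rw [← sq_abs (W ω - e), sq_le_sq₀ hb (abs_nonneg _)]
  rw [hset]
  refine hmk.trans ?_
  rw [hve, hW2e]
  have he2 : e ^ 2 = ∑ α, ∑ β, v α * v β * (M ^ 2 * (avg P (f α) * avg P (f β))) ^ 2 := by
    rw [he, sq, mul_mul_mul_comm, Finset.sum_mul_sum, Finset.mul_sum]
    refine Finset.sum_congr rfl fun α _ => ?_
    rw [Finset.mul_sum]
    exact Finset.sum_congr rfl fun β _ => by ring
  -- The mixed sum is the second moment of one linear combination of the `f α`, hence non-negative;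
  -- this allows `M - 1` to be replaced by `M` at the end.
  have hpos : 0 ≤ ∑ α, ∑ β, v α * v β * (G α β * (avg P (f α) * avg P (f β))) := by
    have h1 : ∑ α, ∑ β, v α * v β * (G α β * (avg P (f α) * avg P (f β))) =
        avg P (fun x => (∑ α, v α * avg P (f α) * f α x) ^ 2) := by
      have h2 : ∀ α β, v α * v β * (G α β * (avg P (f α) * avg P (f β))) =
          ∑ x, mass P x * ((v α * avg P (f α) * f α x) * (v β * avg P (f β) * f β x)) := by
        intro α β
        rw [hG]
        generalize avg P (f α) = a
        generalize avg P (f β) = b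
        simp only [avg, Finset.sum_mul, Finset.mul_sum]
        exact Finset.sum_congr rfl fun x _ => by ring
      simp only [h2]
      rw [avg]
      simp only [sq, Finset.sum_mul_sum]
      rw [Finset.sum_congr rfl fun α _ => Finset.sum_comm, Finset.sum_comm]
      simp only [Finset.mul_sum]
    rw [h1]
    exact Finset.sum_nonneg fun x _ => mul_nonneg (mass_nonneg P x) (sq_nonneg _)
  -- The terms in the fourth power of the means combine to a negative multiple of a square and are
  -- dropped.
  have hsplit : ∑ α, ∑ β, v α * v β *
      (M * G α β + M * (M - 1) * (avg P (f α) * avg P (f β))) ^ 2 - e ^ 2 =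
      M ^ 2 * ∑ α, ∑ β, v α * v β * G α β ^ 2 +
      2 * M ^ 2 * (M - 1) * ∑ α, ∑ β, v α * v β * (G α β * (avg P (f α) * avg P (f β))) -
      (2 * M - 1) * M ^ 2 * ∑ α, ∑ β, (v α * avg P (f α) ^ 2) * (v β * avg P (f β) ^ 2) := by
    rw [he2]
    simp only [Finset.mul_sum, ← Finset.sum_sub_distrib, ← Finset.sum_add_distrib]
    exact Finset.sum_congr rfl fun α _ => Finset.sum_congr rfl fun β _ => by ring
  rw [hsplit, ← Finset.sum_mul_sum]
  rcases Nat.eq_zero_or_pos M with h0 | h0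
  · subst h0; simp
  have hM1 : (1 : ℝ) ≤ M := by exact_mod_cast h0
  have h2 : 0 ≤ (2 * (M : ℝ) - 1) * M ^ 2 *
      ((∑ α, v α * avg P (f α) ^ 2) * ∑ β, v β * avg P (f β) ^ 2) :=
    mul_nonneg (mul_nonneg (by linarith) (sq_nonneg _)) (mul_self_nonneg _)
  have h3 : 0 ≤ 2 * (M : ℝ) ^ 2 * ∑ α, ∑ β, v α * v β * (G α β * (avg P (f α) * avg P (f β))) :=
    mul_nonneg (by positivity) hpos
  nlinarith

/-- The same for weights that depend on an independent batch. -/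
theorem quad_tail (h : IsSampling P μ Y) {ι : Type*} [Fintype ι] (v : (ι → ℝ) → ι → ℝ)
    (good : (ι → ℝ) → Prop) (g f : ι → (Fin n → Bool) → ℝ) {T₀ T T' : Finset ℕ}
    (hT₀ : Disjoint T₀ (T ∪ T')) (hT : Disjoint T T') {M : ℕ} (hM : T.card = M)
    (hM' : T'.card = M) {b δ : ℝ} (hb : 0 < b) (hδ : 0 ≤ δ)
    (hvar : ∀ N, good N →
      M ^ 2 * ∑ α, ∑ β, v N α * v N β * avg P (fun x => f α x * f β x) ^ 2 +
      2 * M ^ 3 * ∑ α, ∑ β, v N α * v N β * (avg P (fun x => f α x * f β x) *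
        (avg P (f α) * avg P (f β))) ≤ δ * b ^ 2) :
    μ.real {ω | good (fun α => ∑ s ∈ T₀, g α (Y s ω)) ∧
      b ≤ |∑ α, v (fun α => ∑ s ∈ T₀, g α (Y s ω)) α *
        ((∑ s ∈ T, f α (Y s ω)) * ∑ s ∈ T', f α (Y s ω)) -
        M ^ 2 * ∑ α, v (fun α => ∑ s ∈ T₀, g α (Y s ω)) α * avg P (f α) ^ 2|} ≤ δ := by
  have hAu : ∀ α ω, ∑ s ∈ T, f α (Y s ω) =
      ∑ s : ↥(T ∪ T'), if (s : ℕ) ∈ T then f α (Y s ω) else 0 := by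
    exact fun α ω => sum_eq_sum_coe Finset.subset_union_left fun s => f α (Y s ω)
  have hBu : ∀ α ω, ∑ s ∈ T', f α (Y s ω) =
      ∑ s : ↥(T ∪ T'), if (s : ℕ) ∈ T' then f α (Y s ω) else 0 := by
    exact fun α ω => sum_eq_sum_coe Finset.subset_union_right fun s => f α (Y s ω)
  have h0 : ∀ α ω, ∑ s ∈ T₀, g α (Y s ω) = ∑ s : T₀, g α (Y s ω) := fun α ω =>
    (Finset.sum_coe_sort T₀ fun s => g α (Y s ω)).symm
  -- Once the first batch is fixed the weights are constants, and the bound of Chebyshev type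
  -- applies to the other two.
  have key := measureReal_le_of_indepFun (μ := μ) (V := fun ω (s : T₀) => Y s ω)
    (W := fun ω (s : ↥(T ∪ T')) => Y s ω) (δ := δ)
    (measurable_pi_lambda _ fun s => h.measurable s) (h.indepFun_restrict hT₀)
    (F := fun z w => good (fun α => ∑ s, g α (z s)) ∧
      b ≤ |∑ α, v (fun α => ∑ s, g α (z s)) α *
        ((∑ s : ↥(T ∪ T'), if (s : ℕ) ∈ T then f α (w s) else 0) *
          ∑ s : ↥(T ∪ T'), if (s : ℕ) ∈ T' then f α (w s) else 0) -
        M ^ 2 * ∑ α, v (fun α => ∑ s, g α (z s)) α * avg P (f α) ^ 2|) ?_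
  · simp only [h0, hAu, hBu]; exact key
  · intro z
    by_cases hz : good (fun α => ∑ s, g α (z s))
    · simp only [hz, true_and, ← hAu, ← hBu]
      have h1 := (h.quad_chebyshev (v fun α => ∑ s, g α (z s)) f hT hM hM' hb.le).trans
        (hvar _ hz)
      rw [mul_comm] at h1
      exact le_of_mul_le_mul_right h1 (by positivity)
    · simp only [hz, false_and]; simpa using hδ

end IsSampling

/-! ### Residuals of a Bayes net -/

section Residuals

variable {n : ℕ} {S : BNStructure n} {σ : Equiv.Perm (Fin n)} {P : Measure (Fin n → Bool)}

theorem avg_add (g h : (Fin n → Bool) → ℝ) : avg P (fun x => g x + h x) = avg P g + avg P h := by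
  simp [avg, mul_add, Finset.sum_add_distrib]

theorem avg_sub (g h : (Fin n → Bool) → ℝ) : avg P (fun x => g x - h x) = avg P g - avg P h := by
  simp [avg, mul_sub, Finset.sum_sub_distrib]

theorem avg_const_mul (r : ℝ) (g : (Fin n → Bool) → ℝ) :
    avg P (fun x => r * g x) = r * avg P g := by
  rw [avg, avg, Finset.mul_sum]
  exact Finset.sum_congr rfl fun x _ => by ring

theorem avg_sum {ι : Type*} (T : Finset ι) (g : ι → (Fin n → Bool) → ℝ) :
    avg P (fun x => ∑ α ∈ T, g α x) = ∑ α ∈ T, avg P (g α) := by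
  simp only [avg, Finset.mul_sum]
  exact Finset.sum_comm

theorem avg_nonneg {g : (Fin n → Bool) → ℝ} (hg : ∀ x, 0 ≤ g x) : 0 ≤ avg P g :=
  Finset.sum_nonneg fun x _ => mul_nonneg (mass_nonneg P x) (hg x)

theorem avg_mono {g h : (Fin n → Bool) → ℝ} (hg : ∀ x, g x ≤ h x) : avg P g ≤ avg P h :=
  Finset.sum_le_sum fun x _ => mul_le_mul_of_nonneg_left (hg x) (mass_nonneg P x)

/-- The indicator of the event that the parents of `X_i` have the values given by `a`. -/
noncomputable def parInd (S : BNStructure n) (i : Fin n) (a x : Fin n → Bool) : ℝ :=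
  open Classical in if ∀ j ∈ S.pa i, x j = a j then 1 else 0

/-- The bit `X_i` as a real number. -/
def bit (x : Fin n → Bool) (i : Fin n) : ℝ := ((x i).toNat : ℝ)

theorem bit_mul_self (x : Fin n → Bool) (i : Fin n) : bit x i * bit x i = bit x i := by
  unfold bit; cases x i <;> simp

/-- The entries of the conditional probability table. -/
noncomputable def table (S : BNStructure n) (P : Measure (Fin n → Bool)) (i : Fin n)
    (a : Fin n → Bool) : ℝ :=
  marg (mass P) (insert i (S.pa i)) (Function.update a i true) / marg (mass P) (S.pa i) a

theorem BNStructure.notMem_pa (S : BNStructure n) (i : Fin n) : i ∉ S.pa i := fun h =>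
  S.acyclic i (Relation.TransGen.single (BNStructure.mem_pa.1 h))

theorem condProbTable_eq_table [IsProbabilityMeasure P] (i : Fin n) (a : Fin n → Bool) :
    condProbTable S P i a = table S P i a := by
  rw [condProbTable, cond_real_eq, table, marg_mass, marg_mass, ← configEvent_inter_eq,
    BNStructure.coe_pa]
  have h : configEvent (S.parents i) (Function.update a i true) = configEvent (S.parents i) a := by
    ext x
    refine forall₂_congr fun j hj => ?_
    rw [Function.update_of_ne]
    rintro rfl
    exact S.notMem_pa j (BNStructure.mem_pa.2 hj)
  rw [h, Function.update_self]

theorem avg_parInd (i : Fin n) (a : Fin n → Bool) :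
    avg P (parInd S i a) = marg (mass P) (S.pa i) a := by
  unfold avg marg parInd
  exact Finset.sum_congr rfl fun x _ => by split_ifs <;> simp

theorem parInd_mul_self (i : Fin n) (a x : Fin n → Bool) :
    parInd S i a x * parInd S i a x = parInd S i a x := by
  unfold parInd; split_ifs <;> simp

theorem parInd_nonneg (i : Fin n) (a x : Fin n → Bool) : 0 ≤ parInd S i a x := by
  unfold parInd; split_ifs <;> simp

theorem parInd_le_one (i : Fin n) (a x : Fin n → Bool) : parInd S i a x ≤ 1 := by
  unfold parInd; split_ifs <;> simp

/-- Conditioning on the coordinates in `B`. -/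
theorem avg_mul_eq_marg {B : Finset (Fin n)} {g : (Fin n → Bool) → ℝ}
    (hg : ∀ x y, (∀ j ∈ B, x j = y j) → g x = g y) (K : (Fin n → Bool) → ℝ) :
    avg P (fun x => g x * K x) =
      ∑ y, mass P y * (g y * (marg (fun x => mass P x * K x) B y / marg (mass P) B y)) := by
  have h1 : ∀ y, mass P y * (g y * (marg (fun x => mass P x * K x) B y / marg (mass P) B y)) =
      ∑ x, if ∀ j ∈ B, x j = y j then
        mass P x * (g x * K x) * (mass P y / marg (mass P) B x) else 0 := by
    intro y
    rw [marg, Finset.sum_div, Finset.mul_sum, Finset.mul_sum]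
    refine Finset.sum_congr rfl fun x _ => ?_
    split_ifs with h
    · rw [hg x y h, marg_congr h]; ring
    · simp
  simp only [h1]
  rw [Finset.sum_comm, avg]
  refine Finset.sum_congr rfl fun x _ => ?_
  have h2 : ∀ y : Fin n → Bool, (∀ j ∈ B, x j = y j) ↔ ∀ j ∈ B, y j = x j := fun y =>
    forall₂_congr fun j _ => eq_comm
  simp only [h2]
  have h3 : ∑ y, (if ∀ j ∈ B, y j = x j then
      mass P x * (g x * K x) * (mass P y / marg (mass P) B x) else 0) =
      mass P x * (g x * K x) * (marg (mass P) B x / marg (mass P) B x) := by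
    conv_rhs => rw [marg, Finset.sum_div, Finset.mul_sum]
    refine Finset.sum_congr rfl fun y _ => ?_
    split_ifs <;> simp [marg]
  rw [h3]
  -- The division by the marginal is harmless: it can vanish only at points of mass zero.
  by_cases hx : mass P x = 0
  · simp [hx]
  · have h4 : 0 < marg (mass P) B x :=
      (lt_of_le_of_ne (mass_nonneg P x) (Ne.symm hx)).trans_le (le_marg (mass_nonneg P) B x)
    rw [div_self h4.ne', mul_one]

theorem marg_mul_bit {B : Finset (Fin n)} {i : Fin n} (hi : i ∉ B) (y : Fin n → Bool) :
    marg (fun x => mass P x * bit x i) B y =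
      marg (mass P) (insert i B) (Function.update y i true) := by
  unfold marg
  refine Finset.sum_congr rfl fun z _ => ?_
  have h : (∀ j ∈ insert i B, z j = Function.update y i true j) ↔
      z i = true ∧ ∀ j ∈ B, z j = y j := by
    rw [Finset.forall_mem_insert, Function.update_self]
    refine and_congr_right fun _ => forall₂_congr fun j hj => ?_
    rw [Function.update_of_ne (ne_of_mem_of_not_mem hj hi)]
  simp only [h, bit]
  cases z i <;> simp

/-- Given the values of its parents, the bit `X_i` is independent of functions of the
predecessors. -/
theorem IsMarkov.avg_mul_bit (hσ : IsNumbering S σ) (hS : IsMarkov S σ (mass P)) {i : Fin n}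
    {a : Fin n → Bool} {g : (Fin n → Bool) → ℝ}
    (hg : ∀ x y, (∀ j ∈ predecessors σ i, x j = y j) → g x = g y)
    (ha : 0 < marg (mass P) (S.pa i) a) :
    avg P (fun x => g x * parInd S i a x * bit x i) =
      table S P i a * avg P (fun x => g x * parInd S i a x) := by
  have hpa : S.pa i ⊆ predecessors σ i := fun j hj =>
    mem_predecessors.2 (hσ _ _ (BNStructure.mem_pa.1 hj))
  have hi : i ∉ predecessors σ i := fun h => lt_irrefl _ (mem_predecessors.1 h)
  have hg' : ∀ x y, (∀ j ∈ predecessors σ i, x j = y j) →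
      g x * parInd S i a x = g y * parInd S i a y := by
    intro x y h
    have h1 : (∀ j ∈ S.pa i, x j = a j) ↔ ∀ j ∈ S.pa i, y j = a j :=
      forall₂_congr fun j hj => by rw [h j (hpa hj)]
    rw [hg x y h, parInd, parInd]
    simp only [h1]
  rw [avg_mul_eq_marg hg' (fun x => bit x i), avg, Finset.mul_sum]
  refine Finset.sum_congr rfl fun y _ => ?_
  rw [marg_mul_bit hi]
  by_cases hy : mass P y = 0
  · simp [hy]
  by_cases hya : ∀ j ∈ S.pa i, y j = a j
  · have hpos : 0 < marg (mass P) (predecessors σ i) y :=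
      (lt_of_le_of_ne (mass_nonneg P y) (Ne.symm hy)).trans_le (le_marg (mass_nonneg P) _ y)
    have h1 := hS i (predecessors σ i) (Function.update y i true) hpa (Finset.Subset.refl _)
    have hu : ∀ (B : Finset (Fin n)) (z : Fin n → Bool), i ∉ B →
        marg (mass P) B (Function.update z i true) = marg (mass P) B z := fun B z hB =>
      marg_congr fun j hj => Function.update_of_ne (ne_of_mem_of_not_mem hj hB) _ _
    have h2 : marg (mass P) (insert i (S.pa i)) (Function.update y i true) =
        marg (mass P) (insert i (S.pa i)) (Function.update a i true) := by
      refine marg_congr fun j hj => ?_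
      rcases Finset.mem_insert.1 hj with rfl | hj
      · simp
      · have : j ≠ i := ne_of_mem_of_not_mem hj (S.notMem_pa i)
        rw [Function.update_of_ne this, Function.update_of_ne this, hya j hj]
    rw [hu _ _ (S.notMem_pa i), hu _ _ hi, marg_congr hya, h2] at h1
    have h3 : marg (mass P) (insert i (predecessors σ i)) (Function.update y i true) /
        marg (mass P) (predecessors σ i) y = table S P i a := by
      rw [table, div_eq_div_iff hpos.ne' ha.ne', h1, mul_comm]
    rw [h3]; ring
  · simp [parInd, hya]

/-- The nodes together with their parental configurations are indexed by `ι`. -/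
def IsTable {ι : Type*} (S : BNStructure n) (node : ι → Fin n) (conf : ι → Fin n → Bool) : Prop :=
  ∀ (i : Fin n) (x : Fin n → Bool), ∃! α, node α = i ∧ ∀ j ∈ S.pa i, x j = conf α j

variable {ι : Type*} {node : ι → Fin n} {conf : ι → Fin n → Bool}

theorem IsTable.parInd_mul_eq_zero (hT : IsTable S node conf) {α β : ι} (hne : α ≠ β)
    (hnode : node α = node β) (x : Fin n → Bool) :
    parInd S (node α) (conf α) x * parInd S (node β) (conf β) x = 0 := by
  unfold parInd
  by_cases h1 : ∀ j ∈ S.pa (node α), x j = conf α j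
  · by_cases h2 : ∀ j ∈ S.pa (node β), x j = conf β j
    · exact absurd ((hT (node α) x).unique ⟨rfl, h1⟩ ⟨hnode.symm, by rw [hnode]; exact h2⟩) hne
    · simp [h2]
  · simp [h1]

/-- At each point `x` exactly one entry per node is active, so a sum over active entries is a sum
over nodes. -/
theorem IsTable.sum_parInd [Fintype ι] (hT : IsTable S node conf) (h : ι → ℝ)
    (g : Fin n → (Fin n → Bool) → ℝ) (x : Fin n → Bool)
    (hg : ∀ α, (∀ j ∈ S.pa (node α), x j = conf α j) → g (node α) x = h α) :
    ∑ α, parInd S (node α) (conf α) x * h α = ∑ i, g i x := by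
  classical
  choose s hs hs' using hT
  have h1 : ∀ i, g i x = h (s i x) := fun i => by
    rw [← hg (s i x) ?_, (hs i x).1]
    intro j hj
    rw [(hs i x).1] at hj
    exact (hs i x).2 j hj
  simp only [h1]
  rw [← Finset.sum_fiberwise (s := Finset.univ) (g := node)]
  refine Finset.sum_congr rfl fun i _ => ?_
  rw [Finset.sum_eq_single (s i x)]
  · have h2 : ∀ j ∈ S.pa (node (s i x)), x j = conf (s i x) j := by
      rw [(hs i x).1]; exact (hs i x).2
    simp only [parInd]
    rw [if_pos h2, one_mul]
  · intro α hα hne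
    simp only [Finset.mem_filter, Finset.mem_univ, true_and] at hα
    have h2 : ¬ ∀ j ∈ S.pa (node α), x j = conf α j := by
      intro h2
      rw [hα] at h2
      exact hne (hs' i x α ⟨hα, h2⟩)
    simp only [parInd]
    rw [if_neg h2, zero_mul]
  · intro h2
    exact absurd (Finset.mem_filter.2 ⟨Finset.mem_univ (s i x), (hs i x).1⟩) h2

/-- The deviation of `X_i` from its conditional expectation, on a parental configuration. -/
noncomputable def bitResidual (S : BNStructure n) (P : Measure (Fin n → Bool)) (i : Fin n)
    (a x : Fin n → Bool) : ℝ := parInd S i a x * (bit x i - table S P i a)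

theorem parInd_congr {i : Fin n} {a x y : Fin n → Bool} (h : ∀ j ∈ S.pa i, x j = y j) :
    parInd S i a x = parInd S i a y := by
  have h1 : (∀ j ∈ S.pa i, x j = a j) ↔ ∀ j ∈ S.pa i, y j = a j :=
    forall₂_congr fun j hj => by rw [h j hj]
  simp only [parInd, h1]

theorem avg_parInd_mul_bit (hσ : IsNumbering S σ) (hS : IsMarkov S σ (mass P)) {i : Fin n}
    {a : Fin n → Bool} (ha : 0 < marg (mass P) (S.pa i) a) :
    avg P (fun x => parInd S i a x * bit x i) = marg (mass P) (S.pa i) a * table S P i a := by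
  have h := hS.avg_mul_bit hσ (g := fun _ => 1) (fun _ _ _ => rfl) ha
  simp only [one_mul] at h
  rw [h, mul_comm]
  congr 1
  exact avg_parInd i a

theorem avg_bitResidual_mul_self (hσ : IsNumbering S σ) (hS : IsMarkov S σ (mass P)) {i : Fin n}
    {a : Fin n → Bool} (ha : 0 < marg (mass P) (S.pa i) a) :
    avg P (fun x => bitResidual S P i a x * bitResidual S P i a x) =
      marg (mass P) (S.pa i) a * (table S P i a * (1 - table S P i a)) := by
  have h1 : ∀ x, bitResidual S P i a x * bitResidual S P i a x =
      (1 - 2 * table S P i a) * (parInd S i a x * bit x i) +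
        table S P i a ^ 2 * parInd S i a x := by
    intro x
    rw [bitResidual, mul_mul_mul_comm, parInd_mul_self]
    linear_combination parInd S i a x * bit_mul_self x i
  simp only [h1]
  rw [avg_add, avg_const_mul, avg_const_mul, avg_parInd_mul_bit hσ hS ha]
  have h2 : avg P (fun x => parInd S i a x) = marg (mass P) (S.pa i) a := avg_parInd i a
  rw [h2]; ring

/-- For entries of different nodes, the residual of the later node has conditional mean zero given
its predecessors, which determine the other residual. Two entries of one node are never active
together. -/
theorem IsTable.avg_bitResidual_mul (hT : IsTable S node conf) (hσ : IsNumbering S σ)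
    (hS : IsMarkov S σ (mass P)) (hpos : ∀ α, 0 < marg (mass P) (S.pa (node α)) (conf α))
    {α β : ι} (hne : α ≠ β) :
    avg P (fun x => bitResidual S P (node α) (conf α) x * bitResidual S P (node β) (conf β) x) = 0 := by
  have key : ∀ α β, σ (node α) < σ (node β) → avg P (fun x =>
      bitResidual S P (node α) (conf α) x * bitResidual S P (node β) (conf β) x) = 0 := by
    intro α β hlt
    have hg : ∀ x y : Fin n → Bool, (∀ j ∈ predecessors σ (node β), x j = y j) →
        bitResidual S P (node α) (conf α) x = bitResidual S P (node α) (conf α) y := by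
      intro x y h
      unfold bitResidual bit
      rw [h _ (mem_predecessors.2 hlt), parInd_congr fun j hj => h j (mem_predecessors.2
        ((hσ _ _ (BNStructure.mem_pa.1 hj)).trans hlt))]
    have h1 := hS.avg_mul_bit hσ hg (hpos β)
    have h2 : ∀ x, bitResidual S P (node α) (conf α) x * bitResidual S P (node β) (conf β) x =
        bitResidual S P (node α) (conf α) x * parInd S (node β) (conf β) x * bit x (node β) -
        table S P (node β) (conf β) *
          (bitResidual S P (node α) (conf α) x * parInd S (node β) (conf β) x) := by
      intro x
      rw [bitResidual.eq_1 S P (node β)]; ring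
    simp only [h2]
    rw [avg_sub, avg_const_mul, h1, sub_self]
  rcases lt_trichotomy (σ (node α)) (σ (node β)) with h | h | h
  · exact key α β h
  · have h1 : ∀ x, bitResidual S P (node α) (conf α) x * bitResidual S P (node β) (conf β) x = 0 := by
      intro x
      rw [bitResidual, bitResidual, mul_mul_mul_comm,
        hT.parInd_mul_eq_zero hne (σ.injective h), zero_mul]
    simp [h1, avg]
  · have := key β α h
    simp only [mul_comm (bitResidual S P (node β) (conf β) _)] at this
    exact this

end Residuals

/-! ### The variance of the statistic -/

section Variance

variable {n : ℕ} {P : Measure (Fin n → Bool)} {ι : Type*} [Fintype ι]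

/-- The square of an expectation is an expectation over two independent copies `x`, `y`. The double
sum becomes the mean of a product of two kernels in `(x, y)`, to which elementary inequalities apply
pointwise. -/
theorem sum_sum_mul_avg_sq (v : ι → ℝ) (f g : ι → (Fin n → Bool) → ℝ) :
    ∑ α, ∑ β, v α * v β * avg P (fun x => f α x * g β x) ^ 2 =
      ∑ x, ∑ y, mass P x * mass P y *
        ((∑ α, v α * (f α x * f α y)) * ∑ β, v β * (g β x * g β y)) := by
  have h1 : ∀ α β, v α * v β * avg P (fun x => f α x * g β x) ^ 2 =
      ∑ x, ∑ y, mass P x * mass P y * ((v α * (f α x * f α y)) * (v β * (g β x * g β y))) := by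
    intro α β
    rw [sq, avg, Finset.sum_mul_sum, Finset.mul_sum]
    refine Finset.sum_congr rfl fun x _ => ?_
    rw [Finset.mul_sum]
    exact Finset.sum_congr rfl fun y _ => by ring
  have h2 : ∀ x y, mass P x * mass P y *
        ((∑ α, v α * (f α x * f α y)) * ∑ β, v β * (g β x * g β y)) =
      ∑ α, ∑ β, mass P x * mass P y * ((v α * (f α x * f α y)) * (v β * (g β x * g β y))) := by
    intro x y
    rw [Finset.sum_mul_sum, Finset.mul_sum]
    exact Finset.sum_congr rfl fun α _ => Finset.mul_sum _ _ _
  simp only [h1, h2]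
  calc ∑ α, ∑ β, ∑ x, ∑ y, mass P x * mass P y *
        ((v α * (f α x * f α y)) * (v β * (g β x * g β y)))
      = ∑ α, ∑ x, ∑ β, ∑ y, mass P x * mass P y *
        ((v α * (f α x * f α y)) * (v β * (g β x * g β y))) :=
        Finset.sum_congr rfl fun α _ => Finset.sum_comm
    _ = ∑ x, ∑ α, ∑ β, ∑ y, mass P x * mass P y *
        ((v α * (f α x * f α y)) * (v β * (g β x * g β y))) := Finset.sum_comm
    _ = ∑ x, ∑ α, ∑ y, ∑ β, mass P x * mass P y *
        ((v α * (f α x * f α y)) * (v β * (g β x * g β y))) :=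
        Finset.sum_congr rfl fun x _ => Finset.sum_congr rfl fun α _ => Finset.sum_comm
    _ = _ := Finset.sum_congr rfl fun x _ => Finset.sum_comm

theorem sum_sum_mul_avg_mixed_le (v : ι → ℝ) (f g : ι → (Fin n → Bool) → ℝ) :
    2 * ∑ α, ∑ β, v α * v β * avg P (fun x => f α x * g β x) ^ 2 ≤
      ∑ α, ∑ β, v α * v β * avg P (fun x => f α x * f β x) ^ 2 +
      ∑ α, ∑ β, v α * v β * avg P (fun x => g α x * g β x) ^ 2 := by
  rw [sum_sum_mul_avg_sq, sum_sum_mul_avg_sq, sum_sum_mul_avg_sq, Finset.mul_sum,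
    ← Finset.sum_add_distrib]
  refine Finset.sum_le_sum fun x _ => ?_
  rw [Finset.mul_sum, ← Finset.sum_add_distrib]
  refine Finset.sum_le_sum fun y _ => ?_
  have h := mul_nonneg (mul_nonneg (mass_nonneg P x) (mass_nonneg P y))
    (sq_nonneg ((∑ α, v α * (f α x * f α y)) - ∑ β, v β * (g β x * g β y)))
  nlinarith

/-- Expanding the product gives four terms, hence a factor 4 by Cauchy–Schwarz; the two mixed sums
are together at most the two pure ones, hence a further factor 2. -/
theorem sum_sum_mul_avg_add_le {v : ι → ℝ} (hv : ∀ α, 0 ≤ v α) (f g : ι → (Fin n → Bool) → ℝ) :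
    ∑ α, ∑ β, v α * v β * avg P (fun x => (f α x + g α x) * (f β x + g β x)) ^ 2 ≤
      8 * (∑ α, ∑ β, v α * v β * avg P (fun x => f α x * f β x) ^ 2 +
      ∑ α, ∑ β, v α * v β * avg P (fun x => g α x * g β x) ^ 2) := by
  have h1 := sum_sum_mul_avg_mixed_le (P := P) v f g
  have h2 := sum_sum_mul_avg_mixed_le (P := P) v g f
  have h3 : ∑ α, ∑ β, v α * v β * avg P (fun x => (f α x + g α x) * (f β x + g β x)) ^ 2 ≤
      4 * (∑ α, ∑ β, v α * v β * avg P (fun x => f α x * f β x) ^ 2 +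
        ∑ α, ∑ β, v α * v β * avg P (fun x => f α x * g β x) ^ 2 +
        ∑ α, ∑ β, v α * v β * avg P (fun x => g α x * f β x) ^ 2 +
        ∑ α, ∑ β, v α * v β * avg P (fun x => g α x * g β x) ^ 2) := by
    rw [← Finset.sum_add_distrib, ← Finset.sum_add_distrib, ← Finset.sum_add_distrib,
      Finset.mul_sum]
    refine Finset.sum_le_sum fun α _ => ?_
    rw [← Finset.sum_add_distrib, ← Finset.sum_add_distrib, ← Finset.sum_add_distrib,
      Finset.mul_sum]
    refine Finset.sum_le_sum fun β _ => ?_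
    have h4 : avg P (fun x => (f α x + g α x) * (f β x + g β x)) =
        avg P (fun x => f α x * f β x) + avg P (fun x => f α x * g β x) +
          avg P (fun x => g α x * f β x) + avg P (fun x => g α x * g β x) := by
      rw [← avg_add, ← avg_add, ← avg_add]
      congr 1; funext x; ring
    rw [h4]
    generalize avg P (fun x => f α x * f β x) = a
    generalize avg P (fun x => f α x * g β x) = b
    generalize avg P (fun x => g α x * f β x) = c
    generalize avg P (fun x => g α x * g β x) = d
    have h5 : (a + b + c + d) ^ 2 ≤ 4 * (a ^ 2 + b ^ 2 + c ^ 2 + d ^ 2) := by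
      nlinarith [sq_nonneg (a - b), sq_nonneg (a - c), sq_nonneg (a - d), sq_nonneg (b - c),
        sq_nonneg (b - d), sq_nonneg (c - d)]
    nlinarith [mul_le_mul_of_nonneg_left h5 (mul_nonneg (hv α) (hv β))]
  linarith

theorem sum_sum_mul_avg_eq (a : ι → ℝ) (f : ι → (Fin n → Bool) → ℝ) :
    ∑ α, ∑ β, a α * a β * avg P (fun x => f α x * f β x) =
      avg P (fun x => (∑ α, a α * f α x) ^ 2) := by
  simp only [sq, Finset.sum_mul_sum]
  rw [avg_sum]
  refine Finset.sum_congr rfl fun α _ => ?_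
  rw [avg_sum]
  refine Finset.sum_congr rfl fun β _ => ?_
  rw [← avg_const_mul]
  congr 1; funext x; ring

theorem sum_sum_mul_avg_add_le' (a : ι → ℝ) (f g : ι → (Fin n → Bool) → ℝ) :
    ∑ α, ∑ β, a α * a β * avg P (fun x => (f α x + g α x) * (f β x + g β x)) ≤
      2 * (∑ α, ∑ β, a α * a β * avg P (fun x => f α x * f β x) +
      ∑ α, ∑ β, a α * a β * avg P (fun x => g α x * g β x)) := by
  rw [sum_sum_mul_avg_eq a (fun α x => f α x + g α x), sum_sum_mul_avg_eq, sum_sum_mul_avg_eq,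
    ← avg_add, ← avg_const_mul]
  refine avg_mono fun x => ?_
  simp only [mul_add, Finset.sum_add_distrib]
  nlinarith [sq_nonneg ((∑ α, a α * f α x) - ∑ α, a α * g α x)]

/-- The second moment bound for the quadratic statistic: `f` is an orthogonal family and `g` a
family of multiples of indicators. -/
theorem quad_variance_le {M u c : ℝ} (hM : 0 < M) (hu : 0 < u) (hc : 0 < c) (hc1 : c ≤ 1)
    {pr δ r s w : ι → ℝ} (hpr : ∀ α, u ≤ M * pr α) (hr : ∀ α, c / 2 ≤ r α)
    (hδ : ∀ α, |δ α| ≤ 1) (hs : ∀ α, 0 ≤ s α) (hsr : ∀ α, s α ≤ r α + |δ α|)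
    (hw : ∀ α, 0 ≤ w α) (hwM : ∀ α, w α * (M * pr α) ≤ 2) {f ind : ι → (Fin n → Bool) → ℝ}
    (hf : ∀ α β, α ≠ β → avg P (fun x => f α x * f β x) = 0)
    (hff : ∀ α, avg P (fun x => f α x * f α x) = pr α * s α)
    (hf0 : ∀ α, avg P (f α) = 0)
    (hind : ∀ α, avg P (ind α) = pr α) (hind0 : ∀ α x, 0 ≤ ind α x) (hind1 : ∀ α x, ind α x ≤ 1) :
    M ^ 2 * ∑ α, ∑ β, w α / r α * (w β / r β) * avg P (fun x => (f α x + δ α * ind α x) *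
        (f β x + δ β * ind β x)) ^ 2 +
      2 * M ^ 3 * ∑ α, ∑ β, w α / r α * (w β / r β) * (avg P (fun x => (f α x + δ α * ind α x) *
        (f β x + δ β * ind β x)) * (avg P (fun x => f α x + δ α * ind α x) *
          avg P (fun x => f β x + δ β * ind β x))) ≤
      64 * Fintype.card ι + 128 * (M * ∑ α, pr α * (δ α ^ 2 / r α)) / (c * u) +
        32 * (M * ∑ α, pr α * (δ α ^ 2 / r α)) ^ 2 / u ^ 2 +
        48 * (M * ∑ α, pr α * (δ α ^ 2 / r α)) / c +
        16 * (M * ∑ α, pr α * (δ α ^ 2 / r α)) ^ 2 / u := by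
  have hr0 : ∀ α, 0 < r α := fun α => (by positivity : (0 : ℝ) < c / 2).trans_le (hr α)
  have hpr0 : ∀ α, 0 < pr α := fun α => pos_of_mul_pos_right (hu.trans_le (hpr α)) hM.le
  set θ : ι → ℝ := fun α => δ α ^ 2 / r α with hθ
  have hθ0 : ∀ α, 0 ≤ θ α := fun α => div_nonneg (sq_nonneg _) (hr0 α).le
  set X : ℝ := M * ∑ α, pr α * θ α with hX
  have hX0 : 0 ≤ X := mul_nonneg hM.le (Finset.sum_nonneg fun α _ => mul_nonneg (hpr0 α).le (hθ0 α))
  have hw0 : ∀ α, 0 ≤ w α * (M * pr α) := fun α => mul_nonneg (hw α) (mul_nonneg hM.le (hpr0 α).le)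
  have hv0 : ∀ α, 0 ≤ w α / r α := fun α => div_nonneg (hw α) (hr0 α).le
  -- Each `M π` is at least `u`, which turns the unweighted sum of the `θ α` into `X / u`.
  have hsumθ : ∑ α, θ α ≤ X / u := by
    rw [le_div_iff₀ hu, hX, Finset.sum_mul, Finset.mul_sum]
    refine Finset.sum_le_sum fun α _ => ?_
    have := mul_le_mul_of_nonneg_left (hpr α) (hθ0 α)
    linarith
  have hsumθ0 : 0 ≤ ∑ α, θ α := Finset.sum_nonneg fun α _ => hθ0 α
  have havg : ∀ α, avg P (fun x => f α x + δ α * ind α x) = pr α * δ α := by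
    intro α
    have h1 : avg P (fun x => f α x) = 0 := hf0 α
    have h2 : avg P (fun x => ind α x) = pr α := hind α
    rw [avg_add, avg_const_mul, h1, h2]; ring
  -- squares of ratios
  have hw2 : ∀ α, (w α * (M * pr α)) ^ 2 ≤ 4 := fun α => by nlinarith [hw0 α, hwM α]
  have hsr' : ∀ α, s α / r α ≤ 1 + |δ α| / r α := fun α => by
    rw [← div_self (hr0 α).ne', ← add_div]
    exact div_le_div_of_nonneg_right (hsr α) (hr0 α).le
  have hsr0 : ∀ α, 0 ≤ s α / r α := fun α => div_nonneg (hs α) (hr0 α).le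
  have hrc : ∀ α, 1 / r α ≤ 2 / c := fun α => by
    rw [div_le_div_iff₀ (hr0 α) hc]; linarith [hr α]
  -- Residual part: only the diagonal survives. The variance `s` under `P` is compared with `r`, the
  -- one under `Q`; the excess `|δ| / r` is paid for by `θ` and `1 / r ≤ 2 / c`.
  have S11 : M ^ 2 * ∑ α, ∑ β, w α / r α * (w β / r β) * avg P (fun x => f α x * f β x) ^ 2 ≤
      8 * Fintype.card ι + 16 * X / (c * u) := by
    have h1 : ∀ α, ∑ β, w α / r α * (w β / r β) * avg P (fun x => f α x * f β x) ^ 2 =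
        w α / r α * (w α / r α) * (pr α * s α) ^ 2 := by
      classical
      intro α
      rw [Finset.sum_eq_single α, hff]
      · intro β _ hβ
        rw [hf α β hβ.symm]; ring
      · simp
    simp only [h1]
    rw [Finset.mul_sum]
    have h2 : ∀ α, M ^ 2 * (w α / r α * (w α / r α) * (pr α * s α) ^ 2) ≤
        8 + 16 / (c * u) * (M * (pr α * θ α)) := by
      intro α
      have e1 : M ^ 2 * (w α / r α * (w α / r α) * (pr α * s α) ^ 2) =
          (w α * (M * pr α)) ^ 2 * (s α / r α) ^ 2 := by ring
      have e2 : (s α / r α) ^ 2 ≤ 2 + 2 * (|δ α| / r α) ^ 2 := by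
        have := pow_le_pow_left₀ (hsr0 α) (hsr' α) 2
        nlinarith [sq_nonneg (1 - |δ α| / r α)]
      have e3 : (|δ α| / r α) ^ 2 = θ α * (1 / r α) := by
        rw [div_pow, sq_abs, hθ]; field_simp
      have e4 : θ α * (1 / r α) ≤ θ α * (2 / c) := mul_le_mul_of_nonneg_left (hrc α) (hθ0 α)
      have e5 : θ α ≤ M * (pr α * θ α) / u := by
        rw [le_div_iff₀ hu]
        have := mul_le_mul_of_nonneg_left (hpr α) (hθ0 α)
        linarith
      have e6 : θ α * (2 / c) ≤ M * (pr α * θ α) / u * (2 / c) :=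
        mul_le_mul_of_nonneg_right e5 (by positivity)
      have e7 : M * (pr α * θ α) / u * (2 / c) = 2 / (c * u) * (M * (pr α * θ α)) := by
        field_simp
      have e8 : 16 / (c * u) * (M * (pr α * θ α)) = 8 * (2 / (c * u) * (M * (pr α * θ α))) := by
        ring
      rw [e1]
      calc (w α * (M * pr α)) ^ 2 * (s α / r α) ^ 2 ≤ 4 * (s α / r α) ^ 2 :=
            mul_le_mul_of_nonneg_right (hw2 α) (sq_nonneg _)
        _ ≤ _ := by linarith
    refine (Finset.sum_le_sum fun α _ => h2 α).trans (le_of_eq ?_)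
    rw [Finset.sum_add_distrib, ← Finset.mul_sum, ← Finset.mul_sum, ← hX]
    simp [Finset.card_univ]; ring
  have hP0 : ∀ α β, 0 ≤ avg P (fun x => ind α x * ind β x) := fun α β =>
    avg_nonneg fun x => mul_nonneg (hind0 α x) (hind0 β x)
  have hP1 : ∀ α β, avg P (fun x => ind α x * ind β x) ≤ pr α := fun α β => by
    rw [← hind α]
    exact avg_mono fun x => mul_le_of_le_one_right (hind0 α x) (hind1 β x)
  have hP2 : ∀ α β, avg P (fun x => ind α x * ind β x) ≤ pr β := fun α β => by
    rw [← hind β]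
    exact avg_mono fun x => mul_le_of_le_one_left (hind0 β x) (hind1 α x)
  have hG22 : ∀ α β, avg P (fun x => δ α * ind α x * (δ β * ind β x)) =
      δ α * δ β * avg P (fun x => ind α x * ind β x) := fun α β => by
    rw [← avg_const_mul]; congr 1; funext x; ring
  -- Indicator part: the probability that two configurations occur together is at most that of
  -- either, so its square is at most their product, which the weights cancel.
  have S22 : M ^ 2 * ∑ α, ∑ β, w α / r α * (w β / r β) *
      avg P (fun x => δ α * ind α x * (δ β * ind β x)) ^ 2 ≤ 4 * (X / u) ^ 2 := by
    have h1 : 4 * (∑ α, θ α) ^ 2 ≤ 4 * (X / u) ^ 2 := by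
      have := pow_le_pow_left₀ hsumθ0 hsumθ 2
      linarith
    refine le_trans ?_ h1
    rw [sq (∑ α, θ α), Finset.sum_mul_sum, Finset.mul_sum, Finset.mul_sum]
    refine Finset.sum_le_sum fun α _ => ?_
    rw [Finset.mul_sum, Finset.mul_sum]
    refine Finset.sum_le_sum fun β _ => ?_
    rw [hG22]
    have e1 : M ^ 2 * (w α / r α * (w β / r β) *
        (δ α * δ β * avg P (fun x => ind α x * ind β x)) ^ 2) =
        (θ α * θ β) * (w α * M * (w β * M) * avg P (fun x => ind α x * ind β x) ^ 2) := by
      simp only [hθ]; ring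
    have e2 : avg P (fun x => ind α x * ind β x) ^ 2 ≤ pr α * pr β := by
      rw [sq]; exact mul_le_mul (hP1 α β) (hP2 α β) (hP0 α β) (hpr0 α).le
    have e3 : w α * M * (w β * M) * avg P (fun x => ind α x * ind β x) ^ 2 ≤ 4 := by
      have e4 : 0 ≤ w α * M * (w β * M) := mul_nonneg (mul_nonneg (hw α) hM.le)
        (mul_nonneg (hw β) hM.le)
      calc _ ≤ w α * M * (w β * M) * (pr α * pr β) := mul_le_mul_of_nonneg_left e2 e4
        _ = (w α * (M * pr α)) * (w β * (M * pr β)) := by ring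
        _ ≤ 2 * 2 := mul_le_mul (hwM α) (hwM β) (hw0 β) (by norm_num)
        _ = 4 := by norm_num
    rw [e1]
    calc _ ≤ (θ α * θ β) * 4 := mul_le_mul_of_nonneg_left e3 (mul_nonneg (hθ0 α) (hθ0 β))
      _ = _ := by ring
  have T1 : M ^ 3 * ∑ α, ∑ β, (w α / r α * (pr α * δ α)) * (w β / r β * (pr β * δ β)) *
      avg P (fun x => f α x * f β x) ≤ 12 * X / c := by
    have h1 : ∀ α, ∑ β, (w α / r α * (pr α * δ α)) * (w β / r β * (pr β * δ β)) *
        avg P (fun x => f α x * f β x) =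
        (w α / r α * (pr α * δ α)) * (w α / r α * (pr α * δ α)) * (pr α * s α) := by
      classical
      intro α
      rw [Finset.sum_eq_single α, hff]
      · intro β _ hβ
        rw [hf α β hβ.symm]; ring
      · simp
    simp only [h1]
    have h3 : 12 * X / c = ∑ α, 12 / c * (M * (pr α * θ α)) := by
      rw [← Finset.mul_sum, ← Finset.mul_sum, ← hX]; ring
    rw [h3, Finset.mul_sum]
    refine Finset.sum_le_sum fun α _ => ?_
    have e1 : M ^ 3 * ((w α / r α * (pr α * δ α)) * (w α / r α * (pr α * δ α)) * (pr α * s α)) =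
        (M * (pr α * θ α)) * ((w α * (M * pr α)) ^ 2 * (s α / r α)) := by
      simp only [hθ]; ring
    have e2 : s α / r α ≤ 3 / c := by
      have e3 : |δ α| / r α ≤ 2 / c := by
        refine le_trans ?_ (hrc α)
        exact div_le_div_of_nonneg_right (hδ α) (hr0 α).le
      have e4 : 1 ≤ 1 / c := by rw [le_div_iff₀ hc]; linarith
      have e5 : 3 / c = 1 / c + 2 / c := by ring
      linarith [hsr' α]
    have e6 : (w α * (M * pr α)) ^ 2 * (s α / r α) ≤ 4 * (3 / c) :=
      mul_le_mul (hw2 α) e2 (hsr0 α) (by norm_num)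
    rw [e1]
    calc _ ≤ (M * (pr α * θ α)) * (4 * (3 / c)) := mul_le_mul_of_nonneg_left e6
          (mul_nonneg hM.le (mul_nonneg (hpr0 α).le (hθ0 α)))
      _ = _ := by ring
  have T2 : M ^ 3 * ∑ α, ∑ β, (w α / r α * (pr α * δ α)) * (w β / r β * (pr β * δ β)) *
      avg P (fun x => δ α * ind α x * (δ β * ind β x)) ≤ 4 * X ^ 2 / u := by
    have h1 : 4 * X * ∑ β, θ β ≤ 4 * X ^ 2 / u := by
      have := mul_le_mul_of_nonneg_left hsumθ (by linarith : 0 ≤ 4 * X)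
      refine this.trans (le_of_eq ?_)
      ring
    refine le_trans ?_ h1
    rw [hX, ← mul_assoc, mul_assoc, Finset.sum_mul_sum, Finset.mul_sum, Finset.mul_sum]
    refine Finset.sum_le_sum fun α _ => ?_
    rw [Finset.mul_sum, Finset.mul_sum]
    refine Finset.sum_le_sum fun β _ => ?_
    rw [hG22]
    have e1 : M ^ 3 * ((w α / r α * (pr α * δ α)) * (w β / r β * (pr β * δ β)) *
        (δ α * δ β * avg P (fun x => ind α x * ind β x))) =
        (M * (θ α * θ β)) * ((w α * (M * pr α)) * (w β * (M * pr β)) *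
          avg P (fun x => ind α x * ind β x)) := by
      simp only [hθ]; ring
    have e2 : (w α * (M * pr α)) * (w β * (M * pr β)) * avg P (fun x => ind α x * ind β x) ≤
        2 * 2 * pr α :=
      mul_le_mul (mul_le_mul (hwM α) (hwM β) (hw0 β) (by norm_num)) (hP1 α β) (hP0 α β)
        (by norm_num)
    rw [e1]
    calc _ ≤ (M * (θ α * θ β)) * (2 * 2 * pr α) := mul_le_mul_of_nonneg_left e2
          (mul_nonneg hM.le (mul_nonneg (hθ0 α) (hθ0 β)))
      _ = _ := by ring
  have hA := sum_sum_mul_avg_add_le (P := P) hv0 f (fun α x => δ α * ind α x)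
  have hB := sum_sum_mul_avg_add_le' (P := P) (fun α => w α / r α * (pr α * δ α)) f
    (fun α x => δ α * ind α x)
  have hA' := mul_le_mul_of_nonneg_left hA (by positivity : 0 ≤ M ^ 2)
  have hB' := mul_le_mul_of_nonneg_left hB (by positivity : 0 ≤ 2 * M ^ 3)
  have hB'' : ∑ α, ∑ β, w α / r α * (w β / r β) * (avg P (fun x => (f α x + δ α * ind α x) *
        (f β x + δ β * ind β x)) * (avg P (fun x => f α x + δ α * ind α x) *
          avg P (fun x => f β x + δ β * ind β x))) =
      ∑ α, ∑ β, w α / r α * (pr α * δ α) * (w β / r β * (pr β * δ β)) *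
        avg P (fun x => (f α x + δ α * ind α x) * (f β x + δ β * ind β x)) := by
    refine Finset.sum_congr rfl fun α _ => Finset.sum_congr rfl fun β _ => ?_
    rw [havg, havg]; ring
  rw [hB'']
  -- The quadratic parts carry the factor 8 of `sum_sum_mul_avg_add_le`; the linear parts carry 2
  -- from `sum_sum_mul_avg_add_le'` and 2 from the variance formula.
  have hfin : 4 * (X / u) ^ 2 * 8 = 32 * X ^ 2 / u ^ 2 := by rw [div_pow]; ring
  have hfin2 : (16 * X / (c * u)) * 8 = 128 * X / (c * u) := by ring
  have hfin3 : 12 * X / c * 4 = 48 * X / c := by ring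
  have hfin4 : 4 * X ^ 2 / u * 4 = 16 * X ^ 2 / u := by ring
  linarith

end Variance

/-! ### The statistic's expectation dominates the squared distance -/

section Divergence

variable {n : ℕ} {S : BNStructure n} {σ : Equiv.Perm (Fin n)} {P Q : Measure (Fin n → Bool)}

theorem table_congr {i : Fin n} {a b : Fin n → Bool} (h : ∀ j ∈ S.pa i, a j = b j) :
    table S P i a = table S P i b := by
  have h1 : ∀ j ∈ insert i (S.pa i), Function.update a i true j = Function.update b i true j := by
    intro j hj
    by_cases hji : j = i
    · subst hji; simp
    · rw [Function.update_of_ne hji, Function.update_of_ne hji,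
        h j ((Finset.mem_insert.1 hj).resolve_left hji)]
  rw [table, table, marg_congr h, marg_congr h1]

theorem marg_insert_eq_table {i : Fin n} {x : Fin n → Bool}
    (hx : 0 < marg (mass P) (S.pa i) x) :
    marg (mass P) (insert i (S.pa i)) x / marg (mass P) (S.pa i) x =
      bit x i * table S P i x + (1 - bit x i) * (1 - table S P i x) := by
  have h1 := marg_insert_update (F := mass P) (x := x) (S.notMem_pa i)
  have h2 : Function.update x i (x i) = x := Function.update_eq_self i x
  have h3 : 1 - table S P i x =
      marg (mass P) (insert i (S.pa i)) (Function.update x i false) / marg (mass P) (S.pa i) x := by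
    rw [table, eq_div_iff hx.ne', sub_mul, div_mul_cancel₀ _ hx.ne']
    linarith
  rw [h3, table, bit]
  cases h : x i
  · rw [h] at h2
    simp [h2]
  · rw [h] at h2
    simp [h2]

theorem table_mem_Icc (P : Measure (Fin n → Bool)) [IsProbabilityMeasure P] (i : Fin n)
    (a : Fin n → Bool) : table S P i a ∈ Set.Icc (0 : ℝ) 1 := by
  have h0 := mass_nonneg P
  refine ⟨div_nonneg (marg_nonneg h0 _ _) (marg_nonneg h0 _ _), div_le_one_of_le₀ ?_
    (marg_nonneg h0 _ _)⟩
  have h1 := marg_insert_update (F := mass P) (x := a) (S.notMem_pa i)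
  have h2 := marg_nonneg h0 (insert i (S.pa i)) (Function.update a i false)
  linarith

/-- By the chain rule the mass is a product of table entries or their complements; induction along
the numbering shows that no factor vanishes. -/
theorem IsMarkov.mass_pos [IsProbabilityMeasure Q] (hσ : IsNumbering S σ)
    (hS : IsMarkov S σ (mass Q)) (hpa : ∀ i x, 0 < marg (mass Q) (S.pa i) x)
    (ht : ∀ i x, 0 < table S Q i x ∧ table S Q i x < 1) (x : Fin n → Bool) : 0 < mass Q x := by
  have hins : ∀ i, 0 < marg (mass Q) (insert i (S.pa i)) x := by
    intro i
    have h1 := marg_insert_eq_table (hpa i x)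
    have h2 : 0 < bit x i * table S Q i x + (1 - bit x i) * (1 - table S Q i x) := by
      have := ht i x
      unfold bit
      cases x i <;> simp <;> linarith
    rw [← h1] at h2
    exact (div_pos_iff_of_pos_right (hpa i x)).1 h2
  have key : ∀ k ≤ n, 0 < marg (mass Q) (initialNodes σ k) x := by
    intro k
    induction k with
    | zero =>
      intro _
      have h1 : initialNodes σ 0 = ∅ := by ext j; simp [initialNodes]
      rw [h1, marg_empty, sum_mass]
      exact one_pos
    | succ k ih =>
      intro hk
      have h1 := ih (by omega)
      have h2 : ((σ (σ.symm ⟨k, hk⟩) : Fin n) : ℕ) = k := by simp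
      rw [← h2] at h1 ⊢
      rw [initialNodes_val] at h1
      rw [initialNodes_succ]
      have h3 := hS (σ.symm ⟨k, hk⟩) (predecessors σ (σ.symm ⟨k, hk⟩)) x (fun j hj =>
        mem_predecessors.2 (hσ _ _ (BNStructure.mem_pa.1 hj))) (Finset.Subset.refl _)
      have h4 := mul_pos h1 (hins (σ.symm ⟨k, hk⟩))
      rw [← h3] at h4
      exact pos_of_mul_pos_left h4 (hpa _ x).le
  have h1 := key n le_rfl
  have h2 : initialNodes σ n = Finset.univ := by ext j; simp [initialNodes]
  rwa [h2, marg_univ] at h1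

variable {ι : Type*} [Fintype ι] {node : ι → Fin n} {conf : ι → Fin n → Bool}

/-- For one entry, `p · p / q + (1 - p) · (1 - p) / (1 - q) - 1 = (p - q)² / (q (1 - q))`, the
chi-square divergence of the two conditional laws of a bit. -/
theorem IsTable.avg_sum_ratio [IsProbabilityMeasure P] [IsProbabilityMeasure Q]
    (hT : IsTable S node conf) (hσ : IsNumbering S σ)
    (hSP : IsMarkov S σ (mass P)) (hpP : ∀ i x, 0 < marg (mass P) (S.pa i) x)
    (hpQ : ∀ i x, 0 < marg (mass Q) (S.pa i) x)
    (ht : ∀ i x, 0 < table S Q i x ∧ table S Q i x < 1) :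
    avg P (fun x => ∑ i, ((marg (mass P) (insert i (S.pa i)) x / marg (mass P) (S.pa i) x) /
      (marg (mass Q) (insert i (S.pa i)) x / marg (mass Q) (S.pa i) x) - 1)) =
    ∑ α, marg (mass P) (S.pa (node α)) (conf α) *
      ((table S P (node α) (conf α) - table S Q (node α) (conf α)) ^ 2 /
        (table S Q (node α) (conf α) * (1 - table S Q (node α) (conf α)))) := by
  have h1 : ∀ x, ∑ i, ((marg (mass P) (insert i (S.pa i)) x / marg (mass P) (S.pa i) x) /
      (marg (mass Q) (insert i (S.pa i)) x / marg (mass Q) (S.pa i) x) - 1) =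
      ∑ α, parInd S (node α) (conf α) x * (bit x (node α) *
        (table S P (node α) (conf α) / table S Q (node α) (conf α)) + (1 - bit x (node α)) *
        ((1 - table S P (node α) (conf α)) / (1 - table S Q (node α) (conf α))) - 1) := by
    intro x
    refine (hT.sum_parInd _ (fun i x => (marg (mass P) (insert i (S.pa i)) x /
      marg (mass P) (S.pa i) x) / (marg (mass Q) (insert i (S.pa i)) x /
      marg (mass Q) (S.pa i) x) - 1) x ?_).symm
    intro α hα
    rw [marg_insert_eq_table (hpP _ x), marg_insert_eq_table (hpQ _ x), table_congr hα,
      table_congr hα]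
    unfold bit
    cases x (node α) <;> simp
  simp only [h1]
  rw [avg_sum]
  refine Finset.sum_congr rfl fun α _ => ?_
  have h2 : ∀ x, parInd S (node α) (conf α) x * (bit x (node α) *
        (table S P (node α) (conf α) / table S Q (node α) (conf α)) + (1 - bit x (node α)) *
        ((1 - table S P (node α) (conf α)) / (1 - table S Q (node α) (conf α))) - 1) =
      (table S P (node α) (conf α) / table S Q (node α) (conf α) -
        (1 - table S P (node α) (conf α)) / (1 - table S Q (node α) (conf α))) *
        (parInd S (node α) (conf α) x * bit x (node α)) +
      ((1 - table S P (node α) (conf α)) / (1 - table S Q (node α) (conf α)) - 1) *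
        parInd S (node α) (conf α) x := fun x => by ring
  simp only [h2]
  have h3 : avg P (fun x => parInd S (node α) (conf α) x) =
      marg (mass P) (S.pa (node α)) (conf α) := avg_parInd _ _
  rw [avg_add, avg_const_mul, avg_const_mul, avg_parInd_mul_bit hσ hSP (hpP _ _), h3]
  obtain ⟨h4, h5⟩ := ht (node α) (conf α)
  have h6 : 1 - table S Q (node α) (conf α) ≠ 0 := by linarith
  field_simp
  ring

/-- `log t ≤ t - 1` at `t = √(q / p)` bounds the squared Hellinger distance by the mean of the
log-likelihood ratio, and Cauchy–Schwarz bounds the squared `L¹` distance by four times the squared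
Hellinger distance. A pointwise upper bound `L` of the ratio is enough; it is needed only on the
support of `P`. -/
theorem sq_l1Dist_le [IsProbabilityMeasure P] [IsProbabilityMeasure Q] {L : (Fin n → Bool) → ℝ}
    (hQ : ∀ x, 0 < mass Q x)
    (hL : ∀ x, 0 < mass P x → Real.log (mass P x) - Real.log (mass Q x) ≤ L x) :
    l1Dist P Q ^ 2 ≤ 4 * avg P L := by
  have h1 : ∀ x, (√(mass P x) - √(mass Q x)) ^ 2 + (mass P x - mass Q x) ≤ mass P x * L x := by
    intro x
    have hq := Real.sq_sqrt (hQ x).le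
    rcases (mass_nonneg P x).eq_or_lt with h0 | h0
    · rw [← h0]; simp; linarith
    · have hp := Real.sq_sqrt h0.le
      have hsp := Real.sqrt_pos.2 h0
      have hsq := Real.sqrt_pos.2 (hQ x)
      have h2 := Real.log_le_sub_one_of_pos (div_pos hsq hsp)
      rw [Real.log_div hsq.ne' hsp.ne', Real.log_sqrt (hQ x).le, Real.log_sqrt h0.le] at h2
      have h3 := hL x h0
      have h4 : 2 - 2 * (√(mass Q x) / √(mass P x)) ≤ L x := by linarith
      have h5 := mul_le_mul_of_nonneg_left h4 h0.le
      have h6 : mass P x * (√(mass Q x) / √(mass P x)) = √(mass P x) * √(mass Q x) := by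
        nth_rewrite 1 [← hp]; field_simp
      have h7 : mass P x * (2 - 2 * (√(mass Q x) / √(mass P x))) =
          2 * mass P x - 2 * (√(mass P x) * √(mass Q x)) := by rw [← h6]; ring
      nlinarith
  have h2 : ∑ x, (√(mass P x) - √(mass Q x)) ^ 2 ≤ avg P L := by
    have h3 := Finset.sum_le_sum fun x (_ : x ∈ Finset.univ) => h1 x
    rw [Finset.sum_add_distrib, Finset.sum_sub_distrib, sum_mass, sum_mass] at h3
    unfold avg
    linarith
  have h3 : ∑ x, (√(mass P x) + √(mass Q x)) ^ 2 ≤ 4 := by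
    have h4 : ∑ x, (√(mass P x) + √(mass Q x)) ^ 2 ≤ ∑ x, (2 * mass P x + 2 * mass Q x) := by
      refine Finset.sum_le_sum fun x _ => ?_
      nlinarith [Real.sq_sqrt (mass_nonneg P x), Real.sq_sqrt (mass_nonneg Q x),
        sq_nonneg (√(mass P x) - √(mass Q x))]
    rw [Finset.sum_add_distrib, ← Finset.mul_sum, ← Finset.mul_sum, sum_mass, sum_mass] at h4
    linarith
  have h4 : l1Dist P Q = ∑ x, |√(mass P x) - √(mass Q x)| * (√(mass P x) + √(mass Q x)) := by
    unfold l1Dist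
    refine Finset.sum_congr rfl fun x _ => ?_
    have h5 : 0 ≤ √(mass P x) + √(mass Q x) := by positivity
    rw [← abs_of_nonneg h5, ← abs_mul]
    congr 1
    have := Real.sq_sqrt (mass_nonneg P x)
    have := Real.sq_sqrt (mass_nonneg Q x)
    change mass P x - mass Q x = _
    nlinarith
  have h5 := Finset.sum_mul_sq_le_sq_mul_sq Finset.univ
    (fun x => |√(mass P x) - √(mass Q x)|) (fun x => √(mass P x) + √(mass Q x))
  rw [← h4] at h5
  simp only [sq_abs] at h5
  have h6 : 0 ≤ ∑ x, (√(mass P x) - √(mass Q x)) ^ 2 := Finset.sum_nonneg fun x _ => sq_nonneg _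
  nlinarith

theorem IsTable.sq_l1Dist_le [IsProbabilityMeasure P] [IsProbabilityMeasure Q]
    (hT : IsTable S node conf) (hσ : IsNumbering S σ)
    (hSP : IsMarkov S σ (mass P)) (hpP : ∀ i x, 0 < marg (mass P) (S.pa i) x)
    {τ : Equiv.Perm (Fin n)} (hτ : IsNumbering S τ) (hSQ : IsMarkov S τ (mass Q))
    (hpQ : ∀ i x, 0 < marg (mass Q) (S.pa i) x)
    (ht : ∀ i x, 0 < table S Q i x ∧ table S Q i x < 1) :
    l1Dist P Q ^ 2 ≤ 4 * ∑ α, marg (mass P) (S.pa (node α)) (conf α) *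
      ((table S P (node α) (conf α) - table S Q (node α) (conf α)) ^ 2 /
        (table S Q (node α) (conf α) * (1 - table S Q (node α) (conf α)))) := by
  rw [← hT.avg_sum_ratio hσ hSP hpP hpQ ht]
  refine _root_.sq_l1Dist_le (hSQ.mass_pos hτ hpQ ht) fun x hx => ?_
  have hQx := hSQ.mass_pos hτ hpQ ht x
  rw [hSP.log_mass (mass_nonneg P) (sum_mass P) hσ hx,
    hSQ.log_mass (mass_nonneg Q) (sum_mass Q) hτ hQx, ← Finset.sum_sub_distrib]
  refine Finset.sum_le_sum fun i _ => ?_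
  have p1 := hx.trans_le (le_marg (mass_nonneg P) (insert i (S.pa i)) x)
  have p2 := hpP i x
  have q1 := hQx.trans_le (le_marg (mass_nonneg Q) (insert i (S.pa i)) x)
  have q2 := hpQ i x
  have h := Real.log_le_sub_one_of_pos (div_pos (div_pos p1 p2) (div_pos q1 q2))
  rwa [Real.log_div (div_pos p1 p2).ne' (div_pos q1 q2).ne', Real.log_div p1.ne' p2.ne',
    Real.log_div q1.ne' q2.ne'] at h

end Divergence

/-! ### What the tester computes, in terms of the samples -/

section Link

variable {n d : ℕ} {ε γ : ℝ} {S : BNStructure n} {Q : Measure (Fin n → Bool)}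

theorem testerInput_edge_pos (ω : Tape n) (i j : Fin n) :
    0 < (testerInput d ε γ S Q ω).edge i j ↔ S.Adj i j := by
  unfold testerInput
  by_cases h : S.Adj i j <;> simp [h]

theorem testerInput_sample (ω : Tape n) (s : ℕ) (i : Fin n) :
    (testerInput d ε γ S Q ω).sample s i = ((ω s).1 i).toNat := by
  simp [testerInput]

/-- The number of parents of `X_i` with index less than `j`. -/
noncomputable def parRank (S : BNStructure n) (i : Fin n) (j : ℕ) : ℕ :=
  ((S.pa i).filter fun l : Fin n => (l : ℕ) < j).card

theorem tableConfig_eq (i : Fin n) (k : ℕ) (j : Fin n) :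
    tableConfig S i k j = k.testBit (parRank S i j) := by
  unfold tableConfig parRank
  congr 1
  rw [← Set.ncard_coe_finset]
  congr 1
  ext l
  simp [BNStructure.mem_pa, BNStructure.parents]

theorem parRank_succ (i : Fin n) (j : Fin n) :
    parRank S i (j + 1) = parRank S i j + if j ∈ S.pa i then 1 else 0 := by
  classical
  have h : (S.pa i).filter (fun l : Fin n => (l : ℕ) < j + 1) =
      (S.pa i).filter (fun l : Fin n => (l : ℕ) < j) ∪ (S.pa i).filter (fun l => l = j) := by
    rw [← Finset.filter_or]
    refine Finset.filter_congr fun l _ => ?_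
    rw [Nat.lt_succ_iff_lt_or_eq, Fin.ext_iff]
  have h2 : ((S.pa i).filter (fun l => l = j)).card = if j ∈ S.pa i then 1 else 0 := by
    rw [Finset.filter_eq']
    split_ifs <;> simp
  rw [parRank, h, Finset.card_union_of_disjoint, h2, parRank]
  rw [Finset.disjoint_filter]
  rintro l _ h3 rfl
  omega

theorem parRank_self (i : Fin n) : parRank S i n = (S.pa i).card := by
  rw [parRank, Finset.filter_true_of_mem]
  intro l _
  exact l.2

theorem parPow_eq (ω : Tape n) (i : Fin n) {j : ℕ} (hj : j ≤ n) :
    parPow (testerInput d ε γ S Q ω) i j = 2 ^ parRank S i j := by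
  induction j with
  | zero => simp [parPow, parRank]
  | succ j ih =>
    have h1 := parRank_succ (S := S) i ⟨j, hj⟩
    have h2 := testerInput_edge_pos (d := d) (ε := ε) (γ := γ) (S := S) (Q := Q) ω ⟨j, hj⟩ i
    simp only at h1 h2
    rw [parPow, h1, ih (by omega)]
    by_cases h : S.Adj ⟨j, hj⟩ i
    · rw [if_pos (h2.2 h), if_pos (BNStructure.mem_pa.2 h), pow_succ]; omega
    · rw [if_neg (mt h2.1 h), if_neg (mt BNStructure.mem_pa.1 h), add_zero]

/-- Reduction modulo `2 ^ parRank` lets the induction over `j` keep the number `k` fixed: a further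
parent compares one more binary digit of `k`. -/
theorem parIdx_eq_iff (ω : Tape n) (t : ℕ) (i : Fin n) {j : ℕ} (hj : j ≤ n) :
    parIdx (testerInput d ε γ S Q ω) t i j < 2 ^ parRank S i j ∧
    ∀ k, parIdx (testerInput d ε γ S Q ω) t i j = k % 2 ^ parRank S i j ↔
      ∀ l ∈ S.pa i, (l : ℕ) < j → (ω t).1 l = tableConfig S i k l := by
  induction j with
  | zero => simp [parIdx, parRank, Nat.mod_one]
  | succ j ih =>
    obtain ⟨ih1, ih2⟩ := ih (by omega)
    have h1 := parRank_succ (S := S) i ⟨j, hj⟩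
    have h2 := testerInput_edge_pos (d := d) (ε := ε) (γ := γ) (S := S) (Q := Q) ω ⟨j, hj⟩ i
    have h3 := testerInput_sample (d := d) (ε := ε) (γ := γ) (S := S) (Q := Q) ω t ⟨j, hj⟩
    simp only at h1 h2 h3
    have hsplit : ∀ k, (∀ l ∈ S.pa i, (l : ℕ) < j + 1 → (ω t).1 l = tableConfig S i k l) ↔
        (∀ l ∈ S.pa i, (l : ℕ) < j → (ω t).1 l = tableConfig S i k l) ∧
        ((⟨j, hj⟩ : Fin n) ∈ S.pa i → (ω t).1 ⟨j, hj⟩ = k.testBit (parRank S i j)) := by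
      intro k
      constructor
      · refine fun h => ⟨fun l hl hlj => h l hl (by omega), fun hm => ?_⟩
        rw [h _ hm (by simp), tableConfig_eq]
      · rintro ⟨h, h'⟩ l hl hlj
        rcases Nat.lt_succ_iff_lt_or_eq.1 hlj with h4 | h4
        · exact h l hl h4
        · have h5 : l = ⟨j, hj⟩ := Fin.ext h4
          subst h5
          rw [h' hl, tableConfig_eq]
    rw [parIdx, h1, h3, parPow_eq ω i (by omega)]
    by_cases h : S.Adj ⟨j, hj⟩ i
    · have hm := BNStructure.mem_pa.2 h
      rw [if_pos hm, pow_succ]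
      constructor
      · split_ifs <;> omega
      · intro k
        rw [hsplit, ← ih2]
        simp only [hm, true_imp_iff, h2.2 h, true_and]
        have h6 : k % (2 ^ parRank S i j * 2) = k % 2 ^ parRank S i j +
            2 ^ parRank S i j * (k / 2 ^ parRank S i j % 2) := Nat.mod_mul
        have h7 : k.testBit (parRank S i j) = decide (k / 2 ^ parRank S i j % 2 = 1) :=
          Nat.testBit_eq_decide_div_mod_eq
        have h8 : k % 2 ^ parRank S i j < 2 ^ parRank S i j := Nat.mod_lt _ (by positivity)
        rw [h6, h7]
        rcases Nat.mod_two_eq_zero_or_one (k / 2 ^ parRank S i j) with h9 | h9 <;>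
          rw [h9] <;> cases (ω t).1 ⟨j, hj⟩ <;> simp <;> omega
    · rw [if_neg (mt BNStructure.mem_pa.1 h), add_zero, if_neg (fun h' => h (h2.1 h'.1))]
      refine ⟨ih1, fun k => ?_⟩
      rw [hsplit, ih2]
      simp [mt BNStructure.mem_pa.1 h]

theorem parIdx_lt (ω : Tape n) (t : ℕ) (i : Fin n) :
    parIdx (testerInput d ε γ S Q ω) t i n < 2 ^ (S.pa i).card := by
  rw [← parRank_self]; exact (parIdx_eq_iff ω t i le_rfl).1

theorem parIdx_eq (ω : Tape n) (t : ℕ) (i : Fin n) {k : ℕ} (hk : k < 2 ^ (S.pa i).card) :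
    parIdx (testerInput d ε γ S Q ω) t i n = k ↔
      ∀ l ∈ S.pa i, (ω t).1 l = tableConfig S i k l := by
  have h := (parIdx_eq_iff (d := d) (ε := ε) (γ := γ) (S := S) (Q := Q) ω t i le_rfl).2 k
  rw [parRank_self, Nat.mod_eq_of_lt hk] at h
  rw [h]
  exact forall₂_congr fun l _ => ⟨fun h => h l.2, fun h _ => h⟩

/-- The entries of the conditional probability table. -/
abbrev TableIndex (S : BNStructure n) : Type := Σ i : Fin n, Fin (2 ^ (S.pa i).card)

theorem isTable_tableConfig {n : ℕ} (S : BNStructure n) :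
    IsTable S (fun α : TableIndex S => α.1) (fun α => tableConfig S α.1 α.2) := by
  intro i x
  -- The index function of the program is used as a decoder, on the tape all of whose samples are
  -- `x`; the remaining arguments are irrelevant.
  obtain ⟨k, hk, h⟩ : ∃ k < 2 ^ (S.pa i).card, ∀ k' < 2 ^ (S.pa i).card,
      k = k' ↔ ∀ l ∈ S.pa i, x l = tableConfig S i k' l :=
    ⟨_, parIdx_lt (d := 0) (ε := 0) (γ := 0) (Q := 0) (fun _ => (x, false)) 0 i,
      fun k' hk' => parIdx_eq (fun _ => (x, false)) 0 i hk'⟩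
  refine ⟨⟨i, k, hk⟩, ⟨rfl, (h k hk).1 rfl⟩, ?_⟩
  rintro ⟨i', k', hk'⟩ ⟨rfl, h'⟩
  have h1 : k = k' := (h k' hk').2 h'
  subst h1
  rfl

/-- The number of samples with times in `T` with the given parental configuration. -/
noncomputable def tableCount (S : BNStructure n) (T : Finset ℕ) (ω : Tape n)
    (α : TableIndex S) : ℝ := ∑ s ∈ T, parInd S α.1 (tableConfig S α.1 α.2) (ω s).1

/-- The sum, over the samples with the given parental configuration, of the deviations from
the table of `Q`. -/
noncomputable def tableDev (S : BNStructure n) (Q : Measure (Fin n → Bool)) (T : Finset ℕ)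
    (ω : Tape n) (α : TableIndex S) : ℝ :=
  ∑ s ∈ T, parInd S α.1 (tableConfig S α.1 α.2) (ω s).1 *
    (bit (ω s).1 α.1 - table S Q α.1 (tableConfig S α.1 α.2))

theorem sum_Ico_shift (f : ℕ → ℝ) (o m : ℕ) :
    ∑ t ∈ Finset.range m, f (t + o) = ∑ s ∈ Finset.Ico o (o + m), f s := by
  rw [Finset.sum_Ico_eq_sum_range, Nat.add_sub_cancel_left]
  exact Finset.sum_congr rfl fun t _ => by rw [add_comm]

theorem parCount_eq (ω : Tape n) (o m : ℕ) (α : TableIndex S) :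
    (parCount (testerInput d ε γ S Q ω) o m α.1 α.2 : ℝ) =
      tableCount S (Finset.Ico o (o + m)) ω α := by
  rw [tableCount, ← sum_Ico_shift, parCount]
  push_cast
  refine Finset.sum_congr rfl fun t _ => ?_
  have h := parIdx_eq (d := d) (ε := ε) (γ := γ) (S := S) (Q := Q) ω (t + o) α.1 α.2.2
  change (if parIdx _ (t + o) α.1 n = _ then (1 : ℝ) else 0) = _
  unfold parInd
  simp only [h]

theorem parOnes_eq (ω : Tape n) (o m : ℕ) (α : TableIndex S) :
    (parOnes (testerInput d ε γ S Q ω) o m α.1 α.2 : ℝ) -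
      parCount (testerInput d ε γ S Q ω) o m α.1 α.2 *
        table S Q α.1 (tableConfig S α.1 α.2) = tableDev S Q (Finset.Ico o (o + m)) ω α := by
  rw [parCount_eq, tableCount, tableDev, ← sum_Ico_shift, ← sum_Ico_shift, parOnes, Finset.sum_mul]
  push_cast
  rw [← Finset.sum_sub_distrib]
  refine Finset.sum_congr rfl fun t _ => ?_
  have h := parIdx_eq (d := d) (ε := ε) (γ := γ) (S := S) (Q := Q) ω (t + o) α.1 α.2.2
  have h' := testerInput_sample (d := d) (ε := ε) (γ := γ) (S := S) (Q := Q) ω (t + o) α.1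
  change (if parIdx _ (t + o) α.1 n = _ then _ else _) - _ = _
  rw [h']
  unfold parInd bit
  simp only [h]
  split_ifs <;> simp

theorem testerInput_cpt [IsProbabilityMeasure Q] (ω : Tape n) (α : TableIndex S) :
    (testerInput d ε γ S Q ω).cpt α.1 α.2 = table S Q α.1 (tableConfig S α.1 α.2) := by
  simp [testerInput, condProbTable_eq_table]

/-- The statistic of the identity test. -/
noncomputable def idStat (S : BNStructure n) (Q : Measure (Fin n → Bool)) (M : ℕ) (ω : Tape n) :
    ℝ :=
  ∑ α : TableIndex S, 1 / tableCount S (Finset.range M) ω α /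
    (table S Q α.1 (tableConfig S α.1 α.2) * (1 - table S Q α.1 (tableConfig S α.1 α.2))) *
    (tableDev S Q (Finset.Ico M (M + M)) ω α *
      tableDev S Q (Finset.Ico (M + M) (M + M + M)) ω α)

/-- The identity test accepts. -/
def IdAccepts (S : BNStructure n) (Q : Measure (Fin n → Bool)) (M : ℕ) (τ b : ℝ)
    (ω : Tape n) : Prop :=
  (∀ α, τ ≤ tableCount S (Finset.range M) ω α) ∧ idStat S Q M ω ≤ b

theorem sum_tableIndex (g : ℕ → ℕ → ℝ) :
    ∑ i ∈ Finset.range n, ∑ k ∈ Finset.range (if h : i < n then 2 ^ (S.pa ⟨i, h⟩).card else 0),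
      g i k = ∑ α : TableIndex S, g α.1 α.2 := by
  rw [Fintype.sum_sigma, Finset.sum_range]
  refine Finset.sum_congr rfl fun i _ => ?_
  simp [Finset.sum_range]

/-- The terms of rare entries are zero in the program but not in `idStat`; the two statistics are
needed to agree only when no entry is rare. -/
theorem accepts_iff [IsProbabilityMeasure Q] (ω : Tape n) (K₃ M m : ℕ) :
    Accepts (testerInput d ε γ S Q ω) K₃ M m ↔
      (∀ u < (n + 1) ^ d, ∀ i j : Fin n,
        ¬ ciFails (testerInput d ε γ S Q ω) m (2 ^ d) (tupleDigit n u) i j) ∧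
      IdAccepts S Q M (K₃ * (d + Nat.clog 2 n + 1 : ℕ)) (M * ε ^ 2 / 16) ω := by
  set I := testerInput d ε γ S Q ω with hI
  set τ : ℝ := K₃ * (d + Nat.clog 2 n + 1 : ℕ) with hτ
  have hpow : ∀ i : Fin n, parPow I i n = 2 ^ (S.pa i).card := fun i => by
    rw [hI, parPow_eq ω i le_rfl, parRank_self]
  have hcount : ∀ α : TableIndex S, (parCount I 0 M α.1 α.2 : ℝ) =
      tableCount S (Finset.range M) ω α := fun α => by
    rw [hI, parCount_eq, zero_add, Nat.Ico_zero_eq_range]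
  have h1 : (¬ ∃ u < (n + 1) ^ d, ∃ i < n, ∃ j < n, ciFails I m (2 ^ d) (tupleDigit n u) i j) ↔
      ∀ u < (n + 1) ^ d, ∀ i j : Fin n, ¬ ciFails I m (2 ^ d) (tupleDigit n u) i j := by
    push Not
    exact forall₂_congr fun u _ => ⟨fun h i j => h i i.2 j j.2,
      fun h i hi j hj => h ⟨i, hi⟩ ⟨j, hj⟩⟩
  have h2 : (¬ ∃ i < n, ∃ k < parPow I i n, idFails I M τ i k) ↔
      ∀ α, τ ≤ tableCount S (Finset.range M) ω α := by
    push Not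
    constructor
    · rintro h ⟨i, k, hk⟩
      have h3 := h i i.2 k (by rwa [hpow i])
      rw [idFails, not_lt] at h3
      rw [← hcount]; exact h3
    · intro h i hi k hk
      have h3 := h ⟨⟨i, hi⟩, k, by rwa [← hpow ⟨i, hi⟩]⟩
      rw [← hcount] at h3
      rwa [idFails, not_lt]
  have h3 : (∀ α, τ ≤ tableCount S (Finset.range M) ω α) →
      ∑ i ∈ Finset.range n, ∑ k ∈ Finset.range (parPow I i n), idTerm I M τ i k =
        idStat S Q M ω := by
    intro h
    have h4 : ∑ i ∈ Finset.range n, ∑ k ∈ Finset.range (parPow I i n), idTerm I M τ i k =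
        ∑ i ∈ Finset.range n, ∑ k ∈ Finset.range
          (if h : i < n then 2 ^ (S.pa ⟨i, h⟩).card else 0), idTerm I M τ i k := by
      refine Finset.sum_congr rfl fun i hi => ?_
      have hi' := Finset.mem_range.1 hi
      have := hpow ⟨i, hi'⟩
      simp only at this
      rw [this, dif_pos hi']
    rw [h4, sum_tableIndex, idStat]
    refine Finset.sum_congr rfl fun α _ => ?_
    have h5 : ¬ idFails I M τ α.1 α.2 := by
      rw [idFails, not_lt, hcount]; exact h α
    have h6 : I.cpt α.1 α.2 = table S Q α.1 (tableConfig S α.1 α.2) := testerInput_cpt ω α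
    rw [idTerm, if_neg h5, h6, hcount, hI, parOnes_eq, parOnes_eq, div_div, mul_comm (_ * _)
      (tableCount _ _ _ _), ← mul_one_div, mul_comm]
  have h7 : (M : ℝ) * (I.eps * I.eps) / 16 = M * ε ^ 2 / 16 := by
    rw [sq]; rfl
  unfold Accepts IdAccepts
  rw [h7]
  refine and_congr h1 ?_
  constructor
  · rintro ⟨ha, hb⟩
    have ha' := h2.1 ha
    exact ⟨ha', by rw [← h3 ha']; exact hb⟩
  · rintro ⟨ha, hb⟩
    exact ⟨h2.2 ha, by rw [← h3 ha] at hb; exact hb⟩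

end Link

/-! ### The probability that the identity test accepts -/

section IdentityTest

variable {n : ℕ} {S : BNStructure n} {σ : Equiv.Perm (Fin n)} {P Q : Measure (Fin n → Bool)}

/-- The probability of the parental configuration. -/
noncomputable def entryProb (S : BNStructure n) (P : Measure (Fin n → Bool)) (α : TableIndex S) :
    ℝ := marg (mass P) (S.pa α.1) (tableConfig S α.1 α.2)

noncomputable def entry (S : BNStructure n) (P : Measure (Fin n → Bool)) (α : TableIndex S) : ℝ :=
  table S P α.1 (tableConfig S α.1 α.2)

/-- The divergence of the conditional distributions of `P` and `Q`, averaged under `P`. -/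
noncomputable def divergence (S : BNStructure n) (P Q : Measure (Fin n → Bool)) : ℝ :=
  ∑ α : TableIndex S, entryProb S P α *
    ((entry S P α - entry S Q α) ^ 2 / (entry S Q α * (1 - entry S Q α)))

theorem avg_entry (α : TableIndex S) :
    avg P (fun x => if x ∈ {x | ∀ j ∈ S.pa α.1, x j = tableConfig S α.1 α.2 j} then 1 else 0) =
      entryProb S P α := by
  rw [entryProb, ← avg_parInd]
  unfold avg parInd
  simp

theorem tableCount_eq (T : Finset ℕ) (ω : Tape n) (α : TableIndex S) :
    tableCount S T ω α = ∑ s ∈ T, if (ω s).1 ∈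
      {x : Fin n → Bool | ∀ j ∈ S.pa α.1, x j = tableConfig S α.1 α.2 j} then (1 : ℝ) else 0 := by
  unfold tableCount parInd
  simp

theorem measure_count_bad [IsProbabilityMeasure P] {M : ℕ} {u : ℝ} (hu : 0 ≤ u)
    (h : ∀ α, u ≤ M * entryProb S P α) :
    (tapeLaw P).real {ω | ¬ ∀ α : TableIndex S,
      M * entryProb S P α / 2 < tableCount S (Finset.range M) ω α ∧
      tableCount S (Finset.range M) ω α < 2 * (M * entryProb S P α)} ≤
      Fintype.card (TableIndex S) * (2 * Real.exp (-u / 8)) := by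
  have hY := isSampling_tapeLaw P
  have h1 : {ω : Tape n | ¬ ∀ α : TableIndex S,
      M * entryProb S P α / 2 < tableCount S (Finset.range M) ω α ∧
      tableCount S (Finset.range M) ω α < 2 * (M * entryProb S P α)} ⊆
      ⋃ α ∈ (Finset.univ : Finset (TableIndex S)),
        ({ω | tableCount S (Finset.range M) ω α ≤ M * entryProb S P α / 2} ∪
        {ω | 2 * (M * entryProb S P α) ≤ tableCount S (Finset.range M) ω α}) := by
    intro ω hω
    simp only [Set.mem_ofPred_eq, not_forall, not_and_or, not_lt] at hω
    simpa using hω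
  have h2 : ∀ α : TableIndex S,
      (tapeLaw P).real ({ω | tableCount S (Finset.range M) ω α ≤ M * entryProb S P α / 2} ∪
        {ω | 2 * (M * entryProb S P α) ≤ tableCount S (Finset.range M) ω α}) ≤
      2 * Real.exp (-u / 8) := by
    intro α
    have h3 := hY.chernoff_lower {x | ∀ j ∈ S.pa α.1, x j = tableConfig S α.1 α.2 j}
      (Finset.range M) (u := M * entryProb S P α) (by rw [Finset.card_range, avg_entry])
      (hu.trans (h α))
    have h4 := hY.chernoff_upper {x | ∀ j ∈ S.pa α.1, x j = tableConfig S α.1 α.2 j}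
      (Finset.range M) (u := M * entryProb S P α) (by rw [Finset.card_range, avg_entry])
      (hu.trans (h α))
    simp only [← tableCount_eq] at h3 h4
    have h5 : Real.exp (-(M * entryProb S P α) / 8) ≤ Real.exp (-u / 8) :=
      Real.exp_le_exp.2 (by linarith [h α])
    exact (measureReal_union_le _ _).trans (by linarith)
  refine (measureReal_mono h1 (measure_ne_top _ _)).trans
    ((measureReal_biUnion_finset_le _ _).trans ?_)
  refine (Finset.sum_le_sum fun α _ => h2 α).trans (le_of_eq ?_)
  rw [Finset.sum_const, nsmul_eq_mul, Finset.card_univ]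

theorem measure_rare_le [IsProbabilityMeasure P] {M : ℕ} {τ : ℝ} (hτ : 0 < τ) {α : TableIndex S}
    (h : M * entryProb S P α ≤ τ / 4) :
    (tapeLaw P).real {ω | τ ≤ tableCount S (Finset.range M) ω α} ≤ 1 / 4 := by
  have h1 := (isSampling_tapeLaw P).markov_count
    {x | ∀ j ∈ S.pa α.1, x j = tableConfig S α.1 α.2 j} (Finset.range M) τ
  rw [Finset.card_range, avg_entry] at h1
  simp only [← tableCount_eq] at h1
  have h2 : τ * (tapeLaw P).real {ω | τ ≤ tableCount S (Finset.range M) ω α} ≤ τ * (1 / 4) := by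
    linarith
  exact le_of_mul_le_mul_left h2 hτ

/-- The number `e` is the mean of the statistic given the first batch. It is a sum of the
contributions to `M` times the divergence, each multiplied by the ratio of expected to actual count,
which lies between `1 / 2` and `2` outside the event of `measure_count_bad`. -/
theorem measure_idStat [IsProbabilityMeasure P] (hn : 0 < n) (hσ : IsNumbering S σ)
    (hS : IsMarkov S σ (mass P)) {c : ℝ} (hc : 0 < c)
    (hQ : ∀ i a, table S Q i a ∈ Set.Icc c (1 - c)) {M : ℕ} (hM : 0 < M) {u : ℝ} (hu : 0 < u)
    (h : ∀ α, u ≤ M * entryProb S P α) {b δ : ℝ} (hb : 0 < b) (hδ : 0 ≤ δ)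
    (hvar : 64 * Fintype.card (TableIndex S) + 128 * (M * divergence S P Q) / (c * u) +
      32 * (M * divergence S P Q) ^ 2 / u ^ 2 + 48 * (M * divergence S P Q) / c +
      16 * (M * divergence S P Q) ^ 2 / u ≤ δ * b ^ 2) :
    (tapeLaw P).real {ω | ¬ ((∀ α : TableIndex S,
      M * entryProb S P α / 2 < tableCount S (Finset.range M) ω α) ∧
      ∃ e, M * divergence S P Q / 2 ≤ e ∧ e ≤ 2 * (M * divergence S P Q) ∧
        |idStat S Q M ω - e| < b)} ≤
      Fintype.card (TableIndex S) * (2 * Real.exp (-u / 8)) + δ := by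
  have hY := isSampling_tapeLaw P
  have hM' : (0 : ℝ) < M := by exact_mod_cast hM
  have hpr : ∀ α, 0 < entryProb S P α := fun α => pos_of_mul_pos_right (hu.trans_le (h α)) hM'.le
  set r : TableIndex S → ℝ := fun α => entry S Q α * (1 - entry S Q α) with hr
  -- Some node exists, so `c ≤ 1 / 2`, and then `q (1 - q) ≥ c (1 - c) ≥ c / 2`.
  have hc2 : c ≤ 1 - c := (hQ ⟨0, hn⟩ fun _ => true).1.trans (hQ ⟨0, hn⟩ fun _ => true).2
  have hq : ∀ α, c ≤ entry S Q α ∧ entry S Q α ≤ 1 - c := fun α => hQ _ _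
  have hrc : ∀ α, c / 2 ≤ r α := fun α => by
    have := hq α
    simp only [hr]
    nlinarith
  have hr0 : ∀ α, 0 < r α := fun α => (by positivity : (0 : ℝ) < c / 2).trans_le (hrc α)
  have hp : ∀ α, 0 ≤ entry S P α ∧ entry S P α ≤ 1 := fun α => table_mem_Icc P _ _
  set δ' : TableIndex S → ℝ := fun α => entry S P α - entry S Q α with hδ'
  set s : TableIndex S → ℝ := fun α => entry S P α * (1 - entry S P α) with hs
  set ind : TableIndex S → (Fin n → Bool) → ℝ :=
    fun α => parInd S α.1 (tableConfig S α.1 α.2) with hind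
  set res : TableIndex S → (Fin n → Bool) → ℝ :=
    fun α => bitResidual S P α.1 (tableConfig S α.1 α.2) with hres
  set f : TableIndex S → (Fin n → Bool) → ℝ := fun α x =>
    ind α x * (bit x α.1 - entry S Q α) with hf
  have hff : f = fun α x => res α x + δ' α * ind α x := by
    funext α x
    simp only [hf, hres, hind, hδ', bitResidual, entry]
    ring
  have hT := isTable_tableConfig S
  have hres0 : ∀ α, avg P (res α) = 0 := by
    intro α
    have h1 : res α = fun x => ind α x * bit x α.1 - entry S P α * ind α x := by
      funext x
      simp only [hres, hind, bitResidual, entry]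
      ring
    have h2 : avg P (fun x => ind α x) = entryProb S P α := avg_parInd _ _
    rw [h1, avg_sub, avg_const_mul, h2]
    simp only [hind]
    rw [avg_parInd_mul_bit hσ hS (hpr α)]
    simp only [entry, entryProb]; ring
  have havg : ∀ α, avg P (f α) = entryProb S P α * δ' α := by
    intro α
    have h1 : avg P (fun x => res α x) = 0 := hres0 α
    have h2 : avg P (fun x => ind α x) = entryProb S P α := avg_parInd _ _
    rw [hff]
    simp only
    rw [avg_add, avg_const_mul, h1, h2]; ring
  let good : (TableIndex S → ℝ) → Prop := fun N => ∀ α,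
    M * entryProb S P α / 2 < N α ∧ N α < 2 * (M * entryProb S P α)
  let v : (TableIndex S → ℝ) → TableIndex S → ℝ := fun N α => 1 / N α / r α
  have hgood0 : ∀ N, good N → ∀ α, 0 < N α := fun N hN α =>
    lt_trans (by have := hpr α; positivity) (hN α).1
  have hd : divergence S P Q = ∑ α, entryProb S P α * (δ' α ^ 2 / r α) := rfl
  -- The weights come from the first block of `M` samples, the two factors from the second and third
  -- blocks.
  have key := hY.quad_tail v good ind f (T₀ := Finset.range M) (T := Finset.Ico M (M + M))
    (T' := Finset.Ico (M + M) (M + M + M)) (M := M) (b := b) (δ := δ) ?_ ?_ (by simp) (by simp)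
    hb hδ ?_
  · have hbad := measure_count_bad (P := P) hu.le h
    refine (measureReal_mono ?_ (measure_ne_top _ _)).trans ((measureReal_union_le
      {ω : Tape n | ¬ ∀ α : TableIndex S,
      M * entryProb S P α / 2 < tableCount S (Finset.range M) ω α ∧
      tableCount S (Finset.range M) ω α < 2 * (M * entryProb S P α)} _).trans
      (add_le_add hbad key))
    intro ω hω
    simp only [Set.mem_ofPred_eq, Set.mem_union] at hω ⊢
    by_contra hcon
    rw [not_or, not_not] at hcon
    obtain ⟨hg, hcon⟩ := hcon
    refine hω ⟨fun α => (hg α).1, ?_⟩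
    have hg' : good (tableCount S (Finset.range M) ω) := hg
    have hcon' : ¬ b ≤ |idStat S Q M ω - M ^ 2 *
        ∑ α, v (tableCount S (Finset.range M) ω) α * avg P (f α) ^ 2| := fun hb' =>
      hcon ⟨hg', hb'⟩
    refine ⟨_, ?_, ?_, not_le.1 hcon'⟩
    · rw [hd, Finset.mul_sum, Finset.sum_div, Finset.mul_sum]
      refine Finset.sum_le_sum fun α _ => ?_
      have e1 : (M : ℝ) ^ 2 * (v (tableCount S (Finset.range M) ω) α * avg P (f α) ^ 2) =
          (M * entryProb S P α / tableCount S (Finset.range M) ω α) *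
          (M * (entryProb S P α * (δ' α ^ 2 / r α))) := by
        rw [havg]; simp only [v]; ring
      have e2 : 1 / 2 ≤ M * entryProb S P α / tableCount S (Finset.range M) ω α := by
        rw [div_le_div_iff₀ two_pos (hgood0 _ hg' α)]
        linarith [(hg α).2]
      have e3 : 0 ≤ M * (entryProb S P α * (δ' α ^ 2 / r α)) :=
        mul_nonneg hM'.le (mul_nonneg (hpr α).le (div_nonneg (sq_nonneg _) (hr0 α).le))
      rw [e1]
      have := mul_le_mul_of_nonneg_right e2 e3
      linarith
    · rw [hd, Finset.mul_sum, Finset.mul_sum, Finset.mul_sum]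
      refine Finset.sum_le_sum fun α _ => ?_
      have e1 : (M : ℝ) ^ 2 * (v (tableCount S (Finset.range M) ω) α * avg P (f α) ^ 2) =
          (M * entryProb S P α / tableCount S (Finset.range M) ω α) *
          (M * (entryProb S P α * (δ' α ^ 2 / r α))) := by
        rw [havg]; simp only [v]; ring
      have e2 : M * entryProb S P α / tableCount S (Finset.range M) ω α ≤ 2 := by
        rw [div_le_iff₀ (hgood0 _ hg' α)]
        linarith [(hg α).1]
      have e3 : 0 ≤ M * (entryProb S P α * (δ' α ^ 2 / r α)) :=
        mul_nonneg hM'.le (mul_nonneg (hpr α).le (div_nonneg (sq_nonneg _) (hr0 α).le))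
      rw [e1]
      exact mul_le_mul_of_nonneg_right e2 e3
  · rw [Finset.disjoint_left]
    intro a ha hb'
    simp only [Finset.mem_range, Finset.mem_union, Finset.mem_Ico] at ha hb'
    omega
  · rw [Finset.disjoint_left]
    intro a ha hb'
    simp only [Finset.mem_Ico] at ha hb'
    omega
  · intro N hN
    refine le_trans ?_ hvar
    rw [hff, hd]
    refine quad_variance_le (w := fun α => 1 / N α) hM' hu hc (by linarith) h hrc ?_ ?_ ?_ ?_ ?_
      (s := s) ?_ ?_ hres0 (fun α => avg_parInd _ _) (fun α x => parInd_nonneg _ _ _)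
      (fun α x => parInd_le_one _ _ _)
    · intro α
      have h1 := hp α
      have h2 := hq α
      rw [abs_le]
      constructor <;> simp only [hδ'] <;> linarith
    · intro α
      exact mul_nonneg (hp α).1 (by linarith [(hp α).2])
    · intro α
      have h1 := hp α
      have h2 := hq α
      have h3 : s α - r α = δ' α * (1 - entry S P α - entry S Q α) := by
        simp only [hs, hr, hδ']; ring
      have h4 : |1 - entry S P α - entry S Q α| ≤ 1 := by
        rw [abs_le]; constructor <;> linarith
      have h5 : δ' α * (1 - entry S P α - entry S Q α) ≤ |δ' α| := by
        refine (le_abs_self _).trans ?_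
        rw [abs_mul]
        exact mul_le_of_le_one_right (abs_nonneg _) h4
      linarith
    · intro α
      exact (one_div_pos.2 (hgood0 N hN α)).le
    · intro α
      rw [one_div_mul_eq_div, div_le_iff₀ (hgood0 N hN α)]
      linarith [(hN α).1]
    · intro α β hne
      exact hT.avg_bitResidual_mul hσ hS hpr hne
    · intro α
      exact avg_bitResidual_mul_self hσ hS (hpr α)

/-- With `P = Q` the divergence is zero, hence so is the conditional mean, and the variance reduces
to the number of entries. Expected counts of at least `2 τ` stay above `τ` by the Chernoff bound. -/
theorem measure_idAccepts_null [IsProbabilityMeasure P] (hn : 0 < n) (hσ : IsNumbering S σ)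
    (hS : IsMarkov S σ (mass P)) {c : ℝ} (hc : 0 < c)
    (hP : ∀ i a, table S P i a ∈ Set.Icc c (1 - c)) {M : ℕ} (hM : 0 < M) {τ : ℝ} (hτ : 0 < τ)
    (h : ∀ α, 2 * τ ≤ M * entryProb S P α) {b δ : ℝ} (hb : 0 < b) (hδ : 0 ≤ δ)
    (hvar : 64 * Fintype.card (TableIndex S) ≤ δ * b ^ 2) :
    (tapeLaw P).real {ω | ¬ IdAccepts S P M τ b ω} ≤
      Fintype.card (TableIndex S) * (2 * Real.exp (-τ / 4)) + δ := by
  have hd : divergence S P P = 0 := by simp [divergence]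
  have key := measure_idStat (Q := P) hn hσ hS hc hP hM (by linarith : 0 < 2 * τ) h hb hδ
    (by rw [hd]; simpa using hvar)
  have he : -(2 * τ) / 8 = -τ / 4 := by ring
  rw [he] at key
  refine (measureReal_mono ?_ (measure_ne_top _ _)).trans key
  intro ω hω
  simp only [Set.mem_ofPred_eq] at hω ⊢
  rintro ⟨h1, e, h2, h3, h4⟩
  rw [hd, mul_zero] at h2 h3
  have h5 : e = 0 := by linarith
  rw [h5, sub_zero] at h4
  exact hω ⟨fun α => by linarith [h1 α, h α], ((le_abs_self _).trans h4.le)⟩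

/-- If some configuration has expected count at most `τ / 4`, Markov's inequality shows that its
count rarely reaches `τ`. Otherwise all configurations have positive probability, `P` is Markov for
`S`, and the statistic concentrates: its conditional mean is at least `X / 2`, the error is below `X
/ 4`, and the threshold `M ε² / 16` is at most `X / 4`. -/
theorem measure_idAccepts_far [IsProbabilityMeasure P] [IsProbabilityMeasure Q] (hn : 0 < n)
    (hσ : IsNumbering S σ) (hSQ : IsMarkov S σ (mass Q))
    (hSP : (∀ i x, 0 < marg (mass P) (S.pa i) x) → IsMarkov S σ (mass P))
    (hpQ : ∀ i x, 0 < marg (mass Q) (S.pa i) x) {c : ℝ} (hc : 0 < c)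
    (hQ : ∀ i a, table S Q i a ∈ Set.Icc c (1 - c)) {M : ℕ} (hM : 0 < M) {τ : ℝ}
    (hτ : 122880 ≤ τ) {ε : ℝ} (hε : 0 < ε) (hPQ : ε < l1Dist P Q)
    (hc' : 92160 ≤ c * (M * ε ^ 2 / 4))
    (hD : 122880 * Fintype.card (TableIndex S) ≤ (M * ε ^ 2 / 4) ^ 2)
    (hcard : Fintype.card (TableIndex S) * (2 * Real.exp (-τ / 32)) ≤ 1 / 24) :
    (tapeLaw P).real {ω | IdAccepts S Q M τ (M * ε ^ 2 / 16) ω} ≤ 1 / 3 := by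
  have hM' : (0 : ℝ) < M := by exact_mod_cast hM
  by_cases hrare : ∃ α, M * entryProb S P α ≤ τ / 4
  · obtain ⟨α, hα⟩ := hrare
    have h1 := measure_rare_le (by linarith) hα
    refine (measureReal_mono (fun ω hω => ?_) (measure_ne_top _ _)).trans (h1.trans (by norm_num))
    exact hω.1 α
  · push Not at hrare
    have hu : ∀ α, τ / 4 ≤ M * entryProb S P α := fun α => (hrare α).le
    have hpos : ∀ i x, 0 < marg (mass P) (S.pa i) x := by
      intro i x
      obtain ⟨α, ⟨rfl, hα⟩, -⟩ := isTable_tableConfig S i x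
      rw [marg_congr hα]
      have h1 := hu α
      have h2 : 0 < M * entryProb S P α := by linarith
      exact pos_of_mul_pos_right h2 hM'.le
    have hS := hSP hpos
    have hX := (isTable_tableConfig S).sq_l1Dist_le hσ hS hpos hσ hSQ hpQ
      (fun i x => ⟨hc.trans_le (hQ i x).1, by linarith [(hQ i x).2]⟩)
    change l1Dist P Q ^ 2 ≤ 4 * divergence S P Q at hX
    set X := M * divergence S P Q with hXdef
    have hX0 : M * ε ^ 2 / 4 ≤ X := by
      have h1 : ε ^ 2 ≤ l1Dist P Q ^ 2 := pow_le_pow_left₀ hε.le hPQ.le 2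
      have h2 := mul_le_mul_of_nonneg_left (h1.trans hX) hM'.le
      rw [hXdef]; linarith
    have hX1 : 0 < M * ε ^ 2 / 4 := by positivity
    have hXpos : 0 < X := hX1.trans_le hX0
    have hcX : 92160 ≤ c * X := hc'.trans (mul_le_mul_of_nonneg_left hX0 hc.le)
    have hu0 : (30720 : ℝ) ≤ τ / 4 := by linarith
    set u := τ / 4 with hudef
    have hupos : 0 < u := by linarith
    have key := measure_idStat hn hσ hS hc hQ hM hupos hu
      (b := X / 4) (δ := 1 / 24) (by positivity) (by norm_num) ?_
    · have he : -u / 8 = -τ / 32 := by rw [hudef]; ring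
      rw [he] at key
      refine (measureReal_mono ?_ (measure_ne_top _ _)).trans (key.trans (by linarith))
      intro ω hω
      simp only [Set.mem_ofPred_eq] at hω ⊢
      rintro ⟨-, e, h2, -, h4⟩
      have h5 := (abs_lt.1 h4).1
      have h6 := hω.2
      linarith
    · have hXX : 0 < X ^ 2 := by positivity
      -- With `δ = 1 / 24` and `b = X / 4` the budget `δ b²` is `X² / 384`, shared equally by the
      -- five terms of the variance. The numerical hypotheses are the coefficients times 1920:
      -- `122880 = 64 · 1920`, `92160 = 48 · 1920`, and `u ≥ 30720 = 16 · 1920`.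
      have t1 : 64 * (Fintype.card (TableIndex S) : ℝ) ≤ X ^ 2 / 1920 := by
        have := pow_le_pow_left₀ hX1.le hX0 2
        linarith
      have t2 : 128 * X / (c * u) ≤ X ^ 2 / 1920 := by
        rw [div_le_div_iff₀ (by positivity) (by norm_num)]
        have h1 : 245760 ≤ (c * X) * u := by nlinarith
        nlinarith
      have t3 : 32 * X ^ 2 / u ^ 2 ≤ X ^ 2 / 1920 := by
        rw [div_le_div_iff₀ (by positivity) (by norm_num)]
        have h1 : 61440 ≤ u ^ 2 := by nlinarith
        nlinarith
      have t4 : 48 * X / c ≤ X ^ 2 / 1920 := by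
        rw [div_le_div_iff₀ hc (by norm_num)]
        nlinarith
      have t5 : 16 * X ^ 2 / u ≤ X ^ 2 / 1920 := by
        rw [div_le_div_iff₀ hupos (by norm_num)]
        nlinarith
      have h6 : 1 / 24 * (X / 4) ^ 2 = 5 * (X ^ 2 / 1920) := by ring
      rw [h6]
      linarith

end IdentityTest

/-! ### The probability that the conditional independence tests accept -/

/-! ### Sets of at most `d` nodes coded as numbers. -/

section Tuples

theorem exists_tupleDigit (n d : ℕ) (T : ℕ → ℕ) (hT : ∀ r, T r ≤ n) :
    ∃ u < (n + 1) ^ d, ∀ r < d, tupleDigit n u r = T r := by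
  induction d generalizing T with
  | zero => exact ⟨0, by simp, by simp⟩
  | succ d ih =>
    obtain ⟨u, hu, h⟩ := ih (fun r => T (r + 1)) fun r => hT _
    have h0 := hT 0
    refine ⟨(n + 1) * u + T 0, ?_, ?_⟩
    · rw [pow_succ']
      calc (n + 1) * u + T 0 < (n + 1) * u + (n + 1) := by omega
        _ = (n + 1) * (u + 1) := by ring
        _ ≤ (n + 1) * (n + 1) ^ d := Nat.mul_le_mul_left _ hu
    · intro r hr
      cases r with
      | zero => simp [tupleDigit, Nat.mod_eq_of_lt (Nat.lt_succ_of_le h0)]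
      | succ r =>
        have h1 : ((n + 1) * u + T 0) / (n + 1) = u := by
          rw [Nat.mul_add_div (by omega), Nat.div_eq_of_lt (by omega), add_zero]
        rw [tupleDigit, pow_succ', ← Nat.div_div_eq_div_mul, h1]
        exact h r (by omega)

theorem hornerKey_lt {f : ℕ → ℕ} (hf : ∀ r, f r ≤ 1) (d : ℕ) : hornerKey f d < 2 ^ d := by
  induction d with
  | zero => simp [hornerKey]
  | succ d ih =>
    have := hf d
    rw [hornerKey, pow_succ]; omega

theorem hornerKey_eq_iff {f g : ℕ → ℕ} (hf : ∀ r, f r ≤ 1) (hg : ∀ r, g r ≤ 1) (d : ℕ) :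
    hornerKey f d = hornerKey g d ↔ ∀ r < d, f r = g r := by
  induction d with
  | zero => simp [hornerKey]
  | succ d ih =>
    rw [Nat.forall_lt_succ_right, ← ih, hornerKey, hornerKey]
    have := hf d
    have := hg d
    omega

end Tuples

section CITest

variable {n d : ℕ} {ε γ : ℝ} {S : BNStructure n} {P Q : Measure (Fin n → Bool)}

/-- The coordinate with index `k` (zero if there is none). -/
def coordNat (x : Fin n → Bool) (k : ℕ) : ℕ := if h : k < n then (x ⟨k, h⟩).toNat else 0

theorem coordNat_le (x : Fin n → Bool) (k : ℕ) : coordNat x k ≤ 1 := by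
  unfold coordNat
  split_ifs
  · exact Bool.toNat_le _
  · exact zero_le_one

/-- The nodes in a tuple. -/
def tupleNodes (n d : ℕ) (T : ℕ → ℕ) : Finset (Fin n) :=
  Finset.univ.filter fun l => ∃ r < d, T r = l

theorem mem_tupleNodes {T : ℕ → ℕ} {l : Fin n} :
    l ∈ tupleNodes n d T ↔ ∃ r < d, T r = l := by simp [tupleNodes]

theorem card_tupleNodes_le (T : ℕ → ℕ) : (tupleNodes n d T).card ≤ d := by
  have h : (tupleNodes n d T).image (fun l : Fin n => (l : ℕ)) ⊆ (Finset.range d).image T := by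
    intro k hk
    obtain ⟨l, hl, rfl⟩ := Finset.mem_image.1 hk
    obtain ⟨r, hr, h⟩ := mem_tupleNodes.1 hl
    exact Finset.mem_image.2 ⟨r, Finset.mem_range.2 hr, h⟩
  rw [← Finset.card_image_of_injective _ Fin.val_injective]
  exact (Finset.card_le_card h).trans (Finset.card_image_le.trans (by simp))

/-- The configuration of `x` on a tuple. -/
def tupleKey (d : ℕ) (T : ℕ → ℕ) (x : Fin n → Bool) : ℕ :=
  hornerKey (fun r => coordNat x (T r)) d

theorem tupleKey_lt (T : ℕ → ℕ) (x : Fin n → Bool) : tupleKey d T x < 2 ^ d :=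
  hornerKey_lt (fun _ => coordNat_le _ _) d

theorem tupleKey_eq_iff (T : ℕ → ℕ) (x y : Fin n → Bool) :
    tupleKey d T x = tupleKey d T y ↔ ∀ l ∈ tupleNodes n d T, x l = y l := by
  rw [tupleKey, tupleKey, hornerKey_eq_iff (fun _ => coordNat_le _ _) fun _ => coordNat_le _ _]
  constructor
  · intro h l hl
    obtain ⟨r, hr, hrl⟩ := mem_tupleNodes.1 hl
    have h1 := h r hr
    simp only [coordNat, hrl, l.2, dif_pos] at h1
    revert h1
    cases x l <;> cases y l <;> simp
  · intro h r hr
    unfold coordNat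
    split_ifs with h1
    · rw [h ⟨T r, h1⟩ (mem_tupleNodes.2 ⟨r, hr, rfl⟩)]
    · rfl

/-- List the elements of `A` and fill up with `n`, which is no node; the input and `coordNat` read
such coordinates as `0`, so they do not influence the configuration. -/
theorem exists_tupleNodes {A : Finset (Fin n)} (hA : A.card ≤ d) :
    ∃ u < (n + 1) ^ d, tupleNodes n d (tupleDigit n u) = A := by
  classical
  let L := A.toList.map fun l : Fin n => (l : ℕ)
  have hL : ∀ k ∈ L, k < n := by
    intro k hk
    obtain ⟨l, -, rfl⟩ := List.mem_map.1 hk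
    exact l.2
  have hlen : L.length ≤ d := by simpa [L] using hA
  have hT : ∀ r, L.getD r n ≤ n := by
    intro r
    rcases lt_or_ge r L.length with h | h
    · rw [List.getD_eq_getElem _ _ h]
      exact (hL _ (List.getElem_mem h)).le
    · rw [List.getD_eq_default _ _ h]
  obtain ⟨u, hu, h⟩ := exists_tupleDigit n d (fun r => L.getD r n) hT
  refine ⟨u, hu, ?_⟩
  ext l
  rw [mem_tupleNodes]
  constructor
  · rintro ⟨r, hr, h1⟩
    rw [h r hr] at h1
    rcases lt_or_ge r L.length with h2 | h2
    · rw [List.getD_eq_getElem _ _ h2] at h1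
      have h3 := List.getElem_mem h2
      rw [h1] at h3
      obtain ⟨l', hl', h4⟩ := List.mem_map.1 h3
      rw [← Fin.ext h4]
      exact Finset.mem_toList.1 hl'
    · rw [List.getD_eq_default _ _ h2] at h1
      exact absurd l.2 (by omega)
  · intro hl
    have h1 : (l : ℕ) ∈ L := List.mem_map.2 ⟨l, Finset.mem_toList.2 hl, rfl⟩
    obtain ⟨r, hr, h2⟩ := List.mem_iff_getElem.1 h1
    refine ⟨r, hr.trans_le hlen, ?_⟩
    rw [h r (hr.trans_le hlen)]
    rw [List.getD_eq_getElem _ _ hr, h2]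

theorem sum_cell_ite (P : Measure (Fin n → Bool)) (key : (Fin n → Bool) → ℕ) (i j : Fin n) (k c : ℕ) :
    ∑ x, mass P x * (if (key x, pairIndex i j x) = (k, c) then (1 : ℝ) else 0) =
      cellWeight (mass P) key i j k c := by
  unfold cellWeight
  refine Finset.sum_congr rfl fun x _ => ?_
  simp only [Prod.mk.injEq, mul_ite, mul_one, mul_zero]

theorem ciCount_eq (ω : Tape n) (T : ℕ → ℕ) (m : ℕ) (i j : Fin n) (k c : ℕ) :
    (ciCount (testerInput d ε γ S Q ω) T m i j k c : ℝ) = ∑ t ∈ Finset.range m,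
      if (tupleKey d T (ω t).1, pairIndex i j (ω t).1) = (k, c) then (1 : ℝ) else 0 := by
  rw [ciCount, Finset.card_filter]
  push_cast
  refine Finset.sum_congr rfl fun t _ => ?_
  have h1 := testerInput_sample (d := d) (ε := ε) (γ := γ) (S := S) (Q := Q) ω t
  have h2 : hornerKey (fun r => (testerInput d ε γ S Q ω).sample t (T r))
      (testerInput d ε γ S Q ω).deg = tupleKey d T (ω t).1 := rfl
  rw [h1, h1, h2]
  simp only [Prod.mk.injEq]
  rfl

theorem abs_ciStat_sub_le (ω : Tape n) (T : ℕ → ℕ) {m : ℕ} (hm : 0 < m) (i j : Fin n) (K : ℕ) :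
    |ciStat (testerInput d ε γ S Q ω) T m i j K - m * covStat (mass P) (tupleKey d T) i j K| ≤
      2 * ∑ z ∈ Finset.range K ×ˢ Finset.range 4, |(∑ t ∈ Finset.range m,
        if (tupleKey d T (ω t).1, pairIndex i j (ω t).1) = z then (1 : ℝ) else 0) -
        m * avg P (fun x => if (tupleKey d T x, pairIndex i j x) = z then 1 else 0)| := by
  have hm' : (0 : ℝ) < m := by exact_mod_cast hm
  have h1 : ciStat (testerInput d ε γ S Q ω) T m i j K =
      ∑ k ∈ Finset.range K, covTerm fun c => (ciCount (testerInput d ε γ S Q ω) T m i j k c : ℝ) :=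
    rfl
  rw [h1, covStat, Finset.mul_sum, ← Finset.sum_sub_distrib, Finset.sum_product, Finset.mul_sum]
  refine (Finset.abs_sum_le_sum_abs _ _).trans (Finset.sum_le_sum fun k _ => ?_)
  rw [← covTerm_smul hm']
  refine (abs_covTerm_sub_le (fun c => Nat.cast_nonneg _) fun c => mul_nonneg hm'.le
    (cellWeight_nonneg (mass_nonneg P) _ _ _ _ _)).trans (le_of_eq ?_)
  congr 1
  refine Finset.sum_congr rfl fun c _ => ?_
  rw [ciCount_eq, ← sum_cell_ite P]
  rfl

theorem pairIndex_lt (i j : Fin n) (x : Fin n → Bool) : pairIndex i j x < 4 := by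
  unfold pairIndex
  cases x i <;> cases x j <;> simp

/-- A bound for the error probability of one conditional independence test. -/
noncomputable def ciError (d m : ℕ) (γ : ℝ) : ℝ :=
  2 ^ (2 ^ d * 4) * Real.exp (-(m * γ ^ 2) / 200)

theorem measure_ciStat [IsProbabilityMeasure P] (hγ : 0 < γ) (T : ℕ → ℕ) {m : ℕ} (hm : 0 < m)
    (i j : Fin n) :
    (tapeLaw P).real {ω | 4 / 5 * (γ * m) ≤ |4 * ciStat (testerInput d ε γ S Q ω) T m i j (2 ^ d) -
      m * (4 * covStat (mass P) (tupleKey d T) i j (2 ^ d))|} ≤ ciError d m γ := by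
  -- With `η = γ / 20` the empirical cells are within `γ m / 10` in `L¹` outside the exceptional
  -- event. The Lipschitz constant 2 and the factor 4 of the statistic turn this into `4 / 5 · γ m`.
  have h1 := (isSampling_tapeLaw P).l1_concentration
    (fun x => (tupleKey d T x, pairIndex i j x)) (Finset.range (2 ^ d) ×ˢ Finset.range 4)
    (fun x => Finset.mem_product.2 ⟨Finset.mem_range.2 (tupleKey_lt T x),
      Finset.mem_range.2 (pairIndex_lt i j x)⟩) m (η := γ / 20) (by positivity)
  have h2 : -2 * (γ / 20) ^ 2 * m = -(m * γ ^ 2) / 200 := by ring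
  rw [h2, Finset.card_product, Finset.card_range, Finset.card_range] at h1
  refine (measureReal_mono (fun ω hω => ?_) (measure_ne_top _ _)).trans h1
  simp only [Set.mem_ofPred_eq] at hω ⊢
  have h3 := abs_ciStat_sub_le (d := d) (ε := ε) (γ := γ) (S := S) (P := P) (Q := Q) ω T hm i j
    (2 ^ d)
  have h4 : |4 * ciStat (testerInput d ε γ S Q ω) T m i j (2 ^ d) -
      m * (4 * covStat (mass P) (tupleKey d T) i j (2 ^ d))| =
      4 * |ciStat (testerInput d ε γ S Q ω) T m i j (2 ^ d) -
      m * covStat (mass P) (tupleKey d T) i j (2 ^ d)| := by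
    rw [← abs_of_pos (by norm_num : (0 : ℝ) < 4), ← abs_mul,
      abs_of_pos (by norm_num : (0 : ℝ) < 4)]
    congr 1; ring
  rw [h4] at hω
  linarith

/-- The program shares the test of the edge from `k` to `j` between conditions (iii) and (iv); here
the two are separated again. -/
theorem ciFails_iff (ω : Tape n) (T : ℕ → ℕ) (m : ℕ) (i j : Fin n) :
    ciFails (testerInput d ε γ S Q ω) m (2 ^ d) T i j ↔
      (Forced S i j (tupleNodes n d T : Set (Fin n)) ∧ i ≠ j ∧ i ∉ tupleNodes n d T ∧
        j ∉ tupleNodes n d T) ∧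
      4 * ciStat (testerInput d ε γ S Q ω) T m i j (2 ^ d) ≤ γ * m := by
  have he := testerInput_edge_pos (d := d) (ε := ε) (γ := γ) (S := S) (Q := Q) ω
  have h1 : edgeFlag (testerInput d ε γ S Q ω) (fun k => ∃ r < d, T r = k) i j n ↔
      Forced S i j (tupleNodes n d T : Set (Fin n)) := by
    unfold edgeFlag Forced
    rw [he]
    refine or_congr_right ?_
    constructor
    · rintro ⟨k, hk, h⟩
      have e1 := he i ⟨k, hk⟩
      have e2 := he j ⟨k, hk⟩
      have e3 := he ⟨k, hk⟩ i
      have e4 := he ⟨k, hk⟩ j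
      simp only at e1 e2 e3 e4
      rw [e1, e2, e3, e4] at h
      have hm : (⟨k, hk⟩ : Fin n) ∈ (tupleNodes n d T : Set (Fin n)) ↔ ∃ r < d, T r = k := by
        rw [Finset.mem_coe, mem_tupleNodes]
      simp only [← hm] at h
      rcases h with ⟨h, h'⟩ | ⟨h, h', h'' | h''⟩
      · exact Or.inl ⟨_, h, h'⟩
      · exact Or.inr (Or.inl ⟨_, h, h'', h'⟩)
      · exact Or.inr (Or.inr ⟨_, h, h'', h'⟩)
    · have hm : ∀ k : Fin n, k ∈ (tupleNodes n d T : Set (Fin n)) ↔ ∃ r < d, T r = k := fun k => by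
        rw [Finset.mem_coe, mem_tupleNodes]
      rintro (⟨k, h, h'⟩ | ⟨k, h, h', h''⟩ | ⟨k, h, h', h''⟩) <;> rw [hm] at h <;>
        refine ⟨k, k.2, ?_⟩ <;> rw [he, he, he, he]
      · exact Or.inl ⟨h, h'⟩
      · exact Or.inr ⟨h, h'', Or.inl h'⟩
      · exact Or.inr ⟨h, h'', Or.inr h'⟩
  unfold ciFails
  refine and_congr (and_congr h1 (and_congr (not_congr Fin.ext_iff).symm (and_congr ?_ ?_))) Iff.rfl
  · rw [mem_tupleNodes]; rfl
  · rw [mem_tupleNodes]; rfl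

/-- The true value of four times the statistic is at least `2 γ` and the threshold is `γ`, so a
failure requires a relative error beyond the tolerance `4 / 5`. -/
theorem measure_ciFails_le [IsProbabilityMeasure P] (hγ : 0 < γ) (hS : IsNonDegenerate S d P γ)
    (T : ℕ → ℕ) {m : ℕ} (hm : 0 < m) (i j : Fin n) :
    (tapeLaw P).real {ω | ciFails (testerInput d ε γ S Q ω) m (2 ^ d) T i j} ≤ ciError d m γ := by
  by_cases h : Forced S i j (tupleNodes n d T : Set (Fin n)) ∧ i ≠ j ∧ i ∉ tupleNodes n d T ∧
      j ∉ tupleNodes n d T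
  · obtain ⟨h1, h2, h3, h4⟩ := h
    have h5 := hS i j (tupleNodes n d T) h2
      (by rw [Set.ncard_coe_finset]; exact card_tupleNodes_le T) h3 h4 h1
    have h6 := two_mul_le_covStat h2 h3 h4 (tupleKey_eq_iff T) (tupleKey_lt T) h5
    refine (measureReal_mono (fun ω hω => ?_) (measure_ne_top _ _)).trans
      (measure_ciStat (d := d) (ε := ε) (S := S) (P := P) (Q := Q) hγ T hm i j)
    have h7 := ((ciFails_iff ω T m i j).1 hω).2
    simp only [Set.mem_ofPred_eq]
    have hm' : (0 : ℝ) < m := by exact_mod_cast hm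
    have h8 := mul_le_mul_of_nonneg_left h6 hm'.le
    have h9 : 0 < γ * m := mul_pos hγ hm'
    rw [abs_sub_comm]
    exact le_trans (by linarith) (le_abs_self _)
  · have h1 : {ω : Tape n | ciFails (testerInput d ε γ S Q ω) m (2 ^ d) T i j} = ∅ := by
      ext ω
      simp only [Set.mem_ofPred_eq, Set.mem_empty_iff_false, iff_false]
      exact fun hω => h ((ciFails_iff ω T m i j).1 hω).1
    rw [h1]
    simp only [measureReal_empty]
    unfold ciError
    positivity

theorem measure_ci_null [IsProbabilityMeasure P] (hγ : 0 < γ) (hS : IsNonDegenerate S d P γ)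
    {m : ℕ} (hm : 0 < m) :
    (tapeLaw P).real {ω | ∃ u < (n + 1) ^ d, ∃ i j : Fin n,
      ciFails (testerInput d ε γ S Q ω) m (2 ^ d) (tupleDigit n u) i j} ≤
      (n + 1) ^ d * (n * n) * ciError d m γ := by
  have h1 : {ω : Tape n | ∃ u < (n + 1) ^ d, ∃ i j : Fin n,
      ciFails (testerInput d ε γ S Q ω) m (2 ^ d) (tupleDigit n u) i j} ⊆
      ⋃ z ∈ Finset.range ((n + 1) ^ d) ×ˢ (Finset.univ : Finset (Fin n × Fin n)),
        {ω | ciFails (testerInput d ε γ S Q ω) m (2 ^ d) (tupleDigit n z.1) z.2.1 z.2.2} := by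
    rintro ω ⟨u, hu, i, j, h⟩
    simp only [Set.mem_iUnion]
    exact ⟨(u, i, j), by simp [hu], h⟩
  refine (measureReal_mono h1 (measure_ne_top _ _)).trans
    ((measureReal_biUnion_finset_le _ _).trans ?_)
  refine (Finset.sum_le_sum fun z _ => measure_ciFails_le hγ hS _ hm _ _).trans (le_of_eq ?_)
  rw [Finset.sum_const, nsmul_eq_mul, Finset.card_product]
  simp

/-- For `d = 0` there are no edges and nothing is tested. The case has to be separated because the
sample size then contains no `log n` to pay for a union bound over pairs. -/
theorem forall_not_ciFails_of_degreeLE_zero (hS : S.DegreeLE 0) (ω : Tape n) (T : ℕ → ℕ) (m : ℕ)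
    (i j : Fin n) : ¬ ciFails (testerInput 0 ε γ S Q ω) m (2 ^ 0) T i j := by
  have h : ∀ i j, ¬ S.Adj i j := by
    intro i j hij
    have h1 := hS j
    rw [Nat.le_zero, Set.ncard_eq_zero (Set.toFinite _)] at h1
    have h2 : i ∈ S.parents j := hij
    rw [h1] at h2
    exact h2
  rw [ciFails_iff]
  rintro ⟨⟨h1, -⟩, -⟩
  rcases h1 with h1 | ⟨k, -, h1, -⟩ | ⟨k, -, h1, -⟩ | ⟨k, -, h1, -⟩ <;> exact h _ _ h1

theorem measure_ci_indep [IsProbabilityMeasure P] (hγ : 0 < γ) {A : Finset (Fin n)}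
    (hA : A.card ≤ d) {i j : Fin n} (hij : i ≠ j) (hi : i ∉ A) (hj : j ∉ A)
    (hF : Forced S i j (A : Set (Fin n))) (h : CondIndepGiven P i j (A : Set (Fin n))) {m : ℕ}
    (hm : 0 < m) :
    (tapeLaw P).real {ω | ∀ u < (n + 1) ^ d, ∀ i j : Fin n,
      ¬ ciFails (testerInput d ε γ S Q ω) m (2 ^ d) (tupleDigit n u) i j} ≤ ciError d m γ := by
  obtain ⟨u, hu, rfl⟩ := exists_tupleNodes hA
  have h1 := covStat_eq_zero hij hi hj (tupleKey_eq_iff (tupleDigit n u)) h (2 ^ d)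
  refine (measureReal_mono (fun ω hω => ?_) (measure_ne_top _ _)).trans
    (measure_ciStat (d := d) (ε := ε) (S := S) (P := P) (Q := Q) hγ (tupleDigit n u) hm i j)
  have h2 := hω u hu i j
  rw [ciFails_iff, not_and] at h2
  have h3 := not_le.1 (h2 ⟨hF, hij, hi, hj⟩)
  simp only [Set.mem_ofPred_eq]
  rw [h1]
  have hm' : (0 : ℝ) < m := by exact_mod_cast hm
  have h9 : 0 < γ * m := mul_pos hγ hm'
  exact le_trans (by linarith) (le_abs_self _)

end CITest

/-! ### Numerical estimates -/

section Estimates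

theorem clog_le_log {n : ℕ} (hn : 1 ≤ n) : (Nat.clog 2 n : ℝ) ≤ 1 + 3 / 2 * Real.log n := by
  have hlog : 0 ≤ Real.log n := Real.log_natCast_nonneg n
  rcases hn.eq_or_lt with rfl | h
  · simp
  have h1 := Nat.pow_pred_clog_lt_self (b := 2) (by norm_num) h
  have h2 : ((2 : ℝ) ^ (Nat.clog 2 n - 1)) ≤ n := by
    have : 2 ^ (Nat.clog 2 n - 1) ≤ n := h1.le
    exact_mod_cast this
  have h3 := Real.log_le_log (by positivity) h2
  rw [Real.log_pow] at h3
  have h4 : (2 : ℝ) / 3 ≤ Real.log 2 := by linarith [Real.log_two_gt_d9]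
  have h5 : 0 < Nat.clog 2 n := Nat.clog_pos (by norm_num) h
  have h6 : ((Nat.clog 2 n - 1 : ℕ) : ℝ) = Nat.clog 2 n - 1 := by
    rw [Nat.cast_sub h5, Nat.cast_one]
  have h7 : (0 : ℝ) ≤ ((Nat.clog 2 n - 1 : ℕ) : ℝ) := Nat.cast_nonneg _
  have h8 := mul_le_mul_of_nonneg_left h4 h7
  rw [h6] at h3 h8
  linarith

theorem log_le_two_mul_sqrt {n : ℕ} (hn : 1 ≤ n) : Real.log n ≤ 2 * √n - 2 := by
  have h : (0 : ℝ) < n := by exact_mod_cast hn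
  have h1 := Real.log_le_sub_one_of_pos (Real.sqrt_pos.2 h)
  rw [Real.log_sqrt h.le] at h1
  linarith

/-- The number of entries is at most `exp lam` with `lam = d + ⌈log₂ n⌉ + 1`, and the threshold for
the counts is `131072 lam`; the exponent `4096 lam` therefore beats the union bound over the
entries. -/
theorem exp_neg_mul_le {D lam t : ℝ} (hlam : 1 ≤ lam) (hD : D ≤ Real.exp lam)
    (ht : 131072 * lam / 32 ≤ t) : D * (2 * Real.exp (-t)) ≤ 1 / 24 := by
  have h1 : Real.exp (-t) ≤ Real.exp (-(4096 * lam)) := Real.exp_le_exp.2 (by linarith)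
  have h2 : D * (2 * Real.exp (-t)) ≤ Real.exp lam * (2 * Real.exp (-(4096 * lam))) :=
    mul_le_mul hD (by linarith) (by positivity) (Real.exp_pos _).le
  have h3 : Real.exp lam * (2 * Real.exp (-(4096 * lam))) = 2 * Real.exp (-(4095 * lam)) := by
    rw [mul_left_comm, ← Real.exp_add]; ring_nf
  have h4 : Real.exp (-(4095 * lam)) ≤ 1 / 48 := by
    rw [Real.exp_neg, inv_le_comm₀ (Real.exp_pos _) (by norm_num)]
    have := Real.add_one_le_exp (4095 * lam)
    linarith
  linarith

theorem two_pow_le_exp (k : ℕ) : (2 : ℝ) ^ k ≤ Real.exp k := by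
  have h : (2 : ℝ) ≤ Real.exp 1 := by linarith [Real.exp_one_gt_d9]
  calc (2 : ℝ) ^ k ≤ Real.exp 1 ^ k := pow_le_pow_left₀ (by norm_num) h k
    _ = Real.exp k := by rw [← Real.exp_nat_mul, mul_one]

/-- There are `4 · 2 ^ d` cells, hence a factor at most `exp (4 · 2 ^ d)`, against an exponent of at
least `2000 / 200 = 10` times `2 ^ d + d l`. -/
theorem ciError_le {d m l : ℕ} {γ : ℝ} (hm : 2000 * ((2 : ℝ) ^ d + d * l) ≤ m * γ ^ 2) :
    ciError d m γ ≤ Real.exp (-(6 * 2 ^ d + 10 * (d * l))) := by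
  unfold ciError
  refine (mul_le_mul_of_nonneg_right (two_pow_le_exp _) (Real.exp_pos _).le).trans ?_
  rw [← Real.exp_add, Real.exp_le_exp]
  push_cast
  linarith

theorem ciError_le_third {d m l : ℕ} {γ : ℝ} (hm : 2000 * ((2 : ℝ) ^ d + d * l) ≤ m * γ ^ 2) :
    ciError d m γ ≤ 1 / 3 := by
  refine (ciError_le hm).trans ?_
  have h1 : (1 : ℝ) ≤ 2 ^ d := one_le_pow₀ (by norm_num)
  have h2 : (0 : ℝ) ≤ d * l := by positivity
  rw [Real.exp_neg, inv_le_comm₀ (Real.exp_pos _) (by norm_num)]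
  have := Real.add_one_le_exp (6 * (2 : ℝ) ^ d + 10 * (d * l))
  linarith

/-- The number of tests is at most `2 ^ ((l + 1) d + 2 l)`. As `d ≥ 1`, its exponent is at most `d +
3 d l`, which is absorbed by the exponent of a single test. -/
theorem union_ciError_le {n d m : ℕ} {γ : ℝ} (hn : 1 ≤ n) (hd : 1 ≤ d)
    (hm : 2000 * ((2 : ℝ) ^ d + d * Nat.clog 2 n) ≤ m * γ ^ 2) :
    ((n : ℝ) + 1) ^ d * (n * n) * ciError d m γ ≤ 1 / 6 := by
  set l := Nat.clog 2 n with hl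
  have h1 : n ≤ 2 ^ l := Nat.le_pow_clog (by norm_num) n
  have h1' : (n : ℝ) ≤ 2 ^ l := by exact_mod_cast h1
  have hl1 : (1 : ℝ) ≤ 2 ^ l := one_le_pow₀ (by norm_num)
  have h2 : ((n : ℝ) + 1) ^ d ≤ 2 ^ ((l + 1) * d) := by
    rw [pow_mul]
    refine pow_le_pow_left₀ (by positivity) ?_ d
    rw [pow_succ]; linarith
  have h3 : (n : ℝ) * n ≤ 2 ^ (2 * l) := by
    rw [two_mul, pow_add]
    exact mul_le_mul h1' h1' (by positivity) (by positivity)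
  have h4 : ((n : ℝ) + 1) ^ d * (n * n) ≤ Real.exp (((l + 1) * d + 2 * l : ℕ) : ℝ) := by
    refine le_trans ?_ (two_pow_le_exp _)
    rw [pow_add]
    exact mul_le_mul h2 h3 (by positivity) (by positivity)
  refine (mul_le_mul h4 (ciError_le hm) (by unfold ciError; positivity)
    (Real.exp_pos _).le).trans ?_
  rw [← Real.exp_add]
  have h5 : (d : ℝ) ≤ 2 ^ d := by exact_mod_cast Nat.lt_two_pow_self.le
  have h6 : (1 : ℝ) ≤ d := by exact_mod_cast hd
  have h7 : (l : ℝ) ≤ d * l := le_mul_of_one_le_left (Nat.cast_nonneg _) h6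
  have h8 : (1 : ℝ) ≤ 2 ^ d := one_le_pow₀ (by norm_num)
  have h9 : (((l + 1) * d + 2 * l : ℕ) : ℝ) + -(6 * 2 ^ d + 10 * (d * l)) ≤ -5 := by
    push_cast
    nlinarith
  refine (Real.exp_le_exp.2 h9).trans ?_
  rw [Real.exp_neg, inv_le_comm₀ (Real.exp_pos _) (by norm_num)]
  linarith [Real.add_one_le_exp (5 : ℝ)]

/-- The size of a batch. -/
theorem exists_batch_size {y e : ℝ} (hy : 0 ≤ y) (he : 0 < e) : ∃ M : ℕ,
    (∀ k : ℕ, (k : ℝ) * e < y ↔ k < M) ∧ y ≤ M * e ∧ (M : ℝ) ≤ y / e + 1 := by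
  refine ⟨⌈y / e⌉₊, fun k => ?_, ?_, (Nat.ceil_lt_add_one (by positivity)).le⟩
  · rw [Nat.lt_ceil, lt_div_iff₀ he]
  · rw [← div_le_iff₀ he]; exact Nat.le_ceil _

/-- With `a = 2 ^ d`, the independence tests cost at most of the order of `a n ^ d` tuples, `n²`
pairs, `a` configurations, `a n H` samples and `a` operations per sample, i.e. `a ^ 4 n ^ (d + 3)
H`. The identity test is of smaller order, and `a ^ 4 = 16 ^ d` disappears in the base `10000000`.
-/
theorem testerTime_le {n d M m : ℕ} {H : ℝ} (hn : 1 ≤ n) (hH : 1 ≤ H)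
    (hM : (M : ℝ) ≤ 2000000 * (2 ^ d * n * H)) (hm : (m : ℝ) ≤ 5000 * (2 ^ d * n * H)) :
    (testerTime n d M m (2 ^ d) : ℝ) ≤ (10000000 * n) ^ (d + 3) * H := by
  have hl : (Nat.clog 2 n : ℝ) ≤ n := by
    exact_mod_cast Nat.clog_le_of_le_pow Nat.lt_two_pow_self.le
  have hd : (d : ℝ) ≤ 2 ^ d := by exact_mod_cast Nat.lt_two_pow_self.le
  have hN : ((n : ℝ) + 1) ^ d ≤ 2 ^ d * (n : ℝ) ^ d := by
    rw [← mul_pow]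
    refine pow_le_pow_left₀ (by positivity) ?_ d
    have : (1 : ℝ) ≤ n := by exact_mod_cast hn
    linarith
  have hn' : (1 : ℝ) ≤ n := by exact_mod_cast hn
  have ha : (1 : ℝ) ≤ 2 ^ d := one_le_pow₀ (by norm_num)
  have hnd : (1 : ℝ) ≤ (n : ℝ) ^ d := one_le_pow₀ hn'
  unfold testerTime
  push_cast
  have hpow : (10000000 * (n : ℝ)) ^ (d + 3) = 10000000 ^ 3 * 10000000 ^ d * ((n : ℝ) ^ d * n ^ 3) := by
    rw [mul_pow, pow_add, pow_add]; ring
  have hbig : ((2 : ℝ) ^ d) ^ 4 ≤ 10000000 ^ d := by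
    rw [← pow_mul, mul_comm, pow_mul]
    exact pow_le_pow_left₀ (by norm_num) (by norm_num) d
  rw [hpow]
  have hm0 : (0 : ℝ) ≤ m := Nat.cast_nonneg _
  have hM0 : (0 : ℝ) ≤ M := Nat.cast_nonneg _
  have hd0 : (0 : ℝ) ≤ d := Nat.cast_nonneg _
  have hN0 : (0 : ℝ) ≤ ((n : ℝ) + 1) ^ d := by positivity
  generalize ((n : ℝ) + 1) ^ d = N at *
  generalize (n : ℝ) ^ d = B at *
  generalize (2 : ℝ) ^ d = a at *
  generalize (10000000 : ℝ) ^ d = Z at *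
  generalize (Nat.clog 2 n : ℝ) = l at *
  generalize (n : ℝ) = x at *
  generalize (m : ℝ) = m' at *
  generalize (M : ℝ) = M' at *
  generalize (d : ℝ) = d' at *
  have ha0 : 0 ≤ a := by linarith
  have hx0 : 0 ≤ x := by linarith
  have hH0 : 0 ≤ H := by linarith
  have hB0 : 0 ≤ B := by linarith
  have q1 : 1 ≤ a ^ 2 * x * H := one_le_mul_of_one_le_of_one_le
    (one_le_mul_of_one_le_of_one_le (one_le_pow₀ ha) hn') hH
  have s1 : m' * (30 * d' + 90) + 220 ≤ 600220 * (a ^ 2 * x * H) := by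
    have := mul_le_mul hm (by linarith : 30 * d' + 90 ≤ 120 * a) (by linarith) (by positivity)
    linarith
  have q2 : x ≤ a ^ 3 * x * H := by
    have := one_le_mul_of_one_le_of_one_le (one_le_pow₀ (n := 3) ha) hH
    have := mul_le_mul_of_nonneg_right this hx0
    linarith
  have s2 : x * 100 + a * (m' * (30 * d' + 90) + 220) + 220 ≤ 600540 * (a ^ 3 * x * H) := by
    have := mul_le_mul_of_nonneg_left s1 ha0
    linarith
  have q3 : 1 ≤ a ^ 3 * x ^ 2 * H := one_le_mul_of_one_le_of_one_le
    (one_le_mul_of_one_le_of_one_le (one_le_pow₀ ha) (one_le_pow₀ hn')) hH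
  have s3 : x * (x * 100 + a * (m' * (30 * d' + 90) + 220) + 220) + 20 ≤
      600560 * (a ^ 3 * x ^ 2 * H) := by
    have := mul_le_mul_of_nonneg_left s2 hx0
    linarith
  have q4 : x ≤ a ^ 3 * x ^ 3 * H := by
    have := mul_le_mul_of_nonneg_left q3 hx0
    linarith
  have q5 : a ≤ a ^ 3 * x ^ 3 * H := by
    have h1 : 1 ≤ a ^ 2 * x ^ 3 * H := one_le_mul_of_one_le_of_one_le
      (one_le_mul_of_one_le_of_one_le (one_le_pow₀ ha) (one_le_pow₀ hn')) hH
    have := mul_le_mul_of_nonneg_left h1 ha0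
    linarith
  have s4 : x * (x * (x * 100 + a * (m' * (30 * d' + 90) + 220) + 220) + 20) + x * 20 + d' * 80 +
      110 ≤ 600790 * (a ^ 3 * x ^ 3 * H) := by
    have := mul_le_mul_of_nonneg_left s3 hx0
    linarith
  have s5 : N * (x * (x * (x * 100 + a * (m' * (30 * d' + 90) + 220) + 220) + 20) + x * 20 +
      d' * 80 + 110) ≤ 600790 * (a ^ 4 * (B * x ^ 3) * H) := by
    have := mul_le_mul hN s4 (by positivity) (by positivity)
    linarith
  have r0 : 1 ≤ a ^ 4 * (B * x ^ 3) * H := one_le_mul_of_one_le_of_one_le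
    (one_le_mul_of_one_le_of_one_le (one_le_pow₀ ha)
      (one_le_mul_of_one_le_of_one_le hnd (one_le_pow₀ hn'))) hH
  have r1 : x ≤ a ^ 4 * (B * x ^ 3) * H := by
    have h1 : 1 ≤ a ^ 4 * (B * x ^ 2) * H := one_le_mul_of_one_le_of_one_le
      (one_le_mul_of_one_le_of_one_le (one_le_pow₀ ha)
        (one_le_mul_of_one_le_of_one_le hnd (one_le_pow₀ hn'))) hH
    have := mul_le_mul_of_nonneg_left h1 hx0
    linarith
  have r2 : a * x ≤ a ^ 4 * (B * x ^ 3) * H := by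
    have h1 : 1 ≤ a ^ 3 * (B * x ^ 2) * H := one_le_mul_of_one_le_of_one_le
      (one_le_mul_of_one_le_of_one_le (one_le_pow₀ ha)
        (one_le_mul_of_one_le_of_one_le hnd (one_le_pow₀ hn'))) hH
    have := mul_le_mul_of_nonneg_left h1 (mul_nonneg ha0 hx0)
    linarith
  have r3 : a * x * H ≤ a ^ 4 * (B * x ^ 3) * H := by
    have h1 : 1 ≤ a ^ 3 * (B * x ^ 2) := one_le_mul_of_one_le_of_one_le (one_le_pow₀ ha)
        (one_le_mul_of_one_le_of_one_le hnd (one_le_pow₀ hn'))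
    have := mul_le_mul_of_nonneg_left h1 (mul_nonneg (mul_nonneg ha0 hx0) hH0)
    linarith
  have r4 : a ^ 2 * x ^ 3 * H ≤ a ^ 4 * (B * x ^ 3) * H := by
    have h1 : 1 ≤ a ^ 2 * B := one_le_mul_of_one_le_of_one_le (one_le_pow₀ ha) hnd
    have := mul_le_mul_of_nonneg_left h1 (by positivity : 0 ≤ a ^ 2 * x ^ 3 * H)
    linarith
  have r5 : d' * (x * 30 + 80) ≤ 110 * (a * x) := by
    have := mul_le_mul hd (by linarith : x * 30 + 80 ≤ 110 * x) (by positivity) ha0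
    linarith
  have r6 : a ≤ a * x := le_mul_of_one_le_right ha0 hn'
  have u1 : M' * (x * 180 + 250) + 170 ≤ 860000170 * (a * x ^ 2 * H) := by
    have h1 := mul_le_mul hM (by linarith : x * 180 + 250 ≤ 430 * x) (by positivity)
      (by positivity)
    have h2 : 1 ≤ a * x ^ 2 * H := one_le_mul_of_one_le_of_one_le
      (one_le_mul_of_one_le_of_one_le ha (one_le_pow₀ hn')) hH
    linarith
  have u2 : a * (M' * (x * 180 + 250) + 170) + x * 60 + 80 ≤ 860000310 * (a ^ 2 * x ^ 2 * H) := by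
    have h1 := mul_le_mul_of_nonneg_left u1 ha0
    have h2 : 1 ≤ a ^ 2 * x * H := q1
    have h3 := mul_le_mul_of_nonneg_left h2 hx0
    linarith
  have u3 := mul_le_mul_of_nonneg_left u2 hx0
  have hfin : 2000000000 * (a ^ 4 * (B * x ^ 3) * H) ≤ 10000000 ^ 3 * Z * (B * x ^ 3) * H := by
    have h1 := mul_le_mul_of_nonneg_right hbig (by positivity : 0 ≤ B * x ^ 3 * H)
    have h2 : 0 ≤ a ^ 4 * (B * x ^ 3 * H) := by positivity
    nlinarith
  linarith

end Estimates

/-! ### The tester -/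

section Tester

variable {n d : ℕ} {ε γ : ℝ} {S : BNStructure n} {Q P : Measure (Fin n → Bool)}

theorem card_pa_le (h : S.DegreeLE d) (i : Fin n) : (S.pa i).card ≤ d := by
  have h1 := h i
  rwa [← BNStructure.coe_pa, Set.ncard_coe_finset] at h1

theorem card_tableIndex_le (h : S.DegreeLE d) : Fintype.card (TableIndex S) ≤ 2 ^ d * n := by
  rw [Fintype.card_sigma]
  calc ∑ i : Fin n, Fintype.card (Fin (2 ^ (S.pa i).card)) ≤ ∑ _i : Fin n, 2 ^ d := by
        refine Finset.sum_le_sum fun i _ => ?_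
        rw [Fintype.card_fin]
        exact Nat.pow_le_pow_right (by norm_num) (card_pa_le h i)
    _ = 2 ^ d * n := by simp [mul_comm]

theorem parPow_testerInput_le (h : S.DegreeLE d) (ω : Tape n) (i : ℕ) :
    parPow (testerInput d ε γ S Q ω) i n ≤ 2 ^ d := by
  by_cases hi : i < n
  · have := parPow_eq (d := d) (ε := ε) (γ := γ) (S := S) (Q := Q) ω ⟨i, hi⟩ le_rfl
    simp only at this
    rw [this, parRank_self]
    exact Nat.pow_le_pow_right (by norm_num) (card_pa_le h _)
  · have h1 : ∀ j, parPow (testerInput d ε γ S Q ω) i j = 1 := by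
      intro j
      induction j with
      | zero => rfl
      | succ j ih =>
        have h2 : (testerInput d ε γ S Q ω).edge j i = 0 := by
          simp only [testerInput]
          rw [if_neg]
          rintro ⟨-, hi', -⟩
          exact hi hi'
        rw [parPow, h2, if_neg (lt_irrefl _), ih]
    rw [h1]
    exact Nat.one_le_two_pow

/-- A configuration of probability zero would give the table entry `0 / 0 = 0`, contrary to
balancedness with `c > 0`. -/
theorem marg_pa_pos [IsProbabilityMeasure Q] {c : ℝ} (hc : 0 < c)
    (h : ∀ i a, table S Q i a ∈ Set.Icc c (1 - c)) (i : Fin n) (x : Fin n → Bool) :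
    0 < marg (mass Q) (S.pa i) x := by
  refine lt_of_le_of_ne (marg_nonneg (mass_nonneg Q) _ _) fun h0 => ?_
  have h1 := (h i x).1
  rw [table, ← h0, div_zero] at h1
  linarith

/-- The product of the batch size and the probabilities of the parental configurations. -/
theorem le_mul_entryProb [IsProbabilityMeasure Q] (hn : 1 ≤ n) (hε : 0 < ε) (hε1 : ε ≤ 1)
    {C : ℝ} (hd : S.DegreeLE d) (hC : (1 + Real.log n) * (d * ε ^ 2 / √n) ≤ C)
    (hQ : ∀ (i : Fin n) (a : Fin n → Bool), C ≤ Q.real (configEvent (S.parents i) a)) {M : ℕ}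
    (hM : 1000000 * √(2 ^ d * n) ≤ M * ε ^ 2) (α : TableIndex S) :
    2 * (131072 * ((d : ℝ) + Nat.clog 2 n + 1)) ≤ M * entryProb S Q α := by
  have hlog : 0 ≤ Real.log n := Real.log_natCast_nonneg n
  have hl := clog_le_log hn
  have hn' : (1 : ℝ) ≤ n := by exact_mod_cast hn
  have hs : 0 < √(n : ℝ) := Real.sqrt_pos.2 (by linarith)
  have hR : √(n : ℝ) ≤ √(2 ^ d * n) :=
    Real.sqrt_le_sqrt (le_mul_of_one_le_left (by linarith) (one_le_pow₀ (by norm_num)))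
  -- For `d = 0` the bound on `C` says nothing, but the only configuration is empty and has
  -- probability one. The logarithm is then absorbed by `log n ≤ 2 √n - 2`.
  rcases Nat.eq_zero_or_pos d with rfl | hd1
  · have h1 : S.pa α.1 = ∅ := Finset.card_eq_zero.1 (Nat.le_zero.1 (card_pa_le hd α.1))
    have h2 : entryProb S Q α = 1 := by
      have h3 : ∀ B : Finset (Fin n), B = ∅ → ∀ x, marg (mass Q) B x = 1 := by
        rintro B rfl x
        rw [marg_empty, sum_mass]
      exact h3 _ h1 _
    have h3 := log_le_two_mul_sqrt hn
    have h4 : (M : ℝ) * ε ^ 2 ≤ M :=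
      mul_le_of_le_one_right (Nat.cast_nonneg _) (pow_le_one₀ hε.le hε1)
    rw [h2]
    push_cast
    linarith
  · have hd' : (1 : ℝ) ≤ d := by exact_mod_cast hd1
    have h1 : C ≤ entryProb S Q α := by
      rw [entryProb, marg_mass, BNStructure.coe_pa]
      exact hQ _ _
    have h2 : (M : ℝ) * ((1 + Real.log n) * (d * ε ^ 2 / √n)) ≤ M * entryProb S Q α :=
      mul_le_mul_of_nonneg_left (hC.trans h1) (Nat.cast_nonneg _)
    have h3 : (M : ℝ) * ((1 + Real.log n) * (d * ε ^ 2 / √n)) =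
        (M * ε ^ 2 / √n) * ((1 + Real.log n) * d) := by ring
    have h4 : 1000000 ≤ M * ε ^ 2 / √n := by
      rw [le_div_iff₀ hs]; linarith
    have h5 : 1000000 * ((1 + Real.log n) * d) ≤ (M * ε ^ 2 / √n) * ((1 + Real.log n) * d) :=
      mul_le_mul_of_nonneg_right h4 (by positivity)
    have h6 : Real.log n ≤ Real.log n * d := le_mul_of_one_le_right hlog hd'
    linarith

theorem tester_outputs [IsProbabilityMeasure Q] (hd : S.DegreeLE d) {M m : ℕ}
    (hM0 : 0 < M)
    (hM : ∀ k : ℕ, (k : ℝ) * k * (ε * ε * (ε * ε)) < (1000000 : ℕ) * (1000000 : ℕ) *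
      ((2 ^ d : ℕ) * n) ↔ k < M)
    (hm : ∀ k : ℕ, (k : ℝ) * (γ * γ) < (2000 : ℕ) * ((2 ^ d : ℕ) + d * Nat.clog 2 n) ↔ k < m)
    (ω : Tape n) :
    ∃ s t, Exec (testerInput d ε γ S Q ω) (testerProg 1000000 2000 131072) RamState.init s t ∧
      s.drawn = M + M + M + m ∧ t ≤ testerTime n d M m (2 ^ d) ∧
      (Accepts (testerInput d ε γ S Q ω) 131072 M m → s.nat 0 0 = 1) ∧
      (¬ Accepts (testerInput d ε γ S Q ω) 131072 M m → s.nat 0 0 = 0) :=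
  testerProg_spec hM hm hM0 (parPow_testerInput_le hd ω)

/-- Replaces the passage to complements, so that the event that the program has a given output need
not be shown to be measurable. -/
theorem one_le_measureReal_add {Ω : Type*} [MeasurableSpace Ω] {μ : Measure Ω}
    [IsProbabilityMeasure μ] {A B : Set Ω} (h : ∀ ω, ω ∈ A ∨ ω ∈ B) : 1 ≤ μ.real A + μ.real B := by
  have h1 : A ∪ B = Set.univ := Set.eq_univ_of_forall h
  have h2 := measureReal_union_le (μ := μ) A B
  rw [h1] at h2
  simpa using h2

theorem card_tableIndex_le_exp (h : S.DegreeLE d) :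
    (Fintype.card (TableIndex S) : ℝ) ≤ Real.exp ((d : ℝ) + Nat.clog 2 n + 1) := by
  have h1 : (n : ℝ) ≤ 2 ^ Nat.clog 2 n := by exact_mod_cast Nat.le_pow_clog (by norm_num) n
  have h2 : (2 : ℝ) ^ d * n ≤ 2 ^ (d + Nat.clog 2 n) := by
    rw [pow_add]; exact mul_le_mul_of_nonneg_left h1 (by positivity)
  have h3 : (Fintype.card (TableIndex S) : ℝ) ≤ 2 ^ d * n := by
    exact_mod_cast card_tableIndex_le h
  refine h3.trans (h2.trans ((two_pow_le_exp _).trans (Real.exp_le_exp.2 ?_)))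
  push_cast
  linarith

theorem IsBalanced.table_mem [IsProbabilityMeasure Q] {c C : ℝ} (hbal : IsBalanced S Q c C)
    (i : Fin n) (a : Fin n → Bool) : table S Q i a ∈ Set.Icc c (1 - c) := by
  rw [← condProbTable_eq_table]; exact (hbal i a).1

/-- Error budget: `1 / 6` for all independence tests together, and `1 / 24` each for the counts and
for the variance of the identity test. -/
theorem measure_not_accepts_le [IsProbabilityMeasure P] (hn : 1 ≤ n) (hε : 0 < ε) (hε1 : ε ≤ 1)
    (hγ : 0 < γ) (hdeg : S.DegreeLE d) {σ : Equiv.Perm (Fin n)} (hσ : IsNumbering S σ)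
    (hSQ : IsMarkov S σ (mass P)) {c C : ℝ} (hc0 : 0 < c)
    (hC : (1 + Real.log n) * (d * ε ^ 2 / √n) ≤ C) (hbal : IsBalanced S P c C)
    (hnd : IsNonDegenerate S d P γ) {M m : ℕ} (hM0 : 0 < M) (hm0 : 0 < m)
    (hMR : 1000000 * √(2 ^ d * n) ≤ M * ε ^ 2)
    (hmlo : 2000 * ((2 : ℝ) ^ d + d * Nat.clog 2 n) ≤ m * γ ^ 2) :
    (tapeLaw P).real {ω | ¬ Accepts (testerInput d ε γ S P ω) 131072 M m} ≤ 1 / 3 := by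
  have hQ := hbal.table_mem
  have hRR : √((2 : ℝ) ^ d * n) ^ 2 = 2 ^ d * n := Real.sq_sqrt (by positivity)
  have hD : (Fintype.card (TableIndex S) : ℝ) ≤ √(2 ^ d * n) ^ 2 := by
    rw [hRR]; exact_mod_cast card_tableIndex_le hdeg
  have hR0 : 0 ≤ √((2 : ℝ) ^ d * n) := Real.sqrt_nonneg _
  have hDexp := card_tableIndex_le_exp hdeg
  set lam : ℝ := (d : ℝ) + Nat.clog 2 n + 1 with hlam
  have hτ : ((131072 : ℕ) : ℝ) * (d + Nat.clog 2 n + 1 : ℕ) = 131072 * lam := by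
    push_cast; ring
  have hlam1 : 1 ≤ lam := by rw [hlam]; linarith [(by positivity : (0 : ℝ) ≤ d + Nat.clog 2 n)]
  have hI : (tapeLaw P).real {ω | ¬ IdAccepts S P M (131072 * lam) (M * ε ^ 2 / 16) ω} ≤
      1 / 24 + 1 / 24 := by
    have h1 := measure_idAccepts_null (τ := 131072 * lam) (b := M * ε ^ 2 / 16) (δ := 1 / 24)
      hn hσ hSQ hc0 hQ hM0 (by linarith)
      (fun α => le_mul_entryProb hn hε hε1 hdeg hC (fun i a => (hbal i a).2) hMR α)
      (by positivity) (by norm_num) ?_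
    · refine h1.trans (add_le_add_left ?_ _)
      rw [neg_div]
      exact exp_neg_mul_le hlam1 hDexp (by linarith)
    · have h2 : 62500 * √(2 ^ d * n) ≤ M * ε ^ 2 / 16 := by linarith
      have h3 := pow_le_pow_left₀ (by positivity) h2 2
      nlinarith
  have hC' : (tapeLaw P).real {ω | ∃ u < (n + 1) ^ d, ∃ i j : Fin n,
      ciFails (testerInput d ε γ S P ω) m (2 ^ d) (tupleDigit n u) i j} ≤ 1 / 6 := by
    rcases Nat.eq_zero_or_pos d with rfl | hd1
    · have h1 : {ω : Tape n | ∃ u < (n + 1) ^ 0, ∃ i j : Fin n,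
          ciFails (testerInput 0 ε γ S P ω) m (2 ^ 0) (tupleDigit n u) i j} = ∅ := by
        ext ω
        simp only [Set.mem_ofPred_eq, Set.mem_empty_iff_false, iff_false]
        rintro ⟨u, -, i, j, h⟩
        exact forall_not_ciFails_of_degreeLE_zero hdeg ω _ m i j h
      rw [h1]; simp
    · exact (measure_ci_null hγ hnd hm0).trans (union_ciError_le hn hd1 hmlo)
  refine (measureReal_mono (fun ω hω => ?_) (measure_ne_top _ _)).trans
    ((measureReal_union_le {ω | ∃ u < (n + 1) ^ d, ∃ i j : Fin n,
      ciFails (testerInput d ε γ S P ω) m (2 ^ d) (tupleDigit n u) i j}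
      {ω | ¬ IdAccepts S P M (131072 * lam) (M * ε ^ 2 / 16) ω}).trans
      ((add_le_add hC' hI).trans (by norm_num)))
  simp only [Set.mem_ofPred_eq, Set.mem_union] at hω ⊢
  rw [accepts_iff, hτ, not_and_or] at hω
  refine hω.imp_left fun h => ?_
  push Not at h
  exact h

/-- Either `P` satisfies one of the independences that the tester checks, and that single test
detects it; or it satisfies none, `S` and `S'` have the same families, and the identity test over
`S` is sound. In the second case the outcome of the independence tests is not needed. -/
theorem measure_accepts_le [IsProbabilityMeasure P] [IsProbabilityMeasure Q] {S' : BNStructure n}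
    (hn : 1 ≤ n) (hε : 0 < ε) (hγ : 0 < γ) (hdeg : S.DegreeLE d) (hdeg' : S'.DegreeLE d)
    (hedge : S'.edgeCount ≤ S.edgeCount) {σ σ' : Equiv.Perm (Fin n)} (hσ : IsNumbering S σ)
    (hSQ : IsMarkov S σ (mass Q)) (hσ' : IsNumbering S' σ') (hSP : IsMarkov S' σ' (mass P))
    {c C : ℝ} (hc0 : 0 < c) (hc : (1 + Real.log n) / √n ≤ c) (hbal : IsBalanced S Q c C)
    (hfar : ε < l1Dist P Q) {M m : ℕ} (hM0 : 0 < M) (hm0 : 0 < m)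
    (hMR : 1000000 * √(2 ^ d * n) ≤ M * ε ^ 2)
    (hmlo : 2000 * ((2 : ℝ) ^ d + d * Nat.clog 2 n) ≤ m * γ ^ 2) :
    (tapeLaw P).real {ω | Accepts (testerInput d ε γ S Q ω) 131072 M m} ≤ 1 / 3 := by
  have hlog : 0 ≤ Real.log n := Real.log_natCast_nonneg n
  have hn' : (1 : ℝ) ≤ n := by exact_mod_cast hn
  have hs : 0 < √(n : ℝ) := Real.sqrt_pos.2 (by linarith)
  have hQ := hbal.table_mem
  have hRR : √((2 : ℝ) ^ d * n) ^ 2 = 2 ^ d * n := Real.sq_sqrt (by positivity)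
  have hD : (Fintype.card (TableIndex S) : ℝ) ≤ √(2 ^ d * n) ^ 2 := by
    rw [hRR]; exact_mod_cast card_tableIndex_le hdeg
  have hR0 : 0 ≤ √((2 : ℝ) ^ d * n) := Real.sqrt_nonneg _
  have hRn : √(n : ℝ) ≤ √(2 ^ d * n) :=
    Real.sqrt_le_sqrt (le_mul_of_one_le_left (by linarith) (one_le_pow₀ (by norm_num)))
  have hDexp := card_tableIndex_le_exp hdeg
  set lam : ℝ := (d : ℝ) + Nat.clog 2 n + 1 with hlam
  have hτ : ((131072 : ℕ) : ℝ) * (d + Nat.clog 2 n + 1 : ℕ) = 131072 * lam := by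
    push_cast; ring
  have hlam1 : 1 ≤ lam := by rw [hlam]; linarith [(by positivity : (0 : ℝ) ≤ d + Nat.clog 2 n)]
  by_cases hdep : ∀ (i j : Fin n) (A : Finset (Fin n)), i ≠ j → A.card ≤ d → i ∉ A → j ∉ A →
      Forced S i j (A : Set (Fin n)) → ¬ CondIndepGiven P i j (A : Set (Fin n))
  · have hfam := isFamily_iff_of_dependent hσ hσ' hSP hdeg' hedge hdep
    have h1 := measure_idAccepts_far (τ := 131072 * lam) hn hσ hSQ
      (fun hpos => IsMarkov.of_families (mass_nonneg P) (sum_mass P) hσ hσ' hfam hSP hpos)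
      (marg_pa_pos hc0 hQ) hc0 hQ hM0 (by linarith) hε hfar ?_ ?_ ?_
    · refine (measureReal_mono (fun ω hω => ?_) (measure_ne_top _ _)).trans h1
      have h2 := ((accepts_iff ω _ _ _).1 hω).2
      rw [hτ] at h2
      exact h2
    · have h2 : 1 / √n ≤ c := by
        refine le_trans (div_le_div_of_nonneg_right ?_ hs.le) hc
        linarith
      have h3 : 250000 * √n ≤ M * ε ^ 2 / 4 := by linarith
      have h4 := mul_le_mul h2 h3 (by positivity) hc0.le
      have h5 : 1 / √n * (250000 * √n) = 250000 := by
        rw [one_div_mul_eq_div, mul_div_assoc, div_self hs.ne', mul_one]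
      linarith
    · have h2 : 250000 * √(2 ^ d * n) ≤ M * ε ^ 2 / 4 := by linarith
      have h3 := pow_le_pow_left₀ (by positivity) h2 2
      nlinarith
    · rw [neg_div]
      exact exp_neg_mul_le hlam1 hDexp le_rfl
  · push Not at hdep
    obtain ⟨i, j, A, hij, hA, hi, hj, hF, hind⟩ := hdep
    refine le_trans (measureReal_mono (fun ω hω => ?_) (measure_ne_top _ _))
      ((measure_ci_indep (ε := ε) (Q := Q) hγ hA hij hi hj hF hind hm0).trans
        (ciError_le_third hmlo))
    exact ((accepts_iff ω _ _ _).1 hω).1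

end Tester

/-! ### The main theorem. -/

theorem mainTheorem5 :
    ∃ (tester : RamProg) (β K : ℝ), 0 < β ∧ 0 < K ∧
      ∀ (n d : ℕ) (ε γ c C : ℝ) (S : BNStructure n) (Q : Measure (Fin n → Bool)),
        1 ≤ n → 0 < ε → ε ≤ 1 → 0 < γ →
        β * (1 + Real.log n) / √n ≤ c →
        β * (1 + Real.log n) * (d * ε ^ 2 / √n) ≤ C →
        IsProbabilityMeasure Q → S.DegreeLE d → IsBayesNet S Q →
        IsBalanced S Q c C → IsNonDegenerate S d Q γ →
        ∀ (P : Measure (Fin n → Bool)) (S' : BNStructure n),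
          IsProbabilityMeasure P → S'.DegreeLE d → IsBayesNet S' P →
          S'.edgeCount ≤ S.edgeCount →
          (∀ ω : Tape n, ∃ s t, Exec (testerInput d ε γ S Q ω) tester RamState.init s t ∧
            (s.drawn : ℝ) ≤ K * ((2 : ℝ) ^ ((d : ℝ) / 2) * √n / ε ^ 2 +
              ((2 : ℝ) ^ d + d * Real.log n) / γ ^ 2) ∧
            (t : ℝ) ≤ (K * n) ^ (d + 3) * (1 / γ ^ 2 + 1 / ε ^ 2)) ∧
          (P = Q →
            2 / 3 ≤ (tapeLaw P).real {ω | Outputs (testerInput d ε γ S Q ω) tester 1}) ∧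
          (ε < l1Dist P Q →
            2 / 3 ≤ (tapeLaw P).real {ω | Outputs (testerInput d ε γ S Q ω) tester 0}) := by
  -- The three numbers fix the size of a batch of the identity test, the number of samples for the
  -- independence tests and the least admissible count. The witness `β = 1` suffices because the
  -- first is large enough for the expected counts to exceed twice that threshold.
  refine ⟨testerProg 1000000 2000 131072, 1, 10000000, one_pos, by norm_num, ?_⟩
  intro n d ε γ c C S Q hn hε hε1 hγ hc hC _ hdeg hbn hbal hnd P S' _ hdeg' hbn' hedge
  rw [one_mul] at hc hC
  have hlog : 0 ≤ Real.log n := Real.log_natCast_nonneg n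
  have hl := clog_le_log hn
  have hn' : (1 : ℝ) ≤ n := by exact_mod_cast hn
  have hs : 0 < √(n : ℝ) := Real.sqrt_pos.2 (by linarith)
  have hc0 : 0 < c := lt_of_lt_of_le (by positivity) hc
  have ha : (1 : ℝ) ≤ 2 ^ d := one_le_pow₀ (by norm_num)
  have han : (1 : ℝ) ≤ 2 ^ d * n := one_le_mul_of_one_le_of_one_le ha hn'
  set R : ℝ := √(2 ^ d * n) with hRdef
  have hR1 : 1 ≤ R := Real.one_le_sqrt.2 han
  have hRR : R ^ 2 = 2 ^ d * n := Real.sq_sqrt (by linarith)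
  have hRpow : (2 : ℝ) ^ ((d : ℝ) / 2) * √n = R := by
    rw [hRdef, Real.sqrt_mul (by positivity), Real.sqrt_eq_rpow (2 ^ d), ← Real.rpow_natCast,
      ← Real.rpow_mul (by norm_num)]
    congr 2
    ring
  have hε2 : 0 < ε ^ 2 := by positivity
  have hγ2 : 0 < γ ^ 2 := by positivity
  have hεE : 1 ≤ 1 / ε ^ 2 := by
    rw [le_div_iff₀ hε2, one_mul]; exact pow_le_one₀ hε.le hε1
  -- the sizes of the batches
  obtain ⟨M, hM, hMlo, hMhi⟩ := exists_batch_size (y := 1000000 * R) (by positivity) hε2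
  obtain ⟨m, hm, hmlo, hmhi⟩ := exists_batch_size
    (y := 2000 * ((2 : ℝ) ^ d + d * Nat.clog 2 n)) (by positivity) hγ2
  have hM0 : 0 < M := by
    rw [← hM]; simp; linarith
  have hm0 : 0 < m := by
    rw [← hm]; simp; positivity
  have hM' : ∀ k : ℕ, (k : ℝ) * k * (ε * ε * (ε * ε)) < (1000000 : ℕ) * (1000000 : ℕ) *
      ((2 ^ d : ℕ) * n) ↔ k < M := by
    -- The program compares squares; both sides are non-negative, so this is the condition defining
    -- `M`.
    intro k
    rw [← hM k, ← sq_lt_sq₀ (a := (k : ℝ) * ε ^ 2) (b := 1000000 * R) (by positivity)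
      (by positivity), mul_pow 1000000 R, hRR]
    push_cast
    constructor <;> intro h <;> linarith
  have hm' : ∀ k : ℕ, (k : ℝ) * (γ * γ) < (2000 : ℕ) * ((2 ^ d : ℕ) + d * Nat.clog 2 n) ↔
      k < m := by
    intro k
    rw [← hm k, sq]
    push_cast
    rfl
  have hout := fun ω => tester_outputs (ε := ε) (γ := γ) (S := S) (Q := Q) hdeg hM0 hM' hm' ω
  have hMhi' : (M : ℝ) ≤ 1000001 * (R * (1 / ε ^ 2)) := by
    have h1 : 1 ≤ R * (1 / ε ^ 2) := one_le_mul_of_one_le_of_one_le hR1 hεE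
    have h2 : 1000000 * R / ε ^ 2 = 1000000 * (R * (1 / ε ^ 2)) := by ring
    linarith
  obtain ⟨σ, hσ, hSQ⟩ := hbn.exists_isMarkov
  obtain ⟨σ', hσ', hSP⟩ := hbn'.exists_isMarkov
  have hMR : 1000000 * R ≤ M * ε ^ 2 := hMlo
  refine ⟨fun ω => ?_, fun hPQ => ?_, fun hfar => ?_⟩
  · obtain ⟨s, t, hex, hdrawn, ht, -, -⟩ := hout ω
    refine ⟨s, t, hex, ?_, ?_⟩
    · rw [hdrawn, hRpow]
      push_cast
      have h1 : (d : ℝ) ≤ 2 ^ d := by exact_mod_cast Nat.lt_two_pow_self.le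
      have h2 : (d : ℝ) * Nat.clog 2 n ≤ d * (1 + 3 / 2 * Real.log n) :=
        mul_le_mul_of_nonneg_left hl (Nat.cast_nonneg _)
      have h3 : 0 ≤ (d : ℝ) * Real.log n := by positivity
      have h4 : 2000 * ((2 : ℝ) ^ d + d * Nat.clog 2 n) / γ ^ 2 ≤
          4000 * (((2 : ℝ) ^ d + d * Real.log n) / γ ^ 2) := by
        rw [← mul_div_assoc]
        exact div_le_div_of_nonneg_right (by linarith) hγ2.le
      have h5 : 0 ≤ ((2 : ℝ) ^ d + d * Real.log n) / γ ^ 2 := by positivity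
      have h6 : R * (1 / ε ^ 2) = R / ε ^ 2 := by ring
      have h7 : 1 ≤ R / ε ^ 2 := by
        rw [← h6]; exact one_le_mul_of_one_le_of_one_le hR1 hεE
      rw [h6] at hMhi'
      linarith
    · set H : ℝ := 1 / γ ^ 2 + 1 / ε ^ 2 with hH
      have hG : 0 < 1 / γ ^ 2 := by positivity
      have hH1 : 1 ≤ H := by rw [hH]; linarith
      have hRle : R ≤ 2 ^ d * n := by rw [← hRR]; nlinarith
      have ht' : (t : ℝ) ≤ testerTime n d M m (2 ^ d) := by exact_mod_cast ht
      refine ht'.trans (testerTime_le hn hH1 ?_ ?_)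
      · have h1 : R * (1 / ε ^ 2) ≤ 2 ^ d * n * H :=
          mul_le_mul hRle (by rw [hH]; linarith) (by positivity) (by positivity)
        have h2 : 0 ≤ 2 ^ d * n * H := by positivity
        linarith
      · have h1 : (d : ℝ) ≤ 2 ^ d := by exact_mod_cast Nat.lt_two_pow_self.le
        have h2 : (Nat.clog 2 n : ℝ) ≤ n := by
          exact_mod_cast Nat.clog_le_of_le_pow Nat.lt_two_pow_self.le
        have h3 : (d : ℝ) * Nat.clog 2 n ≤ 2 ^ d * n :=
          mul_le_mul h1 h2 (by positivity) (by positivity)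
        have h4 : (2 : ℝ) ^ d ≤ 2 ^ d * n := le_mul_of_one_le_right (by positivity) hn'
        have h5 : 2000 * ((2 : ℝ) ^ d + d * Nat.clog 2 n) / γ ^ 2 ≤ 4000 * (2 ^ d * n * H) := by
          rw [div_eq_mul_one_div, mul_assoc 2000]
          have h6 := mul_le_mul (by linarith : (2 : ℝ) ^ d + d * Nat.clog 2 n ≤ 2 * (2 ^ d * n))
            (by rw [hH]; linarith : 1 / γ ^ 2 ≤ H) hG.le (by positivity)
          linarith
        have h7 : 1 ≤ 2 ^ d * n * H := one_le_mul_of_one_le_of_one_le han hH1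
        linarith
  · subst hPQ
    have hsub := measure_not_accepts_le hn hε hε1 hγ hdeg hσ hSQ hc0 hC hbal hnd hM0 hm0 hMR hmlo
    have h1 := one_le_measureReal_add (μ := tapeLaw P)
      (A := {ω | Outputs (testerInput d ε γ S P ω) (testerProg 1000000 2000 131072) 1})
      (B := {ω | ¬ Accepts (testerInput d ε γ S P ω) 131072 M m}) fun ω => by
        by_cases h : Accepts (testerInput d ε γ S P ω) 131072 M m
        · obtain ⟨s, t, hex, -, -, h1, -⟩ := hout ω
          exact Or.inl ⟨s, t, hex, h1 h⟩
        · exact Or.inr h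
    linarith
  · have hsub := measure_accepts_le hn hε hγ hdeg hdeg' hedge hσ hSQ hσ' hSP hc0 hc hbal hfar hM0
      hm0 hMR hmlo
    have h1 := one_le_measureReal_add (μ := tapeLaw P)
      (A := {ω | Outputs (testerInput d ε γ S Q ω) (testerProg 1000000 2000 131072) 0})
      (B := {ω | Accepts (testerInput d ε γ S Q ω) 131072 M m}) fun ω => by
        by_cases h : Accepts (testerInput d ε γ S Q ω) 131072 M m
        · exact Or.inr h
        · obtain ⟨s, t, hex, -, -, -, h1⟩ := hout ω
          exact Or.inl ⟨s, t, hex, h1 h⟩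
    linarith
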